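/- Let $d,n\ge 1$, $m_0,\nu_0>0$ and $\alpha<-d/2$. For $s,\alpha\in\mathbb R$ let $H^{s,\alpha}$ be the Hilbert space of real tempered distributions $\psi$ on $\mathbb R^d$ with finite norm $\|\psi\|_{s,\alpha}=\|\langle x\rangle^{\alpha}\Lambda^s\psi\|_{L^2(\mathbb R^d)}$, where $\langle x\rangle=(1+|x|^2)^{1/2}$ and $\Lambda^s=(1-\Delta)^{s/2}$; let $L^\alpha$ be the space of $u:\mathbb Z^d\to\mathbb R^n$ with $\|u\|_\alpha^2=\sum_k(1+|k|^2)^\alpha|u(k)|^2<\infty$; and let $\mathcal E^{s,\alpha}=H^{1+s,\alpha}\oplus L^\alpha\oplus H^{s,\alpha}\oplus L^\alpha$, with elements $Y=(\psi,u,\pi,v)$ and norm $|||Y|||_{s,\alpha}^2=\|\psi\|_{1+s,\alpha}^2+\|u\|_\alpha^2+\|\pi\|_{s,\alpha}^2+\|v\|_\alpha^2$. Put $\mathcal E=\mathcal E^{0,\alpha}$. Consider the system $$\dot\psi=\pi,\qquad \dot u=v,\qquad \dot\pi=(\Delta-m_0^2)\psi-\sum_{k}u(k)\cdot R(x-k),\qquad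 \dot v(k)=(\Delta_L-\nu_0^2)u(k)-\int R(x-k)\psi(x)\,dx,$$ where $\Delta_Lu(k)=\sum_{|e|=1}(u(k+e)-u(k))$ and $R:\mathbb R^d\to\mathbb R^n$ satisfies: (R1) $R\in C^\infty$ and $|R(x)|\le\bar R e^{-\varepsilon|x|}$ for some $\bar R<\infty$, $\varepsilon>0$. (R2) There is $\kappa>0$ with $(X,\tilde{\mathcal H}(\theta)X)\ge\kappa^2\|X\|^2_{H^1(\mathbb T^d)\oplus\mathbb C^n}$ for all $X=(\varphi,w)\in H^1(\mathbb T^d)\oplus\mathbb C^n$ and $\theta\in[0,2\pi]^d$, where $\mathbb T^d=\mathbb R^d/\mathbb Z^d$, $(\cdot,\cdot)$ is the inner product of $L^2(\mathbb T^d)\oplus\mathbb C^n$, and $$\tilde{\mathcal H}(\theta)(\varphi,w)=\Big(((i\nabla+\theta)^2+m_0^2)\varphi+\tilde R(\theta,\cdot)\cdot w,\ \int_{\mathbb T^d}\tilde R(-\theta,y)\varphi(y)\,dy+\big(\textstyle\sum_j2(1-\cos\theta_j)+\nu_0^2\big)w\Big),$$ with $\tilde R(\theta,y)=e^{iy\cdot\theta}\sum_{k\in\mathbb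 Z^d}e^{ik\cdot\theta}R(k+y)$. Let $\mu_0$ be a Borel probability measure on $\mathcal E$, the law of a random initial datum $Y_0=(\psi_0,u_0,\pi_0,v_0)$, such that: (S0) $EY_0(p)\equiv0$ for $p\in\mathbb P:=\mathbb R^d\sqcup\mathbb Z^d$ (in the sense of distributions). (S1) The correlation functions $E(Y_0(p)\otimes Y_0(p'))$ (in the sense of distributions) are invariant under simultaneous translation of $p,p'$ by any $k\in\mathbb Z^d$. (S2) For some $\bar e_F<\infty$, $E(|\nabla\psi_0(x)|^2+|\psi_0(x)|^2+|\pi_0(x)|^2)\le\bar e_F$ for almost all $x\in\mathbb R^d$, and $E(|u_0(k)|^2+|v_0(k)|^2)<\infty$ for $k\in\mathbb Z^d$. (S3) $\varphi(r)\to0$ as $r\to\infty$ and $\int_0^\infty r^{d-1}\varphi(r)^{1/2}\,dr<\infty$, where $\varphi(r)=\sup|\mu_0(A\cap B)-\mu_0(A)\mu_0(B)|/\mu_0(B)$, the supremum being over all open $\mathcal A,\mathcal B\subset\mathbb P$ at distance at least $r$ and all $A\in\sigma(\mathcal A)$, $B\in\sigma(\mathcal B)$ with $\mu_0(B)>0$;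 here $\sigma(\mathcal A)$ is the $\sigma$-algebra generated by the functionals $Y\mapsto\langle Y,Z\rangle$ with $Z$ a smooth, compactly supported test function on $\mathbb P$ with $\operatorname{supp}Z\subset\mathcal A$. Then for every $Y_0\in\mathcal E$ the system has a unique solution $Y\in C(\mathbb R,\mathcal E)$ (in the sense of distributions) with $Y(0)=Y_0$, the maps $W(t):Y_0\mapsto Y(t)$ are Borel measurable on $\mathcal E$, and the laws $\mu_t$ of $W(t)Y_0$, $t\in\mathbb R$, satisfy: (i) there is a constant $C(\alpha)<\infty$ with $\sup_{t\in\mathbb R}E\,|||W(t)Y_0|||_{0,\alpha}^2\le C(\alpha)$; (ii) for all $s<0$ and $\beta<\alpha$, $\mathcal E$ is continuously embedded in $\mathcal E^{s,\beta}$, and the family $\{\mu_t:t\in\mathbb R\}$ is weakly compact in $\mathcal E^{s,\beta}$, i.e. relatively compact in the space of Borel probability measures on $\mathcal E^{s,\beta}$ with the topology of weak convergence. -/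

import Mathlib

open MeasureTheory Filter Topology TemperedDistribution
open scoped SchwartzMap ENNReal NNReal ContDiff LineDeriv Laplacian

noncomputable section

namespace FieldCrystal

/-! ### Basic spaces -/

/-- The Euclidean space `ℝ^d`. -/
abbrev Space (d : ℕ) : Type := EuclideanSpace ℝ (Fin d)

/-- The lattice `ℤ^d`. -/
abbrev Lat (d : ℕ) : Type := Fin d → ℤ

/-- The space `ℝ^n` of displacements of one atom. -/
abbrev Vec (n : ℕ) : Type := EuclideanSpace ℝ (Fin n)

/-- A lattice point, seen in `ℝ^d`. -/
def latPt {d : ℕ} (k : Lat d) : Space d := WithLp.toLp 2 (fun i => (k i : ℝ))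

/-! ### The weighted Sobolev spaces `H^{s,α}(ℝ^d)` -/

/-- The symbol `⟨ξ⟩^s`; Mathlib's Fourier variable is `ξ / 2π`. -/
def besselSymbol (d : ℕ) (s : ℝ) (ξ : Space d) : ℂ :=
  (((1 + ‖(2 * Real.pi) • ξ‖ ^ 2) ^ (s / 2) : ℝ) : ℂ)

/-- The weight `⟨x⟩^α`. -/
def weight (d : ℕ) (α : ℝ) (x : Space d) : ℂ :=
  (((1 + ‖x‖ ^ 2) ^ (α / 2) : ℝ) : ℂ)

/-- The operator `T ↦ ⟨x⟩^α Λ^s T`, where `Λ^s = (1 - Δ)^{s/2}`, on tempered distributions. -/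
def weightedBessel (d : ℕ) (s α : ℝ) : 𝓢'(Space d, ℂ) →L[ℂ] 𝓢'(Space d, ℂ) :=
  (smulLeftCLM ℂ (weight d α)).comp (fourierMultiplierCLM ℂ (besselSymbol d s))

/-- A tempered distribution is real if it is real on real test functions. -/
def IsRealDist {d : ℕ} (T : 𝓢'(Space d, ℂ)) : Prop :=
  ∀ φ : 𝓢(Space d, ℂ), (∀ x, (φ x).im = 0) → (T φ).im = 0

/-- The real tempered distributions `T` with `⟨x⟩^α Λ^s T ∈ L²`. -/
def sobolevSubmodule (d : ℕ) (s α : ℝ) : Submodule ℝ 𝓢'(Space d, ℂ) where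
  carrier := {T | IsRealDist T ∧ ∃ f : Lp ℂ 2 (volume : Measure (Space d)),
    weightedBessel d s α T = Lp.toTemperedDistributionCLM ℂ volume 2 f}
  add_mem' := by
    rintro S T ⟨hS, f, hf⟩ ⟨hT, g, hg⟩
    refine ⟨fun φ hφ => ?_, f + g, ?_⟩
    · have : (S + T) φ = S φ + T φ := rfl
      rw [this, Complex.add_im, hS φ hφ, hT φ hφ, add_zero]
    · rw [map_add, map_add, hf, hg]
  zero_mem' := by
    refine ⟨fun φ _ => ?_, 0, ?_⟩
    · have : (0 : 𝓢'(Space d, ℂ)) φ = 0 := rfl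
      rw [this, Complex.zero_im]
    · rw [map_zero, map_zero]
  smul_mem' := by
    rintro c T ⟨hT, f, hf⟩
    refine ⟨fun φ hφ => ?_, (c : ℂ) • f, ?_⟩
    · have : (c • T) φ = c • T φ := rfl
      rw [this, Complex.smul_im, hT φ hφ, smul_zero]
    · have : c • T = (c : ℂ) • T := by
        ext φ
        change c • T φ = (c : ℂ) • T φ
        simp
      rw [this, map_smul, map_smul, hf]

/-- The real Hilbert space `H^{s,α}(ℝ^d)`. (A type of its own: it carries the norm topology, not
the topology of distributions.) -/
def WSobolev (d : ℕ) (s α : ℝ) : Type := sobolevSubmodule d s α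

instance (d : ℕ) (s α : ℝ) : AddCommGroup (WSobolev d s α) :=
  inferInstanceAs (AddCommGroup (sobolevSubmodule d s α))

instance (d : ℕ) (s α : ℝ) : Module ℝ (WSobolev d s α) :=
  inferInstanceAs (Module ℝ (sobolevSubmodule d s α))

/-- The underlying distribution. -/
def WSobolev.dist {d : ℕ} {s α : ℝ} (T : WSobolev d s α) : 𝓢'(Space d, ℂ) := T.1

lemma besselSymbol_growth (d : ℕ) (s : ℝ) : (besselSymbol d s).HasTemperateGrowth := by
  have h1 := Function.hasTemperateGrowth_one_add_norm_sq_rpow (Space d) (s / 2)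
  have h2 : (fun ξ : Space d => (2 * Real.pi) • ξ).HasTemperateGrowth :=
    ((2 * Real.pi) • ContinuousLinearMap.id ℝ (Space d)).hasTemperateGrowth
  exact Function.HasTemperateGrowth.comp Complex.ofRealCLM.hasTemperateGrowth (h1.comp h2)

lemma weight_growth (d : ℕ) (α : ℝ) : (weight d α).HasTemperateGrowth :=
  Function.HasTemperateGrowth.comp Complex.ofRealCLM.hasTemperateGrowth
    (Function.hasTemperateGrowth_one_add_norm_sq_rpow (Space d) (α / 2))

lemma weightedBessel_injective (d : ℕ) (s α : ℝ) :
    Function.Injective (weightedBessel d s α) := by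
  have hw : weight d α * weight d (-α) = fun _ => 1 := by
    funext x
    have hx : (0 : ℝ) < 1 + ‖x‖ ^ 2 := by positivity
    simp only [weight, Pi.mul_apply, ← Complex.ofReal_mul]
    rw [← Real.rpow_add hx, show α / 2 + -α / 2 = 0 by ring, Real.rpow_zero, Complex.ofReal_one]
  have hb : besselSymbol d s * besselSymbol d (-s) = fun _ => 1 := by
    funext x
    have hx : (0 : ℝ) < 1 + ‖(2 * Real.pi) • x‖ ^ 2 := by positivity
    simp only [besselSymbol, Pi.mul_apply, ← Complex.ofReal_mul]
    rw [← Real.rpow_add hx, show s / 2 + -s / 2 = 0 by ring, Real.rpow_zero, Complex.ofReal_one]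
  refine Function.LeftInverse.injective
    (g := fun T => fourierMultiplierCLM ℂ (besselSymbol d (-s)) (smulLeftCLM ℂ (weight d (-α)) T))
    fun T => ?_
  change fourierMultiplierCLM ℂ (besselSymbol d (-s)) (smulLeftCLM ℂ (weight d (-α))
    (smulLeftCLM ℂ (weight d α) (fourierMultiplierCLM ℂ (besselSymbol d s) T))) = T
  rw [smulLeftCLM_smulLeftCLM_apply (weight_growth d α) (weight_growth d (-α)), hw,
    smulLeftCLM_const, one_smul,
    fourierMultiplierCLM_fourierMultiplierCLM_apply (besselSymbol_growth d _)
      (besselSymbol_growth d _), hb]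
  simp

lemma toTempered_injective (d : ℕ) :
    Function.Injective (Lp.toTemperedDistributionCLM ℂ (volume : Measure (Space d)) 2) :=
  LinearMap.ker_eq_bot.1 Lp.ker_toTemperedDistributionCLM_eq_bot

/-- The linear map `T ↦ ⟨x⟩^α Λ^s T` from `H^{s,α}` to `L²`. -/
def WSobolev.toL2 (d : ℕ) (s α : ℝ) :
    WSobolev d s α →ₗ[ℝ] Lp ℂ 2 (volume : Measure (Space d)) where
  toFun T := T.2.2.choose
  map_add' S T := by
    apply toTempered_injective d
    rw [map_add, ← S.2.2.choose_spec, ← T.2.2.choose_spec, ← (S + T).2.2.choose_spec]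
    exact map_add (weightedBessel d s α) S.1 T.1
  map_smul' c T := by
    apply toTempered_injective d
    have h : c • T.1 = (c : ℂ) • T.1 := by
      ext φ
      change c • T.1 φ = (c : ℂ) • T.1 φ
      simp
    have h' : c • (T.2.2.choose) = (c : ℂ) • T.2.2.choose := by
      ext1
      filter_upwards [Lp.coeFn_smul c T.2.2.choose, Lp.coeFn_smul (c : ℂ) T.2.2.choose]
        with x h1 h2
      rw [h1, h2]
      simp
    rw [RingHom.id_apply, h', map_smul, ← T.2.2.choose_spec, ← (c • T).2.2.choose_spec]
    change weightedBessel d s α (c • T.1) = _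
    rw [h, map_smul]

lemma WSobolev.toL2_spec {d : ℕ} {s α : ℝ} (T : WSobolev d s α) :
    weightedBessel d s α T.dist =
      Lp.toTemperedDistributionCLM ℂ volume 2 (WSobolev.toL2 d s α T) :=
  T.2.2.choose_spec

lemma WSobolev.toL2_injective (d : ℕ) (s α : ℝ) :
    Function.Injective (WSobolev.toL2 d s α) := by
  intro S T h
  apply Subtype.ext
  apply weightedBessel_injective d s α
  have hS := S.toL2_spec
  have hT := T.toL2_spec
  rw [h] at hS
  exact hS.trans hT.symm

/-- The norm `‖T‖_{s,α} = ‖⟨x⟩^α Λ^s T‖_{L²}`. -/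
instance (d : ℕ) (s α : ℝ) : NormedAddCommGroup (WSobolev d s α) :=
  NormedAddCommGroup.induced _ _ (WSobolev.toL2 d s α) (WSobolev.toL2_injective d s α)

instance (d : ℕ) (s α : ℝ) : NormedSpace ℝ (WSobolev d s α) :=
  NormedSpace.induced ℝ _ _ (WSobolev.toL2 d s α)

/-! ### The weighted lattice spaces `L^α` -/

/-- The sequence `k ↦ ⟨k⟩^α u(k)`. -/
def latWeighted {d n : ℕ} (α : ℝ) (u : Lat d → Vec n) (k : Lat d) : Vec n :=
  ((1 + ‖latPt k‖ ^ 2) ^ (α / 2) : ℝ) • u k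

/-- The sequences `u` with `∑ (1 + |k|²)^α |u(k)|² < ∞`. -/
def latSubmodule (d n : ℕ) (α : ℝ) : Submodule ℝ (Lat d → Vec n) where
  carrier := {u | Memℓp (latWeighted α u) 2}
  add_mem' := by
    intro u v hu hv
    have : latWeighted α (u + v) = latWeighted α u + latWeighted α v := by
      funext k; simp [latWeighted]
    change Memℓp (latWeighted α (u + v)) 2
    rw [this]
    exact hu.add hv
  zero_mem' := by
    have : latWeighted α (0 : Lat d → Vec n) = 0 := by funext k; simp [latWeighted]
    change Memℓp (latWeighted α 0) 2
    rw [this]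
    exact zero_memℓp
  smul_mem' := by
    intro c u hu
    have : latWeighted α (c • u) = c • latWeighted α u := by
      funext k; simp [latWeighted, smul_comm c]
    change Memℓp (latWeighted α (c • u)) 2
    rw [this]
    exact hu.const_smul c

/-- The Hilbert space `L^α` (a type of its own, with the norm topology). -/
def WLattice (d n : ℕ) (α : ℝ) : Type := latSubmodule d n α

instance (d n : ℕ) (α : ℝ) : AddCommGroup (WLattice d n α) :=
  inferInstanceAs (AddCommGroup (latSubmodule d n α))

instance (d n : ℕ) (α : ℝ) : Module ℝ (WLattice d n α) :=
  inferInstanceAs (Module ℝ (latSubmodule d n α))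

/-- The underlying sequence. -/
def WLattice.seq {d n : ℕ} {α : ℝ} (u : WLattice d n α) : Lat d → Vec n := u.1

/-- The linear map `u ↦ ⟨k⟩^α u(k)` from `L^α` to `ℓ²`. -/
def WLattice.toEll2 (d n : ℕ) (α : ℝ) :
    WLattice d n α →ₗ[ℝ] lp (fun _ : Lat d => Vec n) 2 where
  toFun u := ⟨latWeighted α u.1, u.2⟩
  map_add' u v := by
    ext1
    funext k
    exact smul_add _ (u.1 k) (v.1 k)
  map_smul' c u := by
    ext1
    funext k
    exact smul_comm _ c (u.1 k)

lemma WLattice.toEll2_injective (d n : ℕ) (α : ℝ) :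
    Function.Injective (WLattice.toEll2 d n α) := by
  intro u v h
  apply Subtype.ext
  funext k
  have hk : latWeighted α u.1 k = latWeighted α v.1 k := congrFun (congrArg Subtype.val h) k
  have hpos : ((1 + ‖latPt k‖ ^ 2) ^ (α / 2) : ℝ) ≠ 0 := by positivity
  exact smul_right_injective _ hpos hk

/-- The norm `‖u‖_α = (∑ (1 + |k|²)^α |u(k)|²)^{1/2}`. -/
instance (d n : ℕ) (α : ℝ) : NormedAddCommGroup (WLattice d n α) :=
  NormedAddCommGroup.induced _ _ (WLattice.toEll2 d n α) (WLattice.toEll2_injective d n α)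

instance (d n : ℕ) (α : ℝ) : NormedSpace ℝ (WLattice d n α) :=
  NormedSpace.induced ℝ _ _ (WLattice.toEll2 d n α)

/-! ### The phase spaces `E^{s,α}` -/

/-- `E^{s,α} = H^{1+s,α} ⊕ L^α ⊕ H^{s,α} ⊕ L^α`, grouped as `Y = (Y⁰, Y¹) = ((ψ, u), (π, v))`, with
`‖Y‖² = ‖ψ‖²_{1+s,α} + ‖u‖²_α + ‖π‖²_{s,α} + ‖v‖²_α`. -/
def Phase (d n : ℕ) (s α : ℝ) : Type :=
  WithLp 2 (WithLp 2 (WSobolev d (1 + s) α × WLattice d n α) ×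
    WithLp 2 (WSobolev d s α × WLattice d n α))

namespace Phase

variable {d n : ℕ} {s α : ℝ}

instance : NormedAddCommGroup (Phase d n s α) :=
  inferInstanceAs (NormedAddCommGroup (WithLp 2 (WithLp 2 (WSobolev d (1 + s) α × WLattice d n α) ×
    WithLp 2 (WSobolev d s α × WLattice d n α))))

instance : NormedSpace ℝ (Phase d n s α) :=
  inferInstanceAs (NormedSpace ℝ (WithLp 2 (WithLp 2 (WSobolev d (1 + s) α × WLattice d n α) ×
    WithLp 2 (WSobolev d s α × WLattice d n α))))

instance : MeasurableSpace (Phase d n s α) := borel _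

instance : BorelSpace (Phase d n s α) := ⟨rfl⟩

/-- The field `ψ`. -/
def psi (Y : Phase d n s α) : 𝓢'(Space d, ℂ) := (WithLp.fst (WithLp.fst Y)).dist

/-- The displacements `u`. -/
def u (Y : Phase d n s α) : Lat d → Vec n := (WithLp.snd (WithLp.fst Y)).seq

/-- The momentum `π` of the field. -/
def mom (Y : Phase d n s α) : 𝓢'(Space d, ℂ) := (WithLp.fst (WithLp.snd Y)).dist

/-- The velocities `v`. -/
def v (Y : Phase d n s α) : Lat d → Vec n := (WithLp.snd (WithLp.snd Y)).seq

end Phase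

/-! ### The dynamics -/

/-- The distribution `T` is the locally integrable function `f`. -/
def Represents {d : ℕ} (f : Space d → ℝ) (T : 𝓢'(Space d, ℂ)) : Prop :=
  LocallyIntegrable f volume ∧
    ∀ φ : 𝓢(Space d, ℂ), HasCompactSupport φ → T φ = ∫ x, φ x * (f x : ℂ)

open scoped Classical in
/-- The function (unique almost everywhere) that represents a distribution which is a locally
integrable function. -/
def toFn {d : ℕ} (T : 𝓢'(Space d, ℂ)) : Space d → ℝ :=
  if h : ∃ f, Represents f T then h.choose else 0

/-- `(S u)(x) = ∑_k R(x - k) · u(k)`. -/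
def coupling {d n : ℕ} (R : Space d → Vec n) (u : Lat d → Vec n) (x : Space d) : ℝ :=
  ∑' k : Lat d, inner ℝ (R (x - latPt k)) (u k)

/-- `(S^* ψ)(k) = ∫ R(x - k) ψ(x) dx`. -/
def couplingAdj {d n : ℕ} (R : Space d → Vec n) (ψ : Space d → ℝ) (k : Lat d) : Vec n :=
  ∫ x, ψ x • R (x - latPt k)

/-- The discrete Laplacian `∑_{|e| = 1} (u(k + e) - u(k))`. -/
def latLaplacian {d n : ℕ} (u : Lat d → Vec n) (k : Lat d) : Vec n :=
  ∑ j : Fin d, ((u (k + Pi.single j 1) - u k) + (u (k - Pi.single j 1) - u k))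

/-- `Y ∈ C(ℝ, E^{0,α})` solves the Cauchy problem with initial datum `Y₀`; the field equations are
understood in the sense of distributions on `ℝ^d`. -/
structure IsSolution {d n : ℕ} {α : ℝ} (m₀ ν₀ : ℝ) (R : Space d → Vec n)
    (Y₀ : Phase d n 0 α) (Y : ℝ → Phase d n 0 α) : Prop where
  cont : Continuous Y
  init : Y 0 = Y₀
  eq_psi : ∀ (ξ : 𝓢(Space d, ℂ)), HasCompactSupport ξ → ∀ t : ℝ,
    HasDerivAt (fun τ => (Y τ).psi ξ) ((Y t).mom ξ) t
  eq_u : ∀ (k : Lat d) (t : ℝ), HasDerivAt (fun τ => (Y τ).u k) ((Y t).v k) t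
  eq_mom : ∀ (ξ : 𝓢(Space d, ℂ)), HasCompactSupport ξ → ∀ t : ℝ,
    HasDerivAt (fun τ => (Y τ).mom ξ)
      ((Δ (Y t).psi) ξ - (m₀ : ℂ) ^ 2 * (Y t).psi ξ
        - ∫ x, ξ x * ((coupling R (Y t).u x : ℝ) : ℂ)) t
  eq_v : ∀ (k : Lat d) (t : ℝ),
    HasDerivAt (fun τ => (Y τ).v k)
      (latLaplacian (Y t).u k - ν₀ ^ 2 • (Y t).u k - couplingAdj R (toFn (Y t).psi) k) t

open scoped Classical in
/-- The dynamical group `W(t) : Y₀ ↦ Y(t)` on `E^{0,α}`. -/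
def flow {d n : ℕ} {α : ℝ} (m₀ ν₀ : ℝ) (R : Space d → Vec n) (t : ℝ) (Y₀ : Phase d n 0 α) :
    Phase d n 0 α :=
  if h : ∃ Y, IsSolution m₀ ν₀ R Y₀ Y then h.choose t else 0

/-! ### Conditions on the coupling -/

/-- `R` is smooth and exponentially decaying. -/
def CondR1 {d n : ℕ} (R : Space d → Vec n) : Prop :=
  ContDiff ℝ ∞ R ∧ ∃ Rbar ε : ℝ, 0 < ε ∧ ∀ x, ‖R x‖ ≤ Rbar * Real.exp (-ε * ‖x‖)

/-- The unit cell `[0,1]^d`. -/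
def cell (d : ℕ) : Set (Space d) := {y | ∀ i, y i ∈ Set.Icc (0 : ℝ) 1}

/-- The `i`-th component of the Zak transform
`e^{i y·θ} ∑_k e^{i k·θ} R(k + y)` of the coupling function. -/
def zakR {d n : ℕ} (R : Space d → Vec n) (θ y : Space d) (i : Fin n) : ℂ :=
  Complex.exp (Complex.I * ((inner ℝ y θ : ℝ) : ℂ)) *
    ∑' k : Lat d, Complex.exp (Complex.I * ((inner ℝ (latPt k) θ : ℝ) : ℂ)) *
      ((R (latPt k + y) i : ℝ) : ℂ)

/-- `(i ∂_j + θ_j) φ`. -/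
def magDeriv {d : ℕ} (θ : Space d) (j : Fin d) (φ : Space d → ℂ) (y : Space d) : ℂ :=
  Complex.I * fderiv ℝ φ y (EuclideanSpace.single j 1) + (θ j : ℂ) * φ y

/-- `ω_*²(θ) = ∑_j 2 (1 - cos θ_j) + ν₀²`. -/
def omegaStarSq {d : ℕ} (ν₀ : ℝ) (θ : Space d) : ℝ :=
  ∑ j, 2 * (1 - Real.cos (θ j)) + ν₀ ^ 2

/-- The field component of the Bloch operator at `θ`:
`((i∇ + θ)² + m₀²) φ + R_Π(θ, ·) · w`. -/
def blochField {d n : ℕ} (m₀ : ℝ) (R : Space d → Vec n) (θ : Space d)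
    (φ : Space d → ℂ) (w : Fin n → ℂ) (y : Space d) : ℂ :=
  ∑ j, magDeriv θ j (magDeriv θ j φ) y + (m₀ : ℂ) ^ 2 * φ y + ∑ i, zakR R θ y i * w i

/-- The lattice component of the Bloch operator at `θ`:
`∫ R_Π(-θ, y) φ(y) dy + ω_*²(θ) w`. -/
def blochLattice {d n : ℕ} (ν₀ : ℝ) (R : Space d → Vec n) (θ : Space d)
    (φ : Space d → ℂ) (w : Fin n → ℂ) (i : Fin n) : ℂ :=
  (∫ y in cell d, zakR R (-θ) y i * φ y) + (omegaStarSq ν₀ θ : ℂ) * w i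

/-- The quadratic form `(X, H(θ) X)` of the Bloch operator, `X = (φ, w)`, with the inner product of
`L²([0,1]^d) ⊕ ℂ^n`. -/
def blochForm {d n : ℕ} (m₀ ν₀ : ℝ) (R : Space d → Vec n) (θ : Space d)
    (φ : Space d → ℂ) (w : Fin n → ℂ) : ℂ :=
  (∫ y in cell d, (starRingEnd ℂ) (φ y) * blochField m₀ R θ φ w y) +
    ∑ i, (starRingEnd ℂ) (w i) * blochLattice ν₀ R θ φ w i

/-- The Bloch operator is positive definite, uniformly for `θ ∈ [0,2π]^d`:
`(X, H(θ) X) ≥ κ² ‖X‖²_{H¹(T^d) ⊕ ℂ^n}`. The functions `φ` run over the smooth `ℤ^d`-periodic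
functions, which are dense in `H¹(T^d)`; both sides are continuous in the `H¹` norm. -/
def CondR2 {d n : ℕ} (m₀ ν₀ : ℝ) (R : Space d → Vec n) : Prop :=
  ∃ κ : ℝ, 0 < κ ∧ ∀ θ : Space d, (∀ i, θ i ∈ Set.Icc 0 (2 * Real.pi)) →
    ∀ (φ : Space d → ℂ) (w : Fin n → ℂ), ContDiff ℝ ∞ φ →
      (∀ (y : Space d) (k : Lat d), φ (y + latPt k) = φ y) →
      κ ^ 2 * ((∫ y in cell d,
          (‖φ y‖ ^ 2 + ∑ j, ‖fderiv ℝ φ y (EuclideanSpace.single j 1)‖ ^ 2)) + ∑ i, ‖w i‖ ^ 2)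
        ≤ (blochForm m₀ ν₀ R θ φ w).re

/-! ### Conditions on the initial measure -/

/-- The test space `D = [C_0^∞(ℝ^d) ⊕ D_L]²`: real-valued smooth compactly supported functions and
finitely supported sequences. -/
structure TestData (d n : ℕ) where
  ξ₀ : 𝓢(Space d, ℂ)
  χ₀ : Lat d →₀ Vec n
  ξ₁ : 𝓢(Space d, ℂ)
  χ₁ : Lat d →₀ Vec n
  real₀ : ∀ x, (ξ₀ x).im = 0
  real₁ : ∀ x, (ξ₁ x).im = 0
  compact₀ : HasCompactSupport ξ₀
  compact₁ : HasCompactSupport ξ₁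

/-- The pairing `⟨Y, Z⟩`. -/
def pairing {d n : ℕ} {s α : ℝ} (Y : Phase d n s α) (Z : TestData d n) : ℝ :=
  (Y.psi Z.ξ₀).re + (Z.χ₀.sum fun k w => inner ℝ (Y.u k) w) +
    (Y.mom Z.ξ₁).re + (Z.χ₁.sum fun k w => inner ℝ (Y.v k) w)

/-- `Z'` is `Z` translated by `k ∈ ℤ^d`. -/
def IsTranslate {d n : ℕ} (k : Lat d) (Z Z' : TestData d n) : Prop :=
  (∀ x, Z'.ξ₀ x = Z.ξ₀ (x - latPt k)) ∧ (∀ j, Z'.χ₀ j = Z.χ₀ (j - k)) ∧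
    (∀ x, Z'.ξ₁ x = Z.ξ₁ (x - latPt k)) ∧ (∀ j, Z'.χ₁ j = Z.χ₁ (j - k))

/-- Zero expectation, `E Y₀(p) ≡ 0`. -/
def CondS0 {d n : ℕ} {α : ℝ} (μ : Measure (Phase d n 0 α)) : Prop :=
  ∀ Z : TestData d n, ∫ Y, pairing Y Z ∂μ = 0

/-- The correlation functions `E (Y₀(p) ⊗ Y₀(p'))` are invariant under `ℤ^d`-translations. -/
def CondS1 {d n : ℕ} {α : ℝ} (μ : Measure (Phase d n 0 α)) : Prop :=
  ∀ (k : Lat d) (Z₁ Z₂ Z₁' Z₂' : TestData d n), IsTranslate k Z₁ Z₁' → IsTranslate k Z₂ Z₂' →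
    ∫ Y, pairing Y Z₁' * pairing Y Z₂' ∂μ = ∫ Y, pairing Y Z₁ * pairing Y Z₂ ∂μ

/-- Finite mean energy density: `E(|∇ψ₀(x)|² + |ψ₀(x)|² + |π₀(x)|²) ≤ ē_F` for almost all `x`, and
`E(|u₀(k)|² + |v₀(k)|²) < ∞`. Here `ψ₀, ∇ψ₀, π₀` are read through jointly measurable versions
`p`, `g`, `q`, which are unique up to `μ × dx`-null sets. -/
def CondS2 {d n : ℕ} {α : ℝ} (μ : Measure (Phase d n 0 α)) : Prop :=
  (∃ (p q : Phase d n 0 α × Space d → ℝ) (g : Phase d n 0 α × Space d → Space d),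
    Measurable p ∧ Measurable q ∧ Measurable g ∧
    (∀ᵐ Y ∂μ, Represents (fun x => p (Y, x)) Y.psi ∧ Represents (fun x => q (Y, x)) Y.mom ∧
      ∀ i : Fin d, Represents (fun x => g (Y, x) i)
        (∂_{(EuclideanSpace.single i 1 : Space d)} Y.psi)) ∧
    ∃ eF : ℝ≥0, ∀ᵐ x : Space d,
      ∫⁻ Y, (‖g (Y, x)‖ₑ ^ 2 + ‖p (Y, x)‖ₑ ^ 2 + ‖q (Y, x)‖ₑ ^ 2) ∂μ ≤ eF) ∧
  ∀ k : Lat d, ∫⁻ Y, (‖Y.u k‖ₑ ^ 2 + ‖Y.v k‖ₑ ^ 2) ∂μ < ⊤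

/-- The position in `ℝ^d` of a point of the disjoint union `ℝ^d ⊔ ℤ^d`. -/
def pos {d : ℕ} : Space d ⊕ Lat d → Space d := Sum.elim id latPt

/-- `supp Z ⊆ A`, for `A ⊆ ℝ^d ⊔ ℤ^d`. -/
def SuppIn {d n : ℕ} (Z : TestData d n) (A : Set (Space d ⊕ Lat d)) : Prop :=
  (∀ x, x ∈ tsupport Z.ξ₀ ∨ x ∈ tsupport Z.ξ₁ → Sum.inl x ∈ A) ∧
    ∀ k, Z.χ₀ k ≠ 0 ∨ Z.χ₁ k ≠ 0 → Sum.inr k ∈ A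

/-- The σ-algebra `σ(A)` generated by the functionals `Y ↦ ⟨Y, Z⟩` with `supp Z ⊆ A`. -/
@[reducible]
def sigmaAlg {d n : ℕ} {α : ℝ} (A : Set (Space d ⊕ Lat d)) : MeasurableSpace (Phase d n 0 α) :=
  ⨆ (Z : TestData d n) (_ : SuppIn Z A), (borel ℝ).comap fun Y => pairing Y Z

/-- The Ibragimov–Linnik mixing coefficient `φ(r)`. -/
def mixCoeff {d n : ℕ} {α : ℝ} (μ : Measure (Phase d n 0 α)) (r : ℝ) : ℝ≥0∞ :=
  ⨆ (A : Set (Space d ⊕ Lat d)) (B : Set (Space d ⊕ Lat d)) (_ : IsOpen A) (_ : IsOpen B)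
    (_ : ∀ p ∈ A, ∀ q ∈ B, r ≤ ‖pos p - pos q‖)
    (S : Set (Phase d n 0 α)) (T : Set (Phase d n 0 α))
    (_ : MeasurableSet[sigmaAlg A] S) (_ : MeasurableSet[sigmaAlg B] T) (_ : 0 < μ T),
    ENNReal.ofReal (|μ.real (S ∩ T) - μ.real S * μ.real T| / μ.real T)

/-- Strong uniform mixing, with `∫_0^∞ r^{d-1} φ(r)^{1/2} dr < ∞`. -/
def CondS3 {d n : ℕ} {α : ℝ} (μ : Measure (Phase d n 0 α)) : Prop :=
  Tendsto (mixCoeff μ) atTop (𝓝 0) ∧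
    ∫⁻ r in Set.Ioi (0 : ℝ), ENNReal.ofReal (r ^ (d - 1)) * mixCoeff μ r ^ (1 / 2 : ℝ) < ⊤

end FieldCrystal

end

open MeasureTheory Filter Topology TemperedDistribution
open scoped SchwartzMap ENNReal NNReal ContDiff LineDeriv Laplacian

noncomputable section

namespace FieldCrystal

/-- Fourier multipliers on Schwartz functions. -/
notation "𝓜" => SchwartzMap.fourierMultiplierCLM ℂ

/-- Real Schwartz functions. -/
abbrev SR (d : ℕ) : Type := 𝓢(Space d, ℝ)

/-- Complex Schwartz functions. -/
abbrev SC (d : ℕ) : Type := 𝓢(Space d, ℂ)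

/-! ### Weights -/

/-- The weight `(1 + ε²|x|²)^(a/2)`. -/
def wt {d : ℕ} (ε a : ℝ) (x : Space d) : ℝ := (1 + ε ^ 2 * ‖x‖ ^ 2) ^ (a / 2)

/-- The Peetre factor `(2 (1 + |z|²))^(|a|/2)`. -/
def peetre {d : ℕ} (a : ℝ) (z : Space d) : ℝ := (2 * (1 + ‖z‖ ^ 2)) ^ (|a| / 2)

section weights

variable {d : ℕ} {ε a : ℝ}

lemma wt_base_pos (ε : ℝ) (x : Space d) : 0 < 1 + ε ^ 2 * ‖x‖ ^ 2 := by positivity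

lemma wt_pos (ε a : ℝ) (x : Space d) : 0 < wt ε a x := Real.rpow_pos_of_pos (wt_base_pos ε x) _

lemma wt_ne_zero (ε a : ℝ) (x : Space d) : wt ε a x ≠ 0 := (wt_pos ε a x).ne'

lemma wt_mul_wt (ε a b : ℝ) (x : Space d) : wt ε a x * wt ε b x = wt ε (a + b) x := by
  rw [wt, wt, wt, ← Real.rpow_add (wt_base_pos ε x)]
  congr 1; ring

lemma wt_zero (ε : ℝ) (x : Space d) : wt ε 0 x = 1 := by simp [wt]

lemma wt_neg_mul_wt (ε a : ℝ) (x : Space d) : wt ε (-a) x * wt ε a x = 1 := by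
  rw [wt_mul_wt, neg_add_cancel, wt_zero]

lemma wt_mul_wt_neg (ε a : ℝ) (x : Space d) : wt ε a x * wt ε (-a) x = 1 := by
  rw [mul_comm, wt_neg_mul_wt]

lemma wt_neg (ε a : ℝ) (x : Space d) : wt ε (-a) x = (wt ε a x)⁻¹ :=
  eq_inv_of_mul_eq_one_left (wt_neg_mul_wt ε a x)

lemma wt_sq (ε a : ℝ) (x : Space d) : wt ε a x ^ 2 = (1 + ε ^ 2 * ‖x‖ ^ 2) ^ a := by
  rw [sq, wt_mul_wt, wt]; congr 1; ring

lemma weight_eq_wt (a : ℝ) (x : Space d) : weight d a x = (wt 1 a x : ℂ) := by simp [weight, wt]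

lemma wt_growth (ε a : ℝ) : (wt ε a : Space d → ℝ).HasTemperateGrowth := by
  have h1 := Function.hasTemperateGrowth_one_add_norm_sq_rpow (Space d) (a / 2)
  have h2 : (fun x : Space d => ε • x).HasTemperateGrowth :=
    (ε • ContinuousLinearMap.id ℝ (Space d)).hasTemperateGrowth
  have h4 : (wt ε a : Space d → ℝ) = (fun x => (1 + ‖x‖ ^ 2) ^ (a / 2)) ∘ fun x => ε • x := by
    funext x
    simp [wt, norm_smul, mul_pow]
  exact h4 ▸ h1.comp h2

lemma contDiff_wt (ε a : ℝ) : ContDiff ℝ ∞ (wt ε a : Space d → ℝ) := (wt_growth ε a).1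

lemma continuous_wt (ε a : ℝ) : Continuous (wt ε a : Space d → ℝ) := (contDiff_wt ε a).continuous

lemma measurable_wt (ε a : ℝ) : Measurable (wt ε a : Space d → ℝ) := (continuous_wt ε a).measurable

lemma peetre_pos (a : ℝ) (z : Space d) : 0 < peetre a z := Real.rpow_pos_of_pos (by positivity) _

lemma continuous_peetre (a : ℝ) : Continuous (peetre a : Space d → ℝ) := by
  unfold peetre
  exact Continuous.rpow_const (by fun_prop) fun x => Or.inl (by positivity)

lemma peetre_mono (a : ℝ) {x y : Space d} (h : ‖x‖ ≤ ‖y‖) : peetre a x ≤ peetre a y := by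
  unfold peetre
  gcongr

lemma peetre_neg (a : ℝ) (z : Space d) : peetre a (-z) = peetre a z := by simp [peetre]

lemma peetre_abs (a : ℝ) (z : Space d) : peetre (-a) z = peetre a z := by simp [peetre]

lemma wt_base_le (hε : ε ^ 2 ≤ 1) (x y : Space d) :
    1 + ε ^ 2 * ‖x‖ ^ 2 ≤ (1 + ε ^ 2 * ‖y‖ ^ 2) * (2 * (1 + ‖x - y‖ ^ 2)) := by
  have h1 : ‖x‖ ≤ ‖y‖ + ‖x - y‖ := by
    calc ‖x‖ = ‖y + (x - y)‖ := by congr 1; abel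
      _ ≤ _ := norm_add_le _ _
  have h2 : ‖x‖ ^ 2 ≤ 2 * ‖y‖ ^ 2 + 2 * ‖x - y‖ ^ 2 := by
    nlinarith [sq_nonneg (‖y‖ - ‖x - y‖), norm_nonneg x]
  nlinarith [mul_nonneg (sq_nonneg ε) (sq_nonneg ‖y‖), mul_nonneg (sq_nonneg ε) (sq_nonneg ‖x - y‖),
    mul_nonneg (mul_nonneg (sq_nonneg ε) (sq_nonneg ‖y‖)) (sq_nonneg ‖x - y‖), sq_nonneg ‖x - y‖,
    sq_nonneg ‖y‖, mul_le_mul_of_nonneg_left h2 (sq_nonneg ε)]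

/-- Peetre's inequality. -/
lemma wt_le_peetre_mul (hε : ε ^ 2 ≤ 1) (a : ℝ) (x y : Space d) :
    wt ε a x ≤ peetre a (x - y) * wt ε a y := by
  have hx := wt_base_pos ε x
  have hy := wt_base_pos ε y
  have hz : 0 < 2 * (1 + ‖x - y‖ ^ 2) := by positivity
  rcases le_total 0 a with ha | ha
  · rw [wt, wt, peetre, abs_of_nonneg ha, ← Real.mul_rpow hz.le hy.le]
    refine Real.rpow_le_rpow hx.le ?_ (by positivity)
    exact (wt_base_le hε x y).trans_eq (mul_comm _ _)
  · have h := wt_base_le hε y x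
    rw [norm_sub_rev] at h
    have h' : (1 + ε ^ 2 * ‖y‖ ^ 2) / (2 * (1 + ‖x - y‖ ^ 2)) ≤ 1 + ε ^ 2 * ‖x‖ ^ 2 := by
      rwa [div_le_iff₀ hz]
    calc wt ε a x ≤ ((1 + ε ^ 2 * ‖y‖ ^ 2) / (2 * (1 + ‖x - y‖ ^ 2))) ^ (a / 2) :=
          Real.rpow_le_rpow_of_nonpos (by positivity) h' (by linarith)
      _ = _ := by
          rw [Real.div_rpow hy.le hz.le, peetre, abs_of_nonpos ha, wt, neg_div, Real.rpow_neg hz.le]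
          ring

lemma hasFDerivAt_wt (ε a : ℝ) (x : Space d) :
    HasFDerivAt (wt ε a : Space d → ℝ)
      ((a * ε ^ 2 * (1 + ε ^ 2 * ‖x‖ ^ 2) ^ (a / 2 - 1)) • innerSL ℝ x) x := by
  have h1 : HasFDerivAt (fun y : Space d => 1 + ε ^ 2 * ‖y‖ ^ 2)
      (ε ^ 2 • (2 • innerSL ℝ x)) x :=
    ((hasStrictFDerivAt_norm_sq x).hasFDerivAt.const_mul (ε ^ 2)).const_add 1
  have h2 := h1.rpow_const (p := a / 2) (Or.inl (wt_base_pos ε x).ne')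
  refine h2.congr_fderiv ?_
  ext y
  simp
  ring

lemma norm_fderiv_wt_le (hε : 0 ≤ ε) (a : ℝ) (x : Space d) :
    ‖fderiv ℝ (wt ε a : Space d → ℝ) x‖ ≤ |a| * ε * wt ε a x := by
  have hx := wt_base_pos ε x
  rw [(hasFDerivAt_wt ε a x).fderiv, norm_smul, innerSL_apply_norm, Real.rpow_sub_one hx.ne',
    Real.norm_eq_abs, abs_mul, abs_mul, abs_of_nonneg (sq_nonneg ε), abs_div, abs_of_pos hx]
  rw [show |(1 + ε ^ 2 * ‖x‖ ^ 2) ^ (a / 2)| = wt ε a x from abs_of_pos (wt_pos ε a x)]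
  have : ε ^ 2 * ‖x‖ ≤ ε * (1 + ε ^ 2 * ‖x‖ ^ 2) := by
    nlinarith [sq_nonneg (ε * ‖x‖ - 1 / 2), mul_nonneg hε (sq_nonneg (ε * ‖x‖ - 1 / 2))]
  calc |a| * ε ^ 2 * (wt ε a x / (1 + ε ^ 2 * ‖x‖ ^ 2)) * ‖x‖
      = |a| * wt ε a x * (ε ^ 2 * ‖x‖ / (1 + ε ^ 2 * ‖x‖ ^ 2)) := by ring
    _ ≤ |a| * wt ε a x * ε := by
        have := (div_le_iff₀ hx).2 this
        have h0 := (wt_pos ε a x).le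
        gcongr
    _ = _ := by ring

lemma abs_wt_sub_le (hε : 0 ≤ ε) (hε1 : ε ≤ 1) (a : ℝ) (x y : Space d) :
    |wt ε a x - wt ε a y| ≤ |a| * ε * ‖x - y‖ * peetre a (x - y) * wt ε a y := by
  have hε2 : ε ^ 2 ≤ 1 := by nlinarith
  have key : ∀ z ∈ segment ℝ y x, ‖fderiv ℝ (wt ε a : Space d → ℝ) z‖ ≤
      |a| * ε * (peetre a (x - y) * wt ε a y) := by
    intro z hz
    refine (norm_fderiv_wt_le hε a z).trans ?_
    have h1 := wt_le_peetre_mul hε2 a z y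
    have h2 : peetre a (z - y) ≤ peetre a (x - y) := by
      apply peetre_mono
      rw [segment_eq_image'] at hz
      obtain ⟨θ, hθ, rfl⟩ := hz
      rw [add_sub_cancel_left, norm_smul, Real.norm_eq_abs, abs_of_nonneg hθ.1]
      exact mul_le_of_le_one_left (norm_nonneg _) hθ.2
    have h3 : wt ε a z ≤ peetre a (x - y) * wt ε a y :=
      h1.trans (mul_le_mul_of_nonneg_right h2 (wt_pos ε a y).le)
    gcongr
  have := (convex_segment y x).norm_image_sub_le_of_norm_fderiv_le (𝕜 := ℝ)
    (fun z _ => ((contDiff_wt ε a).differentiable (by simp)).differentiableAt) key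
    (left_mem_segment ℝ y x) (right_mem_segment ℝ y x)
  exact this.trans_eq (by ring)

lemma wt_le_one (ha : a ≤ 0) (ε : ℝ) (x : Space d) : wt ε a x ≤ 1 :=
  Real.rpow_le_one_of_one_le_of_nonpos (by nlinarith [mul_nonneg (sq_nonneg ε) (sq_nonneg ‖x‖)])
    (by linarith)

lemma wt_one_le (ha : a ≤ 0) (hε1 : ε ^ 2 ≤ 1) (x : Space d) : wt 1 a x ≤ wt ε a x :=
  Real.rpow_le_rpow_of_nonpos (wt_base_pos ε x) (by nlinarith [sq_nonneg ‖x‖]) (by linarith)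

lemma wt_le_mul_wt_one (ha : a ≤ 0) (hε : 0 < ε) (hε1 : ε ≤ 1) (x : Space d) :
    wt ε a x ≤ (ε ^ 2) ^ (a / 2) * wt 1 a x := by
  rw [wt, wt, ← Real.mul_rpow (by positivity) (by positivity)]
  exact Real.rpow_le_rpow_of_nonpos (by positivity) (by nlinarith) (by linarith)

lemma integrable_wt_one_sq (ha : a < -(d : ℝ) / 2) :
    Integrable (fun x : Space d => wt 1 a x ^ 2) := by
  have := integrable_rpow_neg_one_add_norm_sq (E := Space d) (μ := volume) (r := -(2 * a))
    (by simp; linarith)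
  convert this using 1
  funext x
  rw [wt_sq]
  congr 1 <;> ring

lemma integrable_wt_sq (ha : a < -(d : ℝ) / 2) (hε : 0 < ε) (hε1 : ε ≤ 1) :
    Integrable (fun x : Space d => wt ε a x ^ 2) := by
  have ha0 : a ≤ 0 := by have : (0 : ℝ) ≤ d := by positivity
                         linarith
  refine ((integrable_wt_one_sq ha).const_mul (((ε ^ 2) ^ (a / 2)) ^ 2)).mono'
    ((continuous_wt ε a).pow 2).aestronglyMeasurable (ae_of_all _ fun x => ?_)
  rw [Real.norm_eq_abs, abs_of_nonneg (sq_nonneg _), ← mul_pow]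
  exact pow_le_pow_left₀ (wt_pos _ _ _).le (wt_le_mul_wt_one ha0 hε hε1 x) 2

end weights

/-! ### Schur's test -/

lemma lintegral_schur {X Y : Type*} [MeasurableSpace X] [MeasurableSpace Y] {μ : Measure X}
    {ν : Measure Y} [SFinite μ] [SFinite ν] {k : X → Y → ℝ≥0∞}
    (hk : Measurable (Function.uncurry k))
    {f : Y → ℝ≥0∞} (hf : Measurable f) {A B : ℝ≥0∞} (hA : ∀ᵐ x ∂μ, ∫⁻ y, k x y ∂ν ≤ A)
    (hB : ∀ᵐ y ∂ν, ∫⁻ x, k x y ∂μ ≤ B) :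
    ∫⁻ x, (∫⁻ y, k x y * f y ∂ν) ^ 2 ∂μ ≤ A * B * ∫⁻ y, f y ^ 2 ∂ν := by
  have hkx : ∀ x, Measurable (k x) := fun x => hk.comp measurable_prodMk_left
  have h1 : ∀ᵐ x ∂μ, (∫⁻ y, k x y * f y ∂ν) ^ 2 ≤ A * ∫⁻ y, k x y * f y ^ 2 ∂ν := by
    filter_upwards [hA] with x hx
    have hpq : (2 : ℝ).HolderConjugate 2 := Real.HolderConjugate.two_two
    have := ENNReal.lintegral_mul_le_Lp_mul_Lq ν hpq
      (f := fun y => k x y ^ (1 / 2 : ℝ)) (g := fun y => k x y ^ (1 / 2 : ℝ) * f y)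
      ((hkx x).pow_const _).aemeasurable (((hkx x).pow_const _).mul hf).aemeasurable
    have e1 : ∀ y, ((fun y => k x y ^ (1 / 2 : ℝ)) * fun y => k x y ^ (1 / 2 : ℝ) * f y) y =
        k x y * f y := by
      intro y
      simp only [Pi.mul_apply]
      rw [← mul_assoc, ← ENNReal.rpow_add_of_nonneg _ _ (by norm_num) (by norm_num)]
      norm_num
    have e2 : ∀ y, (k x y ^ (1 / 2 : ℝ)) ^ (2 : ℝ) = k x y := by
      intro y; rw [← ENNReal.rpow_mul]; norm_num
    have e3 : ∀ y, (k x y ^ (1 / 2 : ℝ) * f y) ^ (2 : ℝ) = k x y * f y ^ 2 := by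
      intro y
      rw [ENNReal.mul_rpow_of_nonneg _ _ (by norm_num), e2]
      norm_num
    simp only [e1, e2, e3] at this
    calc (∫⁻ y, k x y * f y ∂ν) ^ 2
        ≤ ((∫⁻ y, k x y ∂ν) ^ (1 / 2 : ℝ) * (∫⁻ y, k x y * f y ^ 2 ∂ν) ^ (1 / 2 : ℝ)) ^ 2 := by
          gcongr
      _ = (∫⁻ y, k x y ∂ν) * ∫⁻ y, k x y * f y ^ 2 ∂ν := by
          rw [mul_pow, ← ENNReal.rpow_natCast, ← ENNReal.rpow_natCast, ← ENNReal.rpow_mul,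
            ← ENNReal.rpow_mul]
          norm_num
      _ ≤ _ := by gcongr
  calc ∫⁻ x, (∫⁻ y, k x y * f y ∂ν) ^ 2 ∂μ
      ≤ ∫⁻ x, A * ∫⁻ y, k x y * f y ^ 2 ∂ν ∂μ := lintegral_mono_ae h1
    _ = A * ∫⁻ x, ∫⁻ y, k x y * f y ^ 2 ∂ν ∂μ := by
        rw [lintegral_const_mul]
        exact (hk.mul ((hf.comp measurable_snd).pow_const 2)).lintegral_prod_right
    _ = A * ∫⁻ y, ∫⁻ x, k x y * f y ^ 2 ∂μ ∂ν := by
        rw [lintegral_lintegral_swap]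
        exact (hk.mul ((hf.comp measurable_snd).pow_const 2)).aemeasurable
    _ = A * ∫⁻ y, (∫⁻ x, k x y ∂μ) * f y ^ 2 ∂ν := by
        congr 1
        refine lintegral_congr fun y => ?_
        rw [lintegral_mul_const]
        exact hk.comp measurable_prodMk_right
    _ ≤ A * ∫⁻ y, B * f y ^ 2 ∂ν := by
        gcongr 1
        refine lintegral_mono_ae ?_
        filter_upwards [hB] with y hy
        gcongr
    _ = A * B * ∫⁻ y, f y ^ 2 ∂ν := by rw [lintegral_const_mul _ (hf.pow_const 2), mul_assoc]

/-! ### Integral operators on `L²` -/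

section L2ops

variable {X Y F : Type*} [MeasurableSpace X] [MeasurableSpace Y] {μ : Measure X} {ν : Measure Y}
  [NormedAddCommGroup F]

lemma enorm_sq_Lp_two (f : Lp F 2 μ) : ‖f‖ₑ ^ 2 = ∫⁻ x, ‖f x‖ₑ ^ 2 ∂μ := by
  rw [Lp.enorm_def, eLpNorm_eq_lintegral_rpow_enorm_toReal (by norm_num) (by norm_num)]
  simp only [ENNReal.toReal_ofNat, ENNReal.rpow_ofNat, one_div]
  rw [← ENNReal.rpow_natCast, ← ENNReal.rpow_mul]
  norm_num

lemma memLp_two_of_lintegral_lt_top {f : X → F} (hf : AEStronglyMeasurable f μ)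
    (h : ∫⁻ x, ‖f x‖ₑ ^ 2 ∂μ < ⊤) : MemLp f 2 μ := by
  refine ⟨hf, ?_⟩
  rw [eLpNorm_eq_lintegral_rpow_enorm_toReal (by norm_num) (by norm_num)]
  simp only [ENNReal.toReal_ofNat, ENNReal.rpow_ofNat, one_div]
  exact ENNReal.rpow_lt_top_of_nonneg (by norm_num) h.ne

lemma enorm_sq_toLp {f : X → F} (hf : MemLp f 2 μ) :
    ‖hf.toLp f‖ₑ ^ 2 = ∫⁻ x, ‖f x‖ₑ ^ 2 ∂μ := by
  rw [enorm_sq_Lp_two]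
  refine lintegral_congr_ae ?_
  filter_upwards [hf.coeFn_toLp] with x hx
  rw [hx]

lemma MemLp.lintegral_sq_lt_top {f : X → F} (hf : MemLp f 2 μ) : ∫⁻ x, ‖f x‖ₑ ^ 2 ∂μ < ⊤ :=
  enorm_sq_toLp hf ▸ ENNReal.pow_lt_top enorm_lt_top

lemma norm_le_of_enorm_sq_le {E G : Type*} [SeminormedAddGroup E] [SeminormedAddGroup G] {x : E}
    {y : G} {C : ℝ≥0} (h : ‖x‖ₑ ^ 2 ≤ (C : ℝ≥0∞) ^ 2 * ‖y‖ₑ ^ 2) : ‖x‖ ≤ C * ‖y‖ := by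
  rw [← mul_pow] at h
  have h2 := (ENNReal.pow_le_pow_left_iff (by norm_num : (2 : ℕ) ≠ 0)).1 h
  have h3 := ENNReal.toReal_mono (ENNReal.mul_lt_top ENNReal.coe_lt_top enorm_lt_top).ne h2
  simpa using h3

/-- A measurable kernel with integrable rows and columns, bounded by `M`. -/
structure IsSchur (k : X → Y → ℝ) (M : ℝ≥0) (μ : Measure X) (ν : Measure Y) : Prop where
  meas : Measurable (Function.uncurry k)
  row : ∀ᵐ x ∂μ, ∫⁻ y, ‖k x y‖ₑ ∂ν ≤ M
  col : ∀ᵐ y ∂ν, ∫⁻ x, ‖k x y‖ₑ ∂μ ≤ M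

namespace IsSchur

variable [SFinite μ] [SFinite ν] {k : X → Y → ℝ} {M : ℝ≥0}

lemma lintegral_le (hk : IsSchur k M μ ν) {f : Y → ℝ} (hf : AEStronglyMeasurable f ν) :
    ∫⁻ x, (∫⁻ y, ‖k x y * f y‖ₑ ∂ν) ^ 2 ∂μ ≤ (M : ℝ≥0∞) ^ 2 * ∫⁻ y, ‖f y‖ₑ ^ 2 ∂ν := by
  have h1 := lintegral_schur (μ := μ) (ν := ν) (k := fun x y => ‖k x y‖ₑ) hk.meas.enorm
    (f := fun y => ‖hf.mk f y‖ₑ) hf.stronglyMeasurable_mk.measurable.enorm hk.row hk.col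
  rw [← sq] at h1
  have e1 : ∀ x, ∫⁻ y, ‖k x y * f y‖ₑ ∂ν = ∫⁻ y, ‖k x y‖ₑ * ‖hf.mk f y‖ₑ ∂ν := fun x => by
    refine lintegral_congr_ae ?_
    filter_upwards [hf.ae_eq_mk] with y hy
    rw [enorm_mul, hy]
  have e2 : ∫⁻ y, ‖f y‖ₑ ^ 2 ∂ν = ∫⁻ y, ‖hf.mk f y‖ₑ ^ 2 ∂ν := by
    refine lintegral_congr_ae ?_
    filter_upwards [hf.ae_eq_mk] with y hy
    rw [hy]
  simp only [e1, e2]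
  exact h1

lemma integrable (hk : IsSchur k M μ ν) {f : Y → ℝ} (hf : MemLp f 2 ν) :
    ∀ᵐ x ∂μ, Integrable (fun y => k x y * f y) ν := by
  have h := hk.lintegral_le hf.1
  have hm : AEMeasurable (fun x => (∫⁻ y, ‖k x y * f y‖ₑ ∂ν) ^ 2) μ := by
    refine AEMeasurable.pow_const ?_ 2
    have : AEMeasurable (Function.uncurry fun x y => ‖k x y * f y‖ₑ) (μ.prod ν) :=
      (hk.meas.aemeasurable.mul (hf.1.comp_snd.aemeasurable)).enorm
    exact this.lintegral_prod_right'
  have h2 := ae_lt_top' hm (h.trans_lt (ENNReal.mul_lt_top (by simp)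
    (MemLp.lintegral_sq_lt_top hf))).ne
  filter_upwards [h2] with x hx
  refine ⟨(hk.meas.comp measurable_prodMk_left).aestronglyMeasurable.mul hf.1, ?_⟩
  by_contra hc
  simp only [HasFiniteIntegral, not_lt, top_le_iff] at hc
  rw [hc] at hx
  simp at hx

lemma memLp (hk : IsSchur k M μ ν) {f : Y → ℝ} (hf : MemLp f 2 ν) :
    MemLp (fun x => ∫ y, k x y * f y ∂ν) 2 μ := by
  refine memLp_two_of_lintegral_lt_top ?_ ?_
  · exact (hk.meas.aestronglyMeasurable.mul hf.1.comp_snd).integral_prod_right'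
  · refine lt_of_le_of_lt ((lintegral_mono fun x => ?_).trans (hk.lintegral_le hf.1))
      (ENNReal.mul_lt_top (by simp) (MemLp.lintegral_sq_lt_top hf))
    gcongr
    exact enorm_integral_le_lintegral_enorm _

/-- The integral operator with a Schur kernel. -/
def op (hk : IsSchur k M μ ν) : Lp ℝ 2 ν →L[ℝ] Lp ℝ 2 μ :=
  LinearMap.mkContinuous
    { toFun := fun f => (hk.memLp (Lp.memLp f)).toLp
      map_add' := fun f g => by
        rw [← MemLp.toLp_add]
        refine MemLp.toLp_congr _ _ ?_
        filter_upwards [hk.integrable (Lp.memLp f), hk.integrable (Lp.memLp g)] with x hf hg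
        simp only [Pi.add_apply]
        rw [← integral_add hf hg]
        refine integral_congr_ae ?_
        filter_upwards [Lp.coeFn_add f g] with y hy
        rw [hy, Pi.add_apply, mul_add]
      map_smul' := fun c f => by
        rw [RingHom.id_apply, ← MemLp.toLp_const_smul]
        refine MemLp.toLp_congr _ _ (ae_of_all _ fun x => ?_)
        simp only [Pi.smul_apply, smul_eq_mul]
        rw [← integral_const_mul]
        refine integral_congr_ae ?_
        filter_upwards [Lp.coeFn_smul c f] with y hy
        rw [hy, Pi.smul_apply, smul_eq_mul]
        ring } M fun f => by
    refine norm_le_of_enorm_sq_le ?_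
    rw [enorm_sq_Lp_two, enorm_sq_Lp_two]
    refine le_trans (lintegral_mono_ae ?_) (hk.lintegral_le (Lp.memLp f).1)
    filter_upwards [(hk.memLp (Lp.memLp f)).coeFn_toLp] with x hx
    refine (congrArg (fun z => ‖z‖ₑ ^ 2) hx).le.trans ?_
    gcongr
    exact enorm_integral_le_lintegral_enorm _

lemma coeFn_op (hk : IsSchur k M μ ν) (f : Lp ℝ 2 ν) :
    hk.op f =ᵐ[μ] fun x => ∫ y, k x y * f y ∂ν :=
  (hk.memLp (Lp.memLp f)).coeFn_toLp

lemma norm_op_le (hk : IsSchur k M μ ν) : ‖hk.op‖ ≤ M := LinearMap.mkContinuous_norm_le _ M.2 _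

lemma op_sub_op {k' : X → Y → ℝ} {M' M'' : ℝ≥0} (hk : IsSchur k M μ ν) (hk' : IsSchur k' M' μ ν)
    (hs : IsSchur (fun x y => k x y - k' x y) M'' μ ν) : hk.op - hk'.op = hs.op := by
  ext f
  filter_upwards [hk.coeFn_op f, hk'.coeFn_op f, hs.coeFn_op f, Lp.coeFn_sub (hk.op f) (hk'.op f),
    hk.integrable (Lp.memLp f), hk'.integrable (Lp.memLp f)] with x h1 h2 h3 h4 h5 h6
  rw [sub_apply, h4, Pi.sub_apply, h1, h2, h3, ← integral_sub h5 h6]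
  simp only [sub_mul]

end IsSchur

/-- An operator between Hilbert spaces which is square summable on a Hilbert basis is compact. -/
lemma isCompactOperator_of_summable {H K ι : Type*} [NormedAddCommGroup H] [InnerProductSpace ℝ H]
    [NormedAddCommGroup K] [InnerProductSpace ℝ K] [CompleteSpace K] (b : HilbertBasis ι ℝ H)
    (T : H →L[ℝ] K) (hT : Summable fun i => ‖T (b i)‖ ^ 2) : IsCompactOperator T := by
  classical
  let P : Finset ι → H →L[ℝ] K := fun s => ∑ i ∈ s, (innerSL ℝ (b i)).smulRight (T (b i))
  have hPc s : IsCompactOperator (P s) := by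
    have h : P s ∈ compactOperator (RingHom.id ℝ) H K := Submodule.sum_mem _ fun i _ =>
      ((isCompactOperator_id_iff_finiteDimensional (𝕜 := ℝ) (E := ℝ)).2 inferInstance).clm_comp
        (ContinuousLinearMap.toSpanSingleton ℝ (T (b i))) |>.comp_clm (innerSL ℝ (b i))
    exact h
  refine isCompactOperator_of_tendsto (l := atTop) (F := P) ?_ (.of_forall hPc)
  have htail := (tendsto_tsum_compl_atTop_zero fun i => ‖T (b i)‖ ^ 2).sqrt
  rw [Real.sqrt_zero] at htail
  rw [tendsto_iff_norm_sub_tendsto_zero]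
  refine squeeze_zero (fun _ => norm_nonneg _) (fun s => ?_) htail
  refine ContinuousLinearMap.opNorm_le_bound _ (Real.sqrt_nonneg _) fun f => ?_
  have hsum : HasSum (fun i => (inner ℝ (b i) f) • T (b i)) (T f) := by
    simpa [b.repr_apply_apply] using (b.hasSum_repr f).mapL T
  have hlim : Tendsto (fun t : Finset ι => ‖P s f - ∑ i ∈ t, (inner ℝ (b i) f) • T (b i)‖) atTop
      (𝓝 ‖(P s - T) f‖) := by
    rw [sub_apply]
    exact (tendsto_const_nhds.sub hsum).norm
  refine le_of_tendsto hlim ?_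
  filter_upwards [eventually_ge_atTop s] with t hst
  have e1 : P s f - ∑ i ∈ t, (inner ℝ (b i) f) • T (b i) =
      -∑ i ∈ t \ s, (inner ℝ (b i) f) • T (b i) := by
    rw [← Finset.sum_sdiff hst]
    simp [P, sum_apply]
  rw [e1, norm_neg]
  calc ‖∑ i ∈ t \ s, (inner ℝ (b i) f) • T (b i)‖
      ≤ ∑ i ∈ t \ s, ‖T (b i)‖ * ‖inner ℝ (b i) f‖ := by
        refine (norm_sum_le _ _).trans (le_of_eq (Finset.sum_congr rfl fun i _ => ?_))
        rw [norm_smul, mul_comm]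
    _ ≤ √(∑ i ∈ t \ s, ‖T (b i)‖ ^ 2) * √(∑ i ∈ t \ s, ‖inner ℝ (b i) f‖ ^ 2) :=
        Real.sum_mul_le_sqrt_mul_sqrt _ _ _
    _ ≤ √(∑' i : {i // i ∉ s}, ‖T (b i)‖ ^ 2) * ‖f‖ := by
        gcongr
        · refine le_of_eq_of_le ?_ ((hT.subtype fun i => i ∉ s).sum_le_tsum
            ((t \ s).subtype (· ∉ s)) fun i _ => sq_nonneg _)
          exact (Finset.sum_subtype_of_mem (fun i => ‖T (b i)‖ ^ 2) fun i hi =>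
            (Finset.mem_sdiff.1 hi).2).symm
        · rw [← Real.sqrt_sq (norm_nonneg f)]
          exact Real.sqrt_le_sqrt (b.orthonormal.sum_inner_products_le f)

/-- A Hilbert–Schmidt integral operator is compact. -/
lemma IsSchur.isCompactOperator_op [SFinite μ] [SFinite ν] {k : X → Y → ℝ} {M : ℝ≥0}
    (hk : IsSchur k M μ ν) (h2 : ∫⁻ x, ∫⁻ y, ‖k x y‖ₑ ^ 2 ∂ν ∂μ < ⊤) :
    IsCompactOperator hk.op := by
  obtain ⟨w, b, -⟩ := exists_hilbertBasis ℝ (Lp ℝ 2 ν)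
  refine isCompactOperator_of_summable b hk.op ?_
  have hkx : ∀ᵐ x ∂μ, MemLp (k x) 2 ν := by
    have hm : AEMeasurable (fun x => ∫⁻ y, ‖k x y‖ₑ ^ 2 ∂ν) μ :=
      (hk.meas.enorm.pow_const 2).lintegral_prod_right'.aemeasurable
    filter_upwards [ae_lt_top' hm h2.ne] with x hx
    exact memLp_two_of_lintegral_lt_top (hk.meas.comp measurable_prodMk_left).aestronglyMeasurable hx
  refine summable_of_sum_le (c := (∫⁻ x, ∫⁻ y, ‖k x y‖ₑ ^ 2 ∂ν ∂μ).toReal)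
    (fun i => sq_nonneg _) fun s => ?_
  have key : ∑ i ∈ s, ‖hk.op (b i)‖ₑ ^ 2 ≤ ∫⁻ x, ∫⁻ y, ‖k x y‖ₑ ^ 2 ∂ν ∂μ := by
    simp only [enorm_sq_Lp_two]
    rw [← lintegral_finsetSum' _ fun i _ => ((Lp.aestronglyMeasurable _).enorm.pow_const 2)]
    refine lintegral_mono_ae ?_
    have hall : ∀ᵐ x ∂μ, ∀ i ∈ s, hk.op (b i) x = ∫ y, k x y * b i y ∂ν :=
      (Finset.eventually_all s).2 fun i _ => hk.coeFn_op (b i)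
    filter_upwards [hkx, hall] with x hx hop
    have e2 : ∀ i ∈ s, hk.op (b i) x = inner ℝ (b i) (hx.toLp (k x)) := by
      intro i hi
      rw [hop i hi, L2.inner_def]
      refine integral_congr_ae ?_
      filter_upwards [hx.coeFn_toLp] with y hy
      rw [hy]
      simp
    have hb := b.orthonormal.sum_inner_products_le (s := s) (hx.toLp (k x))
    rw [← enorm_sq_toLp hx]
    calc ∑ i ∈ s, ‖hk.op (b i) x‖ₑ ^ 2
        = ENNReal.ofReal (∑ i ∈ s, ‖inner ℝ (b i) (hx.toLp (k x))‖ ^ 2) := by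
          rw [ENNReal.ofReal_sum_of_nonneg fun i _ => sq_nonneg _]
          refine Finset.sum_congr rfl fun i hi => ?_
          rw [e2 i hi, ENNReal.ofReal_pow (norm_nonneg _), ofReal_norm]
      _ ≤ ENNReal.ofReal (‖hx.toLp (k x)‖ ^ 2) := ENNReal.ofReal_le_ofReal hb
      _ = _ := by rw [ENNReal.ofReal_pow (norm_nonneg _), ofReal_norm]
  have := ENNReal.toReal_mono h2.ne key
  rwa [ENNReal.toReal_sum fun i _ => (ENNReal.pow_lt_top enorm_lt_top).ne,
    Finset.sum_congr rfl fun i _ => show (‖hk.op (b i)‖ₑ ^ 2).toReal = ‖hk.op (b i)‖ ^ 2 by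
      simp [ENNReal.toReal_pow]] at this

lemma memLp_mul_of_bound {r : X → ℝ} (hr : Measurable r) {C : ℝ≥0} (hC : ∀ x, |r x| ≤ C)
    {f : X → ℝ} (hf : MemLp f 2 μ) : MemLp (fun x => r x * f x) 2 μ :=
  hf.of_le_mul (c := C) (hr.aestronglyMeasurable.mul hf.1)
    (ae_of_all _ fun x => by rw [norm_mul]; exact mul_le_mul_of_nonneg_right (hC x) (norm_nonneg _))

/-- Multiplication by a bounded measurable function, as an operator on `L²`. -/
def mulOp (r : X → ℝ) (hr : Measurable r) (C : ℝ≥0) (hC : ∀ x, |r x| ≤ C) :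
    Lp ℝ 2 μ →L[ℝ] Lp ℝ 2 μ :=
  LinearMap.mkContinuous
    { toFun := fun f => (memLp_mul_of_bound hr hC (Lp.memLp f)).toLp
      map_add' := fun f g => by
        rw [← MemLp.toLp_add]
        refine MemLp.toLp_congr _ _ ?_
        filter_upwards [Lp.coeFn_add f g] with y hy
        simp only [hy, Pi.add_apply, mul_add]
      map_smul' := fun c f => by
        rw [RingHom.id_apply, ← MemLp.toLp_const_smul]
        refine MemLp.toLp_congr _ _ ?_
        filter_upwards [Lp.coeFn_smul c f] with y hy
        simp only [hy, Pi.smul_apply, smul_eq_mul]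
        ring } C fun f => by
    refine Lp.norm_le_mul_norm_of_ae_le_mul ?_
    filter_upwards [(memLp_mul_of_bound hr hC (Lp.memLp f)).coeFn_toLp] with x hx
    refine (congrArg norm hx).le.trans ?_
    rw [norm_mul]
    exact mul_le_mul_of_nonneg_right (hC x) (norm_nonneg _)

lemma coeFn_mulOp (r : X → ℝ) (hr : Measurable r) (C : ℝ≥0) (hC : ∀ x, |r x| ≤ C)
    (f : Lp ℝ 2 μ) : mulOp r hr C hC f =ᵐ[μ] fun x => r x * f x :=
  (memLp_mul_of_bound hr hC (Lp.memLp f)).coeFn_toLp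

end L2ops

/-- Real-valued square-integrable functions on `ℝ^d`. -/
abbrev L2 (d : ℕ) : Type := Lp ℝ 2 (volume : Measure (Space d))

/-- Square-summable sequences on `ℤ^d` with values in `ℝ^n`. -/
abbrev Ell2 (d n : ℕ) : Type := lp (fun _ : Lat d => Vec n) 2

open scoped FourierTransform

lemma fourierMultiplier_apply_eq {d : ℕ} {m : Space d → ℂ} (hm : m.HasTemperateGrowth)
    (φ : SC d) (x : Space d) :
    𝓜 m φ x =
      ∫ ξ, Complex.exp ((2 * Real.pi * inner ℝ ξ x : ℝ) * Complex.I) * (m ξ * 𝓕 φ ξ) := by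
  rw [SchwartzMap.fourierMultiplierCLM_apply, SchwartzMap.fourierInv_coe, Real.fourierInv_eq']
  refine integral_congr_ae (ae_of_all _ fun ξ => ?_)
  simp only [SchwartzMap.smulLeftCLM_apply_apply hm, smul_eq_mul]

lemma schwartz_eq_integral_fourier {d : ℕ} (φ : SC d) (x : Space d) :
    φ x = ∫ ξ, Complex.exp ((2 * Real.pi * inner ℝ ξ x : ℝ) * Complex.I) * 𝓕 φ ξ := by
  conv_lhs => rw [← FourierTransform.fourierInv_fourier_eq (F := (SC d)) φ]
  rw [SchwartzMap.fourierInv_coe, Real.fourierInv_eq']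
  rfl

/-! ### The heat kernel and the Bessel kernels -/

/-- The heat kernel. -/
def heat {d : ℕ} (t : ℝ) (z : Space d) : ℝ :=
  (4 * Real.pi * t) ^ (-(d : ℝ) / 2) * Real.exp (-(‖z‖ ^ 2 / (4 * t)))

/-- The density of the Gamma distribution which subordinates `Λ^{-σ}` to the heat semigroup. -/
def gammaDensity (σ t : ℝ) : ℝ := (Real.Gamma (σ / 2))⁻¹ * (t ^ (σ / 2 - 1) * Real.exp (-t))

/-- The kernel of `Λ^{-σ}`. -/
def besselKer {d : ℕ} (σ : ℝ) (z : Space d) : ℝ :=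
  ∫ t in Set.Ioi (0 : ℝ), gammaDensity σ t * heat t z

section bessel

variable {d : ℕ} {σ t : ℝ}

lemma heat_nonneg (ht : 0 ≤ t) (z : Space d) : 0 ≤ heat t z := by unfold heat; positivity

lemma gammaDensity_nonneg (hσ : 0 < σ) (ht : 0 ≤ t) : 0 ≤ gammaDensity σ t := by
  have := Real.Gamma_pos_of_pos (half_pos hσ)
  unfold gammaDensity; positivity

lemma measurable_gammaDensity (σ : ℝ) : Measurable (gammaDensity σ) := by
  unfold gammaDensity
  fun_prop

lemma measurable_heat : Measurable (fun p : Space d × ℝ => heat p.2 p.1) := by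
  unfold heat
  fun_prop

lemma measurable_gammaDensity_heat (σ : ℝ) :
    Measurable fun p : Space d × ℝ => gammaDensity σ p.2 * heat p.2 p.1 :=
  ((measurable_gammaDensity σ).comp measurable_snd).mul measurable_heat

lemma exists_rpow_le_exp (p : ℝ) {δ : ℝ} (hp : 0 ≤ p) (hδ : 0 < δ) :
    ∃ C : ℝ, 0 < C ∧ ∀ s : ℝ, 0 ≤ s → (1 + s) ^ p ≤ C * Real.exp (δ * s) := by
  set c := (p + 1) / δ with hc
  have hc0 : 0 < c := by positivity
  refine ⟨Real.exp (δ + p * (Real.log c - 1)), Real.exp_pos _, fun s hs => ?_⟩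
  have h1s : 0 < 1 + s := by linarith
  rw [Real.rpow_def_of_pos h1s, ← Real.exp_add]
  refine Real.exp_le_exp.2 ?_
  have h := Real.log_le_sub_one_of_pos (div_pos h1s hc0)
  rw [Real.log_div h1s.ne' hc0.ne'] at h
  have h2 : p * ((1 + s) / c) ≤ δ * (1 + s) := by
    rw [hc]
    have : p * ((1 + s) / ((p + 1) / δ)) = (p / (p + 1)) * (δ * (1 + s)) := by field_simp
    rw [this]
    exact mul_le_of_le_one_left (by positivity) (by rw [div_le_one (by positivity)]; linarith)
  nlinarith [mul_le_mul_of_nonneg_left h hp]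

lemma integrable_exp_neg_mul_sq_norm {b : ℝ} (hb : 0 < b) :
    Integrable (fun z : Space d => Real.exp (-b * ‖z‖ ^ 2)) := by
  by_contra h
  have h1 := GaussianFourier.integral_rexp_neg_mul_sq_norm (V := Space d) hb
  rw [integral_undef h] at h1
  have : 0 < (Real.pi / b) ^ (Module.finrank ℝ (Space d) / 2 : ℝ) := by positivity
  linarith

lemma heat_eq (t : ℝ) (z : Space d) :
    heat t z = (4 * Real.pi * t) ^ (-(d : ℝ) / 2) * Real.exp (-(1 / (4 * t)) * ‖z‖ ^ 2) := by
  unfold heat; congr 2; ring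

lemma integrable_heat (ht : 0 < t) : Integrable (fun z : Space d => heat t z) := by
  simp only [heat_eq]
  exact (integrable_exp_neg_mul_sq_norm (by positivity)).const_mul _

lemma integral_heat (ht : 0 < t) : ∫ z : Space d, heat t z = 1 := by
  simp only [heat_eq]
  rw [integral_const_mul, GaussianFourier.integral_rexp_neg_mul_sq_norm (by positivity)]
  have : Real.pi / (1 / (4 * t)) = 4 * Real.pi * t := by field_simp
  rw [this, finrank_euclideanSpace, Fintype.card_fin, neg_div,
    Real.rpow_neg (by positivity), inv_mul_cancel₀ (by positivity)]

/-- Polynomial factors are absorbed by doubling the time in the heat kernel. -/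
lemma exists_heat_bound (d : ℕ) (N : ℝ) (hN : 0 ≤ N) : ∃ C : ℝ, 0 < C ∧ ∀ t : ℝ, 0 < t →
    ∀ z : Space d, (1 + ‖z‖ ^ 2 / t) * (1 + ‖z‖ ^ 2) ^ N * heat t z ≤
      C * Real.exp (t / 2) * heat (2 * t) z := by
  obtain ⟨C₁, hC₁, h₁⟩ := exists_rpow_le_exp (N + 1) (δ := 1 / 8) (by linarith) (by norm_num)
  obtain ⟨C₂, hC₂, h₂⟩ := exists_rpow_le_exp N (δ := 1 / 2) hN (by norm_num)
  refine ⟨C₁ * C₂ * (2 : ℝ) ^ ((d : ℝ) / 2), by positivity, fun t ht z => ?_⟩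
  set s := ‖z‖ ^ 2 / t with hs
  have hs0 : 0 ≤ s := by positivity
  have hz : ‖z‖ ^ 2 = s * t := by rw [hs]; field_simp
  have e1 : (1 + s) * (1 + ‖z‖ ^ 2) ^ N ≤ (1 + s) ^ (N + 1) * (1 + t) ^ N := by
    rw [Real.rpow_add_one (by positivity), hz]
    calc (1 + s) * (1 + s * t) ^ N ≤ (1 + s) * ((1 + s) * (1 + t)) ^ N := by
          gcongr
          nlinarith
      _ = _ := by rw [Real.mul_rpow (by positivity) (by positivity)]; ring
  have e2 : heat t z = (2 : ℝ) ^ ((d : ℝ) / 2) * heat (2 * t) z * Real.exp (-(s / 8)) := by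
    unfold heat
    have hp := Real.pi_pos
    rw [show 4 * Real.pi * (2 * t) = 2 * (4 * Real.pi * t) by ring,
      Real.mul_rpow (x := 2) (by norm_num) (by positivity), hz, neg_div,
      Real.rpow_neg (by norm_num : (0 : ℝ) ≤ 2),
      show -(s * t / (4 * t)) = -(s * t / (4 * (2 * t))) + -(s / 8) by field_simp; ring,
      Real.exp_add]
    field_simp
  calc (1 + s) * (1 + ‖z‖ ^ 2) ^ N * heat t z
      ≤ (C₁ * Real.exp (1 / 8 * s) * (C₂ * Real.exp (1 / 2 * t))) * heat t z := by
        have h0 := heat_nonneg ht.le z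
        refine mul_le_mul_of_nonneg_right (e1.trans ?_) h0
        exact mul_le_mul (h₁ s hs0) (h₂ t ht.le) (by positivity) (by positivity)
    _ = _ := by
        rw [e2, show t / 2 = 1 / 2 * t by ring]
        have : Real.exp (1 / 8 * s) * Real.exp (-(s / 8)) = 1 := by rw [← Real.exp_add]; simp; ring
        linear_combination (C₁ * C₂ * Real.exp (1 / 2 * t) * 2 ^ ((d : ℝ) / 2) * heat (2 * t) z) * this

lemma integrable_gammaDensity_mul_exp (hσ : 0 < σ) {r : ℝ} (hr : r < 1) :
    IntegrableOn (fun t => gammaDensity σ t * Real.exp (r * t)) (Set.Ioi 0) := by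
  have h := (integrableOn_rpow_mul_exp_neg_mul_rpow (p := 1) (s := σ / 2 - 1) (b := 1 - r)
    (by linarith) one_pos (by linarith)).const_mul (Real.Gamma (σ / 2))⁻¹
  refine IntegrableOn.congr_fun h (fun t _ => ?_) measurableSet_Ioi
  simp only [gammaDensity, Real.rpow_one]
  rw [mul_assoc, mul_assoc, ← Real.exp_add]
  congr 3; ring

/-- The integrability of the heat kernel with polynomial weights, subordinated. -/
lemma integrable_gammaDensity_heat (hσ : 0 < σ) {N : ℝ} (hN : 0 ≤ N) :
    Integrable (fun p : Space d × ℝ => gammaDensity σ p.2 *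
      ((1 + ‖p.1‖ ^ 2 / p.2) * (1 + ‖p.1‖ ^ 2) ^ N * heat p.2 p.1))
      (volume.prod (volume.restrict (Set.Ioi 0))) := by
  obtain ⟨C, hC, hb⟩ := exists_heat_bound d N hN
  have hmeas : Measurable (fun p : Space d × ℝ => gammaDensity σ p.2 *
      ((1 + ‖p.1‖ ^ 2 / p.2) * (1 + ‖p.1‖ ^ 2) ^ N * heat p.2 p.1)) := by
    refine ((measurable_gammaDensity σ).comp measurable_snd).mul (Measurable.mul ?_ measurable_heat)
    fun_prop
  have hpt : ∀ t ∈ Set.Ioi (0 : ℝ), ∀ z : Space d, ‖gammaDensity σ t *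
      ((1 + ‖z‖ ^ 2 / t) * (1 + ‖z‖ ^ 2) ^ N * heat t z)‖ ≤
      gammaDensity σ t * (C * Real.exp (t / 2) * heat (2 * t) z) := by
    intro t ht z
    have ht' : 0 < t := ht
    have h0 := heat_nonneg ht'.le z
    have h1 := gammaDensity_nonneg hσ ht'.le
    rw [Real.norm_eq_abs, abs_of_nonneg (by positivity)]
    exact mul_le_mul_of_nonneg_left (hb t ht' z) h1
  have hInt : ∀ t ∈ Set.Ioi (0 : ℝ), Integrable (fun z : Space d => gammaDensity σ t *
      ((1 + ‖z‖ ^ 2 / t) * (1 + ‖z‖ ^ 2) ^ N * heat t z)) := by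
    intro t ht
    have ht' : (0 : ℝ) < 2 * t := mul_pos two_pos ht
    refine Integrable.mono' (((integrable_heat ht').const_mul (C * Real.exp (t / 2))).const_mul
      (gammaDensity σ t)) (hmeas.comp measurable_prodMk_right).aestronglyMeasurable
      (ae_of_all _ fun z => hpt t ht z)
  rw [integrable_prod_iff' hmeas.aestronglyMeasurable]
  refine ⟨(ae_restrict_iff' measurableSet_Ioi).2 (ae_of_all _ hInt), ?_⟩
  refine Integrable.mono' ((integrable_gammaDensity_mul_exp hσ (r := 1 / 2)
    (by norm_num)).const_mul C) (hmeas.norm.stronglyMeasurable.integral_prod_left'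
      ).aestronglyMeasurable ?_
  refine (ae_restrict_iff' measurableSet_Ioi).2 (ae_of_all _ fun t ht => ?_)
  have ht' : (0 : ℝ) < 2 * t := mul_pos two_pos ht
  rw [Real.norm_eq_abs, abs_of_nonneg (integral_nonneg fun _ => norm_nonneg _)]
  calc _ ≤ ∫ z : Space d, gammaDensity σ t * (C * Real.exp (t / 2) * heat (2 * t) z) :=
        integral_mono (hInt t ht).norm (((integrable_heat ht').const_mul _).const_mul _)
          fun z => hpt t ht z
    _ = _ := by
        rw [integral_const_mul, integral_const_mul, integral_heat ht']
        rw [show 1 / 2 * t = t / 2 by ring]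
        ring

/-- A domination criterion with respect to the subordinated heat kernel. -/
lemma integrable_of_le_gammaDensity_heat {E : Type*} [NormedAddCommGroup E] (hσ : 0 < σ)
    {N C : ℝ} (hN : 0 ≤ N) {F : Space d × ℝ → E}
    (hF : AEStronglyMeasurable F (volume.prod (volume.restrict (Set.Ioi 0))))
    (hle : ∀ (z : Space d) (t : ℝ), 0 < t → ‖F (z, t)‖ ≤ C * (gammaDensity σ t *
      ((1 + ‖z‖ ^ 2 / t) * (1 + ‖z‖ ^ 2) ^ N * heat t z))) :
    Integrable F (volume.prod (volume.restrict (Set.Ioi 0))) := by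
  refine ((integrable_gammaDensity_heat hσ hN).const_mul C).mono' hF ?_
  have : ∀ᵐ p : Space d × ℝ ∂(volume.prod (volume.restrict (Set.Ioi 0))), 0 < p.2 :=
    Measure.quasiMeasurePreserving_snd.ae (ae_restrict_mem measurableSet_Ioi)
  filter_upwards [this] with p hp
  exact hle p.1 p.2 hp

lemma peetre_eq (a : ℝ) (z : Space d) : peetre a z = 2 ^ (|a| / 2) * (1 + ‖z‖ ^ 2) ^ (|a| / 2) :=
  Real.mul_rpow (by norm_num) (by positivity)

lemma integrable_gammaDensity_heat_peetre (hσ : 0 < σ) (a : ℝ) :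
    Integrable (fun p : Space d × ℝ => gammaDensity σ p.2 * heat p.2 p.1 * peetre a p.1)
      (volume.prod (volume.restrict (Set.Ioi 0))) := by
  refine integrable_of_le_gammaDensity_heat (σ := σ) (N := |a| / 2) (C := 2 ^ (|a| / 2)) hσ
    (by positivity) ((measurable_gammaDensity_heat σ).mul ((continuous_peetre a).measurable.comp
      measurable_fst)).aestronglyMeasurable fun z t ht => ?_
  have h0 := heat_nonneg ht.le z
  have h1 := gammaDensity_nonneg hσ ht.le
  have h2 := (peetre_pos a z).le
  rw [Real.norm_of_nonneg (by positivity), peetre_eq]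
  have h3 : (1 : ℝ) ≤ 1 + ‖z‖ ^ 2 / t := le_add_of_nonneg_right (by positivity)
  calc gammaDensity σ t * heat t z * (2 ^ (|a| / 2) * (1 + ‖z‖ ^ 2) ^ (|a| / 2))
      = 2 ^ (|a| / 2) * (gammaDensity σ t * (1 * (1 + ‖z‖ ^ 2) ^ (|a| / 2) * heat t z)) := by ring
    _ ≤ _ := by gcongr

lemma integrable_gammaDensity_heat_prod (hσ : 0 < σ) :
    Integrable (fun p : Space d × ℝ => gammaDensity σ p.2 * heat p.2 p.1)
      (volume.prod (volume.restrict (Set.Ioi 0))) := by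
  simpa [peetre] using integrable_gammaDensity_heat_peetre (d := d) hσ 0

lemma measurable_besselKer (σ : ℝ) : Measurable (besselKer σ : Space d → ℝ) :=
  (measurable_gammaDensity_heat σ).stronglyMeasurable.integral_prod_right'.measurable

lemma besselKer_nonneg (hσ : 0 < σ) (z : Space d) : 0 ≤ besselKer σ z :=
  setIntegral_nonneg measurableSet_Ioi fun _ ht =>
    mul_nonneg (gammaDensity_nonneg hσ (le_of_lt ht)) (heat_nonneg (le_of_lt ht) z)

lemma integrable_besselKer (hσ : 0 < σ) : Integrable (besselKer σ : Space d → ℝ) :=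
  (integrable_gammaDensity_heat_prod hσ).integral_prod_left

lemma integrable_besselKer_mul_peetre (hσ : 0 < σ) (a : ℝ) :
    Integrable (fun z : Space d => besselKer σ z * peetre a z) := by
  refine (integrable_gammaDensity_heat_peetre hσ a).integral_prod_left.congr (ae_of_all _ fun z => ?_)
  simp only [besselKer]
  rw [integral_mul_const]

lemma fourier_heat (ht : 0 < t) (ξ : Space d) :
    𝓕 (fun z : Space d => (heat t z : ℂ)) ξ =
      (Real.exp (-(‖(2 * Real.pi) • ξ‖ ^ 2 * t)) : ℂ) := by
  have hb : 0 < ((1 / (4 * t) : ℝ) : ℂ).re := by rw [Complex.ofReal_re]; positivity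
  have h := fourier_gaussian_innerProductSpace (V := Space d) hb ξ
  have h2 : (fun z : Space d => (heat t z : ℂ)) =
      (((4 * Real.pi * t) ^ (-(d : ℝ) / 2) : ℝ) : ℂ) •
        fun z : Space d => Complex.exp (-((1 / (4 * t) : ℝ) : ℂ) * (‖z‖ : ℂ) ^ 2) := by
    funext z
    rw [heat_eq, Pi.smul_apply, smul_eq_mul]
    push_cast
    ring_nf
  have h3 : ∀ (c : ℂ) (f : Space d → ℂ), 𝓕 (c • f) ξ = c * 𝓕 f ξ := by
    intro c f
    simp only [Real.fourier_eq', Pi.smul_apply, smul_eq_mul, mul_left_comm _ c]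
    rw [integral_const_mul]
  rw [h2, h3, h, ← mul_assoc]
  have e1 : (Real.pi : ℂ) / ((1 / (4 * t) : ℝ) : ℂ) = ((4 * Real.pi * t : ℝ) : ℂ) := by
    push_cast; field_simp
  have e2 : (((Module.finrank ℝ (Space d) : ℕ) : ℂ) / 2) = ((((d : ℝ) / 2 : ℝ)) : ℂ) := by simp
  rw [e1, e2, ← Complex.ofReal_cpow (by positivity), ← Complex.ofReal_mul, neg_div,
    Real.rpow_neg (by positivity), inv_mul_cancel₀ (by positivity), Complex.ofReal_one, one_mul,
    norm_smul, Complex.ofReal_exp]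
  congr 1
  have : |Real.pi| = Real.pi := abs_of_pos Real.pi_pos
  push_cast
  rw [Real.norm_eq_abs, abs_mul, this]
  simp only [abs_two]
  have : (t : ℂ) ≠ 0 := by exact_mod_cast ht.ne'
  push_cast
  field_simp
  ring

lemma fourier_besselKer (hσ : 0 < σ) (ξ : Space d) :
    𝓕 (fun z : Space d => (besselKer σ z : ℂ)) ξ = besselSymbol d (-σ) ξ := by
  rw [Real.fourier_eq']
  let E (z : Space d) : ℂ := Complex.exp (((-2 * Real.pi * inner ℝ z ξ : ℝ) : ℂ) * Complex.I)
  have e1 z : E z • (besselKer σ z : ℂ) =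
      ∫ t in Set.Ioi (0 : ℝ), E z * ((gammaDensity σ t * heat t z : ℝ) : ℂ) := by
    rw [integral_const_mul, integral_complex_ofReal, smul_eq_mul, besselKer]
  refine (integral_congr_ae (ae_of_all _ e1)).trans ?_
  rw [integral_integral_swap]
  · have e2 : ∀ t ∈ Set.Ioi (0 : ℝ), ∫ z, E z * ((gammaDensity σ t * heat t z : ℝ) : ℂ) =
        (((Real.Gamma (σ / 2))⁻¹ * (t ^ (σ / 2 - 1) *
          Real.exp (-((1 + ‖(2 * Real.pi) • ξ‖ ^ 2) * t))) : ℝ) : ℂ) := by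
      intro t ht
      have h := fourier_heat ht ξ
      rw [Real.fourier_eq'] at h
      have e3 z : E z * ((gammaDensity σ t * heat t z : ℝ) : ℂ) =
          (gammaDensity σ t : ℂ) * (E z • (heat t z : ℂ)) := by
        rw [smul_eq_mul]; push_cast; ring
      simp only [e3]
      rw [integral_const_mul, h, ← Complex.ofReal_mul, gammaDensity, mul_assoc, mul_assoc,
        ← Real.exp_add]
      congr 5
      ring
    rw [setIntegral_congr_fun measurableSet_Ioi e2, integral_complex_ofReal, integral_const_mul,
      Real.integral_rpow_mul_exp_neg_mul_Ioi (half_pos hσ) (by positivity), besselSymbol]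
    congr 1
    have h1 := (Real.Gamma_pos_of_pos (half_pos hσ)).ne'
    rw [mul_comm ((1 / _) ^ _), ← mul_assoc, inv_mul_cancel₀ h1, one_mul, neg_div,
      Real.rpow_neg (by positivity), one_div, Real.inv_rpow (by positivity)]
  · have h0 := (integrable_gammaDensity_heat_prod (d := d) hσ).norm
    refine h0.mono' ?_ (ae_of_all _ fun p => ?_)
    · refine Measurable.aestronglyMeasurable ?_
      have h2 : Measurable fun p : Space d × ℝ => E p.1 := by fun_prop
      exact h2.mul (Complex.measurable_ofReal.comp (measurable_gammaDensity_heat σ))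
    · simp only [Function.uncurry]
      rw [norm_mul, Complex.norm_exp_ofReal_mul_I, one_mul, Complex.norm_real]

/-- `Λ^{-σ}` is the convolution with the Bessel kernel. -/
lemma bessel_apply_eq_integral (hσ : 0 < σ) (φ : SC d) (x : Space d) :
    𝓜 (besselSymbol d (-σ)) φ x =
      ∫ z, (besselKer σ z : ℂ) * φ (x - z) := by
  have hg : Integrable (fun ξ : Space d =>
      Complex.exp ((2 * Real.pi * inner ℝ ξ x : ℝ) * Complex.I) * 𝓕 φ ξ) := by
    refine (𝓕 φ).integrable.norm.mono' ?_ (ae_of_all _ fun ξ => ?_)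
    · exact (Continuous.mul (by fun_prop) (𝓕 φ).continuous).aestronglyMeasurable
    · rw [norm_mul, Complex.norm_exp_ofReal_mul_I, one_mul]
  have h := VectorFourier.integral_fourierIntegral_smul_eq_flip (L := innerₗ (Space d))
    (μ := volume) (ν := volume)
    Real.continuous_fourierChar continuous_inner (integrable_besselKer hσ (d := d)).ofReal hg
  have e1 : ∀ ξ, VectorFourier.fourierIntegral Real.fourierChar volume (innerₗ (Space d))
      (fun z : Space d => (besselKer σ z : ℂ)) ξ = besselSymbol d (-σ) ξ := fun ξ =>
    fourier_besselKer hσ ξ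
  have e2 : ∀ z, VectorFourier.fourierIntegral Real.fourierChar volume (innerₗ (Space d)).flip
      (fun ξ : Space d => Complex.exp ((2 * Real.pi * inner ℝ ξ x : ℝ) * Complex.I) * 𝓕 φ ξ) z =
        φ (x - z) := by
    intro z
    rw [schwartz_eq_integral_fourier φ (x - z), VectorFourier.fourierIntegral]
    refine integral_congr_ae (ae_of_all _ fun ξ => ?_)
    simp only [LinearMap.flip_apply, innerₗ_apply_apply, Circle.smul_def, smul_eq_mul,
      Real.fourierChar_apply]
    rw [← mul_assoc, ← Complex.exp_add, inner_sub_right, real_inner_comm z ξ]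
    congr 2
    push_cast
    ring
  rw [fourierMultiplier_apply_eq (besselSymbol_growth d _)]
  have h' : ∫ ξ, besselSymbol d (-σ) ξ •
      (Complex.exp ((2 * Real.pi * inner ℝ ξ x : ℝ) * Complex.I) * 𝓕 φ ξ) =
      ∫ z, (besselKer σ z : ℂ) • φ (x - z) := by
    refine Eq.trans (integral_congr_ae (ae_of_all _ fun ξ => ?_))
      (h.trans (integral_congr_ae (ae_of_all _ fun z => ?_)))
    · exact congrArg (· • _) (e1 ξ).symm
    · exact congrArg (_ • ·) (e2 z)
  simp only [smul_eq_mul] at h'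
  rw [← h']
  refine integral_congr_ae (ae_of_all _ fun ξ => ?_)
  simp only
  ring

end bessel

/-! ### Weighted estimates for Bessel potentials of Schwartz functions -/

/-- The standard basis vectors of `ℝ^d`. -/
def basisVec {d : ℕ} (j : Fin d) : Space d := EuclideanSpace.single j 1

/-- `Λ^s` on Schwartz functions. -/
def bes {d : ℕ} (s : ℝ) : SC d →L[ℂ] SC d := 𝓜 (besselSymbol d s)

/-- Multiplication by `⟨x⟩^a` on Schwartz functions. -/
def wmul {d : ℕ} (a : ℝ) : SC d →L[ℂ] SC d := SchwartzMap.smulLeftCLM ℂ (weight d a)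

/-- The `L²` norm of a Schwartz function. -/
def nrm {d : ℕ} (φ : SC d) : ℝ := ‖φ.toLp 2 (volume : Measure (Space d))‖

section schwartz

variable {d : ℕ}

lemma wmul_apply (a : ℝ) (φ : SC d) (x : Space d) : wmul a φ x = wt 1 a x * φ x := by
  rw [wmul, SchwartzMap.smulLeftCLM_apply_apply (weight_growth d a), weight_eq_wt, smul_eq_mul]

lemma wmul_wmul (a b : ℝ) (φ : SC d) : wmul a (wmul b φ) = wmul (a + b) φ := by
  ext x
  rw [wmul_apply, wmul_apply, wmul_apply, ← wt_mul_wt]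
  push_cast; ring

lemma wmul_zero (φ : SC d) : wmul 0 φ = φ := by ext x; rw [wmul_apply, wt_zero]; simp

lemma besselSymbol_mul (s r : ℝ) : besselSymbol d s * besselSymbol d r = besselSymbol d (s + r) := by
  funext x
  have hx : (0 : ℝ) < 1 + ‖(2 * Real.pi) • x‖ ^ 2 := by positivity
  simp only [besselSymbol, Pi.mul_apply, ← Complex.ofReal_mul]
  rw [← Real.rpow_add hx]; congr 2; ring

lemma besselSymbol_zero : besselSymbol d 0 = fun _ => 1 := by funext x; simp [besselSymbol]

lemma bes_bes (s r : ℝ) (φ : SC d) : bes s (bes r φ) = bes (s + r) φ := by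
  rw [bes, bes, SchwartzMap.fourierMultiplierCLM_fourierMultiplierCLM_apply
    (besselSymbol_growth d s) (besselSymbol_growth d r), besselSymbol_mul, bes]

lemma bes_zero (φ : SC d) : bes 0 φ = φ := by rw [bes, besselSymbol_zero]; simp

lemma mult_comm {m₁ m₂ : Space d → ℂ} (h₁ : m₁.HasTemperateGrowth) (h₂ : m₂.HasTemperateGrowth)
    (φ : SC d) : 𝓜 m₁ (𝓜 m₂ φ) = 𝓜 m₂ (𝓜 m₁ φ) := by
  rw [SchwartzMap.fourierMultiplierCLM_fourierMultiplierCLM_apply h₂ h₁,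
    SchwartzMap.fourierMultiplierCLM_fourierMultiplierCLM_apply h₁ h₂, mul_comm]

lemma innerC_growth (v : Space d) :
    (fun ξ : Space d => (inner ℝ ξ v : ℂ)).HasTemperateGrowth := by fun_prop

lemma pd_eq_mult (v : Space d) (φ : SC d) :
    ∂_{v} φ = (2 * Real.pi * Complex.I) • 𝓜 (fun ξ : Space d => (inner ℝ ξ v : ℂ)) φ := by
  rw [SchwartzMap.lineDeriv_eq_fourierMultiplierCLM,
    ← SchwartzMap.fourierMultiplierCLM_ofReal ℂ (by fun_prop)]
  rfl

lemma mult_pd {m : Space d → ℂ} (h : m.HasTemperateGrowth) (v : Space d) (φ : SC d) :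
    𝓜 m (∂_{v} φ) = ∂_{v} (𝓜 m φ) := by
  rw [pd_eq_mult, pd_eq_mult, map_smul, mult_comm h (innerC_growth v)]

lemma bes_pd (s : ℝ) (v : Space d) (φ : SC d) : bes s (∂_{v} φ) = ∂_{v} (bes s φ) :=
  mult_pd (besselSymbol_growth d s) v φ

lemma nrm_nonneg (φ : SC d) : 0 ≤ nrm φ := norm_nonneg _

lemma nrm_add_le (φ ψ : SC d) : nrm (φ + ψ) ≤ nrm φ + nrm ψ :=
  (congrArg norm (map_add (SchwartzMap.toLpCLM ℝ ℂ 2 volume) φ ψ)).trans_le (norm_add_le _ _)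

lemma nrm_neg (φ : SC d) : nrm (-φ) = nrm φ :=
  (congrArg norm (map_neg (SchwartzMap.toLpCLM ℝ ℂ 2 volume) φ)).trans (norm_neg _)

lemma nrm_sub_le (φ ψ : SC d) : nrm (φ - ψ) ≤ nrm φ + nrm ψ := by
  rw [sub_eq_add_neg, ← nrm_neg ψ]; exact nrm_add_le _ _

lemma nrm_sum_le {ι : Type*} (s : Finset ι) (φ : ι → SC d) :
    nrm (∑ i ∈ s, φ i) ≤ ∑ i ∈ s, nrm (φ i) :=
  (congrArg norm (map_sum (SchwartzMap.toLpCLM ℝ ℂ 2 volume) φ s)).trans_le (norm_sum_le _ _)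

lemma enorm_toLp_sq (φ : SC d) :
    ‖φ.toLp 2 (volume : Measure (Space d))‖ₑ ^ 2 = ∫⁻ x, ‖φ x‖ₑ ^ 2 := enorm_sq_toLp (φ.memLp 2 _)

lemma nrm_le_of_lintegral_le {φ ψ : SC d} {C : ℝ≥0}
    (h : ∫⁻ x, ‖φ x‖ₑ ^ 2 ≤ (C : ℝ≥0∞) ^ 2 * ∫⁻ x, ‖ψ x‖ₑ ^ 2) : nrm φ ≤ C * nrm ψ := by
  rw [← enorm_toLp_sq, ← enorm_toLp_sq] at h
  exact norm_le_of_enorm_sq_le h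

open scoped FourierTransform in
lemma nrm_mult_le {m : Space d → ℂ} (hm : m.HasTemperateGrowth) {B : ℝ≥0} (hB : ∀ ξ, ‖m ξ‖ ≤ B)
    (φ : SC d) : nrm (𝓜 m φ) ≤ B * nrm φ := by
  have h1 : nrm (𝓜 m φ) = nrm (SchwartzMap.smulLeftCLM ℂ m (𝓕 φ)) := by
    rw [nrm, ← SchwartzMap.norm_fourier_toL2_eq, SchwartzMap.fourierMultiplierCLM_apply,
      FourierTransform.fourier_fourierInv_eq, nrm]
  have h2 : nrm φ = nrm (𝓕 φ) := by rw [nrm, nrm, SchwartzMap.norm_fourier_toL2_eq]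
  rw [h1, h2]
  refine nrm_le_of_lintegral_le ?_
  rw [← lintegral_const_mul' _ _ (by simp)]
  refine lintegral_mono fun ξ => ?_
  rw [SchwartzMap.smulLeftCLM_apply_apply hm, smul_eq_mul, enorm_mul, mul_pow]
  gcongr
  rw [enorm_le_coe]
  exact_mod_cast hB ξ

lemma lintegral_conv_sq_le {κ f : Space d → ℝ≥0∞} (hκ : Measurable κ) (hf : Measurable f) :
    ∫⁻ x, (∫⁻ z, κ z * f (x - z)) ^ 2 ≤ (∫⁻ z, κ z) ^ 2 * ∫⁻ x, f x ^ 2 := by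
  have h := lintegral_schur (μ := (volume : Measure (Space d))) (ν := volume)
    (k := fun x y => κ (x - y)) (hκ.comp (measurable_fst.sub measurable_snd)) hf
    (A := ∫⁻ z, κ z) (B := ∫⁻ z, κ z)
    (ae_of_all _ fun x => (lintegral_sub_left_eq_self κ x).le)
    (ae_of_all _ fun y => (lintegral_sub_right_eq_self κ y).le)
  rw [← sq] at h
  refine le_trans (le_of_eq (lintegral_congr fun x => ?_)) h
  rw [← lintegral_sub_left_eq_self _ x]
  simp

lemma wt_one_le_peetre (a : ℝ) (x z : Space d) : wt 1 a x ≤ peetre a z * wt 1 a (x - z) := by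
  simpa using wt_le_peetre_mul (ε := 1) (by norm_num) a x (x - z)

/-- `⟨x⟩^a Λ^{-σ} ⟨x⟩^{-a}` is bounded on `L²`. -/
lemma exists_nrm_wmul_bes_le (d : ℕ) (a : ℝ) {σ : ℝ} (hσ : 0 < σ) : ∃ C : ℝ≥0,
    ∀ φ : SC d, nrm (wmul a (bes (-σ) φ)) ≤ C * nrm (wmul a φ) := by
  have hi := integrable_besselKer_mul_peetre (d := d) hσ a
  refine ⟨(∫⁻ z : Space d, ‖besselKer σ z * peetre a z‖ₑ).toNNReal, fun φ =>
    nrm_le_of_lintegral_le ?_⟩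
  rw [ENNReal.coe_toNNReal hi.2.ne]
  refine le_trans (lintegral_mono fun x => ?_) (lintegral_conv_sq_le
    (((measurable_besselKer σ).mul (continuous_peetre a).measurable).enorm)
    (wmul a φ).continuous.measurable.enorm)
  gcongr
  rw [wmul_apply, bes, bessel_apply_eq_integral hσ, ← integral_const_mul]
  refine (enorm_integral_le_lintegral_enorm _).trans (lintegral_mono fun z => ?_)
  rw [wmul_apply]
  simp only [← ofReal_norm]
  rw [← ENNReal.ofReal_mul (norm_nonneg _)]
  refine ENNReal.ofReal_le_ofReal ?_
  simp only [norm_mul, Complex.norm_real, Real.norm_eq_abs, abs_of_pos (wt_pos _ _ _),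
    abs_of_pos (peetre_pos _ _)]
  have h1 := wt_one_le_peetre a x z
  calc wt 1 a x * (|besselKer σ z| * ‖φ (x - z)‖)
      ≤ (peetre a z * wt 1 a (x - z)) * (|besselKer σ z| * ‖φ (x - z)‖) := by gcongr
    _ = _ := by ring

lemma hasFDerivAt_heat (t : ℝ) (z : Space d) :
    HasFDerivAt (heat t : Space d → ℝ) ((-(heat t z / (2 * t))) • innerSL ℝ z) z := by
  have h1 : HasFDerivAt (fun y : Space d => -(‖y‖ ^ 2 / (4 * t)))
      (-((4 * t)⁻¹ • (2 • innerSL ℝ z))) z := by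
    have := ((hasStrictFDerivAt_norm_sq z).hasFDerivAt.const_mul (4 * t)⁻¹).neg
    refine this.congr_of_eventuallyEq (Eventually.of_forall fun y => ?_)
    simp only [Pi.neg_apply]
    ring
  have h2 := (h1.exp).const_mul ((4 * Real.pi * t) ^ (-(d : ℝ) / 2))
  refine h2.congr_fderiv ?_
  ext y
  simp [heat]
  by_cases ht : t = 0
  · simp [ht]
  · field_simp
    ring

lemma lineDeriv_schwartz (v : Space d) (φ : SC d) (x : Space d) :
    (∂_{v} φ) x = fderiv ℝ φ x v := SchwartzMap.lineDerivOp_apply_eq_fderiv v φ x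

lemma norm_basisVec (j : Fin d) : ‖(basisVec j : Space d)‖ = 1 := by simp [basisVec]

lemma abs_inner_basisVec_le (z : Space d) (j : Fin d) : |inner ℝ z (basisVec j)| ≤ ‖z‖ := by
  simpa [basisVec] using abs_real_inner_le_norm z (basisVec j)

lemma hasFDerivAt_heat_ofReal (t : ℝ) (z : Space d) :
    HasFDerivAt (fun z : Space d => (heat t z : ℂ))
      (Complex.ofRealCLM.comp ((-(heat t z / (2 * t))) • innerSL ℝ z)) z :=
  Complex.ofRealCLM.hasFDerivAt.comp z (hasFDerivAt_heat t z)

lemma fderiv_heat (t : ℝ) (z : Space d) (j : Fin d) :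
    fderiv ℝ (fun z : Space d => (heat t z : ℂ)) z (basisVec j) =
      ((-(heat t z / (2 * t)) * inner ℝ z (basisVec j) : ℝ) : ℂ) := by
  rw [(hasFDerivAt_heat_ofReal t z).fderiv]; simp

lemma heat_le {t : ℝ} (ht : 0 < t) (z : Space d) : heat t z ≤ (4 * Real.pi * t) ^ (-(d : ℝ) / 2) := by
  refine mul_le_of_le_one_right (by positivity) (Real.exp_le_one_iff.2 ?_)
  rw [neg_nonpos]; positivity

lemma integral_heat_mul_commutator {t : ℝ} (ht : 0 < t) (a : ℝ) (j : Fin d) (φ : SC d)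
    (x : Space d) :
    ∫ z, (heat t z : ℂ) * (wt 1 a x * (∂_{basisVec j} φ) (x - z) -
        (∂_{basisVec j} (wmul a φ)) (x - z)) =
      ∫ z, (fderiv ℝ (fun z : Space d => (heat t z : ℂ)) z (basisVec j)) *
        (((wt 1 a x - wt 1 a (x - z) : ℝ) : ℂ) * φ (x - z)) := by
  set Φ : SC d := (wt 1 a x : ℂ) • φ - wmul a φ with hΦ
  set q : Space d → ℂ := fun z => Φ (x - z) with hq
  have hqd : ∀ z, HasFDerivAt q (-(fderiv ℝ Φ (x - z))) z := fun z =>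
    ((Φ.hasFDerivAt (x - z)).comp z ((hasFDerivAt_id z).const_sub x)).congr_fderiv (by ext y; simp)
  have hqf : ∀ z, fderiv ℝ q z (basisVec j) = -((∂_{basisVec j} Φ) (x - z)) := fun z => by
    rw [(hqd z).fderiv, lineDeriv_schwartz]; simp
  have hheatd := hasFDerivAt_heat_ofReal (d := d) t
  have hheatc : Continuous (fun z : Space d => (heat t z : ℂ)) :=
    continuous_iff_continuousAt.2 fun z => (hheatd z).continuousAt
  have hΦint : Integrable q := (integrable_comp_sub_left (fun y => Φ y) x).2 Φ.integrable
  have hΦ'int : Integrable (fun z => fderiv ℝ q z (basisVec j)) := by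
    simp only [hqf]
    exact ((integrable_comp_sub_left (fun y => (∂_{basisVec j} Φ) y) x).2
      ((∂_{basisVec j} Φ).integrable (μ := volume))).neg
  have hbdd1 : ∀ z : Space d, ‖(heat t z : ℂ)‖ ≤ (4 * Real.pi * t) ^ (-(d : ℝ) / 2) := fun z => by
    rw [Complex.norm_real, Real.norm_of_nonneg (heat_nonneg ht.le z)]
    exact heat_le ht z
  obtain ⟨C, hC, hCb⟩ := exists_heat_bound d 1 (by norm_num)
  have hbdd2 : ∀ z : Space d, ‖fderiv ℝ (fun z : Space d => (heat t z : ℂ)) z (basisVec j)‖ ≤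
      (1 / (2 * t)) * (C * Real.exp (t / 2) * (4 * Real.pi * (2 * t)) ^ (-(d : ℝ) / 2)) := by
    intro z
    have h0 := heat_nonneg ht.le z
    rw [fderiv_heat, Complex.norm_real, Real.norm_eq_abs, abs_mul, abs_neg,
      abs_of_nonneg (by positivity)]
    have h3 := hCb t ht z
    have h4 : ‖z‖ * heat t z ≤ (1 + ‖z‖ ^ 2 / t) * (1 + ‖z‖ ^ 2) ^ (1 : ℝ) * heat t z := by
      refine mul_le_mul_of_nonneg_right ?_ h0
      rw [Real.rpow_one]
      have : 0 ≤ ‖z‖ ^ 2 / t := by positivity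
      nlinarith [sq_nonneg (‖z‖ - 1 / 2), sq_nonneg ‖z‖]
    calc heat t z / (2 * t) * |inner ℝ z (basisVec j)| ≤ heat t z / (2 * t) * ‖z‖ := by
          gcongr; exact abs_inner_basisVec_le z j
      _ = (1 / (2 * t)) * (‖z‖ * heat t z) := by ring
      _ ≤ _ := mul_le_mul_of_nonneg_left ((h4.trans h3).trans
          (by gcongr; exact heat_le (by positivity) z)) (by positivity)
  have hm2 : AEStronglyMeasurable (fun z : Space d =>
      fderiv ℝ (fun z : Space d => (heat t z : ℂ)) z (basisVec j)) := by
    simp only [fderiv_heat]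
    refine (Complex.measurable_ofReal.comp ?_).aestronglyMeasurable
    have : Measurable (heat t : Space d → ℝ) := measurable_heat.comp measurable_prodMk_right
    fun_prop
  have hibp := integral_mul_fderiv_eq_neg_fderiv_mul_of_integrable (𝕜 := ℂ)
    (μ := (volume : Measure (Space d))) (f := fun z : Space d => (heat t z : ℂ)) (g := q)
    (v := basisVec j) (hΦint.bdd_mul hm2 (ae_of_all _ hbdd2))
    (hΦ'int.bdd_mul hheatc.aestronglyMeasurable (ae_of_all _ hbdd1))
    (hΦint.bdd_mul hheatc.aestronglyMeasurable (ae_of_all _ hbdd1))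
    (fun z _ => (hheatd z).differentiableAt) (fun z _ => (hqd z).differentiableAt)
  have e1 : ∀ z, wt 1 a x * (∂_{basisVec j} φ) (x - z) - (∂_{basisVec j} (wmul a φ)) (x - z) =
      -fderiv ℝ q z (basisVec j) := by
    intro z
    rw [hqf, neg_neg, hΦ, sub_eq_add_neg (_ • φ), LineDeriv.lineDerivOp_add,
      LineDeriv.lineDerivOp_smul, LineDeriv.lineDerivOp_neg, add_apply, smul_apply, smul_eq_mul,
      neg_apply, sub_eq_add_neg]
  have e2 : ∀ z, ((wt 1 a x - wt 1 a (x - z) : ℝ) : ℂ) * φ (x - z) = q z := by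
    intro z
    rw [hq]
    simp only [hΦ, sub_apply, smul_apply, smul_eq_mul, wmul_apply]
    push_cast; ring
  simp only [e1, e2, mul_neg, integral_neg]
  rw [hibp, neg_neg]

end schwartz

section schwartz

variable {d : ℕ}

/-- The density of the dominating kernel of the commutator of `⟨x⟩^a` with `∂_j Λ^{-1}`. -/
def commDens (a : ℝ) (p : Space d × ℝ) : ℝ :=
  gammaDensity 1 p.2 * (heat p.2 p.1 / (2 * p.2) * ‖p.1‖ * (|a| * ‖p.1‖ * peetre a p.1))

/-- The dominating kernel of the commutator. -/
def commKer (d : ℕ) (a : ℝ) (z : Space d) : ℝ := ∫ t in Set.Ioi (0 : ℝ), commDens a (z, t)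

lemma measurable_commDens (d : ℕ) (a : ℝ) : Measurable (commDens a : Space d × ℝ → ℝ) := by
  have := measurable_heat (d := d)
  have hpe : Measurable (fun p : Space d × ℝ => peetre a p.1) :=
    (continuous_peetre a).measurable.comp measurable_fst
  have hga : Measurable (fun p : Space d × ℝ => gammaDensity 1 p.2) :=
    (measurable_gammaDensity 1).comp measurable_snd
  unfold commDens
  fun_prop

lemma commDens_nonneg (a : ℝ) (z : Space d) {t : ℝ} (ht : 0 < t) : 0 ≤ commDens a (z, t) := by
  have h0 := heat_nonneg ht.le z
  have hg := gammaDensity_nonneg one_pos ht.le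
  have hp := peetre_pos a z
  unfold commDens
  positivity

lemma integrable_commDens (d : ℕ) (a : ℝ) : Integrable (commDens a : Space d × ℝ → ℝ)
    (volume.prod (volume.restrict (Set.Ioi 0))) := by
  refine integrable_of_le_gammaDensity_heat (σ := 1) (N := |a| / 2) (C := |a| * 2 ^ (|a| / 2))
    one_pos (by positivity) (measurable_commDens d a).aestronglyMeasurable fun z t ht => ?_
  have h0 := heat_nonneg ht.le z
  have hg := gammaDensity_nonneg one_pos ht.le
  rw [Real.norm_of_nonneg (commDens_nonneg a z ht), commDens, peetre_eq]
  have : 0 ≤ gammaDensity 1 t * (|a| * 2 ^ (|a| / 2) * (1 + ‖z‖ ^ 2) ^ (|a| / 2) * heat t z) := by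
    positivity
  have h1 : 0 ≤ ‖z‖ ^ 2 / t := by positivity
  refine (le_of_eq ?_).trans ((mul_le_mul_of_nonneg_left (by linarith :
    ‖z‖ ^ 2 / t / 2 ≤ 1 + ‖z‖ ^ 2 / t) this).trans_eq ?_)
  · field_simp
  · ring

lemma integrable_commKer (d : ℕ) (a : ℝ) : Integrable (commKer d a) :=
  (integrable_commDens d a).integral_prod_left

lemma measurable_commKer (d : ℕ) (a : ℝ) : Measurable (commKer d a) :=
  (measurable_commDens d a).stronglyMeasurable.integral_prod_right'.measurable

lemma schwartz_bound (φ : SC d) : ∃ C : ℝ, 0 ≤ C ∧ ∀ x, ‖φ x‖ ≤ C := by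
  obtain ⟨C, hC⟩ := φ.decay 0 0
  exact ⟨C, hC.1.le, fun x => by simpa using hC.2 x⟩

/-- The commutator of `⟨x⟩^a` with `∂_j Λ^{-1}` is dominated by a convolution. -/
lemma enorm_comm_le (a : ℝ) (j : Fin d) (φ : SC d) (x : Space d) :
    ‖wmul a (bes (-1) (∂_{basisVec j} φ)) x - bes (-1) (∂_{basisVec j} (wmul a φ)) x‖ₑ ≤
      ∫⁻ z, ‖commKer d a z‖ₑ * ‖wmul a φ (x - z)‖ₑ := by
  set Q : Space d → ℂ := fun z => wt 1 a x * (∂_{basisVec j} φ) (x - z) -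
        (∂_{basisVec j} (wmul a φ)) (x - z) with hQ
  have hQc : Continuous Q := by
    have h1 := (∂_{basisVec j} φ).continuous
    have h2 := (∂_{basisVec j} (wmul a φ)).continuous
    fun_prop
  obtain ⟨C1, hC1, hb1⟩ := schwartz_bound (∂_{basisVec j} φ)
  obtain ⟨C2, hC2, hb2⟩ := schwartz_bound (∂_{basisVec j} (wmul a φ))
  have hQb : ∀ z, ‖Q z‖ ≤ wt 1 a x * C1 + C2 := by
    intro z
    refine (norm_sub_le _ _).trans (add_le_add ?_ (hb2 _))
    rw [norm_mul, Complex.norm_real, Real.norm_of_nonneg (wt_pos _ _ _).le]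
    exact mul_le_mul_of_nonneg_left (hb1 _) (wt_pos _ _ _).le
  have hprod : Integrable (fun p : Space d × ℝ => ((gammaDensity 1 p.2 * heat p.2 p.1 : ℝ) : ℂ) *
      Q p.1) (volume.prod (volume.restrict (Set.Ioi 0))) := by
    exact ((integrable_gammaDensity_heat_prod one_pos).ofReal).mul_bdd
      (hQc.comp continuous_fst).aestronglyMeasurable (ae_of_all _ fun p => hQb p.1)
  have hInt : ∀ ψ : SC d, Integrable fun z => (besselKer 1 z : ℂ) * ψ (x - z) := by
    intro ψ
    obtain ⟨C, hC, hb⟩ := schwartz_bound ψ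
    refine ((integrable_besselKer one_pos).ofReal).mul_bdd (c := C) ?_ (ae_of_all _ fun z => hb _)
    have := ψ.continuous
    exact (by fun_prop : Continuous fun z => ψ (x - z)).aestronglyMeasurable
  have e1 : wmul a (bes (-1) (∂_{basisVec j} φ)) x - bes (-1) (∂_{basisVec j} (wmul a φ)) x =
      ∫ z, (besselKer 1 z : ℂ) * Q z := by
    rw [wmul_apply, bes, bessel_apply_eq_integral one_pos, bessel_apply_eq_integral one_pos,
      ← integral_const_mul, ← integral_sub ((hInt _).const_mul _) (hInt _)]
    refine integral_congr_ae (ae_of_all _ fun z => ?_)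
    simp only [hQ]; ring
  have e2 : ∫ z, (besselKer 1 z : ℂ) * Q z = ∫ t in Set.Ioi (0 : ℝ), (gammaDensity 1 t : ℂ) *
      ∫ z, (heat t z : ℂ) * Q z := by
    calc ∫ z, (besselKer 1 z : ℂ) * Q z
        = ∫ z, ∫ t in Set.Ioi (0 : ℝ), ((gammaDensity 1 t * heat t z : ℝ) : ℂ) * Q z := by
          refine integral_congr_ae (ae_of_all _ fun z => ?_)
          simp only
          rw [integral_mul_const, besselKer, ← integral_complex_ofReal]
      _ = ∫ t in Set.Ioi (0 : ℝ), ∫ z, ((gammaDensity 1 t * heat t z : ℝ) : ℂ) * Q z :=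
          integral_integral_swap hprod
      _ = _ := by
          refine integral_congr_ae (ae_of_all _ fun t => ?_)
          simp only
          rw [← integral_const_mul]
          refine integral_congr_ae (ae_of_all _ fun z => ?_)
          simp only; push_cast; ring
  rw [e1, e2]
  have hmeas : Measurable (fun p : ℝ × Space d => ENNReal.ofReal (commDens a (p.2, p.1)) *
      ‖wmul a φ (x - p.2)‖ₑ) := by
    have hwm := (wmul a φ).continuous.measurable
    have := (measurable_commDens d a).comp (measurable_swap (α := ℝ))
    exact this.ennreal_ofReal.mul (by fun_prop)
  calc ‖∫ t in Set.Ioi (0 : ℝ), (gammaDensity 1 t : ℂ) * ∫ z, (heat t z : ℂ) * Q z‖ₑ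
      ≤ ∫⁻ t in Set.Ioi (0 : ℝ), ‖(gammaDensity 1 t : ℂ) * ∫ z, (heat t z : ℂ) * Q z‖ₑ :=
        enorm_integral_le_lintegral_enorm _
    _ ≤ ∫⁻ t in Set.Ioi (0 : ℝ), ∫⁻ z,
          ENNReal.ofReal (commDens a (z, t)) * ‖wmul a φ (x - z)‖ₑ := by
        refine setLIntegral_mono' measurableSet_Ioi fun t (ht : 0 < t) => ?_
        rw [hQ, integral_heat_mul_commutator ht, ← integral_const_mul]
        refine (enorm_integral_le_lintegral_enorm _).trans (lintegral_mono fun z => ?_)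
        have h0 := heat_nonneg ht.le z
        have hg := gammaDensity_nonneg one_pos ht.le
        simp only [← ofReal_norm]
        rw [← ENNReal.ofReal_mul (commDens_nonneg a z ht)]
        refine ENNReal.ofReal_le_ofReal ?_
        rw [fderiv_heat, wmul_apply, commDens]
        simp only [norm_mul, Complex.norm_real, Real.norm_eq_abs, abs_neg,
          abs_of_pos (wt_pos _ _ _), abs_of_nonneg hg]
        have h2 := abs_wt_sub_le (ε := 1) zero_le_one le_rfl a x (x - z)
        rw [sub_sub_cancel, mul_one] at h2
        rw [abs_of_nonneg (a := heat t z / (2 * t)) (by positivity)]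
        calc _ ≤ gammaDensity 1 t * (heat t z / (2 * t) * ‖z‖ *
              ((|a| * ‖z‖ * peetre a z * wt 1 a (x - z)) * ‖φ (x - z)‖)) := by
                gcongr
                exact abs_inner_basisVec_le z j
          _ = _ := by ring
    _ = ∫⁻ z, ∫⁻ t in Set.Ioi (0 : ℝ), ENNReal.ofReal (commDens a (z, t)) * ‖wmul a φ (x - z)‖ₑ :=
        lintegral_lintegral_swap hmeas.aemeasurable
    _ ≤ _ := by
        refine lintegral_mono_ae ?_
        filter_upwards [(integrable_commDens d a).prod_right_ae] with z hz
        rw [lintegral_mul_const' _ _ enorm_ne_top]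
        gcongr
        have hnn : ∀ t ∈ Set.Ioi (0 : ℝ), 0 ≤ commDens a (z, t) := fun t ht => commDens_nonneg a z ht
        rw [← ofReal_integral_eq_lintegral_ofReal hz
          ((ae_restrict_iff' measurableSet_Ioi).2 (ae_of_all _ hnn))]
        exact Real.ofReal_le_enorm _

lemma exists_nrm_wmul_bes_pd_le (d : ℕ) (a : ℝ) : ∃ C : ℝ≥0, ∀ (j : Fin d) (φ : SC d),
    nrm (wmul a (bes (-1) (∂_{basisVec j} φ))) ≤ C * nrm (wmul a φ) := by
  have hi := integrable_commKer d a
  refine ⟨(∫⁻ z : Space d, ‖commKer d a z‖ₑ).toNNReal + 1, fun j φ => ?_⟩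
  have h1 : nrm (wmul a (bes (-1) (∂_{basisVec j} φ)) - bes (-1) (∂_{basisVec j} (wmul a φ))) ≤
      (∫⁻ z : Space d, ‖commKer d a z‖ₑ).toNNReal * nrm (wmul a φ) := by
    refine nrm_le_of_lintegral_le ?_
    rw [ENNReal.coe_toNNReal hi.2.ne]
    refine le_trans (lintegral_mono fun x => ?_) (lintegral_conv_sq_le
      (measurable_commKer d a).enorm (wmul a φ).continuous.measurable.enorm)
    gcongr
    exact enorm_comm_le a j φ x
  have h2 : nrm (bes (-1) (∂_{basisVec j} (wmul a φ))) ≤ (1 : ℝ≥0) * nrm (wmul a φ) := by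
    rw [pd_eq_mult, map_smul, bes, SchwartzMap.fourierMultiplierCLM_fourierMultiplierCLM_apply
      (besselSymbol_growth d _) (innerC_growth _)]
    have hg := (besselSymbol_growth d (-1)).mul (innerC_growth (basisVec j))
    have := congrArg (fun A => A (wmul a φ)) (SchwartzMap.fourierMultiplierCLM_smul (F := ℂ) hg
      (2 * Real.pi * Complex.I))
    simp only [smul_apply] at this
    rw [← this]
    refine nrm_mult_le (Function.HasTemperateGrowth.mul (.const _) hg) (fun ξ => ?_) _
    simp only [Pi.mul_apply, besselSymbol, norm_mul,
      Complex.norm_real, Complex.norm_I, Complex.norm_ofNat, Real.norm_eq_abs, norm_smul,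
      abs_of_pos Real.pi_pos]
    norm_num
    rw [abs_of_pos (by positivity), Real.rpow_neg (by positivity), ← Real.sqrt_eq_rpow,
      mul_left_comm, inv_mul_le_one₀ (by positivity)]
    refine le_trans ?_ (Real.le_sqrt_of_sq_le (x := 2 * Real.pi * ‖ξ‖) (by linarith))
    gcongr
    exact abs_inner_basisVec_le ξ j
  have h3 := nrm_add_le (wmul a (bes (-1) (∂_{basisVec j} φ)) -
    bes (-1) (∂_{basisVec j} (wmul a φ))) (bes (-1) (∂_{basisVec j} (wmul a φ)))
  rw [sub_add_cancel] at h3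
  rw [NNReal.coe_add, add_mul]
  linarith

lemma laplacian_eq_sum_pd (φ : SC d) :
    Δ φ = ∑ j : Fin d, ∂_{basisVec j} (∂_{basisVec j} φ) := by
  rw [SchwartzMap.laplacian_eq_sum (EuclideanSpace.basisFun (Fin d) ℝ)]
  simp [basisVec]

lemma mult_add {m₁ m₂ : Space d → ℂ} (h₁ : m₁.HasTemperateGrowth) (h₂ : m₂.HasTemperateGrowth)
    (φ : SC d) : 𝓜 (fun ξ => m₁ ξ + m₂ ξ) φ = 𝓜 m₁ φ + 𝓜 m₂ φ := by
  simp only [SchwartzMap.fourierMultiplierCLM_apply]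
  rw [← FourierTransform.fourierInv_add]
  congr 1
  ext ξ
  rw [add_apply, SchwartzMap.smulLeftCLM_apply_apply h₁, SchwartzMap.smulLeftCLM_apply_apply h₂,
    SchwartzMap.smulLeftCLM_apply_apply (by exact h₁.add h₂), add_smul]

lemma mult_smul {m : Space d → ℂ} (h : m.HasTemperateGrowth) (c : ℂ) (φ : SC d) :
    𝓜 (fun ξ => c * m ξ) φ = c • 𝓜 m φ :=
  congrArg (fun A => A φ) (SchwartzMap.fourierMultiplierCLM_smul (F := ℂ) h c)

lemma normSqC_growth : (fun ξ : Space d => ((‖ξ‖ ^ 2 : ℝ) : ℂ)).HasTemperateGrowth := by fun_prop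

lemma laplacian_eq_mult (φ : SC d) :
    Δ φ = 𝓜 (fun ξ : Space d => (-(2 * Real.pi) ^ 2 : ℂ) * ((‖ξ‖ ^ 2 : ℝ) : ℂ)) φ := by
  rw [mult_smul normSqC_growth, SchwartzMap.laplacian_eq_fourierMultiplierCLM,
    ← SchwartzMap.fourierMultiplierCLM_ofReal ℂ (by fun_prop)]
  ext x
  simp

lemma bes_two (φ : SC d) : bes 2 φ = φ - Δ φ := by
  have h1 : besselSymbol d 2 = fun ξ => 1 + (-1 : ℂ) *
      ((-(2 * Real.pi) ^ 2 : ℂ) * ((‖ξ‖ ^ 2 : ℝ) : ℂ)) := by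
    funext ξ
    rw [besselSymbol, div_self two_ne_zero, Real.rpow_one, norm_smul,
      Real.norm_of_nonneg (by positivity)]
    push_cast; ring
  have hg : (fun ξ : Space d => (-(2 * Real.pi) ^ 2 : ℂ) *
      ((‖ξ‖ ^ 2 : ℝ) : ℂ)).HasTemperateGrowth := by fun_prop
  rw [bes, h1, mult_add (.const _) (by fun_prop), mult_smul hg, ← laplacian_eq_mult]
  simp [sub_eq_add_neg]

/-- `‖⟨x⟩^a Λψ‖ ≤ C (‖⟨x⟩^a ψ‖ + ∑_j ‖⟨x⟩^a ∂_jψ‖)`. -/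
lemma exists_nrm_wmul_bes_one_le (d : ℕ) (a : ℝ) : ∃ C : ℝ≥0, ∀ φ : SC d,
    nrm (wmul a (bes 1 φ)) ≤
      C * (nrm (wmul a φ) + ∑ j : Fin d, nrm (wmul a (∂_{basisVec j} φ))) := by
  obtain ⟨C0, h0⟩ := exists_nrm_wmul_bes_le d a one_pos
  obtain ⟨C1, h1⟩ := exists_nrm_wmul_bes_pd_le d a
  refine ⟨C0 + C1, fun φ => ?_⟩
  have e : bes 1 φ = bes (-1) φ -
      ∑ j : Fin d, bes (-1) (∂_{basisVec j} (∂_{basisVec j} φ)) := by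
    rw [← map_sum, ← laplacian_eq_sum_pd, ← map_sub, ← bes_two, bes_bes]
    norm_num
  have hn := nrm_nonneg (wmul a φ)
  have hs : 0 ≤ ∑ j : Fin d, nrm (wmul a (∂_{basisVec j} φ)) :=
    Finset.sum_nonneg fun j _ => nrm_nonneg _
  have hc0 := C0.2
  have hc1 := C1.2
  calc nrm (wmul a (bes 1 φ)) ≤ nrm (wmul a (bes (-1) φ)) + ∑ j : Fin d,
        nrm (wmul a (bes (-1) (∂_{basisVec j} (∂_{basisVec j} φ)))) := by
        rw [e, map_sub, map_sum]
        exact (nrm_sub_le _ _).trans (add_le_add le_rfl (nrm_sum_le _ _))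
    _ ≤ C0 * nrm (wmul a φ) + ∑ j : Fin d, C1 * nrm (wmul a (∂_{basisVec j} φ)) :=
        add_le_add (h0 φ) (Finset.sum_le_sum fun j _ => h1 j _)
    _ ≤ _ := by
        rw [← Finset.mul_sum]
        push_cast
        nlinarith [mul_nonneg hc0 hs, mul_nonneg hc1 hn]

/-- `‖⟨x⟩^a ψ‖ + ∑_j ‖⟨x⟩^a ∂_jψ‖ ≤ C ‖⟨x⟩^a Λψ‖`, term by term. -/
lemma exists_nrm_wmul_pd_le (d : ℕ) (a : ℝ) : ∃ C : ℝ≥0, ∀ φ : SC d,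
    nrm (wmul a φ) ≤ C * nrm (wmul a (bes 1 φ)) ∧
      ∀ j : Fin d, nrm (wmul a (∂_{basisVec j} φ)) ≤ C * nrm (wmul a (bes 1 φ)) := by
  obtain ⟨C0, h0⟩ := exists_nrm_wmul_bes_le d a one_pos
  obtain ⟨C1, h1⟩ := exists_nrm_wmul_bes_pd_le d a
  refine ⟨C0 + C1, fun φ => ?_⟩
  have e : bes (-1) (bes 1 φ) = φ := by rw [bes_bes]; norm_num [bes_zero]
  have hn := nrm_nonneg (wmul a (bes 1 φ))
  have h2 := h0 (bes 1 φ)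
  rw [e] at h2
  refine ⟨h2.trans ?_, fun j => ?_⟩
  · gcongr; simp
  · have := h1 j (bes 1 φ)
    rw [bes_pd, e] at this
    exact this.trans (by gcongr; simp)

end schwartz

/-! ### Cutoffs of Schwartz functions -/

section cutoff

variable {d : ℕ} {F : Type*} [NormedAddCommGroup F] [NormedSpace ℝ F]

/-- A smooth bump function that is `1` on the unit ball. -/
def bump (d : ℕ) : ContDiffBump (0 : Space d) := ⟨1, 2, one_pos, one_lt_two⟩

/-- The cutoff function at scale `N + 1`. -/
def cutFn (d N : ℕ) (x : Space d) : ℝ := bump d ((N + 1 : ℝ)⁻¹ • x)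

lemma contDiff_bump (d : ℕ) : ContDiff ℝ ∞ (bump d : Space d → ℝ) := (bump d).contDiff

lemma contDiff_cutFn (d N : ℕ) : ContDiff ℝ ∞ (cutFn d N) :=
  (contDiff_bump d).comp (contDiff_const_smul _)

lemma hasCompactSupport_cutFn (d N : ℕ) : HasCompactSupport (cutFn d N) :=
  (bump d).hasCompactSupport.comp_smul (by positivity)

lemma hasTemperateGrowth_of_hasCompactSupport {f : Space d → ℝ} (hf : ContDiff ℝ ∞ f)
    (hs : HasCompactSupport f) : f.HasTemperateGrowth :=
  (hs.toSchwartzMap hf).hasTemperateGrowth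

lemma cutFn_growth (d N : ℕ) : (cutFn d N).HasTemperateGrowth :=
  hasTemperateGrowth_of_hasCompactSupport (contDiff_cutFn d N) (hasCompactSupport_cutFn d N)

/-- The Schwartz function `φ` cut off at scale `N + 1`. -/
def cut (N : ℕ) (φ : 𝓢(Space d, F)) : 𝓢(Space d, F) := SchwartzMap.smulLeftCLM F (cutFn d N) φ

lemma cut_apply (N : ℕ) (φ : 𝓢(Space d, F)) (x : Space d) : cut N φ x = cutFn d N x • φ x :=
  SchwartzMap.smulLeftCLM_apply_apply (cutFn_growth d N) φ x

lemma hasCompactSupport_cut (N : ℕ) (φ : 𝓢(Space d, F)) : HasCompactSupport (cut N φ) := by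
  have : (cut N φ : Space d → F) = cutFn d N • (φ : Space d → F) := by
    funext x; exact cut_apply N φ x
  rw [this]
  exact (hasCompactSupport_cutFn d N).smul_right

lemma exists_iteratedFDeriv_cutFn_sub_one_le (d i : ℕ) : ∃ B : ℝ, 0 ≤ B ∧ ∀ N x,
    ‖iteratedFDeriv ℝ i (fun x => cutFn d N x - 1) x‖ ≤ B := by
  have hη : ContDiff ℝ ∞ (fun x => bump d x - 1) := (contDiff_bump d).sub contDiff_const
  have hB : ∃ B : ℝ, 0 ≤ B ∧ ∀ x, ‖iteratedFDeriv ℝ i (fun x => bump d x - 1) x‖ ≤ B := by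
    have h1 : HasCompactSupport (iteratedFDeriv ℝ i (bump d : Space d → ℝ)) :=
      (bump d).hasCompactSupport.iteratedFDeriv i
    obtain ⟨B, hB⟩ := h1.exists_bound_of_continuous
      ((contDiff_bump d).continuous_iteratedFDeriv (by exact_mod_cast le_top))
    refine ⟨max B 0 + 1, by positivity, fun x => ?_⟩
    have e : iteratedFDeriv ℝ i (fun x => bump d x - 1) x =
        iteratedFDeriv ℝ i (bump d : Space d → ℝ) x -
          iteratedFDeriv ℝ i (fun _ : Space d => (1 : ℝ)) x :=
      iteratedFDeriv_sub_apply ((contDiff_bump d).contDiffAt.of_le (by exact_mod_cast le_top))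
        contDiffAt_const
    have h2 : ‖iteratedFDeriv ℝ i (fun _ : Space d => (1 : ℝ)) x‖ ≤ 1 := by
      rcases Nat.eq_zero_or_pos i with rfl | hi
      · simp
      · rw [iteratedFDeriv_const_of_ne hi.ne']; simp
    rw [e]
    exact (norm_sub_le _ _).trans (add_le_add ((hB x).trans (le_max_left _ _)) h2)
  obtain ⟨B, hB0, hB⟩ := hB
  refine ⟨B, hB0, fun N x => ?_⟩
  have h := ContinuousLinearMap.iteratedFDeriv_comp_right (f := fun x => bump d x - 1) (i := i)
    ((N + 1 : ℝ)⁻¹ • ContinuousLinearMap.id ℝ (Space d)) hη x (by exact_mod_cast le_top)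
  have e : (fun x => cutFn d N x - 1) = (fun x => bump d x - 1) ∘
      ((N + 1 : ℝ)⁻¹ • ContinuousLinearMap.id ℝ (Space d)) := by
    funext y; simp [cutFn]
  rw [e, h]
  refine (ContinuousMultilinearMap.norm_compContinuousLinearMap_le _ _).trans ?_
  refine (mul_le_of_le_one_right (norm_nonneg _) (Finset.prod_le_one (fun _ _ => norm_nonneg _)
    fun _ _ => ?_)).trans (hB _)
  rw [norm_smul, norm_inv, Real.norm_of_nonneg (by positivity)]
  refine mul_le_one₀ (inv_le_one_of_one_le₀ (by have := N.cast_nonneg (α := ℝ); linarith))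
    (norm_nonneg _) ContinuousLinearMap.norm_id_le

lemma cutFn_eventuallyEq_one {N : ℕ} {x : Space d} (hx : ‖x‖ < N + 1) :
    (fun y => cutFn d N y - 1) =ᶠ[𝓝 x] fun _ => 0 := by
  have : ∀ᶠ y in 𝓝 x, ‖y‖ < N + 1 := continuous_norm.tendsto x (gt_mem_nhds hx)
  filter_upwards [this] with y hy
  rw [cutFn, (bump d).one_of_mem_closedBall, sub_self]
  rw [mem_closedBall_zero_iff, norm_smul, norm_inv, Real.norm_of_nonneg (by positivity)]
  change _ ≤ (1 : ℝ)
  rw [inv_mul_le_iff₀ (by positivity)]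
  linarith

lemma tendsto_cut (φ : 𝓢(Space d, F)) : Tendsto (fun N => cut N φ) atTop (𝓝 φ) := by
  rw [(schwartz_withSeminorms ℝ (Space d) F).tendsto_nhds]
  rintro ⟨k, n⟩ ε hε
  choose B hB0 hB using fun i => exists_iteratedFDeriv_cutFn_sub_one_le d i
  set C : ℝ := ∑ i ∈ Finset.range (n + 1), (n.choose i : ℝ) * B i *
    SchwartzMap.seminorm ℝ (k + 1) (n - i) φ with hC
  have hC0 : 0 ≤ C := Finset.sum_nonneg fun i _ => by
    have := hB0 i; have := apply_nonneg (SchwartzMap.seminorm ℝ (k + 1) (n - i)) φ; positivity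
  have key : ∀ N : ℕ, SchwartzMap.seminorm ℝ k n (cut N φ - φ) ≤ C / (N + 1) := by
    intro N
    have hN : (0 : ℝ) < N + 1 := by positivity
    refine SchwartzMap.seminorm_le_bound ℝ k n _ (by positivity) fun x => ?_
    have e : ((cut N φ - φ : 𝓢(Space d, F)) : Space d → F) =
        fun y => (cutFn d N y - 1) • φ y := by
      funext y; rw [sub_apply, cut_apply, sub_smul, one_smul]
    rw [e]
    rcases lt_or_ge ‖x‖ (N + 1) with hx | hx
    · have h0 : (fun y => (cutFn d N y - 1) • φ y) =ᶠ[𝓝 x] fun _ => 0 := by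
        filter_upwards [cutFn_eventuallyEq_one hx] with y hy
        rw [hy, zero_smul]
      rw [h0.iteratedFDeriv ℝ n |>.eq_of_nhds]
      have : iteratedFDeriv ℝ n (fun _ : Space d => (0 : F)) = 0 := iteratedFDeriv_fun_zero
      rw [this]
      simp; positivity
    · have h1 := norm_iteratedFDeriv_smul_le (𝕜 := ℝ) (f := fun y => cutFn d N y - 1)
        (g := (φ : Space d → F)) (N := ∞) ((contDiff_cutFn d N).sub contDiff_const)
        φ.smooth' x (n := n) (by exact_mod_cast le_top)
      have hx1 : 1 ≤ ‖x‖ / (N + 1) := by rwa [le_div_iff₀ hN, one_mul]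
      calc ‖x‖ ^ k * ‖iteratedFDeriv ℝ n (fun y => (cutFn d N y - 1) • φ y) x‖
          ≤ ‖x‖ ^ k * ∑ i ∈ Finset.range (n + 1), (n.choose i : ℝ) *
            ‖iteratedFDeriv ℝ i (fun y => cutFn d N y - 1) x‖ *
              ‖iteratedFDeriv ℝ (n - i) φ x‖ := by gcongr
        _ ≤ (‖x‖ / (N + 1)) * (‖x‖ ^ k * ∑ i ∈ Finset.range (n + 1), (n.choose i : ℝ) *
            B i * ‖iteratedFDeriv ℝ (n - i) φ x‖) := by
            rw [← one_mul (‖x‖ ^ k * _)]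
            gcongr with i hi
            exact hB i N x
        _ = (∑ i ∈ Finset.range (n + 1), (n.choose i : ℝ) * B i *
            (‖x‖ ^ (k + 1) * ‖iteratedFDeriv ℝ (n - i) φ x‖)) / (N + 1) := by
            rw [Finset.mul_sum, Finset.mul_sum, Finset.sum_div]
            refine Finset.sum_congr rfl fun i _ => ?_
            ring
        _ ≤ C / (N + 1) := by
            rw [hC]
            gcongr with i hi
            · exact mul_nonneg (by positivity) (hB0 i)
            · exact SchwartzMap.le_seminorm ℝ (k + 1) (n - i) φ x
  have h0 : Tendsto (fun N : ℕ => C / ((N : ℝ) + 1)) atTop (𝓝 0) :=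
    tendsto_const_div_atTop_nhds_zero_nat C |>.comp (tendsto_add_atTop_nat 1) |>.congr
      fun N => by simp
  filter_upwards [h0.eventually_lt_const hε] with N hN
  exact (key N).trans_lt hN

end cutoff

/-! ### Real operators -/

section realness

variable {d : ℕ}

/-- The inclusion of real Schwartz functions into complex ones. -/
def toC : SR d →L[ℝ] SC d := SchwartzMap.postcompCLM Complex.ofRealCLM

/-- The real part of a Schwartz function. -/
def toR : SC d →L[ℝ] SR d := SchwartzMap.postcompCLM Complex.reCLM

@[simp] lemma toC_apply (φ : SR d) (x : Space d) : toC φ x = (φ x : ℂ) := rfl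

@[simp] lemma toR_apply (φ : SC d) (x : Space d) : toR φ x = (φ x).re := rfl

/-- An operator that maps real functions to real functions. -/
def IsRealOp (A : SC d → SC d) : Prop := ∀ φ, (∀ x, (φ x).im = 0) → ∀ x, (A φ x).im = 0

/-- The restriction of an operator to real Schwartz functions. -/
def realify (A : SC d →L[ℂ] SC d) : SR d →L[ℝ] SR d := toR.comp ((A.restrictScalars ℝ).comp toC)

lemma toC_toR {φ : SC d} (h : ∀ x, (φ x).im = 0) : toC (toR φ) = φ := by
  ext x
  rw [toC_apply, toR_apply]
  exact Complex.ext rfl (h x).symm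

lemma toR_toC (φ : SR d) : toR (toC φ) = φ := by ext x; simp

lemma toC_im (φ : SR d) (x : Space d) : (toC φ x).im = 0 := by simp

lemma toC_realify {A : SC d →L[ℂ] SC d} (h : IsRealOp A)
    (φ : SR d) : toC (realify A φ) = A (toC φ) :=
  toC_toR (h _ (toC_im φ))

lemma isRealOp_wmul (a : ℝ) : IsRealOp (wmul (d := d) a) := by
  intro φ h x
  rw [wmul_apply, Complex.im_ofReal_mul, h, mul_zero]

open scoped FourierTransform in
lemma conj_fourier {φ : SC d} (h : ∀ x, (φ x).im = 0) (ξ : Space d) :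
    (starRingEnd ℂ) (𝓕 φ ξ) = 𝓕 φ (-ξ) := by
  rw [SchwartzMap.fourier_coe, Real.fourier_eq', Real.fourier_eq', ← integral_conj]
  refine integral_congr_ae (ae_of_all _ fun x => ?_)
  simp only [smul_eq_mul, map_mul]
  rw [← Complex.exp_conj, Complex.conj_eq_iff_im.2 (h x)]
  simp [Complex.conj_ofNat]

open scoped FourierTransform in
lemma isRealOp_mult {m : Space d → ℂ} (hm : m.HasTemperateGrowth) (hr : ∀ ξ, (m ξ).im = 0)
    (he : ∀ ξ, m (-ξ) = m ξ) : IsRealOp (𝓜 m) := by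
  intro φ h x
  rw [← Complex.conj_eq_iff_im, fourierMultiplier_apply_eq hm, ← integral_conj,
    ← integral_neg_eq_self]
  refine integral_congr_ae (ae_of_all _ fun ξ => ?_)
  simp only [map_mul]
  rw [← Complex.exp_conj, Complex.conj_eq_iff_im.2 (hr _), conj_fourier h, he, neg_neg]
  simp [Complex.conj_ofNat]

lemma besselSymbol_even (s : ℝ) (ξ : Space d) : besselSymbol d s (-ξ) = besselSymbol d s ξ := by
  simp [besselSymbol]

lemma isRealOp_bes (s : ℝ) : IsRealOp (bes (d := d) s) :=
  isRealOp_mult (besselSymbol_growth d s) (fun ξ => by simp [besselSymbol]) (besselSymbol_even s)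

/-- The class in real `L²` of a real Schwartz function. -/
def sLp : SR d →L[ℝ] L2 d := SchwartzMap.toLpCLM ℝ ℝ 2 volume

lemma coeFn_sLp (φ : SR d) : sLp φ =ᵐ[volume] φ := φ.coeFn_toLp 2 volume

lemma norm_sLp (φ : SR d) : ‖sLp φ‖ = nrm (toC φ) := by
  have h : ‖sLp φ‖ₑ ^ 2 = ‖(toC φ).toLp 2 (volume : Measure (Space d))‖ₑ ^ 2 := by
    rw [enorm_toLp_sq, enorm_sq_Lp_two]
    refine lintegral_congr_ae ?_
    filter_upwards [coeFn_sLp φ] with x hx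
    rw [hx, toC_apply, ← ofReal_norm, ← ofReal_norm, Complex.norm_real]
  have h2 := congrArg ENNReal.toReal h
  simp only [ENNReal.toReal_pow, toReal_enorm] at h2
  exact (sq_eq_sq₀ (norm_nonneg _) (norm_nonneg _)).1 h2

lemma denseRange_sLp : DenseRange (sLp : SR d → L2 d) :=
  SchwartzMap.denseRange_toLpCLM (by norm_num)

end realness

/-! ### Coordinates on the phase spaces -/

section coords

variable {d n : ℕ}

open scoped FourierTransform in
lemma mult_even_apply {m : Space d → ℂ} (hm : m.HasTemperateGrowth) (he : ∀ ξ, m (-ξ) = m ξ)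
    (φ : SC d) :
    𝓕 (SchwartzMap.smulLeftCLM ℂ m (𝓕⁻ φ)) = 𝓜 m φ := by
  ext x
  rw [fourierMultiplier_apply_eq hm, SchwartzMap.fourier_coe, Real.fourier_eq',
    ← integral_neg_eq_self]
  refine integral_congr_ae (ae_of_all _ fun ξ => ?_)
  simp only [smul_eq_mul]
  rw [SchwartzMap.smulLeftCLM_apply_apply hm, he, smul_eq_mul, SchwartzMap.fourierInv_coe,
    Real.fourierInv_eq_fourier_neg, neg_neg, SchwartzMap.fourier_coe]
  simp

lemma fourierMultiplier_dist_apply {m : Space d → ℂ} (hm : m.HasTemperateGrowth)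
    (he : ∀ ξ, m (-ξ) = m ξ) (T : 𝓢'(Space d, ℂ)) (φ : SC d) :
    fourierMultiplierCLM ℂ m T φ = T (𝓜 m φ) := by
  rw [TemperedDistribution.fourierMultiplierCLM_apply_apply, mult_even_apply hm he]

lemma weightedBessel_apply (s α : ℝ) (T : 𝓢'(Space d, ℂ)) (φ : SC d) :
    weightedBessel d s α T φ = T (bes s (wmul α φ)) := by
  change smulLeftCLM ℂ (weight d α) (fourierMultiplierCLM ℂ (besselSymbol d s) T) φ = _
  rw [smulLeftCLM_apply_apply, fourierMultiplier_dist_apply (besselSymbol_growth d s)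
    (besselSymbol_even s)]
  rfl

lemma toTempered_apply (f : Lp ℂ 2 (volume : Measure (Space d))) (φ : SC d) :
    Lp.toTemperedDistributionCLM ℂ volume 2 f φ = ∫ x, φ x * f x := by
  rw [Lp.toTemperedDistributionCLM_apply, Lp.toTemperedDistribution_apply]
  rfl

/-- The inclusion of real `L²` into complex `L²`. -/
def l2C : L2 d →L[ℝ] Lp ℂ 2 (volume : Measure (Space d)) := Complex.ofRealCLM.compLpL 2 volume

/-- The real part of a complex `L²` function. -/
def l2R : Lp ℂ 2 (volume : Measure (Space d)) →L[ℝ] L2 d := Complex.reCLM.compLpL 2 volume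

lemma coeFn_l2C (f : L2 d) : l2C f =ᵐ[volume] fun x => (f x : ℂ) :=
  Complex.ofRealCLM.coeFn_compLpL f

lemma coeFn_l2R (f : Lp ℂ 2 (volume : Measure (Space d))) : l2R f =ᵐ[volume] fun x => (f x).re :=
  Complex.reCLM.coeFn_compLpL f

/-- The tempered distribution `Λ^{-s} ⟨x⟩^{-α} g`. -/
def sobDist (s α : ℝ) (g : L2 d) : 𝓢'(Space d, ℂ) :=
  fourierMultiplierCLM ℂ (besselSymbol d (-s)) (smulLeftCLM ℂ (weight d (-α))
    (Lp.toTemperedDistributionCLM ℂ volume 2 (l2C g)))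

lemma sobDist_apply (s α : ℝ) (g : L2 d) (φ : SC d) :
    sobDist s α g φ = ∫ x, wmul (-α) (bes (-s) φ) x * (g x : ℂ) := by
  rw [sobDist, fourierMultiplier_dist_apply (besselSymbol_growth d _) (besselSymbol_even _),
    smulLeftCLM_apply_apply, toTempered_apply]
  refine integral_congr_ae ?_
  filter_upwards [coeFn_l2C g] with x hx
  rw [hx]
  rfl

lemma bes_neg_bes (s : ℝ) (φ : SC d) : bes (-s) (bes s φ) = φ := by
  rw [bes_bes, neg_add_cancel, bes_zero]

lemma bes_bes_neg (s : ℝ) (φ : SC d) : bes s (bes (-s) φ) = φ := by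
  rw [bes_bes, add_neg_cancel, bes_zero]

lemma wmul_neg_wmul (s : ℝ) (φ : SC d) : wmul (-s) (wmul s φ) = φ := by
  rw [wmul_wmul, neg_add_cancel, wmul_zero]

lemma wmul_wmul_neg (s : ℝ) (φ : SC d) : wmul s (wmul (-s) φ) = φ := by
  rw [wmul_wmul, add_neg_cancel, wmul_zero]

lemma sobDist_mem (s α : ℝ) (g : L2 d) : sobDist s α g ∈ sobolevSubmodule d s α := by
  refine ⟨fun φ hφ => ?_, l2C g, ?_⟩
  · rw [sobDist_apply]
    have h : ∀ x, wmul (-α) (bes (-s) φ) x * (g x : ℂ) =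
        (((wmul (-α) (bes (-s) φ) x).re * g x : ℝ) : ℂ) := by
      intro x
      have := isRealOp_wmul (-α) _ (isRealOp_bes (-s) φ hφ) x
      apply Complex.ext <;> simp [this]
    simp only [h]
    rw [integral_complex_ofReal, Complex.ofReal_im]
  · ext φ
    rw [weightedBessel_apply, sobDist_apply, bes_neg_bes, wmul_neg_wmul, toTempered_apply]
    refine integral_congr_ae ?_
    filter_upwards [coeFn_l2C g] with x hx
    rw [hx]

lemma WSobolev.dist_apply' {s α : ℝ} (T : WSobolev d s α) (φ : SC d) :
    T.dist φ = ∫ x, wmul (-α) (bes (-s) φ) x * WSobolev.toL2 d s α T x := by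
  have h := congrArg (fun S => S (wmul (-α) (bes (-s) φ))) T.toL2_spec
  simp only [weightedBessel_apply, wmul_wmul_neg, bes_bes_neg, toTempered_apply] at h
  exact h

lemma WSobolev.toL2_im {s α : ℝ} (T : WSobolev d s α) :
    ∀ᵐ x, (WSobolev.toL2 d s α T x).im = 0 := by
  set f := WSobolev.toL2 d s α T with hf
  have hloc : LocallyIntegrable (fun x => (f x).im) volume := by
    have h1 : LocallyIntegrable f volume := (Lp.memLp f).locallyIntegrable (by norm_num)
    intro x
    exact (h1 x).imp fun U hU => ⟨hU.1, hU.2.im⟩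
  refine ae_eq_zero_of_integral_contDiff_smul_eq_zero hloc fun g hg hgs => ?_
  set φ : SR d := hgs.toSchwartzMap hg with hφ
  have h1 := T.2.1 (bes s (wmul α (toC φ)))
    (isRealOp_bes s _ (isRealOp_wmul α _ (toC_im φ)))
  have h2 : T.1 (bes s (wmul α (toC φ))) = ∫ x, toC φ x * f x := by
    have := T.dist_apply' (bes s (wmul α (toC φ)))
    rw [bes_neg_bes, wmul_neg_wmul] at this
    exact this
  rw [h2] at h1
  have hInt : Integrable fun x => toC φ x * f x :=
    (MemLp.integrable_mul ((toC φ).memLp 2 volume) (Lp.memLp f) : _)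
  have h3 : (∫ x, toC φ x * f x).im = ∫ x, (toC φ x * f x).im := (integral_im hInt).symm
  rw [h3] at h1
  rw [← h1]
  refine integral_congr_ae (ae_of_all _ fun x => ?_)
  simp only [toC_apply, Complex.im_ofReal_mul, smul_eq_mul]
  rfl

lemma WSobolev.l2C_l2R {s α : ℝ} (T : WSobolev d s α) :
    l2C (l2R (WSobolev.toL2 d s α T)) = WSobolev.toL2 d s α T := by
  ext1
  filter_upwards [coeFn_l2C (l2R (WSobolev.toL2 d s α T)), coeFn_l2R (WSobolev.toL2 d s α T),
    T.toL2_im] with x h1 h2 h3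
  rw [h1, h2]
  exact Complex.ext rfl h3.symm

lemma norm_l2C (f : L2 d) : ‖l2C f‖ = ‖f‖ := by
  rw [Lp.norm_def, Lp.norm_def]
  congr 1
  refine eLpNorm_congr_norm_ae ?_
  filter_upwards [coeFn_l2C f] with x hx
  rw [hx, Complex.norm_real]

lemma l2R_l2C (f : L2 d) : l2R (l2C f) = f := by
  ext1
  filter_upwards [coeFn_l2C f, coeFn_l2R (l2C f)] with x h1 h2
  rw [h2, h1, Complex.ofReal_re]

/-- `T ↦ ⟨x⟩^α Λ^s T` identifies `H^{s,α}` with real `L²`. -/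
def sobEquiv (d : ℕ) (s α : ℝ) : WSobolev d s α ≃ₗᵢ[ℝ] L2 d :=
  LinearIsometryEquiv.ofSurjective
    { toLinearMap := l2R.toLinearMap ∘ₗ WSobolev.toL2 d s α
      norm_map' := fun T => by
        change ‖l2R (WSobolev.toL2 d s α T)‖ = ‖WSobolev.toL2 d s α T‖
        rw [← norm_l2C, T.l2C_l2R] }
    (by
      intro g
      let T : WSobolev d s α := ⟨sobDist s α g, sobDist_mem s α g⟩
      refine ⟨T, ?_⟩
      have hT : WSobolev.toL2 d s α T = l2C g := by
        apply toTempered_injective d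
        rw [← WSobolev.toL2_spec]
        ext φ
        rw [weightedBessel_apply]
        change sobDist s α g _ = _
        rw [sobDist_apply, bes_neg_bes, wmul_neg_wmul, toTempered_apply]
        refine integral_congr_ae ?_
        filter_upwards [coeFn_l2C g] with x hx
        rw [hx]
      change l2R (WSobolev.toL2 d s α T) = g
      rw [hT, l2R_l2C])

lemma dist_apply {s α : ℝ} (T : WSobolev d s α) (φ : SC d) :
    T.dist φ = ∫ x, wmul (-α) (bes (-s) φ) x * (sobEquiv d s α T x : ℂ) := by
  rw [T.dist_apply']
  refine integral_congr_ae ?_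
  filter_upwards [coeFn_l2C (sobEquiv d s α T)] with x hx
  rw [← hx]
  congr 2
  exact congrArg _ T.l2C_l2R.symm

lemma dist_eq_sobDist {s α : ℝ} (T : WSobolev d s α) :
    T.dist = sobDist s α (sobEquiv d s α T) := by
  ext φ
  rw [dist_apply, sobDist_apply]

lemma dist_sobEquiv_symm {s α : ℝ} (g : L2 d) :
    ((sobEquiv d s α).symm g).dist = sobDist s α g := by
  rw [dist_eq_sobDist, LinearIsometryEquiv.apply_symm_apply]

lemma dist_injective {s α : ℝ} : Function.Injective (WSobolev.dist : WSobolev d s α → _) :=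
  Subtype.val_injective

lemma sobDist_injective (s α : ℝ) : Function.Injective (sobDist s α : L2 d → _) := by
  intro f g h
  rw [← dist_sobEquiv_symm, ← dist_sobEquiv_symm] at h
  exact (sobEquiv d s α).symm.injective (dist_injective h)

lemma latWeighted_eq (α : ℝ) (u : Lat d → Vec n) (k : Lat d) :
    latWeighted α u k = wt 1 α (latPt k) • u k := by
  simp [latWeighted, wt]

lemma wt_smul_wt_neg_smul {E : Type*} [AddCommGroup E] [Module ℝ E] (ε a : ℝ) (x : Space d)
    (v : E) : wt ε a x • wt ε (-a) x • v = v := by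
  rw [smul_smul, wt_mul_wt_neg, one_smul]

lemma wt_neg_smul_wt_smul {E : Type*} [AddCommGroup E] [Module ℝ E] (ε a : ℝ) (x : Space d)
    (v : E) : wt ε (-a) x • wt ε a x • v = v := by
  rw [smul_smul, wt_neg_mul_wt, one_smul]

/-- `u ↦ ⟨k⟩^α u(k)` identifies `L^α` with `ℓ²`. -/
def latEquiv (d n : ℕ) (α : ℝ) : WLattice d n α ≃ₗᵢ[ℝ] Ell2 d n :=
  LinearIsometryEquiv.ofSurjective
    { toLinearMap := WLattice.toEll2 d n α
      norm_map' := fun _ => rfl }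
    (by
      intro v
      have h : latWeighted α (fun k => wt 1 (-α) (latPt k) • v k) = v := by
        funext k
        rw [latWeighted_eq, wt_smul_wt_neg_smul]
      refine ⟨⟨fun k => wt 1 (-α) (latPt k) • v k, ?_⟩, ?_⟩
      · change Memℓp _ 2
        rw [h]
        exact lp.memℓp v
      · exact Subtype.ext h)

lemma latEquiv_apply (α : ℝ) (u : WLattice d n α) (k : Lat d) :
    latEquiv d n α u k = wt 1 α (latPt k) • u.seq k :=
  latWeighted_eq α u.1 k

/-- The coordinate space `(L² × ℓ²) × (L² × ℓ²)`. -/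
abbrev XSp (d n : ℕ) : Type := (L2 d × Ell2 d n) × (L2 d × Ell2 d n)

/-- Coordinates on the phase space. -/
def coord (d n : ℕ) (s α : ℝ) : Phase d n s α ≃L[ℝ] XSp d n :=
  (WithLp.prodContinuousLinearEquiv 2 ℝ (WithLp 2 (WSobolev d (1 + s) α × WLattice d n α))
    (WithLp 2 (WSobolev d s α × WLattice d n α))).trans
  (((WithLp.prodContinuousLinearEquiv 2 ℝ (WSobolev d (1 + s) α) (WLattice d n α)).trans
    ((sobEquiv d (1 + s) α).toContinuousLinearEquiv.prodCongr
      (latEquiv d n α).toContinuousLinearEquiv)).prodCongr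
   ((WithLp.prodContinuousLinearEquiv 2 ℝ (WSobolev d s α) (WLattice d n α)).trans
    ((sobEquiv d s α).toContinuousLinearEquiv.prodCongr
      (latEquiv d n α).toContinuousLinearEquiv)))

variable {s α : ℝ}

lemma psi_eq (Y : Phase d n s α) : Y.psi = sobDist (1 + s) α (coord d n s α Y).1.1 :=
  dist_eq_sobDist _

lemma mom_eq (Y : Phase d n s α) : Y.mom = sobDist s α (coord d n s α Y).2.1 := dist_eq_sobDist _

lemma u_eq (Y : Phase d n s α) (k : Lat d) :
    Y.u k = wt 1 (-α) (latPt k) • (coord d n s α Y).1.2 k := by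
  have h : (coord d n s α Y).1.2 k = wt 1 α (latPt k) • Y.u k :=
    latEquiv_apply α (WithLp.snd (WithLp.fst Y)) k
  rw [h, wt_neg_smul_wt_smul]

lemma v_eq (Y : Phase d n s α) (k : Lat d) :
    Y.v k = wt 1 (-α) (latPt k) • (coord d n s α Y).2.2 k := by
  have h : (coord d n s α Y).2.2 k = wt 1 α (latPt k) • Y.v k :=
    latEquiv_apply α (WithLp.snd (WithLp.snd Y)) k
  rw [h, wt_neg_smul_wt_smul]

end coords

/-! ### Operators on `ℓ²` -/

section ell2

variable {d n : ℕ}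

lemma ell2_summable (u : Ell2 d n) : Summable fun k => ‖u k‖ ^ 2 := by
  simpa using (memℓp_gen_iff (p := 2) (by norm_num)).1 (lp.memℓp u)

lemma ell2_norm_sq (u : Ell2 d n) : ‖u‖ ^ 2 = ∑' k, ‖u k‖ ^ 2 := by
  simpa using lp.norm_rpow_eq_tsum (p := 2) (by norm_num) u

lemma memℓp_two_of_summable {f : Lat d → Vec n} (h : Summable fun k => ‖f k‖ ^ 2) : Memℓp f 2 :=
  memℓp_gen (by simpa using h)

/-- The operator `u ↦ (k ↦ c k • u (σ k))` on `ℓ²`. -/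
def wShift (σ : Lat d ≃ Lat d) (c : Lat d → ℝ) (C : ℝ≥0) (hC : ∀ k, |c k| ≤ C) :
    Ell2 d n →L[ℝ] Ell2 d n :=
  have hs : ∀ u : Ell2 d n, ∀ k, ‖c k • u (σ k)‖ ^ 2 ≤ (C : ℝ) ^ 2 * ‖u (σ k)‖ ^ 2 := fun u k => by
    rw [norm_smul, mul_pow, Real.norm_eq_abs]
    have := hC k
    gcongr
  have hsum : ∀ u : Ell2 d n, Summable fun k => (C : ℝ) ^ 2 * ‖u (σ k)‖ ^ 2 := fun u =>
    ((σ.summable_iff (f := fun k => ‖u k‖ ^ 2)).2 (ell2_summable u)).mul_left _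
  LinearMap.mkContinuous
    { toFun := fun u => ⟨fun k => c k • u (σ k), memℓp_two_of_summable
        ((hsum u).of_nonneg_of_le (fun _ => by positivity) (hs u))⟩
      map_add' := fun u v => by ext1; funext k; exact smul_add _ _ _
      map_smul' := fun a u => by ext1; funext k; exact smul_comm (c k) a (u (σ k)) }
    C (fun u => by
      refine abs_le_of_sq_le_sq' ?_ (by positivity) |>.2
      rw [ell2_norm_sq, mul_pow, ell2_norm_sq, ← tsum_mul_left,
        ← σ.tsum_eq (fun k => (C : ℝ) ^ 2 * ‖u k‖ ^ 2)]
      exact ((hsum u).of_nonneg_of_le (fun _ => by positivity) (hs u)).tsum_le_tsum (hs u) (hsum u))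

lemma wShift_apply (σ : Lat d ≃ Lat d) (c : Lat d → ℝ) (C : ℝ≥0) (hC : ∀ k, |c k| ≤ C)
    (u : Ell2 d n) (k : Lat d) : wShift σ c C hC u k = c k • u (σ k) := rfl

lemma norm_wShift_le (σ : Lat d ≃ Lat d) (c : Lat d → ℝ) (C : ℝ≥0) (hC : ∀ k, |c k| ≤ C) :
    ‖(wShift σ c C hC : Ell2 d n →L[ℝ] Ell2 d n)‖ ≤ C := by
  unfold wShift
  exact LinearMap.mkContinuous_norm_le _ C.2 _

lemma norm_le_norm_latPt (k : Lat d) : ‖k‖ ≤ ‖latPt k‖ := by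
  rw [pi_norm_le_iff_of_nonneg (norm_nonneg _)]
  intro i
  have := PiLp.norm_apply_le (latPt k) i
  rwa [latPt, Int.norm_cast_real] at this

lemma tendsto_norm_latPt : Tendsto (fun k : Lat d => ‖latPt k‖) cofinite atTop := by
  refine tendsto_atTop_mono norm_le_norm_latPt ?_
  have h := tendsto_norm_cocompact_atTop (E := Lat d)
  rwa [cocompact_eq_cofinite] at h

lemma isCompactOperator_wShift (c : Lat d → ℝ) (C : ℝ≥0) (hC : ∀ k, |c k| ≤ C)
    (h0 : Tendsto c cofinite (𝓝 0)) :
    IsCompactOperator (wShift (Equiv.refl _) c C hC : Ell2 d n →L[ℝ] Ell2 d n) := by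
  classical
  set A : Finset (Lat d) → (Ell2 d n →L[ℝ] Ell2 d n) := fun s =>
    ∑ k ∈ s, (c k) • (lp.singleContinuousLinearMap ℝ (fun _ : Lat d => Vec n) 2 k).comp
      (lp.evalCLM ℝ (fun _ : Lat d => Vec n) 2 k) with hA
  have hAk : ∀ s, IsCompactOperator (A s) := fun s => by
    refine Finset.sum_induction _ (fun T : Ell2 d n →L[ℝ] Ell2 d n => IsCompactOperator T)
      (fun _ _ h h' => h.add h') isCompactOperator_zero fun k _ => ?_
    exact (((isCompactOperator_id (E := Vec n)).comp_clm
      (lp.evalCLM ℝ (fun _ : Lat d => Vec n) 2 k)).clm_comp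
      (lp.singleContinuousLinearMap ℝ (fun _ : Lat d => Vec n) 2 k)).smul (c k)
  have hAapp : ∀ s (u : Ell2 d n) k, A s u k = if k ∈ s then c k • u k else 0 := by
    intro s u k
    simp only [hA, sum_apply, lp.coeFn_sum, Finset.sum_apply]
    rw [Finset.sum_congr rfl (g := fun j => if k = j then c k • u k else 0)]
    · simp
    · intro j _
      change c j • (lp.single (E := fun _ : Lat d => Vec n) 2 j (u j)) k = _
      rw [lp.single_apply]
      split_ifs with h
      · subst h; simp
      · rw [Pi.single_eq_of_ne h, smul_zero]
  refine isCompactOperator_of_tendsto (l := atTop) (F := A) ?_ (Eventually.of_forall hAk)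
  rw [Metric.tendsto_atTop]
  intro ε hε
  have hfin : {k | ε / 2 < |c k|}.Finite := by
    have h1 := (Metric.tendsto_nhds.1 h0) (ε / 2) (by positivity)
    rw [eventually_cofinite] at h1
    refine h1.subset fun k hk => ?_
    simp only [Set.mem_ofPred_eq, dist_zero_right, not_lt, Real.norm_eq_abs] at hk ⊢
    exact hk.le
  refine ⟨hfin.toFinset, fun s hs => ?_⟩
  have e : wShift (Equiv.refl _) c C hC - A s = (wShift (Equiv.refl _)
      (fun k => if k ∈ s then 0 else c k) (ε / 2).toNNReal (fun k => by
        rw [Real.coe_toNNReal _ (by positivity)]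
        split_ifs with h
        · simpa using by positivity
        · by_contra hcon
          exact h (hs (by simpa using hcon))) : Ell2 d n →L[ℝ] Ell2 d n) := by
    ext u k : 3
    change wShift (Equiv.refl _) c C hC u k - A s u k = _
    rw [hAapp, wShift_apply, wShift_apply]
    split_ifs <;> simp
  rw [dist_comm, dist_eq_norm, e]
  refine (norm_wShift_le _ _ _ _).trans_lt ?_
  rw [Real.coe_toNNReal _ (by positivity)]
  linarith

end ell2

/-! ### The compact embedding -/

section embedding

variable {d n : ℕ}

lemma integral_mult_mul {m : Space d → ℂ} (hm : m.HasTemperateGrowth) (he : ∀ ξ, m (-ξ) = m ξ)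
    (φ ψ : SC d) : ∫ x, 𝓜 m φ x * ψ x = ∫ x, φ x * 𝓜 m ψ x := by
  have h := congrArg (fun T => T φ) (fourierMultiplierCLM_toTemperedDistributionCLM_eq hm ψ)
  simp only at h
  rw [fourierMultiplier_dist_apply hm he] at h
  simpa using h

lemma integral_bes_mul (s : ℝ) (φ ψ : SC d) :
    ∫ x, bes s φ x * ψ x = ∫ x, φ x * bes s ψ x :=
  integral_mult_mul (besselSymbol_growth d s) (besselSymbol_even s) φ ψ

lemma isRealOp_comp {A B : SC d →L[ℂ] SC d} (hA : IsRealOp A)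
    (hB : IsRealOp B) : IsRealOp (A.comp B) := fun φ h => hA _ (hB φ h)

/-- The real Schwartz function `⟨x⟩^{-α} Λ^{-s} φ`. -/
def sobTest (s α : ℝ) : SR d →L[ℝ] SR d := realify ((wmul (-α)).comp (bes (-s)))

lemma toC_sobTest (s α : ℝ) (φ : SR d) :
    toC (sobTest s α φ) = wmul (-α) (bes (-s) (toC φ)) :=
  toC_realify (A := (wmul (-α)).comp (bes (-s))) (isRealOp_comp (isRealOp_wmul _) (isRealOp_bes _)) φ

lemma inner_L2 (f g : L2 d) : inner ℝ f g = ∫ x, f x * g x := by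
  rw [L2.inner_def]
  refine integral_congr_ae (ae_of_all _ fun x => ?_)
  simp [mul_comm]

lemma inner_sLp (φ : SR d) (g : L2 d) : inner ℝ (sLp φ) g = ∫ x, φ x * g x := by
  rw [inner_L2]
  refine integral_congr_ae ?_
  filter_upwards [coeFn_sLp φ] with x hx
  rw [hx]

lemma sobDist_toC (s α : ℝ) (g : L2 d) (φ : SR d) :
    sobDist s α g (toC φ) = (inner ℝ (sLp (sobTest s α φ)) g : ℂ) := by
  rw [sobDist_apply, inner_sLp, ← integral_complex_ofReal, ← toC_sobTest]
  refine integral_congr_ae (ae_of_all _ fun x => ?_)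
  simp

lemma schwartz_re_im (φ : SC d) :
    φ = toC (toR φ) + Complex.I • toC (toR (-Complex.I • φ)) := by
  ext x
  simp only [add_apply, smul_apply, toC_apply, toR_apply, smul_eq_mul]
  apply Complex.ext <;> simp

lemma dist_ext_real {S T : 𝓢'(Space d, ℂ)} (h : ∀ φ : SR d, S (toC φ) = T (toC φ)) :
    S = T := by
  ext φ
  rw [schwartz_re_im φ]
  generalize toR φ = a, toR (-Complex.I • φ) = b
  rw [map_add, map_add, map_smul, map_smul, h, h]

/-- The kernel of `⟨x⟩^β Λ^{-σ} ⟨y⟩^{-α}`. -/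
def embKer (d : ℕ) (σ α β : ℝ) (x y : Space d) : ℝ := wt 1 β x * besselKer σ (x - y) * wt 1 (-α) y

lemma wt_mul_le (α β : ℝ) (x y : Space d) :
    wt 1 β x * wt 1 (-α) y ≤ wt 1 (β - α) x * peetre α (x - y) := by
  have h := wt_le_peetre_mul (ε := 1) (by norm_num) (-α) y x
  rw [peetre_abs, ← neg_sub x y, peetre_neg] at h
  calc wt 1 β x * wt 1 (-α) y ≤ wt 1 β x * (peetre α (x - y) * wt 1 (-α) x) :=
        mul_le_mul_of_nonneg_left h (wt_pos _ _ _).le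
    _ = (wt 1 β x * wt 1 (-α) x) * peetre α (x - y) := by ring
    _ = _ := by rw [wt_mul_wt, ← sub_eq_add_neg]

lemma wt_mul_le_peetre {α β : ℝ} (hβ : β ≤ α) (x y : Space d) :
    wt 1 β x * wt 1 (-α) y ≤ peetre α (x - y) :=
  (wt_mul_le α β x y).trans
    (mul_le_of_le_one_left (peetre_pos _ _).le (wt_le_one (by linarith) 1 x))

lemma tendsto_rpow_weight {ι : Type*} {l : Filter ι} {f : ι → ℝ} (hf : Tendsto f l atTop) {γ : ℝ}
    (hγ : γ < 0) : Tendsto (fun i => (1 + f i ^ 2) ^ (γ / 2)) l (𝓝 0) := by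
  have := (tendsto_rpow_neg_atTop (y := -(γ / 2)) (by linarith)).comp
    (tendsto_atTop_add_const_left _ 1 ((tendsto_pow_atTop two_ne_zero).comp hf))
  simpa [Function.comp_def] using this

lemma isSchur_of_abs_le_conv {k : Space d → Space d → ℝ} (hk : Measurable (Function.uncurry k))
    {κ : Space d → ℝ} (hκ : Integrable κ) (h : ∀ x y, |k x y| ≤ κ (x - y)) {M : ℝ≥0}
    (hM : ∫ z, κ z ≤ M) : IsSchur k M volume volume := by
  have h0 : ∀ z, 0 ≤ κ z := fun z => by have := (abs_nonneg _).trans (h z 0); rwa [sub_zero] at this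
  have hI : ∫⁻ z, ENNReal.ofReal (κ z) ≤ M := by
    rw [← ofReal_integral_eq_lintegral_ofReal hκ (ae_of_all _ h0)]
    exact ENNReal.ofReal_le_of_le_toReal hM
  have hle : ∀ x y, ‖k x y‖ₑ ≤ ENNReal.ofReal (κ (x - y)) := fun x y => by
    rw [← ofReal_norm]; exact ENNReal.ofReal_le_ofReal (h x y)
  exact ⟨hk, ae_of_all _ fun x => (lintegral_mono fun y => hle x y).trans
      ((lintegral_sub_left_eq_self (fun z => ENNReal.ofReal (κ z)) x).trans_le hI),
    ae_of_all _ fun y => (lintegral_mono fun x => hle x y).trans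
      ((lintegral_sub_right_eq_self (fun z => ENNReal.ofReal (κ z)) y).trans_le hI)⟩

lemma measurable_embKer (σ α β : ℝ) : Measurable (Function.uncurry (embKer d σ α β)) := by
  have h1 : Measurable (fun p : Space d × Space d => besselKer σ (p.1 - p.2)) :=
    (measurable_besselKer σ).comp (measurable_fst.sub measurable_snd)
  have h2 : Measurable (fun p : Space d × Space d => wt 1 β p.1) :=
    (measurable_wt _ _).comp measurable_fst
  have h3 : Measurable (fun p : Space d × Space d => wt 1 (-α) p.2) :=
    (measurable_wt _ _).comp measurable_snd
  exact (h2.mul h1).mul h3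

/-- The truncation of `embKer` to bounded `x` and bounded values of the Bessel kernel. -/
def embKerTrunc (d : ℕ) (σ α β : ℝ) (N : ℕ) (x y : Space d) : ℝ :=
  (Metric.closedBall (0 : Space d) N).indicator (fun x => wt 1 β x) x *
    min (besselKer σ (x - y)) N * wt 1 (-α) y

lemma measurable_embKerTrunc (σ α β : ℝ) (N : ℕ) :
    Measurable (Function.uncurry (embKerTrunc d σ α β N)) := by
  have h1 : Measurable (fun p : Space d × Space d => min (besselKer σ (p.1 - p.2)) (N : ℝ)) :=
    ((measurable_besselKer σ).comp (measurable_fst.sub measurable_snd)).min measurable_const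
  have h2 : Measurable (fun p : Space d × Space d =>
      (Metric.closedBall (0 : Space d) N).indicator (fun x => wt 1 β x) p.1) :=
    ((measurable_wt _ _).indicator Metric.isClosed_closedBall.measurableSet).comp measurable_fst
  have h3 : Measurable (fun p : Space d × Space d => wt 1 (-α) p.2) :=
    (measurable_wt _ _).comp measurable_snd
  exact (h2.mul h1).mul h3

variable {σ α β : ℝ}

lemma abs_embKer_le (hσ : 0 < σ) (hβ : β ≤ α) (x y : Space d) :
    |embKer d σ α β x y| ≤ besselKer σ (x - y) * peetre α (x - y) := by
  have hG := besselKer_nonneg hσ (x - y)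
  have hw := wt_pos 1 β x
  have hw' := wt_pos 1 (-α) y
  rw [embKer, abs_of_nonneg (by positivity), mul_right_comm, mul_comm]
  exact mul_le_mul_of_nonneg_left (wt_mul_le_peetre hβ x y) hG

lemma min_besselKer_nonneg (hσ : 0 < σ) (N : ℕ) (z : Space d) :
    0 ≤ min (besselKer σ z) (N : ℝ) := le_min (besselKer_nonneg hσ z) (by positivity)

lemma isSchur_embKer (hσ : 0 < σ) (hβ : β ≤ α) : IsSchur (embKer d σ α β)
    (∫ z : Space d, besselKer σ z * peetre α z).toNNReal volume volume :=
  isSchur_of_abs_le_conv (measurable_embKer σ α β) (integrable_besselKer_mul_peetre hσ α)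
    (abs_embKer_le hσ hβ) (Real.le_coe_toNNReal _)

lemma embKerTrunc_nonneg (hσ : 0 < σ) (N : ℕ) (x y : Space d) : 0 ≤ embKerTrunc d σ α β N x y :=
  mul_nonneg (mul_nonneg (Set.indicator_nonneg (fun x _ => (wt_pos 1 β x).le) x)
    (min_besselKer_nonneg hσ N _)) (wt_pos 1 (-α) y).le

lemma embKerTrunc_le (hσ : 0 < σ) (N : ℕ) (x y : Space d) :
    embKerTrunc d σ α β N x y ≤ embKer d σ α β x y :=
  mul_le_mul_of_nonneg_right (mul_le_mul (Set.indicator_le_self' (fun x _ => (wt_pos 1 β x).le) x)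
    (min_le_left _ _) (min_besselKer_nonneg hσ N _) (wt_pos 1 β x).le) (wt_pos 1 (-α) y).le

lemma isSchur_embKerTrunc (hσ : 0 < σ) (hβ : β ≤ α) (N : ℕ) : IsSchur (embKerTrunc d σ α β N)
    (∫ z : Space d, besselKer σ z * peetre α z).toNNReal volume volume :=
  isSchur_of_abs_le_conv (measurable_embKerTrunc σ α β N) (integrable_besselKer_mul_peetre hσ α)
    (fun x y => by
      rw [abs_of_nonneg (embKerTrunc_nonneg hσ N x y)]
      exact (embKerTrunc_le hσ N x y).trans ((le_abs_self _).trans (abs_embKer_le hσ hβ x y)))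
    (Real.le_coe_toNNReal _)

lemma peetre_sq (a : ℝ) (z : Space d) : peetre a z ^ 2 = peetre (2 * a) z := by
  rw [peetre, peetre, ← Real.rpow_natCast, ← Real.rpow_mul (by positivity)]
  congr 1
  rw [abs_mul, abs_two]
  push_cast; ring

lemma isCompactOperator_embKerTrunc (hσ : 0 < σ) (hβ : β ≤ α) (N : ℕ) :
    IsCompactOperator (isSchur_embKerTrunc (d := d) hσ hβ N).op := by
  refine (isSchur_embKerTrunc hσ hβ N).isCompactOperator_op ?_
  have hi := (integrable_besselKer_mul_peetre (d := d) hσ (2 * α)).const_mul (N : ℝ)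
  set κ : Space d → ℝ := fun z => (N : ℝ) * (besselKer σ z * peetre (2 * α) z) with hκ
  have hle : ∀ x y, ‖embKerTrunc d σ α β N x y‖ₑ ^ 2 ≤
      (Metric.closedBall (0 : Space d) N).indicator 1 x * ENNReal.ofReal (κ (x - y)) := by
    intro x y
    by_cases hx : x ∈ Metric.closedBall (0 : Space d) N
    · rw [Set.indicator_of_mem hx, Pi.one_apply, one_mul, ← ofReal_norm,
        ← ENNReal.ofReal_pow (norm_nonneg _)]
      refine ENNReal.ofReal_le_ofReal ?_
      rw [Real.norm_of_nonneg (embKerTrunc_nonneg hσ N x y), embKerTrunc, Set.indicator_of_mem hx]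
      have hw := wt_pos 1 β x
      have hw' := wt_pos 1 (-α) y
      have hm : min (besselKer σ (x - y)) (N : ℝ) ^ 2 ≤ N * besselKer σ (x - y) := by
        rw [sq]
        exact mul_le_mul (min_le_right _ _) (min_le_left _ _) (min_besselKer_nonneg hσ N _)
          (by positivity)
      have h3 := wt_mul_le_peetre hβ x y
      calc (wt 1 β x * min (besselKer σ (x - y)) (N : ℝ) * wt 1 (-α) y) ^ 2
          = (wt 1 β x * wt 1 (-α) y) ^ 2 * min (besselKer σ (x - y)) (N : ℝ) ^ 2 := by ring
        _ ≤ peetre α (x - y) ^ 2 * (N * besselKer σ (x - y)) := by gcongr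
        _ = κ (x - y) := by rw [peetre_sq, hκ]; ring
    · simp [embKerTrunc, Set.indicator_of_notMem hx]
  calc ∫⁻ x, ∫⁻ y, ‖embKerTrunc d σ α β N x y‖ₑ ^ 2
      ≤ ∫⁻ x, ∫⁻ y, (Metric.closedBall (0 : Space d) N).indicator 1 x *
          ENNReal.ofReal (κ (x - y)) := lintegral_mono fun x => lintegral_mono fun y => hle x y
    _ = ∫⁻ x, (Metric.closedBall (0 : Space d) N).indicator 1 x * ∫⁻ z, ENNReal.ofReal (κ z) := by
        refine lintegral_congr fun x => ?_
        rw [lintegral_const_mul' _ _ (by by_cases h : x ∈ Metric.closedBall (0 : Space d) N <;>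
          simp [h]), lintegral_sub_left_eq_self (fun z => ENNReal.ofReal (κ z)) x]
    _ < ⊤ := by
        rw [lintegral_mul_const' _ _ hi.lintegral_lt_top.ne,
          lintegral_indicator_one Metric.isClosed_closedBall.measurableSet]
        exact ENNReal.mul_lt_top measure_closedBall_lt_top hi.lintegral_lt_top

lemma isCompactOperator_embKer (hσ : 0 < σ) (hβ : β < α) :
    IsCompactOperator (isSchur_embKer (d := d) hσ hβ.le).op := by
  have hi := integrable_besselKer_mul_peetre (d := d) hσ α
  set c : ℕ → ℝ := fun N => (1 + (N : ℝ) ^ 2) ^ ((β - α) / 2) with hc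
  have hc0 : ∀ N, 0 ≤ c N := fun N => by positivity
  set r : ℕ → Space d → ℝ := fun N z => (besselKer σ z - min (besselKer σ z) N) * peetre α z with hr
  have hr0 : ∀ N z, 0 ≤ r N z := fun N z =>
    mul_nonneg (sub_nonneg.2 (min_le_left _ _)) (peetre_pos _ _).le
  have hrle : ∀ N z, r N z ≤ besselKer σ z * peetre α z := fun N z => by
    refine mul_le_mul_of_nonneg_right ?_ (peetre_pos _ _).le
    linarith [min_besselKer_nonneg hσ N z]
  have hrm : ∀ N, Measurable (r N) := fun N => by
    have := measurable_besselKer (d := d) σ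
    have := (continuous_peetre (d := d) α).measurable
    fun_prop
  have hri : ∀ N, Integrable (r N) := fun N => hi.mono' (hrm N).aestronglyMeasurable
    (ae_of_all _ fun z => by rw [Real.norm_of_nonneg (hr0 N z)]; exact hrle N z)
  set κ : ℕ → Space d → ℝ := fun N z => r N z + c N * (besselKer σ z * peetre α z) with hκ
  have hκi : ∀ N, Integrable (κ N) := fun N => (hri N).add (hi.const_mul _)
  have hdom : ∀ N x y, |embKer d σ α β x y - embKerTrunc d σ α β N x y| ≤ κ N (x - y) := by
    intro N x y
    rw [abs_of_nonneg (sub_nonneg.2 (embKerTrunc_le hσ N x y))]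
    have h1 := wt_mul_le α β x y
    have hp := (peetre_pos α (x - y)).le
    have hG := besselKer_nonneg hσ (x - y)
    by_cases hx : x ∈ Metric.closedBall (0 : Space d) N
    · rw [embKer, embKerTrunc, Set.indicator_of_mem hx]
      calc wt 1 β x * besselKer σ (x - y) * wt 1 (-α) y -
            wt 1 β x * min (besselKer σ (x - y)) (N : ℝ) * wt 1 (-α) y
          = (besselKer σ (x - y) - min (besselKer σ (x - y)) (N : ℝ)) *
              (wt 1 β x * wt 1 (-α) y) := by ring
        _ ≤ r N (x - y) := mul_le_mul_of_nonneg_left (wt_mul_le_peetre hβ.le x y) (sub_nonneg.2 (min_le_left _ _))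
        _ ≤ κ N (x - y) := le_add_of_nonneg_right (by have := hc0 N; positivity)
    · rw [embKer, embKerTrunc, Set.indicator_of_notMem hx, zero_mul, zero_mul, sub_zero]
      have hx' : (N : ℝ) < ‖x‖ := by simpa using hx
      have h2 : wt 1 (β - α) x ≤ c N := by
        rw [wt, hc, one_pow, one_mul]
        refine Real.rpow_le_rpow_of_nonpos (by positivity) ?_ (by linarith)
        have : (0 : ℝ) ≤ N := by positivity
        gcongr
      calc wt 1 β x * besselKer σ (x - y) * wt 1 (-α) y
          = besselKer σ (x - y) * (wt 1 β x * wt 1 (-α) y) := by ring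
        _ ≤ besselKer σ (x - y) * (c N * peetre α (x - y)) := by
            refine mul_le_mul_of_nonneg_left (h1.trans ?_) hG
            gcongr
        _ = c N * (besselKer σ (x - y) * peetre α (x - y)) := by ring
        _ ≤ κ N (x - y) := le_add_of_nonneg_left (hr0 _ _)
  have hsch : ∀ N, IsSchur (fun x y => embKer d σ α β x y - embKerTrunc d σ α β N x y)
      (∫ z, κ N z).toNNReal volume volume := fun N =>
    isSchur_of_abs_le_conv ((measurable_embKer σ α β).sub (measurable_embKerTrunc σ α β N))
      (hκi N) (hdom N) (Real.le_coe_toNNReal _)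
  have hκ0 : ∀ N, 0 ≤ ∫ z, κ N z := fun N => integral_nonneg fun z =>
    add_nonneg (hr0 N z) (mul_nonneg (hc0 N) (mul_nonneg (besselKer_nonneg hσ z)
      (peetre_pos _ _).le))
  have hlim : Tendsto (fun N => ∫ z, κ N z) atTop (𝓝 0) := by
    have e : ∀ N, ∫ z, κ N z = (∫ z, r N z) + c N * ∫ z : Space d, besselKer σ z * peetre α z := by
      intro N
      rw [integral_add (hri N) (hi.const_mul _), integral_const_mul]
    simp only [e]
    have h1 : Tendsto (fun N => ∫ z, r N z) atTop (𝓝 (∫ _ : Space d, (0 : ℝ))) := by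
      refine tendsto_integral_of_dominated_convergence _
        (fun N => (hrm N).aestronglyMeasurable) hi (fun N => ae_of_all _ fun z => by
          rw [Real.norm_of_nonneg (hr0 N z)]; exact hrle N z) (ae_of_all _ fun z => ?_)
      refine tendsto_const_nhds.congr' ?_
      filter_upwards [eventually_ge_atTop ⌈besselKer σ z⌉₊] with N hN
      change _ = (besselKer σ z - min _ _) * _
      rw [min_eq_left (Nat.ceil_le.1 hN), sub_self, zero_mul]
    have h2 : Tendsto c atTop (𝓝 0) :=
      tendsto_rpow_weight tendsto_natCast_atTop_atTop (by linarith)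
    have := h1.add (h2.mul_const (∫ z : Space d, besselKer σ z * peetre α z))
    simpa using this
  refine isCompactOperator_of_tendsto (l := atTop)
    (F := fun N => (isSchur_embKerTrunc (d := d) hσ hβ.le N).op) ?_
    (Eventually.of_forall fun N => isCompactOperator_embKerTrunc hσ hβ.le N)
  rw [tendsto_iff_norm_sub_tendsto_zero]
  refine squeeze_zero (fun _ => norm_nonneg _) (fun N => ?_) hlim
  rw [norm_sub_rev, (isSchur_embKer hσ hβ.le).op_sub_op _ (hsch N)]
  refine ((hsch N).norm_op_le).trans ?_
  rw [Real.coe_toNNReal _ (hκ0 N)]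

lemma isRealOp_emb (σ α β : ℝ) : IsRealOp
    ((wmul β).comp ((bes (-σ)).comp (wmul (-α))) : SC d →L[ℂ] SC d) :=
  isRealOp_comp (isRealOp_wmul _) (isRealOp_comp (isRealOp_bes _) (isRealOp_wmul _))

lemma embOp_sLp (hσ : 0 < σ) (hβ : β ≤ α) (φ : SR d) :
    (isSchur_embKer hσ hβ).op (sLp φ) =
      sLp (realify ((wmul β).comp ((bes (-σ)).comp (wmul (-α)))) φ) := by
  ext1
  filter_upwards [(isSchur_embKer hσ hβ).coeFn_op (sLp φ), coeFn_sLp (realify ((wmul β).comp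
    ((bes (-σ)).comp (wmul (-α)))) φ)] with x h1 h2
  rw [h1, h2]
  apply Complex.ofReal_injective
  have e := congrArg (fun f => f x) (toC_realify (isRealOp_emb σ α β) φ)
  simp only [toC_apply] at e
  rw [e]
  change _ = wmul β (bes (-σ) (wmul (-α) (toC φ))) x
  have e0 : ∫ y, embKer d σ α β x y * sLp φ y = ∫ y, embKer d σ α β x y * φ y := by
    refine integral_congr_ae ?_
    filter_upwards [coeFn_sLp φ] with y hy
    rw [hy]
  rw [wmul_apply, bes, bessel_apply_eq_integral hσ, ← integral_const_mul, e0,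
    ← integral_complex_ofReal,
    ← integral_sub_left_eq_self (fun y => ((embKer d σ α β x y * φ y : ℝ) : ℂ)) volume x]
  refine integral_congr_ae (ae_of_all _ fun y => ?_)
  simp only [embKer, sub_sub_cancel, wmul_apply, toC_apply]
  push_cast
  ring

lemma sobDist_embOp (hσ : 0 < σ) (hβ : β ≤ α) (r : ℝ) (f : L2 d) :
    sobDist (r - σ) β ((isSchur_embKer hσ hβ).op f) = sobDist r α f := by
  refine dist_ext_real fun φ => ?_
  rw [sobDist_toC, sobDist_toC, Complex.ofReal_inj]
  have hcont : Continuous fun f : L2 d => (inner ℝ (sLp (sobTest (r - σ) β φ))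
    ((isSchur_embKer hσ hβ).op f) : ℝ) := by fun_prop
  have hcont' : Continuous fun f : L2 d => (inner ℝ (sLp (sobTest r α φ)) f : ℝ) := by fun_prop
  refine congrFun (denseRange_sLp.equalizer hcont hcont' (funext fun χ => ?_)) f
  simp only [Function.comp_apply]
  rw [embOp_sLp hσ hβ]
  apply Complex.ofReal_injective
  have key : ∀ a b : SR d, (inner ℝ (sLp a) (sLp b) : ℂ) = ∫ x, toC a x * toC b x := by
    intro a b
    rw [inner_sLp, ← integral_complex_ofReal]
    refine integral_congr_ae ?_
    filter_upwards [coeFn_sLp b] with x hx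
    rw [hx]; simp
  rw [key, key, toC_sobTest, toC_sobTest, toC_realify (isRealOp_emb σ α β)]
  change ∫ x, _ * (wmul β (bes (-σ) (wmul (-α) (toC χ)))) x = _
  have e1 : ∀ x, wmul (-β) (bes (-(r - σ)) (toC φ)) x * (wmul β (bes (-σ) (wmul (-α) (toC χ)))) x =
      bes (-(r - σ)) (toC φ) x * bes (-σ) (wmul (-α) (toC χ)) x := by
    intro x
    rw [wmul_apply, wmul_apply, wt_neg]
    have : (wt 1 β x : ℂ) ≠ 0 := by exact_mod_cast wt_ne_zero 1 β x
    push_cast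
    field_simp
  simp only [e1]
  rw [← integral_bes_mul, bes_bes, show -σ + -(r - σ) = -r by ring]
  refine integral_congr_ae (ae_of_all _ fun x => ?_)
  simp only [wmul_apply]
  ring

lemma isCompactOperator_comp_comp {E F G H : Type*} [NormedAddCommGroup E] [NormedSpace ℝ E]
    [NormedAddCommGroup F] [NormedSpace ℝ F] [NormedAddCommGroup G] [NormedSpace ℝ G]
    [NormedAddCommGroup H] [NormedSpace ℝ H] (C : G →L[ℝ] H) {A : F →L[ℝ] G} (B : E →L[ℝ] F)
    (hA : IsCompactOperator A) : IsCompactOperator (C.comp (A.comp B)) :=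
  (hA.comp_clm B).clm_comp C

lemma isCompactOperator_prodMap {E F G H : Type*} [NormedAddCommGroup E] [NormedSpace ℝ E]
    [NormedAddCommGroup F] [NormedSpace ℝ F] [NormedAddCommGroup G] [NormedSpace ℝ G]
    [NormedAddCommGroup H] [NormedSpace ℝ H] {A : E →L[ℝ] F} {B : G →L[ℝ] H}
    (hA : IsCompactOperator A) (hB : IsCompactOperator B) : IsCompactOperator (A.prodMap B) := by
  have e : A.prodMap B = (ContinuousLinearMap.inl ℝ _ _).comp (A.comp
      (ContinuousLinearMap.fst ℝ _ _)) + (ContinuousLinearMap.inr ℝ _ _).comp (B.comp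
      (ContinuousLinearMap.snd ℝ _ _)) := by
    ext <;> simp
  rw [e]
  exact (isCompactOperator_comp_comp _ _ hA).add (isCompactOperator_comp_comp _ _ hB)

/-- For `s < 0` and `β < α` the space `E^{0,α}` embeds compactly into `E^{s,β}`. -/
theorem exists_compact_embedding (d n : ℕ) {s : ℝ} (hs : s < 0) (hβ : β < α) :
    ∃ ι : Phase d n 0 α →L[ℝ] Phase d n s β,
      (∀ Y, (ι Y).psi = Y.psi ∧ (ι Y).u = Y.u ∧ (ι Y).mom = Y.mom ∧ (ι Y).v = Y.v) ∧
      IsCompactOperator ι := by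
  have hσ : 0 < -s := by linarith
  set K : L2 d →L[ℝ] L2 d := (isSchur_embKer (d := d) hσ hβ.le).op
  have hc : ∀ k : Lat d, |wt 1 (β - α) (latPt k)| ≤ (1 : ℝ≥0) := fun k => by
    rw [abs_of_pos (wt_pos _ _ _)]; exact wt_le_one (by linarith) 1 _
  set D : Ell2 d n →L[ℝ] Ell2 d n := wShift (Equiv.refl _) (fun k => wt 1 (β - α) (latPt k)) 1 hc
    with hD
  have hDc : IsCompactOperator D := by
    refine isCompactOperator_wShift _ _ _ ?_
    simpa [wt] using tendsto_rpow_weight (tendsto_norm_latPt (d := d)) (sub_neg.2 hβ)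
  set A : XSp d n →L[ℝ] XSp d n := (K.prodMap D).prodMap (K.prodMap D)
  have hKD := isCompactOperator_prodMap (isCompactOperator_embKer (d := d) hσ hβ) hDc
  refine ⟨((coord d n s β).symm : XSp d n →L[ℝ] Phase d n s β).comp
    (A.comp (coord d n 0 α : Phase d n 0 α →L[ℝ] XSp d n)), fun Y => ?_,
    isCompactOperator_comp_comp _ _ (isCompactOperator_prodMap hKD hKD)⟩
  have hco := (coord d n s β).apply_symm_apply (A (coord d n 0 α Y))
  have hlat : ∀ (w : Ell2 d n) (k : Lat d),
      wt 1 (-β) (latPt k) • D w k = wt 1 (-α) (latPt k) • w k := by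
    intro w k
    rw [hD, wShift_apply, smul_smul, wt_mul_wt]
    congr 2; ring
  refine ⟨(psi_eq ..).trans ?_, funext fun k => (u_eq ..).trans ?_, (mom_eq ..).trans ?_,
    funext fun k => (v_eq ..).trans ?_⟩
  · rw [psi_eq, ← sobDist_embOp hσ hβ.le (1 + 0)]
    exact congrArg₂ (sobDist · β) (by ring) (congrArg (·.1.1) hco)
  · rw [u_eq]
    exact (congrArg (fun z : XSp d n => wt 1 (-β) (latPt k) • z.1.2 k) hco).trans (hlat _ k)
  · rw [mom_eq, ← sobDist_embOp hσ hβ.le 0]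
    exact congrArg₂ (sobDist · β) (by ring) (congrArg (·.2.1) hco)
  · rw [v_eq]
    exact (congrArg (fun z : XSp d n => wt 1 (-β) (latPt k) • z.2.2 k) hco).trans (hlat _ k)

end embedding

/-! ### The weighted field and its gradient as bounded operators -/

section fieldops

variable {d : ℕ}

/-- Multiplication by `⟨x⟩^a` on real Schwartz functions. -/
def wmulR (a : ℝ) : SR d →L[ℝ] SR d := realify (wmul a)

/-- `Λ^s` on real Schwartz functions. -/
def besR (s : ℝ) : SR d →L[ℝ] SR d := realify (bes s)

/-- The `j`-th partial derivative of a real Schwartz function. -/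
def pdR (j : Fin d) (φ : SR d) : SR d := ∂_{(basisVec j : Space d)} φ

lemma toC_wmulR (a : ℝ) (φ : SR d) : toC (wmulR a φ) = wmul a (toC φ) :=
  toC_realify (isRealOp_wmul a) φ

lemma toC_besR (s : ℝ) (φ : SR d) : toC (besR s φ) = bes s (toC φ) := toC_realify (isRealOp_bes s) φ

lemma toC_injective : Function.Injective (toC : SR d → SC d) :=
  Function.LeftInverse.injective toR_toC

lemma wmulR_apply (a : ℝ) (φ : SR d) (x : Space d) : wmulR a φ x = wt 1 a x * φ x := by
  have h := congrArg (fun f => f x) (toC_wmulR a φ)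
  simp only [toC_apply, wmul_apply] at h
  exact_mod_cast h

lemma pdR_apply (j : Fin d) (φ : SR d) (x : Space d) :
    pdR j φ x = fderiv ℝ φ x (basisVec j) := SchwartzMap.lineDerivOp_apply_eq_fderiv _ φ x

lemma toC_pdR (j : Fin d) (φ : SR d) :
    toC (pdR j φ) = ∂_{(basisVec j : Space d)} (toC φ) := by
  ext x
  have h1 : HasFDerivAt (toC φ) (Complex.ofRealCLM.comp (fderiv ℝ φ x)) x :=
    Complex.ofRealCLM.hasFDerivAt.comp x (φ.hasFDerivAt x)
  rw [toC_apply, pdR_apply, lineDeriv_schwartz, h1.fderiv]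
  rfl

lemma pdR_add (j : Fin d) (φ ψ : SR d) : pdR j (φ + ψ) = pdR j φ + pdR j ψ :=
  LineDeriv.lineDerivOp_add _ _ _

lemma pdR_smul (j : Fin d) (c : ℝ) (φ : SR d) : pdR j (c • φ) = c • pdR j φ :=
  LineDeriv.lineDerivOp_smul _ _ _

lemma pdR_sub (j : Fin d) (φ ψ : SR d) : pdR j (φ - ψ) = pdR j φ - pdR j ψ := by
  rw [sub_eq_add_neg, sub_eq_add_neg, pdR_add]
  congr 1
  exact LineDeriv.lineDerivOp_neg _ _

lemma besR_neg_besR (s : ℝ) (φ : SR d) : besR (-s) (besR s φ) = φ := by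
  apply toC_injective
  rw [toC_besR, toC_besR, bes_neg_bes]

lemma besR_besR_neg (s : ℝ) (φ : SR d) : besR s (besR (-s) φ) = φ := by
  apply toC_injective
  rw [toC_besR, toC_besR, bes_bes_neg]

lemma wmulR_wmulR_neg (s : ℝ) (φ : SR d) : wmulR s (wmulR (-s) φ) = φ := by
  apply toC_injective
  rw [toC_wmulR, toC_wmulR, wmul_wmul_neg]

/-- The coordinate `⟨x⟩^α Λψ` of a Schwartz field `ψ`. -/
def jPsi (α : ℝ) : SR d →L[ℝ] L2 d := sLp.comp ((wmulR α).comp (besR 1))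

/-- The coordinate `⟨x⟩^α π` of a Schwartz momentum `π`. -/
def jPi (α : ℝ) : SR d →L[ℝ] L2 d := sLp.comp (wmulR α)

lemma jPsi_apply (α : ℝ) (ψ : SR d) : jPsi α ψ = sLp (wmulR α (besR 1 ψ)) := rfl

lemma jPi_apply (α : ℝ) (ψ : SR d) : jPi α ψ = sLp (wmulR α ψ) := rfl

lemma denseRange_jPsi (α : ℝ) : DenseRange (jPsi (d := d) α) := by
  have h : Function.Surjective ((wmulR α).comp (besR 1) : SR d →L[ℝ] SR d) :=
    fun φ => ⟨besR (-1) (wmulR (-α) φ), by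
      change wmulR α (besR 1 (besR (-1) (wmulR (-α) φ))) = φ
      rw [besR_besR_neg, wmulR_wmulR_neg]⟩
  exact denseRange_sLp.comp h.denseRange sLp.continuous

lemma denseRange_jPi (α : ℝ) : DenseRange (jPi (d := d) α) := by
  have h : Function.Surjective (wmulR α : SR d →L[ℝ] SR d) :=
    fun φ => ⟨wmulR (-α) φ, wmulR_wmulR_neg α φ⟩
  exact denseRange_sLp.comp h.denseRange sLp.continuous

lemma norm_jPsi (α : ℝ) (ψ : SR d) : ‖jPsi α ψ‖ = nrm (wmul α (bes 1 (toC ψ))) := by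
  rw [jPsi_apply, norm_sLp, toC_wmulR, toC_besR]

lemma norm_jPi (α : ℝ) (ψ : SR d) : ‖jPi α ψ‖ = nrm (wmul α (toC ψ)) := by
  rw [jPi_apply, norm_sLp, toC_wmulR]

lemma exists_norm_jPi_le (d : ℕ) (α : ℝ) : ∃ C : ℝ≥0, ∀ ψ : SR d,
    ‖jPi α ψ‖ ≤ C * ‖jPsi α ψ‖ ∧ ∀ j, ‖jPi α (pdR j ψ)‖ ≤ C * ‖jPsi α ψ‖ := by
  obtain ⟨C, hC⟩ := exists_nrm_wmul_pd_le d α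
  refine ⟨C, fun ψ => ⟨?_, fun j => ?_⟩⟩
  · rw [norm_jPi, norm_jPsi]; exact (hC _).1
  · rw [norm_jPi, norm_jPsi, toC_pdR]; exact (hC _).2 j

lemma exists_norm_jPsi_le (d : ℕ) (α : ℝ) : ∃ C : ℝ≥0, ∀ ψ : SR d,
    ‖jPsi α ψ‖ ≤ C * (‖jPi α ψ‖ + ∑ j, ‖jPi α (pdR j ψ)‖) := by
  obtain ⟨C, hC⟩ := exists_nrm_wmul_bes_one_le d α
  refine ⟨C, fun ψ => ?_⟩
  simp only [norm_jPi, norm_jPsi, toC_pdR]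
  exact hC _

/-- The derivative `∂_j` as a linear map into weighted `L²`. -/
def jPd (α : ℝ) (j : Fin d) : SR d →ₗ[ℝ] L2 d where
  toFun ψ := jPi α (pdR j ψ)
  map_add' φ ψ := by rw [pdR_add, map_add]
  map_smul' c φ := by rw [pdR_smul, map_smul]; rfl

/-- The operator `⟨x⟩^α Λψ ↦ ⟨x⟩^α ψ`. -/
def opA (d : ℕ) (α : ℝ) : L2 d →L[ℝ] L2 d := (jPi α).toLinearMap.extendOfNorm (jPsi α).toLinearMap

/-- The operator `⟨x⟩^α Λψ ↦ ⟨x⟩^α ∂_jψ`. -/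
def opD (d : ℕ) (α : ℝ) (j : Fin d) : L2 d →L[ℝ] L2 d := (jPd α j).extendOfNorm (jPsi α).toLinearMap

lemma opA_jPsi (α : ℝ) (ψ : SR d) : opA d α (jPsi α ψ) = jPi α ψ := by
  obtain ⟨C, hC⟩ := exists_norm_jPi_le d α
  exact LinearMap.extendOfNorm_eq (f := (jPi α).toLinearMap) (e := (jPsi α).toLinearMap)
    (denseRange_jPsi α) ⟨C, fun x => (hC x).1⟩ ψ

lemma opD_jPsi (α : ℝ) (j : Fin d) (ψ : SR d) :
    opD d α j (jPsi α ψ) = jPi α (pdR j ψ) := by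
  obtain ⟨C, hC⟩ := exists_norm_jPi_le d α
  exact LinearMap.extendOfNorm_eq (f := jPd α j) (e := (jPsi α).toLinearMap)
    (denseRange_jPsi α) ⟨C, fun x => (hC x).2 j⟩ ψ

/-- The graph norm of the gradient controls the norm of `⟨x⟩^α Λψ`. -/
lemma exists_norm_le_opA (d : ℕ) (α : ℝ) : ∃ C : ℝ≥0, ∀ f : L2 d,
    ‖f‖ ≤ C * (‖opA d α f‖ + ∑ j, ‖opD d α j f‖) := by
  obtain ⟨C, hC⟩ := exists_norm_jPsi_le d α
  refine ⟨C, fun f => ?_⟩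
  refine (denseRange_jPsi α).induction_on (p := fun f => ‖f‖ ≤ C * (‖opA d α f‖ +
    ∑ j, ‖opD d α j f‖)) f (isClosed_le (by fun_prop) (by fun_prop)) fun ψ => ?_
  simp only [opA_jPsi, opD_jPsi]
  exact hC ψ

end fieldops

/-! ### The free Klein–Gordon equation on Schwartz functions -/

section kleinGordon

variable {d : ℕ} {m : ℝ}

/-- The dispersion relation `ω(ξ) = (m² + |2πξ|²)^{1/2}`. -/
def omg (d : ℕ) (m : ℝ) (ξ : Space d) : ℝ := m * wt (2 * Real.pi / m) 1 ξ

lemma omg_sq (hm : 0 < m) (ξ : Space d) : omg d m ξ ^ 2 = m ^ 2 + (2 * Real.pi) ^ 2 * ‖ξ‖ ^ 2 := by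
  rw [omg, mul_pow, wt_sq, Real.rpow_one]
  field_simp

lemma omg_pos (hm : 0 < m) (ξ : Space d) : 0 < omg d m ξ := mul_pos hm (wt_pos _ _ _)

lemma le_omg (hm : 0 < m) (ξ : Space d) : m ≤ omg d m ξ := by
  refine abs_le_of_sq_le_sq' ?_ (omg_pos hm ξ).le |>.2
  rw [omg_sq hm]
  have : 0 ≤ (2 * Real.pi) ^ 2 * ‖ξ‖ ^ 2 := by positivity
  linarith

lemma omg_neg (ξ : Space d) : omg d m (-ξ) = omg d m ξ := by simp [omg, wt]

lemma omg_growth : (omg d m).HasTemperateGrowth := by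
  have := wt_growth (d := d) (2 * Real.pi / m) 1
  unfold omg
  fun_prop

lemma omg_inv_growth : (fun ξ => (omg d m ξ)⁻¹).HasTemperateGrowth := by
  have h := wt_growth (d := d) (2 * Real.pi / m) (-1)
  have e : (fun ξ : Space d => (omg d m ξ)⁻¹) = fun ξ => m⁻¹ * wt (2 * Real.pi / m) (-1) ξ := by
    funext ξ
    rw [omg, wt_neg, mul_inv]
  rw [e]
  fun_prop

lemma hasTemperateGrowth_cos : Real.cos.HasTemperateGrowth := by
  refine ⟨Real.contDiff_cos, fun n => ⟨0, 1, fun x => ?_⟩⟩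
  rw [norm_iteratedFDeriv_eq_norm_iteratedDeriv]
  simpa using Real.abs_iteratedDeriv_cos_le_one n x

lemma hasTemperateGrowth_sin : Real.sin.HasTemperateGrowth := by
  refine ⟨Real.contDiff_sin, fun n => ⟨0, 1, fun x => ?_⟩⟩
  rw [norm_iteratedFDeriv_eq_norm_iteratedDeriv]
  simpa using Real.abs_iteratedDeriv_sin_le_one n x

/-- The symbol `cos(tω)`. -/
def cosSym (d : ℕ) (m t : ℝ) (ξ : Space d) : ℂ := (Real.cos (t * omg d m ξ) : ℂ)

/-- The symbol `sin(tω)/ω`. -/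
def sinSym (d : ℕ) (m t : ℝ) (ξ : Space d) : ℂ :=
  ((Real.sin (t * omg d m ξ) * (omg d m ξ)⁻¹ : ℝ) : ℂ)

/-- The symbol `ω²`. -/
def omgSqSym (d : ℕ) (m : ℝ) (ξ : Space d) : ℂ := ((omg d m ξ ^ 2 : ℝ) : ℂ)

lemma cosSym_growth (t : ℝ) : (cosSym d m t).HasTemperateGrowth := by
  have h1 := omg_growth (d := d) (m := m)
  have h2 : (fun ξ => t * omg d m ξ).HasTemperateGrowth := by fun_prop
  exact Complex.ofRealCLM.hasTemperateGrowth.comp (hasTemperateGrowth_cos.comp h2)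

lemma sinSym_growth (t : ℝ) : (sinSym d m t).HasTemperateGrowth := by
  have h1 := omg_growth (d := d) (m := m)
  have h2 : (fun ξ => t * omg d m ξ).HasTemperateGrowth := by fun_prop
  exact Complex.ofRealCLM.hasTemperateGrowth.comp
    ((hasTemperateGrowth_sin.comp h2).mul omg_inv_growth)

lemma omgSqSym_growth : (omgSqSym d m).HasTemperateGrowth := by
  have h1 := omg_growth (d := d) (m := m)
  exact Complex.ofRealCLM.hasTemperateGrowth.comp (h1.pow 2)

/-- The operator `cos(tω)`. -/
def kgC (d : ℕ) (m t : ℝ) : SC d →L[ℂ] SC d := 𝓜 (cosSym d m t)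

/-- The operator `sin(tω)/ω`. -/
def kgS (d : ℕ) (m t : ℝ) : SC d →L[ℂ] SC d := 𝓜 (sinSym d m t)

/-- The operator `ω² = m² - Δ`. -/
def kgH (d : ℕ) (m : ℝ) : SC d →L[ℂ] SC d := 𝓜 (omgSqSym d m)

lemma kgH_apply (hm : 0 < m) (φ : SC d) : kgH d m φ = (m ^ 2 : ℂ) • φ - Δ φ := by
  have h1 : omgSqSym d m = fun ξ => ((m : ℂ) ^ 2) + (-1 : ℂ) *
      ((-(2 * Real.pi) ^ 2 : ℂ) * ((‖ξ‖ ^ 2 : ℝ) : ℂ)) := by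
    funext ξ
    rw [omgSqSym, omg_sq hm]
    push_cast; ring
  have hg : (fun ξ : Space d => (-(2 * Real.pi) ^ 2 : ℂ) *
      ((‖ξ‖ ^ 2 : ℝ) : ℂ)).HasTemperateGrowth := by fun_prop
  rw [kgH, h1, mult_add (.const _) (by fun_prop), mult_smul hg, ← laplacian_eq_mult]
  simp [sub_eq_add_neg]

lemma isRealOp_kgC (t : ℝ) : IsRealOp (kgC d m t) :=
  isRealOp_mult (cosSym_growth t) (fun ξ => Complex.ofReal_im _)
    (fun ξ => by rw [cosSym, cosSym, omg_neg])

lemma isRealOp_kgS (t : ℝ) : IsRealOp (kgS d m t) :=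
  isRealOp_mult (sinSym_growth t) (fun ξ => Complex.ofReal_im _)
    (fun ξ => by rw [sinSym, sinSym, omg_neg])

lemma isRealOp_kgH : IsRealOp (kgH d m) :=
  isRealOp_mult omgSqSym_growth (fun ξ => Complex.ofReal_im _)
    (fun ξ => by rw [omgSqSym, omgSqSym, omg_neg])

open scoped FourierTransform in
lemma integrable_growth_mul_fourier {g : Space d → ℂ} (hg : g.HasTemperateGrowth)
    (φ : SC d) : Integrable fun ξ => g ξ * 𝓕 φ ξ := by
  have h := (SchwartzMap.smulLeftCLM ℂ g (𝓕 φ)).integrable (μ := volume)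
  refine h.congr (ae_of_all _ fun ξ => ?_)
  rw [SchwartzMap.smulLeftCLM_apply_apply hg, smul_eq_mul]

open scoped FourierTransform in
lemma norm_mult_apply_le {g : Space d → ℂ} (hg : g.HasTemperateGrowth) {B : ℝ}
    (hB : ∀ ξ, ‖g ξ‖ ≤ B) (φ : SC d) (x : Space d) :
    ‖𝓜 g φ x‖ ≤ B * ∫ ξ, ‖𝓕 φ ξ‖ := by
  rw [fourierMultiplier_apply_eq hg, ← integral_const_mul]
  refine (norm_integral_le_integral_norm _).trans (integral_mono_of_nonneg
    (ae_of_all _ fun _ => norm_nonneg _) (((𝓕 φ).integrable (μ := volume)).norm.const_mul B)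
    (ae_of_all _ fun ξ => ?_))
  simp only [norm_mul, Complex.norm_exp_ofReal_mul_I, one_mul]
  exact mul_le_mul_of_nonneg_right (hB ξ) (norm_nonneg _)

open scoped FourierTransform in
lemma hasDerivAt_mult {g g' : ℝ → Space d → ℂ} (hg : ∀ t, (g t).HasTemperateGrowth)
    (hg' : ∀ t, (g' t).HasTemperateGrowth) (hd : ∀ t ξ, HasDerivAt (fun t => g t ξ) (g' t ξ) t)
    {b : Space d → ℂ} (hb : b.HasTemperateGrowth) (hb' : ∀ t ξ, ‖g' t ξ‖ ≤ ‖b ξ‖)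
    (φ : SC d) (x : Space d) (t : ℝ) :
    HasDerivAt (fun t => 𝓜 (g t) φ x)
      (𝓜 (g' t) φ x) t := by
  have e : ∀ h : Space d → ℂ, h.HasTemperateGrowth → Integrable fun ξ =>
      Complex.exp ((2 * Real.pi * inner ℝ ξ x : ℝ) * Complex.I) * (h ξ * 𝓕 φ ξ) := by
    intro h hh
    refine (integrable_growth_mul_fourier hh φ).bdd_mul (c := 1) ?_
      (ae_of_all _ fun ξ => (Complex.norm_exp_ofReal_mul_I _).le)
    exact (by fun_prop : Continuous fun ξ : Space d =>
      Complex.exp ((2 * Real.pi * inner ℝ ξ x : ℝ) * Complex.I)).aestronglyMeasurable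
  have h := hasDerivAt_integral_of_dominated_loc_of_deriv_le (μ := (volume : Measure (Space d)))
    (F := fun t ξ => Complex.exp ((2 * Real.pi * inner ℝ ξ x : ℝ) * Complex.I) * (g t ξ * 𝓕 φ ξ))
    (F' := fun t ξ => Complex.exp ((2 * Real.pi * inner ℝ ξ x : ℝ) * Complex.I) *
      (g' t ξ * 𝓕 φ ξ)) (x₀ := t) (s := Set.univ) (bound := fun ξ => ‖b ξ * 𝓕 φ ξ‖) univ_mem
    (Eventually.of_forall fun t => (e _ (hg t)).aestronglyMeasurable) (e _ (hg t))
    (e _ (hg' t)).aestronglyMeasurable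
    (ae_of_all _ fun ξ t _ => by
      simp only [norm_mul, Complex.norm_exp_ofReal_mul_I, one_mul]
      exact mul_le_mul_of_nonneg_right (hb' t ξ) (norm_nonneg _))
    (integrable_growth_mul_fourier hb φ).norm
    (ae_of_all _ fun ξ t _ => ((hd t ξ).mul_const _).const_mul _)
  simp only [fourierMultiplier_apply_eq (hg _), fourierMultiplier_apply_eq (hg' _)]
  exact h.2

end kleinGordon

section kleinGordon

variable {d : ℕ} {m : ℝ}

local notation "𝓩" => SR d × SR d

lemma hasDerivAt_kgC (hm : 0 < m) (φ : SC d) (x : Space d) (t : ℝ) :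
    HasDerivAt (fun t => kgC d m t φ x) (-(kgS d m t (kgH d m φ) x)) t := by
  have hs t := (sinSym_growth (d := d) (m := m) t).mul (omgSqSym_growth (m := m))
  have hval : ∀ t ξ, (-1 : ℂ) * (sinSym d m t * omgSqSym d m) ξ =
      (-Real.sin (t * omg d m ξ) * omg d m ξ : ℝ) := fun t ξ => by
    have := (omg_pos hm ξ).ne'
    rw [Pi.mul_apply, sinSym, omgSqSym, ← Complex.ofReal_mul, ← Complex.ofReal_one,
      ← Complex.ofReal_neg, ← Complex.ofReal_mul]
    congr 1
    field_simp
  have h := hasDerivAt_mult (g := cosSym d m) (b := fun ξ => (omg d m ξ : ℂ)) cosSym_growth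
    (fun t => (Function.HasTemperateGrowth.const (-1 : ℂ)).mul (hs t)) (fun t ξ => ?_)
    (Complex.ofRealCLM.hasTemperateGrowth.comp omg_growth) (fun t ξ => ?_) φ x t
  · refine h.congr_deriv ?_
    erw [mult_smul (hs t)]
    rw [← SchwartzMap.fourierMultiplierCLM_fourierMultiplierCLM_apply (sinSym_growth t)
      omgSqSym_growth, smul_apply, neg_one_smul]
    rfl
  · refine HasDerivAt.congr_deriv ?_ (hval t ξ).symm
    have h1 := ((hasDerivAt_id t).mul_const (omg d m ξ)).cos
    simp only [id, one_mul] at h1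
    exact h1.ofReal_comp
  · refine (congrArg _ (hval t ξ)).trans_le ?_
    rw [Complex.norm_real, Complex.norm_real, norm_mul, norm_neg]
    exact mul_le_of_le_one_left (norm_nonneg _) (Real.abs_sin_le_one _)

lemma hasDerivAt_kgS (hm : 0 < m) (φ : SC d) (x : Space d) (t : ℝ) :
    HasDerivAt (fun t => kgS d m t φ x) (kgC d m t φ x) t := by
  refine hasDerivAt_mult (g := sinSym d m) (g' := cosSym d m) (b := fun _ => 1)
    sinSym_growth cosSym_growth (fun t ξ => ?_) (.const _) (fun t ξ => ?_) φ x t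
  · have := (omg_pos hm ξ).ne'
    have h1 := ((hasDerivAt_id t).mul_const (omg d m ξ)).sin.mul_const (omg d m ξ)⁻¹
    exact (h1.congr_deriv (by simp only [id]; field_simp)).ofReal_comp
  · rw [cosSym, Complex.norm_real, norm_one]
    exact Real.abs_cos_le_one _

lemma kgC_neg (t : ℝ) (φ : SC d) : kgC d m (-t) φ = kgC d m t φ := by
  have : cosSym d m (-t) = cosSym d m t := by funext ξ; simp [cosSym]
  rw [kgC, this, kgC]

lemma kgS_neg (t : ℝ) (φ : SC d) : kgS d m (-t) φ = -kgS d m t φ := by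
  have : sinSym d m (-t) = fun ξ => (-1 : ℂ) * sinSym d m t ξ := by funext ξ; simp [sinSym]
  rw [kgS, this, mult_smul (sinSym_growth t), neg_one_smul, kgS]

lemma kgC_kgC_add (hm : 0 < m) (t : ℝ) (φ : SC d) :
    kgC d m t (kgC d m t φ) + kgS d m t (kgS d m t (kgH d m φ)) = φ := by
  have hc := cosSym_growth (d := d) (m := m) t
  have hs := sinSym_growth (d := d) (m := m) t
  have ho := omgSqSym_growth (d := d) (m := m)
  simp only [kgC, kgS, kgH]
  rw [SchwartzMap.fourierMultiplierCLM_fourierMultiplierCLM_apply hs ho,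
    SchwartzMap.fourierMultiplierCLM_fourierMultiplierCLM_apply hs (hs.mul ho),
    SchwartzMap.fourierMultiplierCLM_fourierMultiplierCLM_apply hc hc,
    ← mult_add (hc.mul hc) (hs.mul (hs.mul ho))]
  have e : (fun ξ => (cosSym d m t * cosSym d m t) ξ +
      (sinSym d m t * (sinSym d m t * omgSqSym d m)) ξ) = fun _ => 1 := by
    funext ξ
    have := (omg_pos hm ξ).ne'
    simp only [Pi.mul_apply, cosSym, sinSym, omgSqSym, ← Complex.ofReal_mul, ← Complex.ofReal_add]
    rw [← Complex.ofReal_one]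
    congr 1
    have h := Real.sin_sq_add_cos_sq (t * omg d m ξ)
    field_simp
    linarith
  rw [e]
  simp

lemma kgC_kgS_comm (t : ℝ) (φ : SC d) :
    kgC d m t (kgS d m t φ) = kgS d m t (kgC d m t φ) :=
  mult_comm (cosSym_growth t) (sinSym_growth t) φ

lemma kgH_kgC (t : ℝ) (φ : SC d) : kgH d m (kgC d m t φ) = kgC d m t (kgH d m φ) :=
  mult_comm omgSqSym_growth (cosSym_growth t) φ

lemma kgH_kgS (t : ℝ) (φ : SC d) : kgH d m (kgS d m t φ) = kgS d m t (kgH d m φ) :=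
  mult_comm omgSqSym_growth (sinSym_growth t) φ

/-- `cos(tω)` on real functions. -/
def cR (d : ℕ) (m t : ℝ) : SR d →L[ℝ] SR d := realify (kgC d m t)

/-- `sin(tω)/ω` on real functions. -/
def sR (d : ℕ) (m t : ℝ) : SR d →L[ℝ] SR d := realify (kgS d m t)

/-- `m² - Δ` on real functions. -/
def hR (d : ℕ) (m : ℝ) : SR d →L[ℝ] SR d := realify (kgH d m)

local notation "γ" => cR d m
local notation "σ" => sR d m
local notation "η" => hR d m

lemma toC_cR (t : ℝ) (φ : SR d) : toC (γ t φ) = kgC d m t (toC φ) :=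
  toC_realify (isRealOp_kgC t) φ

lemma toC_sR (t : ℝ) (φ : SR d) : toC (σ t φ) = kgS d m t (toC φ) :=
  toC_realify (isRealOp_kgS t) φ

lemma toC_hR (φ : SR d) : toC (η φ) = kgH d m (toC φ) := toC_realify isRealOp_kgH φ

/-- The field at time `t`. -/
def evPsi (d : ℕ) (m t : ℝ) : SR d × SR d →L[ℝ] SR d :=
  (cR d m t).comp (.fst ℝ _ _) + (sR d m t).comp (.snd ℝ _ _)

/-- The momentum at time `t`. -/
def evPi (d : ℕ) (m t : ℝ) : SR d × SR d →L[ℝ] SR d :=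
  (cR d m t).comp (.snd ℝ _ _) -
    (sR d m t).comp ((hR d m).comp (.fst ℝ _ _))

local notation "Ψ" => evPsi d m
local notation "Φ" => evPi d m

lemma evPsi_apply (t : ℝ) (z : 𝓩) :
    Ψ t z = γ t z.1 + σ t z.2 := rfl

lemma evPi_apply (t : ℝ) (z : 𝓩) :
    Φ t z = γ t z.2 - σ t (η z.1) := rfl

lemma sR_apply_eq (t : ℝ) (φ : SR d) (x : Space d) :
    σ t φ x = (kgS d m t (toC φ) x).re := rfl

lemma _root_.HasDerivAt.map {E F : Type*} [NormedAddCommGroup E] [NormedSpace ℝ E]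
    [NormedAddCommGroup F] [NormedSpace ℝ F] {f : ℝ → E} {f' : E} {t : ℝ} (h : HasDerivAt f f' t)
    (A : E →L[ℝ] F) : HasDerivAt (fun s => A (f s)) (A f') t :=
  A.hasFDerivAt.comp_hasDerivAt t h

lemma hasDerivAt_cR (hm : 0 < m) (φ : SR d) (x : Space d) (t : ℝ) :
    HasDerivAt (fun t => γ t φ x) (-(σ t (η φ) x)) t := by
  refine ((hasDerivAt_kgC hm (toC φ) x t).map Complex.reCLM).congr_deriv ?_
  rw [sR_apply_eq, toC_hR]
  simp

lemma hasDerivAt_sR (hm : 0 < m) (φ : SR d) (x : Space d) (t : ℝ) :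
    HasDerivAt (fun t => σ t φ x) (γ t φ x) t :=
  (hasDerivAt_kgS hm (toC φ) x t).map Complex.reCLM

lemma hR_cR (t : ℝ) (φ : SR d) : η (γ t φ) = γ t (η φ) := by
  apply toC_injective
  rw [toC_hR, toC_cR, toC_cR, toC_hR, kgH_kgC]

lemma hR_sR (t : ℝ) (φ : SR d) : η (σ t φ) = σ t (η φ) := by
  apply toC_injective
  rw [toC_hR, toC_sR, toC_sR, toC_hR, kgH_kgS]

lemma cR_neg (t : ℝ) (φ : SR d) : γ (-t) φ = γ t φ := by
  apply toC_injective; rw [toC_cR, toC_cR, kgC_neg]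

lemma sR_neg (t : ℝ) (φ : SR d) : σ (-t) φ = -σ t φ := by
  apply toC_injective; rw [map_neg, toC_sR, toC_sR, kgS_neg]

lemma cR_sR (t : ℝ) (φ : SR d) : γ t (σ t φ) = σ t (γ t φ) := by
  apply toC_injective; rw [toC_cR, toC_sR, toC_sR, toC_cR, kgC_kgS_comm]

lemma cR_cR_add (hm : 0 < m) (t : ℝ) (φ : SR d) :
    γ t (γ t φ) + σ t (σ t (η φ)) = φ := by
  apply toC_injective
  rw [map_add, toC_cR, toC_cR, toC_sR, toC_sR, toC_hR, kgC_kgC_add hm]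

lemma cR_zero (φ : SR d) : γ 0 φ = φ := by
  apply toC_injective
  rw [toC_cR, kgC, show cosSym d m 0 = fun _ => 1 by funext ξ; simp [cosSym]]
  simp

lemma sR_zero (φ : SR d) : σ 0 φ = 0 := by
  apply toC_injective
  rw [toC_sR, kgS, show sinSym d m 0 = fun _ => 0 by funext ξ; simp [sinSym]]
  simp

lemma evPsi_zero (z : 𝓩) : Ψ 0 z = z.1 := by
  rw [evPsi_apply, cR_zero, sR_zero, add_zero]

lemma evPi_zero (z : 𝓩) : Φ 0 z = z.2 := by
  rw [evPi_apply, cR_zero, sR_zero, sub_zero]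

lemma evPsi_neg_ev (hm : 0 < m) (t : ℝ) (z : 𝓩) :
    Ψ (-t) (Ψ t z, Φ t z) = z.1 := by
  simp only [evPsi_apply, evPi_apply, cR_neg, sR_neg, map_add, map_sub]
  rw [cR_sR]
  conv_rhs => rw [← cR_cR_add hm t z.1]
  abel

lemma evPi_neg_ev (hm : 0 < m) (t : ℝ) (z : 𝓩) :
    Φ (-t) (Ψ t z, Φ t z) = z.2 := by
  simp only [evPsi_apply, evPi_apply, cR_neg, sR_neg, map_add, map_sub, hR_cR, hR_sR]
  rw [cR_sR]
  conv_rhs => rw [← cR_cR_add hm t z.2]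
  abel

lemma hasDerivAt_evPsi (hm : 0 < m) (z : 𝓩) (x : Space d) (t : ℝ) :
    HasDerivAt (fun t => Ψ t z x) (Φ t z x) t := by
  have h := (hasDerivAt_cR hm z.1 x t).add (hasDerivAt_sR hm z.2 x t)
  refine h.congr_deriv ?_
  rw [evPi_apply, sub_apply]
  ring

lemma hasDerivAt_evPi (hm : 0 < m) (z : 𝓩) (x : Space d) (t : ℝ) :
    HasDerivAt (fun t => Φ t z x) (-(η (Ψ t z) x)) t := by
  have h := (hasDerivAt_cR hm z.2 x t).sub (hasDerivAt_sR hm (η z.1) x t)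
  refine h.congr_deriv ?_
  rw [evPsi_apply, map_add, add_apply, hR_cR, hR_sR]
  ring

lemma hR_evPsi (t : ℝ) (z : 𝓩) :
    η (Ψ t z) = Ψ t (η z.1, η z.2) := by
  rw [evPsi_apply, map_add, hR_cR, hR_sR, evPsi_apply]

lemma pdR_cR (j : Fin d) (t : ℝ) (φ : SR d) :
    pdR j (γ t φ) = γ t (pdR j φ) := by
  apply toC_injective
  rw [toC_pdR, toC_cR, toC_cR, toC_pdR, kgC, mult_pd (cosSym_growth t)]

lemma pdR_sR (j : Fin d) (t : ℝ) (φ : SR d) :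
    pdR j (σ t φ) = σ t (pdR j φ) := by
  apply toC_injective
  rw [toC_pdR, toC_sR, toC_sR, toC_pdR, kgS, mult_pd (sinSym_growth t)]

lemma pdR_hR (j : Fin d) (φ : SR d) : pdR j (η φ) = η (pdR j φ) := by
  apply toC_injective
  rw [toC_pdR, toC_hR, toC_hR, toC_pdR, kgH, mult_pd omgSqSym_growth]

lemma pdR_evPsi (j : Fin d) (t : ℝ) (z : 𝓩) :
    pdR j (Ψ t z) = Ψ t (pdR j z.1, pdR j z.2) := by
  rw [evPsi_apply, pdR_add, pdR_cR, pdR_sR, evPsi_apply]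

lemma pdR_evPi (j : Fin d) (t : ℝ) (z : 𝓩) :
    pdR j (Φ t z) = Φ t (pdR j z.1, pdR j z.2) := by
  rw [evPi_apply, pdR_sub, pdR_cR, pdR_sR, evPi_apply, pdR_hR]

lemma hR_apply (hm : 0 < m) (φ : SR d) (x : Space d) :
    η φ x = m ^ 2 * φ x - ∑ j, pdR j (pdR j φ) x := by
  have h := congrArg (fun f => f x) (toC_hR (m := m) φ)
  simp only [toC_apply] at h
  rw [kgH_apply hm, laplacian_eq_sum_pd] at h
  simp only [← toC_pdR, ← map_sum, sub_apply, smul_apply, toC_apply, smul_eq_mul] at h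
  rw [sum_apply] at h
  exact_mod_cast h

lemma exists_bound_cR (φ : SR d) : ∃ K : ℝ, ∀ t x, |γ t φ x| ≤ K := by
  refine ⟨_, fun t x => (Complex.abs_re_le_norm _).trans (norm_mult_apply_le (cosSym_growth t)
    (B := 1) (fun ξ => ?_) (toC φ) x)⟩
  rw [cosSym, Complex.norm_real]
  exact Real.abs_cos_le_one _

lemma exists_bound_sR (hm : 0 < m) (φ : SR d) : ∃ K : ℝ, ∀ t x, |σ t φ x| ≤ K := by
  refine ⟨_, fun t x => (Complex.abs_re_le_norm _).trans (norm_mult_apply_le (sinSym_growth t)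
    (B := m⁻¹) (fun ξ => ?_) (toC φ) x)⟩
  rw [sinSym, Complex.norm_real, norm_mul, norm_inv, Real.norm_of_nonneg (omg_pos hm ξ).le]
  calc _ ≤ 1 * (omg d m ξ)⁻¹ := by
        have := omg_pos hm ξ
        gcongr
        exact Real.abs_sin_le_one _
    _ ≤ _ := by rw [one_mul]; exact inv_anti₀ hm (le_omg hm ξ)

lemma exists_bound_evPsi (hm : 0 < m) (z : 𝓩) :
    ∃ K : ℝ, ∀ t x, |Ψ t z x| ≤ K := by
  obtain ⟨K1, h1⟩ := exists_bound_cR (m := m) z.1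
  obtain ⟨K2, h2⟩ := exists_bound_sR hm z.2
  exact ⟨K1 + K2, fun t x => (abs_add_le _ _).trans (add_le_add (h1 t x) (h2 t x))⟩

lemma exists_bound_evPi (hm : 0 < m) (z : 𝓩) :
    ∃ K : ℝ, ∀ t x, |Φ t z x| ≤ K := by
  obtain ⟨K1, h1⟩ := exists_bound_cR (m := m) z.2
  obtain ⟨K2, h2⟩ := exists_bound_sR hm (η z.1)
  exact ⟨K1 + K2, fun t x => (abs_sub _ _).trans (add_le_add (h1 t x) (h2 t x))⟩

/-! ### Weighted energies of Schwartz solutions -/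

lemma integrable_schwartz_mul (φ ψ : SR d) : Integrable fun x => φ x * ψ x :=
  (φ.memLp 2 volume).integrable_mul (ψ.memLp 2 volume)

/-- Differentiation under an integral with an integrable weight. -/
lemma hasDerivAt_integral_weight {g : Space d → ℝ} (hg : Integrable g) {a a' : ℝ → Space d → ℝ}
    (hc : ∀ t, Continuous (a t)) (hc' : ∀ t, Continuous (a' t))
    (hd : ∀ t x, HasDerivAt (fun t => a t x) (a' t x) t)
    (hK : ∃ K : ℝ, ∀ t x, |a t x| ≤ K) (hK' : ∃ K : ℝ, ∀ t x, |a' t x| ≤ K) (t : ℝ) :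
    HasDerivAt (fun t => ∫ x, g x * a t x) (∫ x, g x * a' t x) t := by
  obtain ⟨K, hK⟩ := hK
  obtain ⟨K', hK'⟩ := hK'
  have e {b : Space d → ℝ} {K : ℝ} (hb : Continuous b) (hle : ∀ x, |b x| ≤ K) :
      Integrable fun x => g x * b x := hg.mul_bdd hb.aestronglyMeasurable (ae_of_all _ hle)
  exact (hasDerivAt_integral_of_dominated_loc_of_deriv_le (s := Set.univ)
    (bound := fun x => |g x| * K') univ_mem
    (.of_forall fun t => (e (hc t) (hK t)).aestronglyMeasurable)
    (e (hc t) (hK t)) (e (hc' t) (hK' t)).aestronglyMeasurable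
    (ae_of_all _ fun x t _ => by
      rw [norm_mul]
      exact mul_le_mul_of_nonneg_left (hK' t x) (abs_nonneg _))
    (hg.norm.mul_const K') (ae_of_all _ fun x t _ => (hd t x).const_mul _)).2

lemma hasDerivAt_integral_weight_sq {g : Space d → ℝ} (hg : Integrable g)
    {a a' : ℝ → Space d → ℝ} (hc : ∀ t, Continuous (a t)) (hc' : ∀ t, Continuous (a' t))
    (hd : ∀ t x, HasDerivAt (fun t => a t x) (a' t x) t)
    (hK : ∃ K : ℝ, ∀ t x, |a t x| ≤ K) (hK' : ∃ K : ℝ, ∀ t x, |a' t x| ≤ K) (t : ℝ) :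
    HasDerivAt (fun t => ∫ x, g x * a t x ^ 2) (2 * ∫ x, g x * (a t x * a' t x)) t := by
  obtain ⟨K, hK⟩ := hK
  obtain ⟨K', hK'⟩ := hK'
  refine (hasDerivAt_integral_weight hg (fun t => (hc t).fun_pow 2)
    (fun t => continuous_const.mul ((hc t).mul (hc' t))) (a' := fun t x => 2 * (a t x * a' t x))
    (fun t x => ((hd t x).pow 2).congr_deriv (by ring)) ⟨K ^ 2, fun t x => ?_⟩
    ⟨2 * (K * K'), fun t x => ?_⟩ t).congr_deriv ?_
  · rw [abs_pow]; exact pow_le_pow_left₀ (abs_nonneg _) (hK t x) 2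
  · rw [abs_mul, abs_mul, abs_two]
    have := (abs_nonneg _).trans (hK t x)
    gcongr
    exacts [hK t x, hK' t x]
  · rw [← integral_const_mul]
    simp only [mul_left_comm]

/-- Integration by parts against a bounded weight. -/
lemma integral_weight_div {r : Space d → ℝ} (hr : ContDiff ℝ 1 r) {B : ℝ} (hB : ∀ x, |r x| ≤ B)
    (hB' : ∀ x, ‖fderiv ℝ r x‖ ≤ B) (j : Fin d) (φ ψ : SR d) :
    ∫ x, r x * (φ x * pdR j ψ x + pdR j φ x * ψ x) =
      -∫ x, fderiv ℝ r x (basisVec j) * (φ x * ψ x) := by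
  have hd x := (φ.hasFDerivAt x).fun_mul (ψ.hasFDerivAt x)
  have hval x : fderiv ℝ (fun x => φ x * ψ x) x (basisVec j) =
      φ x * pdR j ψ x + pdR j φ x * ψ x := by
    rw [(hd x).fderiv, pdR_apply, pdR_apply]
    simp [mul_comm]
  have hi := integrable_schwartz_mul (d := d)
  have hr' : Continuous fun x => fderiv ℝ r x (basisVec j) :=
    (hr.continuous_fderiv (by norm_num)).clm_apply continuous_const
  have hb' x : ‖fderiv ℝ r x (basisVec j)‖ ≤ B := by
    refine ((fderiv ℝ r x).le_opNorm _).trans ?_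
    rw [norm_basisVec, mul_one]; exact hB' x
  have hi2 : Integrable fun x => fderiv ℝ (fun x => φ x * ψ x) x (basisVec j) := by
    simp only [hval]
    exact (hi _ _).add (hi _ _)
  have hm := hr.continuous.aestronglyMeasurable (μ := volume)
  have h := integral_mul_fderiv_eq_neg_fderiv_mul_of_integrable (𝕜 := ℝ)
    ((hi φ ψ).bdd_mul hr'.aestronglyMeasurable (ae_of_all _ hb'))
    (hi2.bdd_mul hm (ae_of_all _ hB)) ((hi φ ψ).bdd_mul hm (ae_of_all _ hB))
    (fun x _ => hr.differentiable (by norm_num) x) (fun x _ => (hd x).differentiableAt)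
  simpa only [hval] using h

/-- The energy identity for Schwartz solutions of the Klein–Gordon equation, with a weight. -/
lemma hasDerivAt_energy (hm : 0 < m) {r : Space d → ℝ} (hri : Integrable r)
    (hr : ContDiff ℝ 1 r) {B : ℝ} (hB : ∀ x, |r x| ≤ B) (hB' : ∀ x, ‖fderiv ℝ r x‖ ≤ B)
    (z : 𝓩) (t : ℝ) :
    HasDerivAt (fun t => (∫ x, r x * Φ t z x ^ 2) +
        ∑ j, (∫ x, r x * pdR j (Ψ t z) x ^ 2) + m ^ 2 * ∫ x, r x * Ψ t z x ^ 2)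
      (-2 * ∑ j, ∫ x, fderiv ℝ r x (basisVec j) *
        (Φ t z x * pdR j (Ψ t z) x)) t := by
  have hs w := hasDerivAt_integral_weight_sq hri (fun t => (Ψ t w).continuous)
    (fun t => (Φ t w).continuous) (fun t x => hasDerivAt_evPsi hm w x t)
    (exists_bound_evPsi hm w) (exists_bound_evPi hm w) t
  have hp := hasDerivAt_integral_weight_sq hri (fun t => (Φ t z).continuous)
    (fun t => (η (Ψ t z)).continuous.neg) (fun t x => hasDerivAt_evPi hm z x t)
    (exists_bound_evPi hm z) (by
      simp only [hR_evPsi, Pi.neg_apply, abs_neg]; exact exists_bound_evPsi hm _) t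
  simp only [pdR_evPsi]
  refine ((hp.fun_add (.fun_sum fun j _ => hs _)).fun_add
    ((hs z).const_mul (m ^ 2))).congr_deriv ?_
  simp only [← pdR_evPsi, ← pdR_evPi]
  generalize Ψ t z = ψ
  generalize Φ t z = π
  have hi (a b : SR d) : Integrable fun x => r x * (a x * b x) :=
    (integrable_schwartz_mul a b).bdd_mul hr.continuous.aestronglyMeasurable (ae_of_all _ hB)
  have e : ∫ x, r x * (π x * -η ψ x) =
      (∑ j, ∫ x, r x * (π x * pdR j (pdR j ψ) x)) - m ^ 2 * ∫ x, r x * (ψ x * π x) := by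
    rw [← integral_finsetSum _ fun j _ => hi _ _, ← integral_const_mul, ← integral_sub
      (integrable_finsetSum _ fun j _ => hi _ _) ((hi _ _).const_mul _)]
    refine integral_congr_ae (ae_of_all _ fun x => ?_)
    simp only [hR_apply hm, ← Finset.mul_sum]
    ring
  have e2 j : -∫ x, fderiv ℝ r x (basisVec j) * (π x * pdR j ψ x) =
      (∫ x, r x * (π x * pdR j (pdR j ψ) x)) + ∫ x, r x * (pdR j ψ x * pdR j π x) := by
    rw [← integral_weight_div hr hB hB', ← integral_add (hi _ _) (hi _ _)]
    simp only [mul_add, mul_comm (pdR j π _)]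
  rw [neg_mul, ← mul_neg, ← Finset.sum_neg_distrib]
  simp only [e2, Pi.neg_apply, e, Finset.sum_add_distrib, ← Finset.mul_sum]
  ring

end kleinGordon

/-! ### Weights with a small parameter -/

section ratios

variable {d : ℕ} {α : ℝ}

lemma alpha_nonpos [hα : Fact (α < -(d : ℝ) / 2)] : α ≤ 0 := by
  have h := hα.out
  have : (0 : ℝ) ≤ d := by positivity
  linarith

/-- The small parameters. -/
abbrev Eps : Type := Set.Ioc (0 : ℝ) 1

lemma Eps.sq_le_one (ε : Eps) : (ε : ℝ) ^ 2 ≤ 1 := by nlinarith [ε.2.1, ε.2.2]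

/-- `⟨εx⟩^α ⟨x⟩^{-α}`. -/
def rat (α : ℝ) (ε : Eps) (x : Space d) : ℝ := wt ε α x * wt 1 (-α) x

/-- `∂_j ⟨εx⟩^α ⟨x⟩^{-α}`. -/
def drat (α : ℝ) (ε : Eps) (j : Fin d) (x : Space d) : ℝ :=
  fderiv ℝ (wt ε α : Space d → ℝ) x (basisVec j) * wt 1 (-α) x

lemma rat_pos (ε : Eps) (x : Space d) : 0 < rat α ε x := mul_pos (wt_pos _ _ _) (wt_pos _ _ _)

/-- The bound `ε^α`, as a nonnegative real. -/
def ratB (α : ℝ) (ε : Eps) : ℝ≥0 := (((ε : ℝ) ^ 2) ^ (α / 2)).toNNReal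

lemma rat_le [hα : Fact (α < -(d : ℝ) / 2)] (ε : Eps) (x : Space d) : |rat α ε x| ≤ ratB α ε := by
  rw [abs_of_pos (rat_pos ε x), rat, ratB, Real.coe_toNNReal _ (by positivity)]
  have h := wt_le_mul_wt_one (d := d) (alpha_nonpos (d := d) (α := α)) ε.2.1 ε.2.2 x
  calc _ ≤ (((ε : ℝ) ^ 2) ^ (α / 2) * wt 1 α x) * wt 1 (-α) x :=
        mul_le_mul_of_nonneg_right h (wt_pos _ _ _).le
    _ = _ := by rw [mul_assoc, wt_mul_wt_neg, mul_one]

lemma one_le_rat [hα : Fact (α < -(d : ℝ) / 2)] (ε : Eps) (x : Space d) : 1 ≤ rat α ε x := by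
  have h := wt_one_le (d := d) (alpha_nonpos (d := d) (α := α)) ε.sq_le_one x
  calc 1 = wt 1 α x * wt 1 (-α) x := by rw [wt_mul_wt_neg]
    _ ≤ _ := mul_le_mul_of_nonneg_right h (wt_pos _ _ _).le

lemma abs_fderiv_wt_le (ε : Eps) (j : Fin d) (x : Space d) :
    |fderiv ℝ (wt ε α : Space d → ℝ) x (basisVec j)| ≤ |α| * ε * wt ε α x := by
  have h := (fderiv ℝ (wt ε α : Space d → ℝ) x).le_opNorm (basisVec j)
  rw [norm_basisVec, mul_one] at h
  exact h.trans (norm_fderiv_wt_le ε.2.1.le α x)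

lemma abs_drat_le (ε : Eps) (j : Fin d) (x : Space d) :
    |drat α ε j x| ≤ |α| * ε * rat α ε x := by
  rw [drat, rat, abs_mul, abs_of_pos (wt_pos 1 (-α) x), ← mul_assoc]
  exact mul_le_mul_of_nonneg_right (abs_fderiv_wt_le ε j x) (wt_pos _ _ _).le

lemma drat_le [hα : Fact (α < -(d : ℝ) / 2)] (ε : Eps) (j : Fin d) (x : Space d) : |drat α ε j x| ≤ (|α|.toNNReal * ratB α ε : ℝ≥0) := by
  refine (abs_drat_le ε j x).trans ?_
  have h := rat_le (α := α) ε x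
  rw [abs_of_pos (rat_pos ε x)] at h
  have h0 := (rat_pos (α := α) ε x).le
  rw [NNReal.coe_mul, Real.coe_toNNReal _ (abs_nonneg _)]
  have h2 : |α| * (ε : ℝ) ≤ |α| := mul_le_of_le_one_right (abs_nonneg _) ε.2.2
  have := abs_nonneg α
  gcongr

lemma measurable_rat (ε : Eps) : Measurable (rat α ε : Space d → ℝ) :=
  (measurable_wt _ _).mul (measurable_wt _ _)

lemma measurable_drat (ε : Eps) (j : Fin d) : Measurable (drat α ε j : Space d → ℝ) :=
  (((contDiff_wt _ _).continuous_fderiv (by norm_num)).clm_apply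
    continuous_const).measurable.mul (measurable_wt _ _)

lemma coeFn_jPi (φ : SR d) : jPi α φ =ᵐ[volume] fun x => wt 1 α x * φ x := by
  filter_upwards [coeFn_sLp (wmulR α φ)] with x hx
  rw [jPi_apply, hx, wmulR_apply]

lemma norm_le_of_abs_le_ae {f g : L2 d} {C : ℝ}
    (h : ∀ᵐ x, |f x| ≤ C * |g x|) : ‖f‖ ≤ C * ‖g‖ :=
  Lp.norm_le_mul_norm_of_ae_le_mul h

lemma norm_sq_L2 (f : L2 d) : ‖f‖ ^ 2 = ∫ x, f x ^ 2 := by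
  rw [← real_inner_self_eq_norm_sq, inner_L2]
  refine integral_congr_ae (ae_of_all _ fun x => ?_)
  simp only; ring

variable [Fact (α < -(d : ℝ) / 2)]

/-- Multiplication by `⟨εx⟩^α ⟨x⟩^{-α}`. -/
def ratOp (d : ℕ) (α : ℝ) [Fact (α < -(d : ℝ) / 2)] (ε : Eps) : L2 d →L[ℝ] L2 d :=
  mulOp (rat α ε) (measurable_rat ε) (ratB α ε) (rat_le ε)

local notation "ρ" => ratOp d α

/-- Multiplication by `∂_j ⟨εx⟩^α ⟨x⟩^{-α}`. -/
def dratOp (d : ℕ) (α : ℝ) [Fact (α < -(d : ℝ) / 2)] (ε : Eps) (j : Fin d) : L2 d →L[ℝ] L2 d :=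
  mulOp (drat α ε j) (measurable_drat ε j) (|α|.toNNReal * ratB α ε) (drat_le ε j)

lemma coeFn_ratOp (ε : Eps) (f : L2 d) : ρ ε f =ᵐ[volume] fun x => rat α ε x * f x :=
  coeFn_mulOp _ _ _ _ f

lemma coeFn_dratOp (ε : Eps) (j : Fin d) (f : L2 d) :
    dratOp d α ε j f =ᵐ[volume] fun x => drat α ε j x * f x :=
  coeFn_mulOp _ _ _ _ f

lemma norm_le_ratOp (ε : Eps) (f : L2 d) : ‖f‖ ≤ ‖ρ ε f‖ := by
  have : ‖f‖ ≤ 1 * ‖ρ ε f‖ := by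
    refine norm_le_of_abs_le_ae ?_
    filter_upwards [coeFn_ratOp (α := α) ε f] with x hx
    rw [hx, abs_mul, one_mul, abs_of_pos (rat_pos ε x)]
    exact le_mul_of_one_le_left (abs_nonneg _) (one_le_rat ε x)
  rwa [one_mul] at this

lemma norm_dratOp_le (ε : Eps) (j : Fin d) (f : L2 d) :
    ‖dratOp d α ε j f‖ ≤ |α| * ε * ‖ρ ε f‖ := by
  refine norm_le_of_abs_le_ae ?_
  filter_upwards [coeFn_ratOp (α := α) ε f, coeFn_dratOp (α := α) ε j f] with x h1 h2
  rw [h1, h2, abs_mul, abs_mul, ← mul_assoc, abs_of_pos (rat_pos ε x)]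
  exact mul_le_mul_of_nonneg_right (abs_drat_le ε j x) (abs_nonneg _)

lemma coeFn_ratOp_jPi (ε : Eps) (φ : SR d) :
    ρ ε (jPi α φ) =ᵐ[volume] fun x => wt ε α x * φ x := by
  filter_upwards [coeFn_ratOp (α := α) ε (jPi α φ), coeFn_jPi (α := α) φ] with x h1 h2
  rw [h1, h2, rat, wt_neg]
  have := wt_ne_zero 1 α x
  field_simp

lemma coeFn_dratOp_jPi (ε : Eps) (j : Fin d) (φ : SR d) :
    dratOp d α ε j (jPi α φ) =ᵐ[volume] fun x =>
      fderiv ℝ (wt ε α : Space d → ℝ) x (basisVec j) * φ x := by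
  filter_upwards [coeFn_dratOp (α := α) ε j (jPi α φ), coeFn_jPi (α := α) φ] with x h1 h2
  rw [h1, h2, drat, wt_neg]
  have := wt_ne_zero 1 α x
  field_simp

lemma norm_sq_ratOp_jPi (ε : Eps) (φ : SR d) :
    ‖ρ ε (jPi α φ)‖ ^ 2 = ∫ x, wt ε α x ^ 2 * φ x ^ 2 := by
  rw [norm_sq_L2]
  refine integral_congr_ae ?_
  filter_upwards [coeFn_ratOp_jPi (α := α) ε φ] with x hx
  rw [hx]; ring

lemma inner_ratOp_dratOp_jPi (ε : Eps) (j : Fin d) (φ ψ : SR d) :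
    inner ℝ (ratOp d α ε (jPi α φ)) (dratOp d α ε j (jPi α ψ)) =
      ∫ x, wt ε α x * fderiv ℝ (wt ε α : Space d → ℝ) x (basisVec j) * (φ x * ψ x) := by
  rw [inner_L2]
  refine integral_congr_ae ?_
  filter_upwards [coeFn_ratOp_jPi (α := α) ε φ, coeFn_dratOp_jPi (α := α) ε j ψ] with x h1 h2
  rw [h1, h2]; ring

/-- The weighted field energy. -/
def fEn (d : ℕ) (α : ℝ) [Fact (α < -(d : ℝ) / 2)] (m : ℝ) (ε : Eps) (y : L2 d × L2 d) : ℝ :=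
  ‖ratOp d α ε y.2‖ ^ 2 + ∑ j, ‖ratOp d α ε (opD d α j y.1)‖ ^ 2 +
    m ^ 2 * ‖ratOp d α ε (opA d α y.1)‖ ^ 2

/-- The time derivative of the weighted field energy. -/
def fEnDot (d : ℕ) (α : ℝ) [Fact (α < -(d : ℝ) / 2)] (ε : Eps) (y : L2 d × L2 d) : ℝ :=
  -4 * ∑ j, inner ℝ (ratOp d α ε y.2) (dratOp d α ε j (opD d α j y.1))

lemma continuous_fEn (m : ℝ) (ε : Eps) : Continuous (fEn d α m ε) := by unfold fEn; fun_prop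

lemma continuous_fEnDot (ε : Eps) : Continuous (fEnDot d α ε) := by unfold fEnDot; fun_prop

lemma fEn_nonneg (m : ℝ) (ε : Eps) (y : L2 d × L2 d) : 0 ≤ fEn d α m ε y := by
  unfold fEn; positivity

lemma abs_fEnDot_le (m : ℝ) (ε : Eps) (y : L2 d × L2 d) :
    |fEnDot d α ε y| ≤ 2 * |α| * (d + 1) * ε * fEn d α m ε y := by
  have hj j : |inner ℝ (ρ ε y.2) (dratOp d α ε j (opD d α j y.1))| ≤
      |α| * ε * ((‖ρ ε y.2‖ ^ 2 + ‖ρ ε (opD d α j y.1)‖ ^ 2) / 2) := by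
    refine (abs_real_inner_le_norm _ _).trans ?_
    have h1 := mul_le_mul_of_nonneg_left (norm_dratOp_le (α := α) ε j (opD d α j y.1))
      (norm_nonneg (ρ ε y.2))
    have := mul_nonneg (abs_nonneg α) ε.2.1.le
    nlinarith [mul_nonneg this (sq_nonneg (‖ρ ε y.2‖ - ‖ρ ε (opD d α j y.1)‖))]
  have hs := (Finset.abs_sum_le_sum_abs _ _).trans (Finset.univ.sum_le_sum fun j _ => hj j)
  rw [← Finset.mul_sum, ← Finset.sum_div, Finset.sum_add_distrib, Finset.sum_const,
    Finset.card_univ, Fintype.card_fin, nsmul_eq_mul] at hs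
  have hS : 0 ≤ ∑ j, ‖ρ ε (opD d α j y.1)‖ ^ 2 := by positivity
  have hA : 0 ≤ m ^ 2 * ‖ρ ε (opA d α y.1)‖ ^ 2 := by positivity
  have hF : d * ‖ρ ε y.2‖ ^ 2 + ∑ j, ‖ρ ε (opD d α j y.1)‖ ^ 2 ≤ (d + 1) * fEn d α m ε y := by
    unfold fEn
    nlinarith [sq_nonneg ‖ρ ε y.2‖, mul_nonneg d.cast_nonneg hS, mul_nonneg d.cast_nonneg hA]
  have := mul_le_mul_of_nonneg_left hF (mul_nonneg (abs_nonneg α) ε.2.1.le)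
  rw [fEnDot, abs_mul, abs_neg, abs_of_nonneg (by norm_num : (0 : ℝ) ≤ 4)]
  linarith

end ratios

/-! ### The free group -/

section freeGroup

variable {d : ℕ} {α m : ℝ}

local notation "ρ" => ratOp d α
local notation "Aα" => opA d α
local notation "Dα" => opD d α

/-- The coordinates of a pair of Schwartz functions. -/
def jF (d : ℕ) (α : ℝ) : SR d × SR d →L[ℝ] L2 d × L2 d := (jPsi α).prodMap (jPi α)

lemma denseRange_jF : DenseRange (jF d α) := (denseRange_jPsi α).prodMap (denseRange_jPi α)

/-- The evolution of a pair of Schwartz functions. -/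
def ev (d : ℕ) (m t : ℝ) :
    SR d × SR d →L[ℝ] SR d × SR d :=
  (evPsi d m t).prod (evPi d m t)

/-- A function with `|n'| ≤ c n` grows at most exponentially. -/
lemma le_mul_exp_of_abs_deriv_le {n n' : ℝ → ℝ} {c : ℝ} (hd : ∀ t, HasDerivAt n (n' t) t)
    (hc : ∀ t, |n' t| ≤ c * n t) (t : ℝ) : n t ≤ n 0 * Real.exp (c * |t|) := by
  have key {p p' : ℝ → ℝ} (hp : ∀ t, HasDerivAt p (p' t) t) (hpc : ∀ t, |p' t| ≤ c * p t)
      (t : ℝ) (ht : 0 ≤ t) : p t ≤ p 0 * Real.exp (c * t) := by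
    have h1 s := (hp s).fun_mul ((hasDerivAt_id s).const_mul c).fun_neg.exp
    have h2 := antitone_of_deriv_nonpos (fun s => (h1 s).differentiableAt) (fun s => by
      rw [(h1 s).deriv]
      have := (le_abs_self _).trans (hpc s)
      have := Real.exp_pos (-(c * s))
      simp only [id]
      nlinarith) ht
    simp only [id, mul_zero, neg_zero, Real.exp_zero, mul_one] at h2
    rwa [Real.exp_neg, ← div_eq_mul_inv, div_le_iff₀ (Real.exp_pos _)] at h2
  rcases le_total 0 t with ht | ht
  · rw [abs_of_nonneg ht]; exact key hd hc t ht
  · have h := key (p := fun s => n (-s)) (p' := fun s => -n' (-s)) (fun s =>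
      ((hd (-s)).scomp s (hasDerivAt_neg s)).congr_deriv (by simp)) (fun s => by
        rw [abs_neg]; exact hc (-s)) (-t) (by linarith)
    simp only [neg_neg, neg_zero] at h
    rwa [abs_of_nonpos ht]

variable [hα : Fact (α < -(d : ℝ) / 2)]

lemma fEn_jF (ε : Eps) (z : SR d × SR d) :
    fEn d α m ε (jF d α z) = (∫ x, wt ε α x ^ 2 * z.2 x ^ 2) +
      ∑ j, (∫ x, wt ε α x ^ 2 * pdR j z.1 x ^ 2) + m ^ 2 * ∫ x, wt ε α x ^ 2 * z.1 x ^ 2 := by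
  simp [← norm_sq_ratOp_jPi, fEn, jF, opA_jPsi, opD_jPsi]

lemma integrable_wt_eps_sq (ε : Eps) : Integrable fun x : Space d => wt ε α x ^ 2 :=
  integrable_wt_sq hα.out ε.2.1 ε.2.2

lemma hasDerivAt_fEn_jF (hm : 0 < m) (ε : Eps) (z : SR d × SR d) (t : ℝ) : HasDerivAt
    (fun t => fEn d α m ε (jF d α (ev d m t z))) (fEnDot d α ε (jF d α (ev d m t z))) t := by
  have hw : (fun x : Space d => wt ε α x ^ 2) = wt ε (2 * α) := by
    funext x; rw [sq, wt_mul_wt, two_mul]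
  have h3 := wt_le_one (d := d) (a := 2 * α) (by linarith [alpha_nonpos (d := d) (α := α)]) ε
  have h := hasDerivAt_energy hm (integrable_wt_eps_sq (α := α) ε) (B := max 1 |2 * α|) ?_
    (fun x => ?_) (fun x => ?_) z t
  · simp only [fEn_jF]
    refine h.congr_deriv ?_
    have e : fEnDot d α ε (jF d α (ev d m t z)) = -4 * ∑ j, inner ℝ
      (ρ ε (jPi α (evPi d m t z))) (dratOp d α ε j (Dα j (jPsi α (evPsi d m t z)))) := rfl
    simp only [e, opD_jPsi, inner_ratOp_dratOp_jPi, Finset.mul_sum, ← integral_const_mul]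
    refine Finset.sum_congr rfl fun j _ => integral_congr_ae (ae_of_all _ fun x => ?_)
    simp only [((hasFDerivAt_wt ε α x).pow 2).fderiv, (hasFDerivAt_wt ε α x).fderiv]
    simp; ring
  · rw [hw]; exact (contDiff_wt _ _).of_le (by norm_num)
  · rw [abs_of_nonneg (sq_nonneg _), congrFun hw x]
    exact (h3 x).trans (le_max_left _ _)
  · rw [hw]
    refine (norm_fderiv_wt_le ε.2.1.le (2 * α) x).trans (le_trans ?_ (le_max_right _ _))
    rw [mul_assoc]
    exact mul_le_of_le_one_right (abs_nonneg _) (mul_le_one₀ ε.2.2 (wt_pos _ _ _).le (h3 x))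

lemma fEn_ev_le (hm : 0 < m) (ε : Eps) (z : SR d × SR d) (t : ℝ) :
    fEn d α m ε (jF d α (ev d m t z)) ≤
      fEn d α m ε (jF d α z) * Real.exp (2 * |α| * (d + 1) * ε * |t|) := by
  have h := le_mul_exp_of_abs_deriv_le (hasDerivAt_fEn_jF hm ε z)
    (fun t => abs_fEnDot_le (α := α) m ε (jF d α (ev d m t z))) t
  have h0 : ev d m 0 z = z := Prod.ext (evPsi_zero z) (evPi_zero z)
  rwa [h0] at h

lemma norm_sq_le_ratOp (ε : Eps) (f : L2 d) : ‖f‖ ^ 2 ≤ ‖ρ ε f‖ ^ 2 :=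
  pow_le_pow_left₀ (norm_nonneg _) (norm_le_ratOp ε f) 2

lemma norm_snd_sq_le_fEn (m : ℝ) (ε : Eps) (y : L2 d × L2 d) : ‖y.2‖ ^ 2 ≤ fEn d α m ε y := by
  refine (norm_sq_le_ratOp (α := α) ε y.2).trans ?_
  rw [fEn, add_assoc]
  exact le_add_of_nonneg_right (by positivity)

lemma norm_opA_opD_sq_le_fEn (hm : 0 < m) (ε : Eps) (y : L2 d × L2 d) :
    ‖Aα y.1‖ ^ 2 + ∑ j, ‖Dα j y.1‖ ^ 2 ≤ (1 + (m ^ 2)⁻¹) * fEn d α m ε y := by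
  have e2 : ∑ j, ‖Dα j y.1‖ ^ 2 ≤ ∑ j, ‖ρ ε (Dα j y.1)‖ ^ 2 :=
    Finset.sum_le_sum fun j _ => norm_sq_le_ratOp ε _
  rw [add_mul, one_mul, inv_mul_eq_div, add_comm]
  refine add_le_add (e2.trans ?_) ((le_div_iff₀' (by positivity)).2 ?_) <;> unfold fEn
  · linarith [sq_nonneg ‖ρ ε y.2‖, mul_nonneg (sq_nonneg m) (sq_nonneg ‖ρ ε (Aα y.1)‖)]
  · refine (mul_le_mul_of_nonneg_left (norm_sq_le_ratOp ε _) (sq_nonneg m)).trans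
      (le_add_of_nonneg_left (by positivity))

lemma exists_norm_fst_sq_le (d : ℕ) (α : ℝ) [Fact (α < -(d : ℝ) / 2)] : ∃ C : ℝ, 0 ≤ C ∧
    ∀ f : L2 d, ‖f‖ ^ 2 ≤ C * (‖opA d α f‖ ^ 2 + ∑ j, ‖opD d α j f‖ ^ 2) := by
  obtain ⟨C, hC⟩ := exists_norm_le_opA d α
  refine ⟨(C : ℝ) ^ 2 * (d + 1), by positivity, fun f => ?_⟩
  have h3 := sq_sum_le_card_mul_sum_sq (s := (Finset.univ : Finset (Option (Fin d))))
    (f := fun o => Option.elim o ‖opA d α f‖ fun j => ‖opD d α j f‖)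
  simp only [Fintype.sum_option, Option.elim, Finset.card_univ, Fintype.card_option,
    Fintype.card_fin, Nat.cast_add, Nat.cast_one] at h3
  calc ‖f‖ ^ 2 ≤ (C * (‖opA d α f‖ + ∑ j, ‖opD d α j f‖)) ^ 2 :=
        pow_le_pow_left₀ (norm_nonneg _) (hC f) 2
    _ = (C : ℝ) ^ 2 * (‖opA d α f‖ + ∑ j, ‖opD d α j f‖) ^ 2 := mul_pow _ _ _
    _ ≤ _ := by
        rw [mul_assoc]
        exact mul_le_mul_of_nonneg_left h3 (sq_nonneg _)

/-- The field energy controls the square of the norm. -/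
lemma exists_norm_sq_le_fEn (hm : 0 < m) : ∃ C : ℝ, 0 < C ∧ ∀ (ε : Eps) (y : L2 d × L2 d),
    ‖y‖ ^ 2 ≤ C * fEn d α m ε y := by
  obtain ⟨C, hC0, hC⟩ := exists_norm_fst_sq_le d α
  refine ⟨C * (1 + (m ^ 2)⁻¹) + 1, by positivity, fun ε y => ?_⟩
  have h0 := fEn_nonneg (α := α) m ε y
  have h2 := norm_snd_sq_le_fEn (α := α) m ε y
  have h1 : ‖y.1‖ ^ 2 ≤ C * ((1 + (m ^ 2)⁻¹) * fEn d α m ε y) :=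
    (hC y.1).trans (mul_le_mul_of_nonneg_left (norm_opA_opD_sq_le_fEn hm ε y) hC0)
  have h3 : 0 ≤ C * ((1 + (m ^ 2)⁻¹) * fEn d α m ε y) :=
    mul_nonneg hC0 (mul_nonneg (by positivity) h0)
  rw [Prod.norm_def]
  rcases max_cases ‖y.1‖ ‖y.2‖ with h | h
  · rw [h.1]; linarith
  · rw [h.1]; linarith

lemma exists_fEn_le_norm_sq (d : ℕ) (α m : ℝ) [Fact (α < -(d : ℝ) / 2)] (ε : Eps) :
    ∃ C : ℝ, 0 ≤ C ∧ ∀ y : L2 d × L2 d, fEn d α m ε y ≤ C * ‖y‖ ^ 2 := by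
  refine ⟨‖ratOp d α ε‖ ^ 2 + ∑ j, ‖(ratOp d α ε).comp (opD d α j)‖ ^ 2 +
    m ^ 2 * ‖(ratOp d α ε).comp (opA d α)‖ ^ 2, by positivity, fun y => ?_⟩
  have h1 : ‖y.1‖ ≤ ‖y‖ := norm_fst_le y
  have h2 : ‖y.2‖ ≤ ‖y‖ := norm_snd_le y
  have hb : ∀ (A : L2 d →L[ℝ] L2 d) (f : L2 d), ‖f‖ ≤ ‖y‖ → ‖A f‖ ^ 2 ≤ ‖A‖ ^ 2 * ‖y‖ ^ 2 := by
    intro A f hf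
    rw [← mul_pow]
    have := (A.le_opNorm f).trans (mul_le_mul_of_nonneg_left hf (norm_nonneg _))
    gcongr
  rw [add_mul, add_mul, Finset.sum_mul, mul_assoc, fEn]
  refine add_le_add (add_le_add (hb _ _ h2) (Finset.sum_le_sum fun j _ => ?_)) ?_
  · exact hb ((ratOp d α ε).comp (opD d α j)) _ h1
  · exact mul_le_mul_of_nonneg_left (hb ((ratOp d α ε).comp (opA d α)) _ h1) (sq_nonneg m)

end freeGroup

/-! ### Strongly continuous families of operators -/

section c0

variable {E S : Type*} [NormedAddCommGroup E] [NormedSpace ℝ E]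

/-- A strongly continuous, exponentially bounded family of operators with inverses `W (-t)`. -/
structure IsC0Family (W : ℝ → E →L[ℝ] E) : Prop where
  zero : ∀ y, W 0 y = y
  neg : ∀ t y, W (-t) (W t y) = y
  bound : ∃ M c : ℝ, 0 ≤ M ∧ 0 ≤ c ∧ ∀ t y, ‖W t y‖ ≤ M * Real.exp (c * |t|) * ‖y‖
  cont : Continuous fun p : ℝ × E => W p.1 p.2

namespace IsC0Family

variable {W : ℝ → E →L[ℝ] E}

lemma cont_comp (hW : IsC0Family W) {X : Type*} [TopologicalSpace X] {τ : X → ℝ} {y : X → E}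
    (hτ : Continuous τ) (hy : Continuous y) : Continuous fun x => W (τ x) (y x) :=
  hW.cont.comp (hτ.prodMk hy)

lemma abs_le_of_mem_uIoc {s t : ℝ} (hs : s ∈ Set.uIoc 0 t) : |s| ≤ |t| := by
  rcases Set.mem_uIoc.1 hs with h | h
  · rw [abs_of_pos h.1]; exact h.2.trans (le_abs_self _)
  · rw [abs_of_nonpos h.2]; exact (neg_le_neg h.1.le).trans (neg_le_abs _)

/-- A differential identity for the functional `φ` along the family extends from a dense set of
data to all data. -/
lemma hasDerivAt_of_dense (hW : IsC0Family W) {φ b : E → ℝ} (hφ : Continuous φ)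
    (hb : Continuous b) {C : ℝ} (hC : ∀ y, |b y| ≤ C * (1 + ‖y‖ ^ 2)) {j : S → E}
    (hj : DenseRange j)
    (h : ∀ (z : S) (t : ℝ), HasDerivAt (fun t => φ (W t (j z))) (b (W t (j z))) t)
    (y : E) (t : ℝ) : HasDerivAt (fun t => φ (W t y)) (b (W t y)) t := by
  have hbW : ∀ y, Continuous fun t => b (W t y) := fun y =>
    hb.comp (hW.cont_comp continuous_id continuous_const)
  obtain ⟨M, c, hM, hc, hbd⟩ := hW.bound
  have hC0 : 0 ≤ C := by simpa using (abs_nonneg _).trans (hC 0)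
  have key (t y) : φ (W t y) = φ y + ∫ s in (0 : ℝ)..t, b (W s y) := by
    have hcont : Continuous fun y => φ y + ∫ s in (0 : ℝ)..t, b (W s y) := by
      refine hφ.add (continuous_iff_continuousAt.2 fun y₀ => ?_)
      refine intervalIntegral.continuousAt_of_dominated_interval
        (bound := fun _ => C * (1 + (M * Real.exp (c * |t|) * (‖y₀‖ + 1)) ^ 2))
        (.of_forall fun y => (hbW y).aestronglyMeasurable) ?_
        intervalIntegrable_const (ae_of_all _ fun s _ => ?_)
      · filter_upwards [Metric.ball_mem_nhds y₀ one_pos] with y hy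
        refine ae_of_all _ fun s hs => (hC _).trans ?_
        have h1 : ‖y‖ ≤ ‖y₀‖ + 1 := by
          have := norm_sub_norm_le y y₀
          rw [mem_ball_iff_norm] at hy
          linarith
        have h2 := abs_le_of_mem_uIoc hs
        have h3 := (hbd s y).trans (show _ ≤ M * Real.exp (c * |t|) * (‖y₀‖ + 1) by gcongr)
        gcongr
      · exact (hb.comp (W s).continuous).continuousAt
    refine hj.induction_on y (isClosed_eq (hφ.comp (W t).continuous) hcont) fun z => ?_
    have h := intervalIntegral.integral_eq_sub_of_hasDerivAt (fun s _ => h z s)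
      ((hbW (j z)).intervalIntegrable 0 t)
    rw [h, hW.zero]
    ring
  exact (((hbW y).integral_hasStrictDerivAt 0 t).hasDerivAt.const_add (φ y)).congr_of_eventuallyEq
    (.of_forall fun s => key s y)

lemma continuous_of_dense {M c : ℝ} (hM : 0 ≤ M) (hc : 0 ≤ c)
    (hb : ∀ t y, ‖W t y‖ ≤ M * Real.exp (c * |t|) * ‖y‖) {j : S → E} (hj : DenseRange j)
    (h : ∀ z, Continuous fun t => W t (j z)) : Continuous fun p : ℝ × E => W p.1 p.2 := by
  refine continuous_iff_continuousAt.2 fun p =>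
    (continuousOn_prod_of_subset_closure_continuousOn_lipschitzOnWith' _
      (Set.subset_univ (Set.range j)) hj.closure_range.ge
      (M * Real.exp (c * (|p.1| + 1))).toNNReal (fun t ht => ?_) ?_).continuousAt
      (prod_mem_nhds (Metric.ball_mem_nhds p.1 one_pos) univ_mem)
  · refine (AddMonoidHomClass.lipschitz_of_bound (W t) _ fun y =>
      (hb t y).trans ?_).lipschitzOnWith
    have := abs_sub_abs_le_abs_sub t p.1
    have : |t| ≤ |p.1| + 1 := by linarith [Metric.mem_ball.1 ht, Real.dist_eq t p.1]
    gcongr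
  · rintro _ ⟨z, rfl⟩
    exact (h z).continuousOn

end IsC0Family

end c0

/-! ### The free group on the weighted space -/

section freeGroupOps

variable {d : ℕ} {α m : ℝ}

/-- The Klein–Gordon group. -/
def W0 (d : ℕ) (α m t : ℝ) : L2 d × L2 d →L[ℝ] L2 d × L2 d :=
  ((jF d α).comp (ev d m t)).toLinearMap.extendOfNorm (jF d α).toLinearMap

lemma ev_zero (z : SR d × SR d) : ev d m 0 z = z := Prod.ext (evPsi_zero z) (evPi_zero z)

lemma ev_neg_ev (hm : 0 < m) (t : ℝ) (z : SR d × SR d) :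
    ev d m (-t) (ev d m t z) = z :=
  Prod.ext (evPsi_neg_ev hm t z) (evPi_neg_ev hm t z)

/-- A family of Schwartz functions that is bounded and pointwise continuous in the parameter is
continuous in weighted `L²`. -/
lemma continuous_jPi_of_bound (hα : α < -(d : ℝ) / 2) {φ : ℝ → SR d} {K : ℝ}
    (hc : ∀ x, Continuous fun t => φ t x) (hK : ∀ t x, |φ t x| ≤ K) :
    Continuous fun t => jPi α (φ t) := by
  refine continuous_iff_continuousAt.2 fun t => ?_
  rw [ContinuousAt, tendsto_iff_norm_sub_tendsto_zero]
  have hn (ψ : SR d) : √(∫ x, wt 1 α x ^ 2 * ψ x ^ 2) = ‖jPi α ψ‖ := by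
    rw [← Real.sqrt_sq (norm_nonneg _), norm_sq_L2]
    congr 1
    refine integral_congr_ae ?_
    filter_upwards [coeFn_jPi (α := α) ψ] with x hx
    rw [hx]; ring
  have h := ((continuous_of_dominated (F := fun s x => wt 1 α x ^ 2 * (φ s - φ t) x ^ 2)
    (bound := fun x => wt 1 α x ^ 2 * (2 * K) ^ 2) (fun s => (((continuous_wt 1 α).pow 2).mul
      ((φ s - φ t).continuous.pow 2)).aestronglyMeasurable) (fun s => ae_of_all _ fun x => by
      rw [Real.norm_of_nonneg (by positivity), sub_apply]
      refine mul_le_mul_of_nonneg_left (sq_le_sq' ?_ ?_) (sq_nonneg _) <;>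
      linarith [abs_le.1 (hK s x), abs_le.1 (hK t x)]) ((integrable_wt_one_sq hα).mul_const _)
    (ae_of_all _ fun x => continuous_const.mul (((hc x).sub continuous_const).pow 2))).sqrt).tendsto t
  simpa only [hn, sub_self, map_zero, norm_zero, map_sub] using h

variable [hα : Fact (α < -(d : ℝ) / 2)]

/-- The growth rate of the free group. -/
lemma exists_norm_jF_ev_le (d : ℕ) (α : ℝ) [hα : Fact (α < -(d : ℝ) / 2)] (hm : 0 < m) :
    ∃ M c : ℝ, 0 ≤ M ∧ 0 ≤ c ∧ ∀ (t : ℝ) (z : SR d × SR d),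
      ‖jF d α (ev d m t z)‖ ≤ M * Real.exp (c * |t|) * ‖jF d α z‖ := by
  let ε : Eps := ⟨1, one_pos, le_rfl⟩
  obtain ⟨C, hC0, hC⟩ := exists_norm_sq_le_fEn (d := d) (α := α) hm
  obtain ⟨C', hC0', hC'⟩ := exists_fEn_le_norm_sq d α m ε
  refine ⟨Real.sqrt (C * C'), |α| * (d + 1), by positivity, by positivity, fun t z => ?_⟩
  refine abs_le_of_sq_le_sq' ?_ (by positivity) |>.2
  have h := fEn_ev_le (α := α) hm ε z t
  have h1 := hC ε (jF d α (ev d m t z))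
  have h2 := hC' (jF d α z)
  have he : Real.exp (2 * |α| * (d + 1) * ε * |t|) = Real.exp (|α| * (d + 1) * |t|) ^ 2 := by
    rw [← Real.exp_nat_mul]; congr 1
    change 2 * |α| * (d + 1) * 1 * |t| = _
    push_cast; ring
  rw [he] at h
  calc _ ≤ C * (C' * ‖jF d α z‖ ^ 2 * Real.exp (|α| * (d + 1) * |t|) ^ 2) :=
        h1.trans (mul_le_mul_of_nonneg_left (h.trans
          (mul_le_mul_of_nonneg_right h2 (sq_nonneg _))) hC0.le)
    _ = _ := by rw [mul_pow, mul_pow, Real.sq_sqrt (by positivity)]; ring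

lemma W0_jF (hm : 0 < m) (t : ℝ) (z : SR d × SR d) :
    W0 d α m t (jF d α z) = jF d α (ev d m t z) := by
  obtain ⟨M, c, -, -, h⟩ := exists_norm_jF_ev_le d α hm
  exact LinearMap.extendOfNorm_eq (f := ((jF d α).comp (ev d m t)).toLinearMap)
    (e := (jF d α).toLinearMap) denseRange_jF ⟨_, h t⟩ z

lemma exists_norm_W0_le (d : ℕ) (α : ℝ) [hα : Fact (α < -(d : ℝ) / 2)] (hm : 0 < m) :
    ∃ M c : ℝ, 0 ≤ M ∧ 0 ≤ c ∧ ∀ t y, ‖W0 d α m t y‖ ≤ M * Real.exp (c * |t|) * ‖y‖ := by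
  obtain ⟨M, c, hM, hc, h⟩ := exists_norm_jF_ev_le d α hm
  exact ⟨M, c, hM, hc, fun t y => LinearMap.norm_extendOfNorm_apply_le
    (f := ((jF d α).comp (ev d m t)).toLinearMap) (e := (jF d α).toLinearMap) denseRange_jF _
    (h t) y⟩

lemma W0_zero (hm : 0 < m) (y : L2 d × L2 d) : W0 d α m 0 y = y :=
  denseRange_jF.induction_on y (isClosed_eq (W0 d α m 0).continuous continuous_id) fun z => by
    rw [W0_jF hm, ev_zero]

lemma W0_neg_W0 (hm : 0 < m) (t : ℝ) (y : L2 d × L2 d) :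
    W0 d α m (-t) (W0 d α m t y) = y :=
  denseRange_jF.induction_on y (isClosed_eq (by fun_prop) continuous_id) fun z => by
    rw [W0_jF hm, W0_jF hm, ev_neg_ev hm]

lemma continuous_jF_ev (hm : 0 < m) (z : SR d × SR d) :
    Continuous fun t => jF d α (ev d m t z) := by
  have h1 (z : SR d × SR d) : Continuous fun t => jPi α (evPsi d m t z) := by
    obtain ⟨K, hK⟩ := exists_bound_evPsi hm z
    exact continuous_jPi_of_bound hα.out
      (fun x => continuous_iff_continuousAt.2 fun t => (hasDerivAt_evPsi hm z x t).continuousAt) hK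
  have h2 : Continuous fun t => jPi α (evPi d m t z) := by
    obtain ⟨K, hK⟩ := exists_bound_evPi hm z
    exact continuous_jPi_of_bound hα.out
      (fun x => continuous_iff_continuousAt.2 fun t => (hasDerivAt_evPi hm z x t).continuousAt) hK
  have h3 : Continuous fun t => jPsi α (evPsi d m t z) := by
    obtain ⟨C, hC⟩ := exists_norm_jPsi_le d α
    refine continuous_iff_continuousAt.2 fun t => ?_
    rw [ContinuousAt, tendsto_iff_norm_sub_tendsto_zero]
    have hA := tendsto_iff_norm_sub_tendsto_zero.1 ((h1 z).tendsto t)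
    have hD := fun j => tendsto_iff_norm_sub_tendsto_zero.1
      ((h1 (pdR j z.1, pdR j z.2)).tendsto t)
    have hlim := (hA.add (tendsto_finsetSum Finset.univ fun j _ => hD j)).const_mul (C : ℝ)
    simp only [Finset.sum_const_zero, add_zero, mul_zero] at hlim
    refine squeeze_zero (fun _ => norm_nonneg _) (fun s => ?_) hlim
    rw [← map_sub, ← map_sub]
    refine (hC _).trans (le_of_eq ?_)
    simp only [pdR_sub, pdR_evPsi, map_sub]
  exact h3.prodMk h2

/-- Strong continuity, jointly in time and datum. -/
lemma continuous_W0 (hm : 0 < m) :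
    Continuous fun p : ℝ × (L2 d × L2 d) => W0 d α m p.1 p.2 := by
  obtain ⟨M, c, hM, hc, hb⟩ := exists_norm_W0_le d α hm
  exact IsC0Family.continuous_of_dense hM hc hb (denseRange_jF (α := α)) fun z => by
    simpa only [W0_jF hm] using continuous_jF_ev hm z

lemma isC0Family_W0 (d : ℕ) (α : ℝ) [Fact (α < -(d : ℝ) / 2)] (hm : 0 < m) :
    IsC0Family (W0 d α m) :=
  ⟨W0_zero hm, W0_neg_W0 hm, exists_norm_W0_le d α hm, continuous_W0 hm⟩

/-- A differential identity for the functional `φ` along the free group extends from Schwartz data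
to all data. -/
lemma hasDerivAt_W0_of_jF (hm : 0 < m) {φ b : L2 d × L2 d → ℝ} (hφ : Continuous φ)
    (hb : Continuous b) {C : ℝ} (hC : ∀ y, |b y| ≤ C * (1 + ‖y‖ ^ 2))
    (hj : ∀ (z : SR d × SR d) (t : ℝ),
      HasDerivAt (fun t => φ (jF d α (ev d m t z))) (b (jF d α (ev d m t z))) t)
    (y : L2 d × L2 d) (t : ℝ) :
    HasDerivAt (fun t => φ (W0 d α m t y)) (b (W0 d α m t y)) t := by
  refine (isC0Family_W0 d α hm).hasDerivAt_of_dense hφ hb hC (denseRange_jF (α := α)) (fun z t => ?_) y t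
  simp only [W0_jF hm]
  exact hj z t

lemma hasDerivAt_fEn_W0 (hm : 0 < m) (ε : Eps) (y : L2 d × L2 d) (t : ℝ) :
    HasDerivAt (fun t => fEn d α m ε (W0 d α m t y)) (fEnDot d α ε (W0 d α m t y)) t := by
  obtain ⟨C, hC0, hC⟩ := exists_fEn_le_norm_sq d α m ε
  refine hasDerivAt_W0_of_jF hm (continuous_fEn m ε) (continuous_fEnDot ε)
    (C := 2 * |α| * (d + 1) * ε * C) (fun y => ?_) (hasDerivAt_fEn_jF hm ε) y t
  refine (abs_fEnDot_le m ε y).trans ?_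
  have hε := ε.2.1
  have h : fEn d α m ε y ≤ C * (1 + ‖y‖ ^ 2) :=
    (hC y).trans (mul_le_mul_of_nonneg_left (by linarith) hC0)
  rw [mul_assoc _ C]
  exact mul_le_mul_of_nonneg_left h (by positivity)

end freeGroupOps

/-! ### Bounded perturbations -/

namespace IsC0Family

variable {E : Type*} [NormedAddCommGroup E] [NormedSpace ℝ E] {W : ℝ → E →L[ℝ] E}

lemma neg' (hW : IsC0Family W) (t : ℝ) (y : E) : W t (W (-t) y) = y := by
  have h := hW.neg (-t) y
  rwa [neg_neg] at h

/-- The terms of the Dyson series. -/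
def dyson (W : ℝ → E →L[ℝ] E) (B : E →L[ℝ] E) (y : E) : ℕ → ℝ → E
  | 0 => fun _ => y
  | k + 1 => fun t => ∫ s in (0 : ℝ)..t, W (-s) (B (W s (dyson W B y k s)))

lemma exists_bound_conj (hW : IsC0Family W) (B : E →L[ℝ] E) (T : ℝ) : ∃ L : ℝ, 0 ≤ L ∧
    ∀ t y, |t| ≤ T → ‖W (-t) (B (W t y))‖ ≤ L * ‖y‖ := by
  obtain ⟨M, c, hM, hc, h⟩ := hW.bound
  refine ⟨M * Real.exp (c * T) * (‖B‖ * (M * Real.exp (c * T))), by positivity, fun t y ht => ?_⟩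
  have h0 : ∀ s z, |s| = |t| → ‖W s z‖ ≤ M * Real.exp (c * T) * ‖z‖ := fun s z hs =>
    (h s z).trans (by rw [hs]; gcongr)
  calc _ ≤ M * Real.exp (c * T) * ‖B (W t y)‖ := h0 _ _ (abs_neg t)
    _ ≤ M * Real.exp (c * T) * (‖B‖ * ‖W t y‖) := by gcongr; exact B.le_opNorm _
    _ ≤ M * Real.exp (c * T) * (‖B‖ * (M * Real.exp (c * T) * ‖y‖)) := by gcongr; exact h0 _ _ rfl
    _ = _ := by ring

lemma cont_conj (hW : IsC0Family W) (B : E →L[ℝ] E) {D : ℝ → E} (hD : Continuous D) :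
    Continuous fun s => W (-s) (B (W s (D s))) :=
  hW.cont_comp continuous_neg (B.continuous.comp (hW.cont_comp continuous_id hD))

lemma continuous_dyson [CompleteSpace E] (hW : IsC0Family W) (B : E →L[ℝ] E) (y : E) (k : ℕ) :
    Continuous (dyson W B y k) := by
  induction k with
  | zero => exact continuous_const
  | succ k ih =>
    exact intervalIntegral.continuous_primitive
      (fun a b => (hW.cont_conj B ih).intervalIntegrable a b) 0

lemma hasDerivAt_dyson [CompleteSpace E] (hW : IsC0Family W) (B : E →L[ℝ] E) (y : E) (k : ℕ)
    (t : ℝ) : HasDerivAt (dyson W B y (k + 1)) (W (-t) (B (W t (dyson W B y k t)))) t :=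
  ((hW.cont_conj B (hW.continuous_dyson B y k)).integral_hasStrictDerivAt 0 t).hasDerivAt

lemma norm_dyson_le {B : E →L[ℝ] E} {T L : ℝ} (hL0 : 0 ≤ L)
    (hL : ∀ t y, |t| ≤ T → ‖W (-t) (B (W t y))‖ ≤ L * ‖y‖) (y : E) (k : ℕ) (t : ℝ)
    (ht : |t| ≤ T) : ‖dyson W B y k t‖ ≤ L ^ k * |t| ^ k / k.factorial * ‖y‖ := by
  induction k generalizing t with
  | zero => simp [dyson]
  | succ k ih =>
    rw [dyson]
    have hInt : IntegrableOn (fun s => L * (L ^ k * |s - 0| ^ k / k.factorial * ‖y‖))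
        (Set.uIoc 0 t) := by
      refine (Continuous.integrableOn_Icc ?_).mono_set Set.uIoc_subset_uIcc
      fun_prop
    calc _ ≤ ∫ s in Set.uIoc 0 t, ‖W (-s) (B (W s (dyson W B y k s)))‖ :=
          intervalIntegral.norm_integral_le_integral_norm_uIoc
      _ ≤ ∫ s in Set.uIoc 0 t, L * (L ^ k * |s - 0| ^ k / k.factorial * ‖y‖) := by
          refine integral_mono_of_nonneg (ae_of_all _ fun _ => norm_nonneg _) hInt
            ((ae_restrict_iff' measurableSet_uIoc).2 (ae_of_all _ fun s hs => ?_))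
          have h1 := (abs_le_of_mem_uIoc hs).trans ht
          refine (hL s _ h1).trans ?_
          simp only [sub_zero]
          exact mul_le_mul_of_nonneg_left (ih s h1) hL0
      _ = (∫ s in Set.uIoc 0 t, |s - 0| ^ k) * (L * (L ^ k / k.factorial * ‖y‖)) := by
          rw [← integral_mul_const]
          refine integral_congr_ae (ae_of_all _ fun s => ?_)
          simp only; ring
      _ = _ := by
          rw [integral_pow_abs_sub_uIoc, sub_zero, Nat.factorial_succ]
          push_cast
          field_simp
          ring

/-- The sum of the Dyson series solves the equation in the interaction picture. -/
lemma exists_interaction [CompleteSpace E] (hW : IsC0Family W) (B : E →L[ℝ] E) (y : E) :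
    ∃ Z : ℝ → E, Z 0 = y ∧ ∀ t, HasDerivAt Z (W (-t) (B (W t (Z t)))) t := by
  have hsum : ∀ L T x : ℝ, Summable fun k : ℕ => L ^ k * T ^ k / k.factorial * x := fun L T x => by
    simpa only [mul_pow] using (Real.summable_pow_div_factorial (L * T)).mul_right x
  have hS : ∀ t, Summable fun k => dyson W B y k t := by
    intro t
    obtain ⟨L, hL0, hL⟩ := hW.exists_bound_conj B |t|
    exact Summable.of_norm_bounded (hsum L |t| ‖y‖) fun k => norm_dyson_le hL0 hL y k t le_rfl
  refine ⟨fun t => ∑' k, dyson W B y k t, ?_, fun t => ?_⟩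
  · refine (tsum_eq_single 0 fun k hk => ?_).trans rfl
    obtain ⟨k, rfl⟩ := Nat.exists_eq_succ_of_ne_zero hk
    simp [dyson]
  · obtain ⟨L, hL0, hL⟩ := hW.exists_bound_conj B (|t| + 1)
    have hb : ∀ s ∈ Metric.ball (0 : ℝ) (|t| + 1), |s| ≤ |t| + 1 := fun s hs => by
      rw [mem_ball_zero_iff] at hs; exact hs.le
    have h := hasDerivAt_tsum_of_isPreconnected (u := fun k : ℕ =>
        L * (L ^ k * (|t| + 1) ^ k / k.factorial * ‖y‖))
      (g := fun k => dyson W B y (k + 1)) (g' := fun k s => W (-s) (B (W s (dyson W B y k s))))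
      (t := Metric.ball (0 : ℝ) (|t| + 1)) (y₀ := 0) (y := t) ((hsum L (|t| + 1) ‖y‖).mul_left L)
      Metric.isOpen_ball (convex_ball _ _).isPreconnected
      (fun k s _ => hW.hasDerivAt_dyson B y k s)
      (fun k s hs => (hL s _ (hb s hs)).trans (mul_le_mul_of_nonneg_left
        ((norm_dyson_le hL0 hL y k s (hb s hs)).trans (by
          have := hb s hs
          gcongr)) hL0))
      (Metric.mem_ball_self (by positivity))
      (by simpa only [dyson] using (summable_nat_add_iff 1).2 (hS 0))
      (by rw [mem_ball_zero_iff, Real.norm_eq_abs]; linarith)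
    have e : ∀ s, ∑' k, dyson W B y k s = y + ∑' k, dyson W B y (k + 1) s := fun s =>
      (hS s).tsum_eq_zero_add
    have e2 : ∑' k, W (-t) (B (W t (dyson W B y k t))) =
        W (-t) (B (W t (∑' k, dyson W B y k t))) := by
      rw [(W t).map_tsum (hS t), B.map_tsum ((W t).summable (hS t)),
        (W (-t)).map_tsum (B.summable ((W t).summable (hS t)))]
    rw [e2] at h
    exact (h.const_add y).congr_of_eventuallyEq (.of_forall e)

lemma norm_le_of_interaction {B : E →L[ℝ] E} {T L : ℝ}
    (hL : ∀ t y, |t| ≤ T → ‖W (-t) (B (W t y))‖ ≤ L * ‖y‖) {Z : ℝ → E}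
    (hZ : ∀ t, HasDerivAt Z (W (-t) (B (W t (Z t)))) t) {t : ℝ} (ht : |t| ≤ T) :
    ‖Z t‖ ≤ ‖Z 0‖ * Real.exp (L * |t|) := by
  have key (D D' : ℝ → E) (hD : ∀ s, HasDerivAt D (D' s) s)
      (hD' : ∀ s, |s| ≤ T → ‖D' s‖ ≤ L * ‖D s‖) (s) (hs : 0 ≤ s) (hsT : s ≤ T) :
      ‖D s‖ ≤ ‖D 0‖ * Real.exp (L * s) := by
    have h := norm_le_gronwallBound_of_norm_deriv_right_le (a := 0) (ε := 0) (fun r _ => (hD r).continuousAt.continuousWithinAt)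
      (fun r _ => (hD r).hasDerivWithinAt) le_rfl (fun r hr => by
        rw [add_zero]
        refine hD' r ?_
        rw [abs_of_nonneg hr.1]; exact hr.2.le.trans hsT) s ⟨hs, le_rfl⟩
    rwa [gronwallBound_ε0, sub_zero] at h
  rcases le_total 0 t with h | h
  · rw [abs_of_nonneg h] at ht ⊢
    exact key Z _ hZ (fun s hs => hL s _ hs) t h ht
  · rw [abs_of_nonpos h] at ht ⊢
    have := key (fun s => Z (-s)) (fun s => -(W (-(-s)) (B (W (-s) (Z (-s)))))) (fun s =>
      ((hZ (-s)).scomp s (hasDerivAt_neg s)).congr_deriv (by simp))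
      (fun s hs => by rw [norm_neg]; exact hL _ _ (by rwa [abs_neg])) (-t) (by linarith) ht
    simpa using this

lemma interaction_unique (hW : IsC0Family W) (B : E →L[ℝ] E) {Z Z' : ℝ → E}
    (hZ : ∀ t, HasDerivAt Z (W (-t) (B (W t (Z t)))) t)
    (hZ' : ∀ t, HasDerivAt Z' (W (-t) (B (W t (Z' t)))) t) (h0 : Z 0 = Z' 0) : Z = Z' := by
  funext t
  obtain ⟨L, hL0, hL⟩ := hW.exists_bound_conj B |t|
  have h := norm_le_of_interaction hL (Z := fun t => Z t - Z' t) (fun t => by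
    simpa only [map_sub] using (hZ t).fun_sub (hZ' t)) le_rfl
  rw [h0, sub_self, norm_zero, zero_mul] at h
  exact sub_eq_zero.1 (norm_le_zero_iff.1 h)

/-- The perturbed family, and the uniqueness of its orbits. -/
theorem exists_perturbed [CompleteSpace E] (hW : IsC0Family W) (B : E →L[ℝ] E) :
    ∃ V : ℝ → E →L[ℝ] E, (∀ y, V 0 y = y) ∧ (∀ y, Continuous fun t => V t y) ∧
      (∀ y t, HasDerivAt (fun s => W (-s) (V s y)) (W (-t) (B (V t y))) t) ∧
      ∀ Y : ℝ → E, (∀ t, HasDerivAt (fun s => W (-s) (Y s)) (W (-t) (B (Y t))) t) →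
        ∀ t, Y t = V t (Y 0) := by
  choose Z hZ0 hZ using fun y => hW.exists_interaction B y
  have hadd : ∀ y y' t, Z (y + y') t = Z y t + Z y' t := fun y y' t =>
    congrFun (hW.interaction_unique B (Z := Z (y + y')) (Z' := fun t => Z y t + Z y' t) (hZ _)
      (fun t => by simpa only [map_add] using (hZ y t).fun_add (hZ y' t)) (by simp only [hZ0])) t
  have hsmul : ∀ (c : ℝ) y t, Z (c • y) t = c • Z y t := fun c y t =>
    congrFun (hW.interaction_unique B (Z := Z (c • y)) (Z' := fun t => c • Z y t) (hZ _)
      (fun t => by simpa only [map_smul] using (hZ y t).fun_const_smul c) (by simp only [hZ0])) t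
  choose L hL0 hL using fun T => hW.exists_bound_conj B T
  let ZL : ℝ → E →L[ℝ] E := fun t => LinearMap.mkContinuous
    { toFun := fun y => Z y t
      map_add' := fun y y' => hadd y y' t
      map_smul' := fun c y => hsmul c y t } (Real.exp (L |t| * |t|)) (fun y => by
        have h := norm_le_of_interaction (hL |t|) (hZ y) (t := t) le_rfl
        rwa [hZ0, mul_comm] at h)
  refine ⟨fun t => (W t).comp (ZL t), fun y => ?_, fun y => ?_, fun y t => ?_, fun Y hY t => ?_⟩
  · exact (hW.zero _).trans (hZ0 y)
  · exact hW.cont_comp continuous_id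
      (continuous_iff_continuousAt.2 fun t => (hZ y t).continuousAt)
  · exact (hZ y t).congr_of_eventuallyEq (.of_forall fun s => hW.neg s _)
  · have h := hW.interaction_unique B (Z := fun s => W (-s) (Y s)) (Z' := Z (Y 0))
      (fun t => by simpa only [hW.neg'] using hY t) (hZ _)
      (by simp only [neg_zero, hW.zero, hZ0])
    exact (hW.neg' _ _).symm.trans (congrArg (W t) (congrFun h t))

/-- Differentiation of a functional along an orbit of the perturbed family. -/
lemma hasDerivAt_perturbed (hW : IsC0Family W) {B : E →L[ℝ] E} {φ b : E → ℝ}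
    {φ' : E → E →L[ℝ] ℝ} (hφ : ∀ y, HasStrictFDerivAt φ (φ' y) y)
    (hb : ∀ y t, HasDerivAt (fun t => φ (W t y)) (b (W t y)) t) {Y : ℝ → E}
    (hY : ∀ t, HasDerivAt (fun s => W (-s) (Y s)) (W (-t) (B (Y t))) t) (t : ℝ) :
    HasDerivAt (fun t => φ (Y t)) (b (Y t) + φ' (Y t) (B (Y t))) t := by
  set Z : ℝ → E := fun s => W (-s) (Y s) with hZdef
  have hYZ : ∀ s, W s (Z s) = Y s := fun s => hW.neg' s _
  have hZc : Continuous Z := continuous_iff_continuousAt.2 fun t => (hY t).continuousAt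
  have hq : HasDerivAt (fun s => W s (Z s - Z t)) (B (Y t)) t := by
    rw [hasDerivAt_iff_tendsto_slope]
    have h1 := hasDerivAt_iff_tendsto_slope.1 (hY t)
    have h2 : Tendsto (fun s => W s (slope Z t s)) (𝓝[≠] t) (𝓝 (W t (W (-t) (B (Y t))))) :=
      (hW.cont.tendsto (t, W (-t) (B (Y t)))).comp
        ((tendsto_id.mono_left nhdsWithin_le_nhds).prodMk_nhds h1)
    rw [hW.neg'] at h2
    refine h2.congr fun s => ?_
    simp only [slope, vsub_eq_sub, sub_self, map_zero, sub_zero, map_smul]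
  have hsp : HasDerivAt (fun s => φ (W s (Z s)) - φ (W s (Z t))) (φ' (Y t) (B (Y t))) t := by
    have hlin := hq.map (φ' (Y t))
    have ht1 : Tendsto (fun s => (W s (Z s), W s (Z t))) (𝓝 t) (𝓝 (Y t, Y t)) := by
      simpa only [hYZ, id] using ((hW.cont_comp continuous_id hZc).prodMk
        (hW.cont_comp continuous_id (continuous_const (y := Z t)))).tendsto t
    have ho := (hφ (Y t)).isLittleO.comp_tendsto ht1
    have hO : (fun s => W s (Z s) - W s (Z t)) =O[𝓝 t] fun s => s - t := by
      simpa only [sub_self, map_zero, sub_zero, map_sub] using hq.isBigO_sub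
    rw [hasDerivAt_iff_isLittleO] at hlin ⊢
    refine ((ho.trans_isBigO hO).add hlin).congr_left fun s => ?_
    simp only [Function.comp_apply, sub_self, map_zero, map_sub, sub_zero]
    ring
  have h := (hb (Z t) t).add hsp
  rw [hYZ] at h
  refine h.congr_of_eventuallyEq (.of_forall fun s => ?_)
  simp only [Pi.add_apply, hYZ, add_sub_cancel]

/-- A weak solution, tested against a separating family of functionals, is a mild solution. -/
lemma hasDerivAt_of_weak [CompleteSpace E] (hW : IsC0Family W) {B : E →L[ℝ] E} {Y : ℝ → E}
    (hYc : Continuous Y) {I : Type*} {l l' : I → E →L[ℝ] ℝ}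
    (hsep : ∀ x, (∀ i, l i x = 0) → x = 0)
    (hl : ∀ i y s, HasDerivAt (fun s => l i (W s y)) (l' i (W s y)) s)
    (hw : ∀ i s t, HasDerivAt (fun t => l i (W s (Y t)))
      (l' i (W s (Y t)) + l i (W s (B (Y t)))) t) (t : ℝ) :
    HasDerivAt (fun s => W (-s) (Y s)) (W (-t) (B (Y t))) t := by
  have toSpan : Continuous fun x : ℝ => ContinuousLinearMap.toSpanSingleton ℝ x :=
    (ContinuousLinearMap.toSpanSingletonCLE (𝕜 := ℝ) (E := ℝ)).continuous
  have hcB : Continuous fun s => W (-s) (B (Y s)) :=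
    hW.cont_comp continuous_neg (B.continuous.comp hYc)
  have hF i t : HasDerivAt (fun s => l i (W (-s) (Y s))) (l i (W (-t) (B (Y t)))) t := by
    have h := hasStrictFDerivAt_uncurry_coprod (u := (t, t)) (f := fun s r => l i (W (-s) (Y r)))
      (f₁ := fun s r => .toSpanSingleton ℝ (-l' i (W (-s) (Y r))))
      (f₂ := fun s r => .toSpanSingleton ℝ (l' i (W (-s) (Y r)) + l i (W (-s) (B (Y r)))))
      (.of_forall fun p => ((hl i (Y p.2) (-p.1)).scomp p.1 (hasDerivAt_neg p.1)).congr_deriv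
        (by simp)) (.of_forall fun p => hw i (-p.1) p.2)
      (toSpan.comp ((l' i).continuous.comp
        (hW.cont_comp continuous_fst.neg (hYc.comp continuous_snd))).neg).continuousAt
      (toSpan.comp (((l' i).continuous.comp (hW.cont_comp continuous_fst.neg
        (hYc.comp continuous_snd))).add ((l i).continuous.comp (hW.cont_comp continuous_fst.neg
          (B.continuous.comp (hYc.comp continuous_snd)))))).continuousAt
    refine (h.hasFDerivAt.comp_hasDerivAt (f := fun s => (s, s)) t
      ((hasDerivAt_id t).prodMk (hasDerivAt_id t))).congr_deriv ?_
    simp [Function.HasUncurry.uncurry]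
  have key t : W (-t) (Y t) = Y 0 + ∫ s in (0 : ℝ)..t, W (-s) (B (Y s)) := by
    refine sub_eq_zero.1 (hsep _ fun i => ?_)
    have h := intervalIntegral.integral_eq_sub_of_hasDerivAt (fun s _ => hF i s)
      (((l i).continuous.comp hcB).intervalIntegrable 0 t)
    rw [(l i).intervalIntegral_comp_comm (hcB.intervalIntegrable 0 t), neg_zero, hW.zero] at h
    rw [map_sub, map_add, h]
    ring
  exact ((hcB.integral_hasStrictDerivAt 0 t).hasDerivAt.const_add (Y 0)).congr_of_eventuallyEq
    (.of_forall key)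

end IsC0Family

/-! ### The unit cell -/

section cells

variable {d : ℕ}

/-- The half-open unit cell. -/
def cellO (d : ℕ) : Set (Space d) := {y | ∀ i, y i ∈ Set.Ico (0 : ℝ) 1}

lemma measurable_coord (i : Fin d) : Measurable fun y : Space d => y i := by fun_prop

lemma preimage_ofLp_cellO :
    (WithLp.ofLp (p := 2)) ⁻¹' (Set.univ.pi fun _ : Fin d => Set.Ico (0 : ℝ) 1) = cellO d := by
  ext y; simp [cellO]

lemma measurableSet_cellO : MeasurableSet (cellO d) := by
  rw [← preimage_ofLp_cellO]
  exact (PiLp.volume_preserving_ofLp (Fin d)).measurable (.univ_pi fun _ => measurableSet_Ico)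

lemma latPt_apply (k : Lat d) (i : Fin d) : latPt k i = k i := rfl

/-- The translate of the cell by a lattice vector. -/
def cellAt (k : Lat d) : Set (Space d) := {x | x - latPt k ∈ cellO d}

lemma measurableSet_cellAt (k : Lat d) : MeasurableSet (cellAt k) :=
  (measurable_id.sub_const (latPt k)) measurableSet_cellO

lemma mem_cellAt {k : Lat d} {x : Space d} : x ∈ cellAt k ↔ ∀ i, k i = ⌊x i⌋ := by
  simp only [cellAt, cellO, Set.mem_ofPred_eq, PiLp.sub_apply, latPt_apply, Set.mem_Ico]
  refine forall_congr' fun i => ?_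
  rw [eq_comm, Int.floor_eq_iff]
  constructor <;> rintro ⟨h1, h2⟩ <;> constructor <;> linarith

lemma pairwise_disjoint_cellAt : Pairwise (Function.onFun Disjoint (cellAt (d := d))) := by
  intro k l hkl
  refine Set.disjoint_left.2 fun x hk hl => hkl (funext fun i => ?_)
  rw [mem_cellAt.1 hk i, mem_cellAt.1 hl i]

lemma iUnion_cellAt : ⋃ k : Lat d, cellAt k = Set.univ :=
  Set.eq_univ_of_forall fun x => Set.mem_iUnion.2 ⟨fun i => ⌊x i⌋, mem_cellAt.2 fun _ => rfl⟩

lemma restrict_cellAt (k : Lat d) : (volume : Measure (Space d)).restrict (cellAt k) =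
    (volume.restrict (cellO d)).map (MeasurableEquiv.addRight (latPt k)) := by
  have h := (measurePreserving_add_right (volume : Measure (Space d)) (latPt k)).restrict_preimage
    (measurableSet_cellAt k)
  have e : (· + latPt k) ⁻¹' cellAt k = cellO d := by ext; simp [cellAt]
  rw [e] at h
  exact h.map_eq.symm

lemma lintegral_eq_tsum_cell (f : Space d → ℝ≥0∞) :
    ∫⁻ x, f x = ∑' k : Lat d, ∫⁻ y in cellO d, f (y + latPt k) := by
  rw [← setLIntegral_univ, ← iUnion_cellAt, lintegral_iUnion measurableSet_cellAt
    pairwise_disjoint_cellAt]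
  simp only [restrict_cellAt, lintegral_map_equiv]
  rfl

lemma hasSum_integral_cell {F : Type*} [NormedAddCommGroup F] [NormedSpace ℝ F] {f : Space d → F}
    (hf : Integrable f) :
    HasSum (fun k : Lat d => ∫ y in cellO d, f (y + latPt k)) (∫ x, f x) := by
  have h := hasSum_integral_iUnion (f := f) (measurableSet_cellAt (d := d))
    pairwise_disjoint_cellAt hf.integrableOn
  simp only [iUnion_cellAt, setIntegral_univ, restrict_cellAt, integral_map_equiv] at h
  exact h

lemma cell_ae_eq_cellO : cell d =ᵐ[volume] cellO d := by
  have h2 := (PiLp.volume_preserving_ofLp (Fin d)).quasiMeasurePreserving.preimage_ae_eq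
    (Measure.univ_pi_Ico_ae_eq_Icc (f := fun _ => (0 : ℝ)) (g := fun _ => 1))
  rw [preimage_ofLp_cellO] at h2
  have e : (WithLp.ofLp (p := 2)) ⁻¹' (Set.Icc (fun _ : Fin d => (0 : ℝ)) fun _ => 1) = cell d := by
    ext y; simp [cell, Pi.le_def, forall_and]
  exact (e ▸ h2).symm

lemma volume_cellO : volume (cellO d) = 1 := by
  rw [← preimage_ofLp_cellO, (PiLp.volume_preserving_ofLp (Fin d)).measure_preimage
    (MeasurableSet.univ_pi fun _ => measurableSet_Ico).nullMeasurableSet, Real.volume_pi_Ico]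
  simp

lemma norm_le_of_mem_cellO {y : Space d} (hy : y ∈ cellO d) : ‖y‖ ≤ d := by
  rw [EuclideanSpace.norm_eq]
  have h : ∑ i, ‖y i‖ ^ 2 ≤ d := by
    refine (Finset.sum_le_card_nsmul _ _ 1 fun i _ => ?_).trans (by simp)
    rw [Real.norm_of_nonneg (hy i).1]
    nlinarith [(hy i).1, (hy i).2]
  refine Real.sqrt_le_iff.2 ⟨by positivity, h.trans ?_⟩
  rcases Nat.eq_zero_or_pos d with h0 | h0
  · subst h0; simp
  · have : (1 : ℝ) ≤ d := by exact_mod_cast h0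
    nlinarith

end cells

/-! ### Lattice kernels -/

section latticeKernels

variable {d n : ℕ}

lemma enorm_sq_eq {E : Type*} [NormedAddCommGroup E] (x : E) :
    ‖x‖ₑ ^ 2 = ENNReal.ofReal (‖x‖ ^ 2) := by
  rw [ENNReal.ofReal_pow (norm_nonneg _), ofReal_norm]

lemma enorm_ell2_sq (u : Ell2 d n) : ‖u‖ₑ ^ 2 = ∑' k, ‖u k‖ₑ ^ 2 := by
  rw [enorm_sq_eq, ell2_norm_sq, ENNReal.ofReal_tsum_of_nonneg (fun _ => by positivity) (ell2_summable u)]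
  simp only [enorm_sq_eq]

/-- A kernel satisfying the Schur test between the lattice and the space. -/
structure LatKer (κ : Space d → Lat d → Vec n) (C : ℝ≥0) : Prop where
  meas : ∀ k, Measurable fun x => κ x k
  row : ∀ x, ∑' k, ‖κ x k‖ₑ ≤ C
  col : ∀ k, ∫⁻ x, ‖κ x k‖ₑ ≤ C

namespace LatKer

variable {κ κ' : Space d → Lat d → Vec n} {C C' : ℝ≥0}

lemma summable_norm (h : LatKer κ C) (x : Space d) : Summable fun k => ‖κ x k‖ := by
  simpa using ENNReal.summable_toReal ((h.row x).trans_lt ENNReal.coe_lt_top).ne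

lemma summable (h : LatKer κ C) (u : Ell2 d n) (x : Space d) :
    Summable fun k => inner ℝ (κ x k) (u k) := by
  refine Summable.of_norm_bounded ((h.summable_norm x).mul_right ‖u‖) fun k => ?_
  exact (norm_inner_le_norm _ _).trans
    (mul_le_mul_of_nonneg_left (lp.norm_apply_le_norm (by norm_num) u k) (norm_nonneg _))

/-- The function `x ↦ ∑_k κ(x,k) · u(k)`. -/
def fn (κ : Space d → Lat d → Vec n) (u : Ell2 d n) (x : Space d) : ℝ := ∑' k, inner ℝ (κ x k) (u k)

lemma measurable_fn (h : LatKer κ C) (u : Ell2 d n) : Measurable (fn κ u) := by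
  refine measurable_of_tendsto_metrizable' (Filter.atTop : Filter (Finset (Lat d)))
    (f := fun s x => ∑ k ∈ s, inner ℝ (κ x k) (u k))
    (fun s => Finset.measurable_sum s fun k _ => (h.meas k).inner measurable_const) ?_
  exact tendsto_pi_nhds.2 fun x => (h.summable u x).hasSum

lemma lintegral_fn_le (h : LatKer κ C) (u : Ell2 d n) :
    ∫⁻ x, ‖fn κ u x‖ₑ ^ 2 ≤ (C : ℝ≥0∞) ^ 2 * ‖u‖ₑ ^ 2 := by
  have hm : Measurable (Function.uncurry fun (x : Space d) (k : Lat d) => ‖κ x k‖ₑ) :=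
    measurable_from_prod_countable_left fun k => (h.meas k).enorm
  have hs := lintegral_schur (μ := (volume : Measure (Space d))) (ν := Measure.count) hm
    (f := fun k => ‖u k‖ₑ) (measurable_of_countable _) (A := C) (B := C)
    (ae_of_all _ fun x => by rw [lintegral_count]; exact h.row x) (ae_of_all _ h.col)
  simp only [lintegral_count] at hs
  rw [← enorm_ell2_sq, ← sq] at hs
  refine le_trans (lintegral_mono fun x => ?_) hs
  refine pow_le_pow_left' ?_ 2
  refine enorm_tsum_le_tsum_enorm.trans (ENNReal.tsum_le_tsum fun k => ?_)
  rw [← enorm_norm (κ x k), ← enorm_norm (u k), ← enorm_mul]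
  exact enorm_le_iff_norm_le.2 (by
    rw [norm_mul, norm_norm, norm_norm]; exact norm_inner_le_norm _ _)

lemma memLp_fn (h : LatKer κ C) (u : Ell2 d n) : MemLp (fn κ u) 2 :=
  memLp_two_of_lintegral_lt_top (h.measurable_fn u).aestronglyMeasurable
    ((h.lintegral_fn_le u).trans_lt (ENNReal.mul_lt_top
      (ENNReal.pow_lt_top ENNReal.coe_lt_top) (ENNReal.pow_lt_top enorm_lt_top)))

/-- The operator with kernel `κ`. -/
def op (h : LatKer κ C) : Ell2 d n →L[ℝ] L2 d :=
  LinearMap.mkContinuous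
    { toFun := fun u => (h.memLp_fn u).toLp _
      map_add' := fun u v => by
        rw [← MemLp.toLp_add]
        congr 1
        funext x
        simp only [fn, Pi.add_apply, lp.coeFn_add, inner_add_right]
        exact (h.summable u x).tsum_add (h.summable v x)
      map_smul' := fun c u => by
        rw [RingHom.id_apply, ← MemLp.toLp_const_smul]
        congr 1
        funext x
        simp only [fn, Pi.smul_apply, lp.coeFn_smul, inner_smul_right, smul_eq_mul]
        exact tsum_mul_left }
    C (fun u => by
      refine norm_le_of_enorm_sq_le ?_
      rw [enorm_sq_Lp_two]
      refine le_trans (le_of_eq (lintegral_congr_ae ?_)) (h.lintegral_fn_le u)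
      filter_upwards [MemLp.coeFn_toLp (h.memLp_fn u)] with x hx
      exact congrArg (fun r => ‖r‖ₑ ^ 2) hx)

lemma coeFn_op (h : LatKer κ C) (u : Ell2 d n) : h.op u =ᵐ[volume] fn κ u :=
  MemLp.coeFn_toLp (h.memLp_fn u)

end LatKer

/-- The operator with kernel `κ`, or `0` if the Schur test fails. -/
def latOp (κ : Space d → Lat d → Vec n) : Ell2 d n →L[ℝ] L2 d :=
  open scoped Classical in if h : ∃ C, LatKer κ C then h.choose_spec.op else 0

section

variable {κ κ' : Space d → Lat d → Vec n} {C C' : ℝ≥0}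

lemma latOp_eq (h : LatKer κ C) : latOp κ = h.op := by
  have h' : ∃ C, LatKer κ C := ⟨C, h⟩
  rw [latOp, dif_pos h']
  ext1 u
  ext1
  filter_upwards [h'.choose_spec.coeFn_op u, h.coeFn_op u] with x h1 h2
  rw [h1, h2]

lemma coeFn_latOp (h : LatKer κ C) (u : Ell2 d n) :
    latOp κ u =ᵐ[volume] fun x => ∑' k, inner ℝ (κ x k) (u k) := by
  rw [latOp_eq h]; exact h.coeFn_op u

lemma norm_latOp_sub_le (h : LatKer κ C) (h' : LatKer κ' C') {K : ℝ≥0}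
    (hK : LatKer (fun x k => κ x k - κ' x k) K) : ‖latOp κ - latOp κ'‖ ≤ K := by
  have e : latOp κ - latOp κ' = hK.op := by
    ext1 u
    ext1
    filter_upwards [Lp.coeFn_sub (latOp κ u) (latOp κ' u), coeFn_latOp h u, coeFn_latOp h' u,
      hK.coeFn_op u] with x h1 h2 h3 h4
    rw [sub_apply, h1, Pi.sub_apply, h2, h3, h4, ← (h.summable u x).tsum_sub (h'.summable u x)]
    simp only [LatKer.fn, inner_sub_left]
  rw [e, LatKer.op]
  exact LinearMap.mkContinuous_norm_le _ K.2 _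

lemma adjoint_latOp_apply (h : LatKer κ C) (f : L2 d) (k : Lat d) :
    (latOp κ).adjoint f k = ∫ x, f x • κ x k := by
  have hκ2 : MemLp (fun x => κ x k) 2 := by
    refine memLp_two_of_lintegral_lt_top (h.meas k).aestronglyMeasurable ?_
    refine (lintegral_mono (g := fun x => C * ‖κ x k‖ₑ) fun x => ?_).trans_lt ?_
    · rw [sq]
      exact mul_le_mul_left ((ENNReal.le_tsum (f := fun k => ‖κ x k‖ₑ) k).trans (h.row x)) _
    · rw [lintegral_const_mul _ (h.meas k).enorm]
      exact ENNReal.mul_lt_top ENNReal.coe_lt_top ((h.col k).trans_lt ENNReal.coe_lt_top)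
  have hi : Integrable fun x => f x • κ x k := by
    refine ((Lp.memLp f).integrable_mul hκ2.norm).norm.mono' ((Lp.aestronglyMeasurable f).smul
      (h.meas k).aestronglyMeasurable) (ae_of_all _ fun x => ?_)
    rw [norm_smul, Pi.mul_apply, norm_mul, norm_norm]
  refine ext_inner_right ℝ fun e => ?_
  have h1 : inner ℝ ((latOp κ).adjoint f k) e = inner ℝ ((latOp κ).adjoint f) (lp.single 2 k e) :=
    (lp.inner_single_right (𝕜 := ℝ) k e ((latOp κ).adjoint f)).symm
  rw [h1, ContinuousLinearMap.adjoint_inner_left, inner_L2, real_inner_comm, ← integral_inner hi]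
  refine integral_congr_ae ?_
  filter_upwards [coeFn_latOp h (lp.single 2 k e)] with x hx
  rw [hx, tsum_eq_single k fun l hl => by
    rw [lp.single_apply_ne _ _ _ hl, inner_zero_right], lp.single_apply_self, inner_smul_right, real_inner_comm]

end

end latticeKernels

/-! ### The weighted couplings -/

section coefficients

variable {d n : ℕ}

/-- The quotient `⟨εx⟩^a / ⟨εy⟩^a`. -/
def cf (ε : Eps) (a : ℝ) (x y : Space d) : ℝ := wt ε a x * wt ε (-a) y

lemma cf_pos (ε : Eps) (a : ℝ) (x y : Space d) : 0 < cf ε a x y :=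
  mul_pos (wt_pos _ _ _) (wt_pos _ _ _)

lemma cf_zero (ε : Eps) (x y : Space d) : cf ε 0 x y = 1 := by
  rw [cf, neg_zero, wt_zero, wt_zero, one_mul]

lemma cf_le (ε : Eps) (a : ℝ) (x y : Space d) : cf ε a x y ≤ peetre a (x - y) := by
  have h := wt_le_peetre_mul ε.sq_le_one a x y
  calc cf ε a x y ≤ peetre a (x - y) * wt ε a y * wt ε (-a) y :=
        mul_le_mul_of_nonneg_right h (wt_pos _ _ _).le
    _ = _ := by rw [mul_assoc, wt_mul_wt_neg, mul_one]

lemma abs_cf_sub_one_le (ε : Eps) (a : ℝ) (x y : Space d) :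
    |cf ε a x y - 1| ≤ |a| * ε * ‖x - y‖ * peetre a (x - y) := by
  have h := abs_wt_sub_le ε.2.1.le ε.2.2 a x y
  have e : cf ε a x y - 1 = (wt ε a x - wt ε a y) * wt ε (-a) y := by
    rw [sub_mul, wt_mul_wt_neg, cf]
  rw [e, abs_mul, abs_of_pos (wt_pos ε (-a) y)]
  calc _ ≤ |a| * ε * ‖x - y‖ * peetre a (x - y) * wt ε a y * wt ε (-a) y :=
        mul_le_mul_of_nonneg_right h (wt_pos _ _ _).le
    _ = _ := by rw [mul_assoc _ (wt _ _ _), wt_mul_wt_neg, mul_one]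

lemma peetre_eq_wt (a : ℝ) (z : Space d) : peetre a z = 2 ^ (|a| / 2) * wt 1 |a| z := by
  rw [peetre, wt, Real.mul_rpow (by norm_num) (by positivity), one_pow, one_mul]

lemma norm_le_wt_one (z : Space d) : ‖z‖ ≤ wt 1 1 z := by
  rw [wt, one_pow, one_mul, ← Real.sqrt_eq_rpow]
  exact Real.le_sqrt_of_sq_le (by linarith)

lemma wt_one_mono {a b : ℝ} (h : a ≤ b) (z : Space d) : wt 1 a z ≤ wt 1 b z := by
  unfold wt
  exact Real.rpow_le_rpow_of_exponent_le (by nlinarith [sq_nonneg ‖z‖]) (by linarith)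

lemma exists_lattice_sum_le (d : ℕ) : ∃ C : ℝ≥0,
    (∀ x : Space d, ∑' k : Lat d, ENNReal.ofReal (wt 1 (-(d + 1)) (x - latPt k)) ≤ C) ∧
    ∀ k : Lat d, ∫⁻ x : Space d, ENNReal.ofReal (wt 1 (-(d + 1)) (x - latPt k)) ≤ C := by
  set a : ℝ := -(d + 1) with ha
  have hInt : Integrable fun x : Space d => wt 1 a x := by
    have h := integrable_wt_one_sq (d := d) (a := a / 2) (by rw [ha]; linarith)
    refine h.congr (ae_of_all _ fun x => ?_)
    simp only [sq, wt_mul_wt, add_halves]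
  set J := ∫⁻ x : Space d, ENNReal.ofReal (wt 1 a x) with hJ
  set P : ℝ := (2 * (1 + (d : ℝ) ^ 2)) ^ (|a| / 2) with hP
  have hP1 : 1 ≤ P := Real.one_le_rpow (by nlinarith [sq_nonneg (d : ℝ)]) (by positivity)
  refine ⟨(ENNReal.ofReal P * J).toNNReal, ?_⟩
  rw [ENNReal.coe_toNNReal (ENNReal.mul_lt_top ENNReal.ofReal_lt_top hInt.lintegral_lt_top).ne]
  refine ⟨fun x => ?_, fun k => ?_⟩
  · rw [← lintegral_sub_left_eq_self _ x, lintegral_eq_tsum_cell, ← ENNReal.tsum_mul_left]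
    refine ENNReal.tsum_le_tsum fun k => ?_
    have hm : Measurable fun y : Space d => ENNReal.ofReal (wt 1 a (x - (y + latPt k))) :=
      ((measurable_wt 1 a).comp (measurable_const.sub (measurable_id.add_const _))).ennreal_ofReal
    rw [← lintegral_const_mul _ hm, ← mul_one (ENNReal.ofReal (wt 1 a (x - latPt k))),
      ← volume_cellO, ← setLIntegral_const]
    refine setLIntegral_mono (hm.const_mul _) fun y hy => ?_
    rw [← ENNReal.ofReal_mul (by positivity)]
    refine ENNReal.ofReal_le_ofReal ((wt_le_peetre_mul (by norm_num) a _
      (x - (y + latPt k))).trans (mul_le_mul_of_nonneg_right ?_ (wt_pos _ _ _).le))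
    rw [show x - latPt k - (x - (y + latPt k)) = y by abel, peetre, hP]
    have := norm_le_of_mem_cellO hy
    gcongr
  · rw [lintegral_sub_right_eq_self (fun x => ENNReal.ofReal (wt 1 a x)) (latPt k), ← hJ]
    exact le_mul_of_one_le_left' (ENNReal.one_le_ofReal.2 hP1)

lemma exists_latKer_of_le (d n : ℕ) : ∃ K : ℝ≥0, ∀ (κ : Space d → Lat d → Vec n) (c : ℝ≥0),
    (∀ k, Measurable fun x => κ x k) →
    (∀ x k, ‖κ x k‖ ≤ c * wt 1 (-(d + 1)) (x - latPt k)) → LatKer κ (c * K) := by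
  obtain ⟨K, h1, h2⟩ := exists_lattice_sum_le d
  refine ⟨K, fun κ c hm hc => ?_⟩
  have hle x k : ‖κ x k‖ₑ ≤ c * ENNReal.ofReal (wt 1 (-(d + 1)) (x - latPt k)) := by
    rw [← ofReal_norm, ← ENNReal.ofReal_coe_nnreal, ← ENNReal.ofReal_mul (NNReal.coe_nonneg c)]
    exact ENNReal.ofReal_le_ofReal (hc x k)
  refine ⟨hm, fun x => (ENNReal.tsum_le_tsum (hle x)).trans ?_,
    fun k => (lintegral_mono (hle · k)).trans ?_⟩
  · rw [ENNReal.tsum_mul_left, ENNReal.coe_mul]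
    exact mul_le_mul_right (h1 x) _
  · rw [lintegral_const_mul' _ _ ENNReal.coe_ne_top, ENNReal.coe_mul]
    exact mul_le_mul_right (h2 k) _

/-- Exponential decay beats every power. -/
lemma exists_decay {R : Space d → Vec n} (hR : CondR1 R) (q : ℝ) : ∃ C : ℝ≥0, ∀ z,
    ‖R z‖ ≤ C * wt 1 (-q) z := by
  obtain ⟨-, Rb, ε, hε, hb⟩ := hR
  obtain ⟨N, hq⟩ := exists_nat_ge q
  refine ⟨⟨|Rb| * (N.factorial * Real.exp ε / ε ^ N), by positivity⟩, fun z => ?_⟩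
  have hw : wt 1 q z ≤ (1 + ‖z‖) ^ N := by
    refine (wt_one_mono hq z).trans ?_
    rw [wt, one_pow, one_mul, ← Real.rpow_natCast (1 + ‖z‖) N]
    calc (1 + ‖z‖ ^ 2) ^ ((N : ℝ) / 2) ≤ ((1 + ‖z‖) ^ 2) ^ ((N : ℝ) / 2) := by
          gcongr; nlinarith [norm_nonneg z]
      _ = _ := by
          rw [← Real.rpow_natCast (1 + ‖z‖) 2, ← Real.rpow_mul (by positivity)]
          congr 1; push_cast; ring
  have he : (1 + ‖z‖) ^ N * Real.exp (-ε * ‖z‖) ≤ N.factorial * Real.exp ε / ε ^ N := by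
    have h := Real.pow_div_factorial_le_exp (ε * (1 + ‖z‖)) (by positivity) N
    rw [div_le_iff₀ (by positivity), mul_pow] at h
    rw [le_div_iff₀ (by positivity)]
    have e : Real.exp (ε * (1 + ‖z‖)) * Real.exp (-ε * ‖z‖) = Real.exp ε := by
      rw [← Real.exp_add]; congr 1; ring
    rw [← e]
    nlinarith [mul_le_mul_of_nonneg_right h (Real.exp_pos (-ε * ‖z‖)).le]
  rw [wt_neg, ← div_eq_mul_inv, le_div_iff₀ (wt_pos _ _ _)]
  calc ‖R z‖ * wt 1 q z ≤ (|Rb| * Real.exp (-ε * ‖z‖)) * (1 + ‖z‖) ^ N := by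
        refine mul_le_mul ((hb z).trans ?_) hw (wt_pos _ _ _).le (by positivity)
        gcongr; exact le_abs_self _
    _ = |Rb| * ((1 + ‖z‖) ^ N * Real.exp (-ε * ‖z‖)) := by ring
    _ ≤ |Rb| * (N.factorial * Real.exp ε / ε ^ N) := by gcongr

/-- The kernel `⟨εx⟩^a R(x - k) ⟨εk⟩^{-a}`. -/
def coupKer (R : Space d → Vec n) (ε : Eps) (a : ℝ) (x : Space d) (k : Lat d) : Vec n :=
  cf ε a x (latPt k) • R (x - latPt k)

lemma measurable_coupKer {R : Space d → Vec n} (hR : CondR1 R) (ε : Eps) (a : ℝ) (k : Lat d) :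
    Measurable fun x => coupKer R ε a x k := by
  have h : Measurable R := hR.1.continuous.measurable
  exact ((measurable_wt ε a).mul measurable_const).smul (h.comp (measurable_id.sub_const _))

lemma exists_latKer_coupKer {R : Space d → Vec n} (hR : CondR1 R) (a : ℝ) : ∃ C C' : ℝ≥0,
    ∀ ε : Eps, LatKer (coupKer R ε a) C ∧
      LatKer (fun x k => coupKer R ε a x k - coupKer R ε 0 x k) (ε.1.toNNReal * C') := by
  obtain ⟨K, hK⟩ := exists_latKer_of_le d n
  obtain ⟨C, hC⟩ := exists_decay hR (|a| + 1 + (d + 1))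
  set c : ℝ≥0 := ⟨2 ^ (|a| / 2) * C, by positivity⟩
  have hz (z : Space d) : wt 1 1 z * peetre a z * ‖R z‖ ≤ c * wt 1 (-(d + 1)) z := by
    refine (mul_le_mul_of_nonneg_left (hC z)
      (mul_pos (wt_pos _ _ _) (peetre_pos _ _)).le).trans_eq ?_
    rw [peetre_eq_wt, show wt 1 (-(d + 1)) z = wt 1 1 z * (wt 1 |a| z *
      wt 1 (-(|a| + 1 + (d + 1))) z) by rw [wt_mul_wt, wt_mul_wt]; congr 1; ring]
    change _ = 2 ^ (|a| / 2) * (C : ℝ) * _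
    ring
  have h1 (z : Space d) : 1 ≤ wt 1 1 z := (wt_zero 1 z).symm.trans_le (wt_one_mono zero_le_one z)
  refine ⟨c * K, |a|.toNNReal * c * K, fun ε => ⟨hK _ c (measurable_coupKer hR ε a) fun x k => ?_,
    ?_⟩⟩
  · rw [coupKer, norm_smul, Real.norm_of_nonneg (cf_pos _ _ _ _).le]
    refine (mul_le_mul_of_nonneg_right ((cf_le ε a x _).trans ?_) (norm_nonneg _)).trans (hz _)
    exact le_mul_of_one_le_left (peetre_pos _ _).le (h1 _)
  · rw [← mul_assoc]
    refine hK (fun x k => coupKer R ε a x k - coupKer R ε 0 x k) _ (fun k => (measurable_coupKer hR ε a k).sub (measurable_coupKer hR ε 0 k))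
      fun x k => ?_
    have := mul_le_mul_of_nonneg_left (hz (x - latPt k)) (mul_nonneg (abs_nonneg a) ε.2.1.le)
    have := (peetre_pos a (x - latPt k)).le
    have := ε.2.1
    rw [coupKer, coupKer, cf_zero, ← sub_smul, norm_smul, Real.norm_eq_abs]
    calc _ ≤ (|a| * ε * wt 1 1 (x - latPt k) * peetre a (x - latPt k)) * ‖R (x - latPt k)‖ := by
          refine mul_le_mul_of_nonneg_right ((abs_cf_sub_one_le ε a x _).trans ?_) (norm_nonneg _)
          gcongr
          exact norm_le_wt_one _
      _ ≤ _ := by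
          push_cast
          rw [Real.coe_toNNReal _ ε.2.1.le, Real.coe_toNNReal _ (abs_nonneg a)]
          linarith

/-- The operator `⟨εx⟩^a S ⟨εk⟩^{-a}`. -/
def coupOp (R : Space d → Vec n) (ε : Eps) (a : ℝ) : Ell2 d n →L[ℝ] L2 d := latOp (coupKer R ε a)

lemma exists_norm_coupOp_sub_le {R : Space d → Vec n} (hR : CondR1 R) (a : ℝ) :
    ∃ C : ℝ≥0, ∀ ε : Eps, ‖coupOp R ε a - coupOp R ε 0‖ ≤ ε * C := by
  obtain ⟨_, C, h⟩ := exists_latKer_coupKer hR a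
  obtain ⟨_, _, h₀⟩ := exists_latKer_coupKer hR 0
  refine ⟨C, fun ε => (norm_latOp_sub_le (h ε).1 (h₀ ε).1 (h ε).2).trans_eq ?_⟩
  rw [NNReal.coe_mul, Real.coe_toNNReal _ ε.2.1.le]

/-- The unit vectors of the lattice. -/
abbrev latE (j : Fin d) : Lat d := Pi.single j 1

lemma latPt_add (k l : Lat d) : latPt (k + l) = latPt k + latPt l := by ext i; simp [latPt_apply]

lemma latPt_neg (k : Lat d) : latPt (-k) = -latPt k := by ext i; simp [latPt_apply]

lemma norm_latPt_latE (j : Fin d) : ‖latPt (latE j)‖ = 1 := by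
  have : latPt (latE j) = EuclideanSpace.single j (1 : ℝ) := by
    ext i
    by_cases h : i = j <;> simp [latPt_apply, h]
  rw [this]; simp

/-- The coefficients of the weighted shift. -/
def shiftCf (ε : Eps) (a : ℝ) (l k : Lat d) : ℝ := cf ε a (latPt k) (latPt (k + l))

/-- A bound for the coefficients of weighted unit shifts. -/
def shiftB (a : ℝ) : ℝ≥0 := ⟨4 ^ (|a| / 2), by positivity⟩

lemma peetre_unit (a : ℝ) {k l : Lat d} (hl : ‖latPt l‖ = 1) :
    peetre a (latPt k - latPt (k + l)) = shiftB a := by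
  rw [latPt_add, sub_add_cancel_left, peetre_neg, peetre, hl]
  change _ = (4 : ℝ) ^ (|a| / 2)
  norm_num

lemma abs_shiftCf_le (ε : Eps) (a : ℝ) {l : Lat d} (hl : ‖latPt l‖ = 1) (k : Lat d) :
    |shiftCf ε a l k| ≤ shiftB a := by
  rw [shiftCf, abs_of_pos (cf_pos _ _ _ _), ← peetre_unit a hl]
  exact cf_le _ _ _ _

lemma abs_shiftCf_sub_one_le (ε : Eps) (a : ℝ) {l : Lat d} (hl : ‖latPt l‖ = 1) (k : Lat d) :
    |shiftCf ε a l k - 1| ≤ (ε.1.toNNReal * (|a|.toNNReal * shiftB a) : ℝ≥0) := by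
  refine (abs_cf_sub_one_le ε a _ _).trans (le_of_eq ?_)
  rw [peetre_unit a hl, latPt_add, sub_add_cancel_left, norm_neg, hl]
  push_cast
  rw [Real.coe_toNNReal _ ε.2.1.le, Real.coe_toNNReal _ (abs_nonneg a)]
  ring

open scoped Classical in
/-- The weighted shift `u ↦ (k ↦ ⟨εk⟩^a ⟨ε(k + l)⟩^{-a} u(k + l))` by a unit vector. -/
def shiftOp (n : ℕ) (ε : Eps) (a : ℝ) (l : Lat d) : Ell2 d n →L[ℝ] Ell2 d n :=
  if hl : ‖latPt l‖ = 1 then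
    wShift (Equiv.addRight l) (shiftCf ε a l) (shiftB a) (abs_shiftCf_le ε a hl) else 0

lemma shiftOp_apply (ε : Eps) (a : ℝ) {l : Lat d} (hl : ‖latPt l‖ = 1) (u : Ell2 d n) (k : Lat d) :
    shiftOp n ε a l u k = cf ε a (latPt k) (latPt (k + l)) • u (k + l) := by
  rw [shiftOp, dif_pos hl]; rfl

lemma norm_shiftOp_sub_le (ε : Eps) (a : ℝ) {l : Lat d} (hl : ‖latPt l‖ = 1) :
    ‖shiftOp n ε a l - shiftOp n ε 0 l‖ ≤ ε * (|a| * shiftB a) := by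
  have e : shiftOp n ε a l - shiftOp n ε 0 l =
      wShift (Equiv.addRight l) (fun k => shiftCf ε a l k - 1) _ (abs_shiftCf_sub_one_le ε a hl) := by
    ext1 u
    ext1
    funext k
    change shiftOp n ε a l u k - shiftOp n ε 0 l u k = _
    rw [shiftOp_apply ε a hl, shiftOp_apply ε 0 hl, wShift_apply, ← sub_smul, cf_zero]
    rfl
  rw [e]
  refine (norm_wShift_le _ _ _ _).trans (le_of_eq ?_)
  push_cast
  rw [Real.coe_toNNReal _ ε.2.1.le, Real.coe_toNNReal _ (abs_nonneg a)]

/-- The operator `⟨εk⟩^a (Δ_L - ν²) ⟨εk⟩^{-a}`. -/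
def latL (d n : ℕ) (ν : ℝ) (ε : Eps) (a : ℝ) : Ell2 d n →L[ℝ] Ell2 d n :=
  ∑ j : Fin d, (shiftOp n ε a (latE j) + shiftOp n ε a (-latE j) -
    (2 : ℝ) • ContinuousLinearMap.id ℝ _) - ν ^ 2 • ContinuousLinearMap.id ℝ _

lemma norm_latPt_neg_latE (j : Fin d) : ‖latPt (-latE j)‖ = 1 := by
  rw [latPt_neg, norm_neg, norm_latPt_latE]

lemma latL_apply (ν : ℝ) (ε : Eps) (a : ℝ) (u : Ell2 d n) (k : Lat d) :
    latL d n ν ε a u k = ∑ j : Fin d, (cf ε a (latPt k) (latPt (k + latE j)) • u (k + latE j) +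
      cf ε a (latPt k) (latPt (k + -latE j)) • u (k + -latE j) - (2 : ℝ) • u k) - ν ^ 2 • u k := by
  have hsum : ∀ (s : Finset (Fin d)) (F : Fin d → Ell2 d n), (∑ j ∈ s, F j) k = ∑ j ∈ s, F j k :=
    fun s F => by rw [lp.coeFn_sum, Finset.sum_apply]
  simp only [latL, sub_apply, sum_apply, add_apply, smul_apply, lp.coeFn_sub, Pi.sub_apply, hsum,
    lp.coeFn_add, Pi.add_apply, lp.coeFn_smul, Pi.smul_apply, ContinuousLinearMap.id_apply,
    shiftOp_apply ε a (norm_latPt_latE _), shiftOp_apply ε a (norm_latPt_neg_latE _)]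

lemma norm_latL_sub_le (ν : ℝ) (ε : Eps) (a : ℝ) :
    ‖latL d n ν ε a - latL d n ν ε 0‖ ≤ ε * (2 * d * (|a| * shiftB a)) := by
  have e : latL d n ν ε a - latL d n ν ε 0 = ∑ j : Fin d,
      ((shiftOp n ε a (latE j) - shiftOp n ε 0 (latE j)) +
        (shiftOp n ε a (-latE j) - shiftOp n ε 0 (-latE j))) := by
    rw [latL, latL, sub_sub_sub_cancel_right, ← Finset.sum_sub_distrib]
    refine Finset.sum_congr rfl fun j _ => ?_
    abel
  rw [e]
  refine (norm_sum_le _ _).trans ((Finset.sum_le_sum fun j _ => (norm_add_le _ _).trans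
    (add_le_add (norm_shiftOp_sub_le ε a (norm_latPt_latE j))
      (norm_shiftOp_sub_le ε a (norm_latPt_neg_latE j)))).trans (le_of_eq ?_))
  simp only [Finset.sum_const, Finset.card_univ, Fintype.card_fin, nsmul_eq_mul]
  ring

end coefficients

/-! ### Testing the free field -/

section fieldTests

variable {d : ℕ} {α m : ℝ}

/-- The element `⟨x⟩^{-α} ξ` of `L²`. -/
def dT (α : ℝ) : SR d →L[ℝ] L2 d := sLp.comp (wmulR (-α))

lemma coeFn_dT (ξ : SR d) : dT α ξ =ᵐ[volume] fun x => wt 1 (-α) x * ξ x := by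
  filter_upwards [coeFn_sLp (wmulR (-α) ξ)] with x hx
  rw [dT, ContinuousLinearMap.comp_apply, hx, wmulR_apply]

lemma denseRange_dT : DenseRange (dT (d := d) α) := denseRange_jPi (-α)

lemma inner_dT_jPi (ξ ψ : SR d) : inner ℝ (dT α ξ) (jPi α ψ) = ∫ x, ξ x * ψ x := by
  rw [inner_L2]
  refine integral_congr_ae ?_
  filter_upwards [coeFn_dT (α := α) ξ, coeFn_jPi (α := α) ψ] with x h1 h2
  rw [h1, h2, wt_neg]
  have := wt_ne_zero 1 α x
  field_simp

lemma inner_dT_realify {A : SC d →L[ℂ] SC d} (hr : IsRealOp A)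
    (hA : ∀ φ ψ : SC d, ∫ x, A φ x * ψ x = ∫ x, φ x * A ψ x) (φ ψ : SR d) :
    inner ℝ (dT α (realify A φ)) (jPi α ψ) = inner ℝ (dT α φ) (jPi α (realify A ψ)) := by
  have h := hA (toC φ) (toC ψ)
  simp only [← toC_realify hr, toC_apply, ← Complex.ofReal_mul] at h
  rw [integral_complex_ofReal, integral_complex_ofReal] at h
  rw [inner_dT_jPi, inner_dT_jPi]
  exact_mod_cast h

lemma inner_dT_cR (t : ℝ) (φ ψ : SR d) :
    inner ℝ (dT α (cR d m t φ)) (jPi α ψ) = inner ℝ (dT α φ) (jPi α (cR d m t ψ)) :=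
  inner_dT_realify (isRealOp_kgC t) (integral_mult_mul (cosSym_growth t) fun ξ => by
    simp only [cosSym, omg_neg]) φ ψ

lemma inner_dT_sR (t : ℝ) (φ ψ : SR d) :
    inner ℝ (dT α (sR d m t φ)) (jPi α ψ) = inner ℝ (dT α φ) (jPi α (sR d m t ψ)) :=
  inner_dT_realify (isRealOp_kgS t) (integral_mult_mul (sinSym_growth t) fun ξ => by
    simp only [sinSym, omg_neg]) φ ψ

lemma inner_dT_hR (φ ψ : SR d) :
    inner ℝ (dT α (hR d m φ)) (jPi α ψ) = inner ℝ (dT α φ) (jPi α (hR d m ψ)) :=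
  inner_dT_realify isRealOp_kgH (integral_mult_mul omgSqSym_growth fun ξ => by
    simp only [omgSqSym, omg_neg]) φ ψ

lemma sobDist_zero_toC (g : L2 d) (ξ : SR d) :
    sobDist 0 α g (toC ξ) = (inner ℝ (dT α ξ) g : ℂ) := by
  have e : sobTest 0 α ξ = wmulR (-α) ξ := by
    apply toC_injective
    rw [toC_sobTest, neg_zero, bes_zero, toC_wmulR]
  rw [sobDist_toC, e]
  rfl

lemma inner_sobTest_one (f : L2 d) (ξ : SR d) :
    inner ℝ (sLp (sobTest 1 α ξ)) f = inner ℝ (dT α ξ) (opA d α f) := by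
  refine (denseRange_jPsi α).induction_on f (isClosed_eq (by fun_prop) (by fun_prop)) fun ψ => ?_
  have e : sobTest 1 α ξ = wmulR (-α) (besR (-1) ξ) := by
    apply toC_injective
    rw [toC_sobTest, toC_wmulR, toC_besR]
  rw [opA_jPsi, e]
  refine (inner_dT_realify (α := α) (isRealOp_bes (-1)) (integral_bes_mul (-1)) ξ
    (besR 1 ψ)).trans ?_
  rw [← besR, besR_neg_besR]

lemma sobDist_one_toC (f : L2 d) (ξ : SR d) :
    sobDist 1 α f (toC ξ) = (inner ℝ (dT α ξ) (opA d α f) : ℂ) := by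
  rw [sobDist_toC, inner_sobTest_one]

lemma opA_injective : Function.Injective (opA d α) := by
  refine (injective_iff_map_eq_zero _).2 fun f hf => sobDist_injective 1 α ?_
  refine dist_ext_real fun φ => ?_
  rw [sobDist_one_toC, hf, inner_zero_right, sobDist_toC, inner_zero_right]

lemma eq_zero_of_inner_dT {g : L2 d} (h : ∀ ξ, inner ℝ (dT α ξ) g = 0) : g = 0 :=
  (denseRange_dT (d := d) (α := α)).eq_zero_of_inner_left ℝ fun ξ => (real_inner_comm _ _).trans (h ξ)

/-- The functional `(ψ, π) ↦ ∫ ζ₀ ψ + ∫ ζ₁ π` in coordinates. -/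
def tF (α : ℝ) (ζ : SR d × SR d) : L2 d × L2 d →L[ℝ] ℝ :=
  (innerSL ℝ (dT α ζ.1)).comp ((opA d α).comp (.fst ℝ _ _)) +
    (innerSL ℝ (dT α ζ.2)).comp (.snd ℝ _ _)

lemma tF_apply (ζ : SR d × SR d) (y : L2 d × L2 d) :
    tF α ζ y = inner ℝ (dT α ζ.1) (opA d α y.1) + inner ℝ (dT α ζ.2) y.2 := rfl

lemma tF_jF (ζ z : SR d × SR d) :
    tF α ζ (jF d α z) = inner ℝ (dT α ζ.1) (jPi α z.1) + inner ℝ (dT α ζ.2) (jPi α z.2) := by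
  rw [← opA_jPsi]; rfl

lemma continuous_tF (y : L2 d × L2 d) : Continuous fun ζ => tF α ζ y := by
  simp only [tF_apply]; fun_prop

lemma eq_zero_of_tF {y : L2 d × L2 d} (h : ∀ ζ, tF α ζ y = 0) : y = 0 := by
  refine Prod.ext (opA_injective (α := α) ?_) (eq_zero_of_inner_dT (α := α) fun ξ => ?_)
  · rw [Prod.fst_zero, map_zero]
    refine eq_zero_of_inner_dT (α := α) fun ξ => ?_
    simpa [tF_apply] using h (ξ, 0)
  · simpa [tF_apply] using h (0, ξ)

/-- The transposed generator. -/
def genD (d : ℕ) (m : ℝ) (ζ : SR d × SR d) : SR d × SR d := (-hR d m ζ.2, ζ.1)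

/-- The transposed evolution. -/
def evD (d : ℕ) (m t : ℝ) (ζ : SR d × SR d) : SR d × SR d :=
  (evPi d m t (ζ.2, ζ.1), evPsi d m t (ζ.2, ζ.1))

lemma continuous_genD : Continuous (genD d m) :=
  (((hR d m).continuous.comp continuous_snd).neg).prodMk continuous_fst

lemma genD_evD (t : ℝ) (ζ : SR d × SR d) :
    genD d m (evD d m t ζ) = evD d m t (genD d m ζ) := by
  simp only [genD, evD, evPsi_apply, evPi_apply, map_add, map_neg, hR_cR, hR_sR, neg_add]
  refine Prod.ext ?_ ?_
  · simp only; abel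
  · simp only; abel

variable [hα : Fact (α < -(d : ℝ) / 2)]

lemma tF_W0 (hm : 0 < m) (t : ℝ) (ζ : SR d × SR d) (y : L2 d × L2 d) :
    tF α ζ (W0 d α m t y) = tF α (evD d m t ζ) y := by
  refine (denseRange_jF (α := α)).induction_on y (isClosed_eq (by fun_prop) (by fun_prop))
    fun z => ?_
  rw [W0_jF hm, tF_jF, tF_jF]
  change inner ℝ _ (jPi α (evPsi d m t z)) + inner ℝ _ (jPi α (evPi d m t z)) = _
  simp only [evD, evPsi_apply, evPi_apply, map_add, map_sub, inner_add_left, inner_add_right,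
    inner_sub_left, inner_sub_right, inner_dT_cR, inner_dT_sR, inner_dT_hR, hR_sR]
  ring

lemma hasDerivAt_tF_W0 (hm : 0 < m) (ζ : SR d × SR d) (y : L2 d × L2 d) (t : ℝ) :
    HasDerivAt (fun t => tF α ζ (W0 d α m t y)) (tF α (genD d m ζ) (W0 d α m t y)) t := by
  refine hasDerivAt_W0_of_jF hm (tF α ζ).continuous (tF α (genD d m ζ)).continuous
    (C := ‖tF α (genD d m ζ)‖) (fun y => ?_) (fun z t => ?_) y t
  · refine ((tF α (genD d m ζ)).le_opNorm y).trans (mul_le_mul_of_nonneg_left ?_ (norm_nonneg _))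
    nlinarith [sq_nonneg (‖y‖ - 1)]
  · simp only [tF_jF, inner_dT_jPi]
    have d1 := hasDerivAt_integral_weight (ζ.1.integrable (μ := volume))
      (fun t => (evPsi d m t z).continuous) (fun t => (evPi d m t z).continuous)
      (fun t x => hasDerivAt_evPsi hm z x t) (exists_bound_evPsi hm z) (exists_bound_evPi hm z) t
    have d2 := hasDerivAt_integral_weight (ζ.2.integrable (μ := volume))
      (fun t => (evPi d m t z).continuous) (fun t => (-hR d m (evPsi d m t z)).continuous)
      (fun t x => hasDerivAt_evPi hm z x t) (exists_bound_evPi hm z) (by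
        simp only [hR_evPsi, neg_apply, abs_neg]; exact exists_bound_evPsi hm _) t
    refine (d1.add d2).congr_deriv ?_
    simp only [← inner_dT_jPi (α := α), genD, map_neg, inner_neg_left, inner_neg_right,
      inner_dT_hR]
    exact add_comm _ _

end fieldTests

/-! ### The coupled dynamics in coordinates -/

section coupled

variable {d n : ℕ} {α m ν : ℝ} {R : Space d → Vec n}

local notation "𝓔" => Phase d n 0 α

open ContinuousLinearMap (fst snd)

/-- The coordinates, grouped as field and crystal. -/
abbrev XF (d n : ℕ) : Type := (L2 d × L2 d) × (Ell2 d n × Ell2 d n)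

/-- The phase space in coordinates. -/
def coordF (d n : ℕ) (α : ℝ) : Phase d n 0 α ≃L[ℝ] XF d n :=
  (coord d n 0 α).trans (ContinuousLinearEquiv.prodProdProdComm ℝ _ _ _ _)

local notation "cF" => coordF d n α

lemma psi_eqF (Y : 𝓔) : Y.psi = sobDist 1 α (cF Y).1.1 := by
  have h := psi_eq Y
  rwa [add_zero] at h

lemma mom_eqF (Y : 𝓔) : Y.mom = sobDist 0 α (cF Y).1.2 := mom_eq Y

lemma u_eqF (Y : 𝓔) (k : Lat d) :
    Y.u k = wt 1 (-α) (latPt k) • (cF Y).2.1 k := u_eq Y k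

lemma v_eqF (Y : 𝓔) (k : Lat d) :
    Y.v k = wt 1 (-α) (latPt k) • (cF Y).2.2 k := v_eq Y k

lemma psi_toC (Y : 𝓔) (ξ : SR d) :
    Y.psi (toC ξ) = (tF α (ξ, 0) (cF Y).1 : ℂ) := by
  rw [psi_eqF, sobDist_one_toC, tF_apply]
  simp

lemma mom_toC (Y : 𝓔) (ξ : SR d) :
    Y.mom (toC ξ) = (tF α (0, ξ) (cF Y).1 : ℂ) := by
  rw [mom_eqF, sobDist_zero_toC, tF_apply]
  simp

/-- The parameter `1`. -/
def Eps.one : Eps := ⟨1, one_pos, le_rfl⟩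

local notation "S₁" => coupOp R Eps.one

/-- The free evolution of the field, the crystal at rest. -/
def freeU (d n : ℕ) (α m t : ℝ) : XF d n →L[ℝ] XF d n :=
  (W0 d α m t).prodMap (ContinuousLinearMap.id ℝ _)

lemma freeU_apply (t : ℝ) (y : XF d n) : freeU d n α m t y = (W0 d α m t y.1, y.2) := rfl

/-- The coupling of field and crystal. -/
def pertB (α ν : ℝ) (R : Space d → Vec n) : XF d n →L[ℝ] XF d n :=
  ((0 : XF d n →L[ℝ] L2 d).prod (-(coupOp R Eps.one α).comp ((fst ℝ _ _).comp (snd ℝ _ _)))).prod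
  (((snd ℝ _ _).comp (snd ℝ _ _)).prod ((latL d n ν Eps.one α).comp ((fst ℝ _ _).comp (snd ℝ _ _)) -
    ((coupOp R Eps.one (-α)).adjoint).comp ((opA d α).comp ((fst ℝ _ _).comp (fst ℝ _ _)))))

lemma pertB_apply (y : XF d n) : pertB α ν R y = ((0, -S₁ α y.2.1),
    (y.2.2, latL d n ν Eps.one α y.2.1 - (S₁ (-α)).adjoint (opA d α y.1.1))) := rfl

lemma isC0Family_freeU (d n : ℕ) (α : ℝ) [Fact (α < -(d : ℝ) / 2)] (hm : 0 < m) :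
    IsC0Family (freeU d n α m) := by
  have h := isC0Family_W0 d α hm
  obtain ⟨M, c, hM, hc, hb⟩ := h.bound
  refine ⟨fun y => ?_, fun t y => ?_, ⟨M + 1, c, by positivity, hc, fun t y => ?_⟩, ?_⟩
  · rw [freeU_apply, h.zero]
  · rw [freeU_apply, freeU_apply, h.neg]
  · rw [freeU_apply, Prod.norm_def]
    have he : 1 ≤ Real.exp (c * |t|) := Real.one_le_exp (by positivity)
    have h1 : ‖y.1‖ ≤ ‖y‖ := norm_fst_le y
    have h2 : ‖y.2‖ ≤ ‖y‖ := norm_snd_le y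
    refine max_le ((hb t y.1).trans ?_) (h2.trans ?_)
    · gcongr; linarith
    · refine le_mul_of_one_le_left (norm_nonneg _) ?_
      nlinarith
  · exact (h.cont_comp continuous_fst (continuous_fst.comp continuous_snd)).prodMk
      (continuous_snd.comp continuous_snd)

lemma coupling_eq (hR : CondR1 R) (Y : 𝓔) :
    S₁ α (cF Y).2.1 =ᵐ[volume] fun x => wt 1 α x * coupling R Y.u x := by
  obtain ⟨C, _, hC⟩ := exists_latKer_coupKer hR α
  filter_upwards [coeFn_latOp (hC Eps.one).1 (cF Y).2.1] with x hx
  rw [coupOp, hx, coupling, ← tsum_mul_left]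
  refine tsum_congr fun k => ?_
  rw [u_eqF, coupKer, cf, inner_smul_left, inner_smul_right]
  simp only [Eps.one, conj_trivial]
  ring

lemma integral_mul_of_ae {f : Space d → ℝ} {g : L2 d}
    (h : g =ᵐ[volume] fun x => wt 1 α x * f x) (ξ : SR d) :
    Integrable (fun x => ξ x * f x) ∧ ∫ x, ξ x * f x = inner ℝ (dT α ξ) g := by
  have e : (fun x => ξ x * f x) =ᵐ[volume] fun x => dT α ξ x * g x := by
    filter_upwards [coeFn_dT (α := α) ξ, h] with x h1 h2
    rw [h1, h2, wt_neg]
    have := wt_ne_zero 1 α x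
    field_simp
  refine ⟨((Lp.memLp _).integrable_mul (Lp.memLp _)).congr e.symm, ?_⟩
  rw [inner_L2]
  exact integral_congr_ae e

/-! ### The field as a function -/

lemma Represents.ae_eq {f g : Space d → ℝ} {T : 𝓢'(Space d, ℂ)} (hf : Represents f T)
    (hg : Represents g T) : f =ᵐ[volume] g := by
  refine ae_eq_of_integral_contDiff_smul_eq hf.1 hg.1 fun φ hφ hs => ?_
  set ξ : SC d := toC (hs.toSchwartzMap hφ)
  have hc : HasCompactSupport ξ := hs.comp_left (g := fun r : ℝ => (r : ℂ)) (by simp)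
  have h := (hf.2 ξ hc).symm.trans (hg.2 ξ hc)
  have e : ∀ x, ξ x = (φ x : ℂ) := fun x => rfl
  simp only [e, ← Complex.ofReal_mul] at h
  rw [integral_complex_ofReal, integral_complex_ofReal] at h
  exact_mod_cast h

lemma represents_of_inner_dT {g : L2 d} {T : 𝓢'(Space d, ℂ)}
    (h : ∀ ξ, T (toC ξ) = (inner ℝ (dT α ξ) g : ℂ)) :
    Represents (fun x => wt 1 (-α) x * g x) T := by
  have hr := integral_mul_of_ae (α := α) (g := g) (f := fun x => wt 1 (-α) x * g x)
    (.of_forall fun x => by simp only; rw [← mul_assoc, wt_mul_wt_neg, one_mul])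
  refine ⟨(locallyIntegrable_iff.2 fun K hK => ?_), fun φ _ => ?_⟩
  · exact ((Lp.memLp g).locallyIntegrable (by norm_num)
      |>.integrableOn_isCompact hK).continuousOn_mul (continuous_wt 1 (-α)).continuousOn hK
  · have e : ∀ x, φ x * ((wt 1 (-α) x * g x : ℝ) : ℂ) =
        ((toR φ x * (wt 1 (-α) x * g x) : ℝ) : ℂ) +
          Complex.I * ((toR (-Complex.I • φ) x * (wt 1 (-α) x * g x) : ℝ) : ℂ) := fun x => by
      have := congrArg (fun f => f x) (schwartz_re_im φ)
      simp only [add_apply, smul_apply, toC_apply, smul_eq_mul] at this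
      rw [this]
      push_cast
      ring
    simp only [e]
    rw [integral_add ((hr _).1.ofReal) ((hr _).1.ofReal.const_mul _), integral_const_mul,
      integral_complex_ofReal, integral_complex_ofReal, (hr _).2, (hr _).2]
    conv_lhs => rw [schwartz_re_im φ]
    rw [map_add, map_smul, h, h, smul_eq_mul]

lemma represents_psi (Y : 𝓔) :
    Represents (fun x => wt 1 (-α) x * opA d α (cF Y).1.1 x) Y.psi :=
  represents_of_inner_dT fun ξ => by rw [psi_eqF, sobDist_one_toC]

lemma represents_mom (Y : 𝓔) :
    Represents (fun x => wt 1 (-α) x * (cF Y).1.2 x) Y.mom :=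
  represents_of_inner_dT fun ξ => by rw [mom_eqF, sobDist_zero_toC]

lemma toFn_psi (Y : 𝓔) :
    toFn Y.psi =ᵐ[volume] fun x => wt 1 (-α) x * opA d α (cF Y).1.1 x := by
  have h : ∃ f, Represents f Y.psi := ⟨_, represents_psi Y⟩
  rw [toFn, dif_pos h]
  exact h.choose_spec.ae_eq (represents_psi Y)

lemma wt_smul_couplingAdj (hR : CondR1 R) (Y : 𝓔) (k : Lat d) :
    wt 1 α (latPt k) • couplingAdj R (toFn Y.psi) k =
      (S₁ (-α)).adjoint (opA d α (cF Y).1.1) k := by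
  obtain ⟨C, _, hC⟩ := exists_latKer_coupKer hR (-α)
  rw [coupOp, adjoint_latOp_apply (hC Eps.one).1, couplingAdj, ← integral_smul]
  refine integral_congr_ae ?_
  filter_upwards [toFn_psi Y] with x hx
  rw [hx, coupKer, cf, smul_smul, smul_smul, neg_neg]
  simp only [Eps.one]
  congr 1
  ring

lemma wt_smul_force (hR : CondR1 R) (Y : 𝓔) (k : Lat d) :
    wt 1 α (latPt k) • (latLaplacian Y.u k - ν ^ 2 • Y.u k - couplingAdj R (toFn Y.psi) k) =
      (pertB α ν R (cF Y)).2.2 k := by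
  rw [smul_sub, wt_smul_couplingAdj hR, pertB_apply]
  simp only [lp.coeFn_sub, Pi.sub_apply, latL_apply]
  congr 1
  rw [smul_sub, latLaplacian, Finset.smul_sum]
  congr 1
  · refine Finset.sum_congr rfl fun j _ => ?_
    simp only [u_eqF, cf, Eps.one, ← sub_eq_add_neg, smul_add, smul_sub, smul_smul, wt_mul_wt,
      sub_self, wt_zero, one_smul, two_smul]
    abel
  · rw [u_eqF, smul_comm, wt_smul_wt_neg_smul]

lemma force_field (hm : 0 < m) (hR : CondR1 R) (Y : 𝓔) (a : SR d) :
    (Δ Y.psi) (toC a) - (m : ℂ) ^ 2 * Y.psi (toC a) - ∫ x, toC a x * (coupling R Y.u x : ℂ) =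
      ((tF α (genD d m (0, a)) (cF Y).1 +
        tF α (0, a) (pertB α ν R (cF Y)).1 : ℝ) : ℂ) := by
  have h1 : (Δ Y.psi) (toC a) - (m : ℂ) ^ 2 * Y.psi (toC a) = -Y.psi (toC (FieldCrystal.hR d m a)) := by
    rw [laplacian_apply_apply, toC_hR, kgH_apply hm, map_sub, map_smul, smul_eq_mul]
    ring
  have h2 : ∫ x, toC a x * (coupling R Y.u x : ℂ) =
      (inner ℝ (dT α a) (S₁ α (cF Y).2.1) : ℂ) := by
    rw [← (integral_mul_of_ae (coupling_eq hR Y) a).2, ← integral_complex_ofReal]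
    refine integral_congr_ae (ae_of_all _ fun x => ?_)
    simp
  rw [h1, h2, psi_toC, pertB_apply]
  simp only [tF_apply, genD, map_neg, map_zero, inner_zero_left, inner_zero_right, inner_neg_left,
    inner_neg_right]
  push_cast
  ring

/-- The equations of motion, tested in coordinates. -/
structure CoordEqs (m ν : ℝ) (R : Space d → Vec n) (α : ℝ) (y : ℝ → XF d n) : Prop where
  field : ∀ ζ t, HasDerivAt (fun s => tF α ζ (y s).1)
    (tF α (genD d m ζ) (y t).1 + tF α ζ (pertB α ν R (y t)).1) t
  disp : ∀ k t, HasDerivAt (fun s => (y s).2.1 k) ((pertB α ν R (y t)).2.1 k) t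
  vel : ∀ k t, HasDerivAt (fun s => (y s).2.2 k) ((pertB α ν R (y t)).2.2 k) t

lemma isSolution_of_coordEqs (hm : 0 < m) (hR : CondR1 R) {y : ℝ → XF d n} (hy : Continuous y)
    (h : CoordEqs m ν R α y) :
    IsSolution m ν R ((cF).symm (y 0)) fun t => (cF).symm (y t) := by
  have hcY : ∀ t, cF ((cF).symm (y t)) = y t := fun t =>
    (cF).apply_symm_apply _
  refine ⟨(cF).symm.continuous.comp hy, rfl, fun ξ _ t => ?_, fun k t => ?_,
    fun ξ _ t => ?_, fun k t => ?_⟩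
  · have hr : ∀ a : SR d, HasDerivAt
        (fun s => ((cF).symm (y s)).psi (toC a))
        (((cF).symm (y t)).mom (toC a)) t := fun a => by
      simp only [psi_toC, mom_toC, hcY]
      refine (h.field (a, 0) t).ofReal_comp.congr_deriv ?_
      simp [pertB_apply, tF_apply, genD]
    rw [schwartz_re_im ξ]
    simp only [map_add, map_smul]
    exact (hr _).fun_add ((hr _).fun_const_smul _)
  · simp only [u_eqF, v_eqF, hcY]
    exact (h.disp k t).fun_const_smul _
  · set Yt := (cF).symm (y t) with hYt
    have hr : ∀ a : SR d, HasDerivAt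
        (fun s => ((cF).symm (y s)).mom (toC a))
        ((Δ Yt.psi) (toC a) - (m : ℂ) ^ 2 * Yt.psi (toC a) -
          ∫ x, toC a x * (coupling R Yt.u x : ℂ)) t := fun a => by
      rw [force_field (ν := ν) hm hR]
      simp only [mom_toC, hcY, hYt]
      exact (h.field (0, a) t).ofReal_comp
    have hi (a : SR d) : Integrable fun x => toC a x * (coupling R Yt.u x : ℂ) :=
      (integral_mul_of_ae (coupling_eq hR Yt) a).1.ofReal.congr (ae_of_all _ fun x => by simp)
    rw [schwartz_re_im ξ]
    generalize toR ξ = a, toR (-Complex.I • ξ) = b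
    have e : ∫ x, (toC a + Complex.I • toC b) x * (coupling R Yt.u x : ℂ) =
        (∫ x, toC a x * (coupling R Yt.u x : ℂ)) +
          Complex.I * ∫ x, toC b x * (coupling R Yt.u x : ℂ) := by
      rw [← integral_const_mul, ← integral_add (hi a) ((hi b).const_mul _)]
      simp only [add_apply, smul_apply, smul_eq_mul, add_mul, mul_assoc]
    rw [e]
    simp only [map_add, map_smul]
    refine ((hr a).fun_add ((hr b).fun_const_smul Complex.I)).congr_deriv ?_
    simp only [smul_eq_mul]
    ring
  · set Yt := (cF).symm (y t) with hYt
    have h1 := (h.vel k t).const_smul (wt 1 (-α) (latPt k))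
    rw [← hcY t, ← hYt, ← wt_smul_force hR, wt_neg_smul_wt_smul] at h1
    simp only [v_eqF, hcY]
    exact h1

lemma hasCompactSupport_toC {φ : SR d} (h : HasCompactSupport φ) :
    HasCompactSupport (toC φ) := h.comp_left (g := fun r : ℝ => (r : ℂ)) (by simp)

lemma hasDerivAt_of_ofReal {f : ℝ → ℝ} {f' : ℝ} {t : ℝ}
    (h : HasDerivAt (fun s => (f s : ℂ)) (f' : ℂ) t) : HasDerivAt f f' t :=
  h.map Complex.reCLM

lemma IsSolution.coordEqs (hm : 0 < m) (hR : CondR1 R) {Y₀ : 𝓔}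
    {Y : ℝ → 𝓔} (h : IsSolution m ν R Y₀ Y) :
    CoordEqs m ν R α fun t => cF (Y t) := by
  set y : ℝ → XF d n := fun t => cF (Y t) with hy
  have hyc : Continuous y := (cF).continuous.comp h.cont
  have hy1 : Continuous fun t => (y t).1 := continuous_fst.comp hyc
  have hyB : Continuous fun t => (pertB α ν R (y t)).1 :=
    continuous_fst.comp ((pertB α ν R).continuous.comp hyc)
  have hcomp : ∀ ζ : SR d × SR d, HasCompactSupport ζ.1 →
      HasCompactSupport ζ.2 → ∀ t, HasDerivAt (fun s => tF α ζ (y s).1)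
        (tF α (genD d m ζ) (y t).1 + tF α ζ (pertB α ν R (y t)).1) t := by
    intro ζ h1 h2 t
    have d1 := h.eq_psi (toC ζ.1) (hasCompactSupport_toC h1) t
    have d2 := h.eq_mom (toC ζ.2) (hasCompactSupport_toC h2) t
    rw [force_field (ν := ν) hm hR] at d2
    simp only [psi_toC, mom_toC] at d1 d2
    have e : ∀ x : L2 d × L2 d, tF α ζ x = tF α (ζ.1, 0) x + tF α (0, ζ.2) x := fun x => by
      simp [tF_apply]
    simp only [e]
    refine ((hasDerivAt_of_ofReal d1).add (hasDerivAt_of_ofReal d2)).congr_deriv ?_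
    simp [tF_apply, genD, pertB_apply, hy]
    ring
  refine ⟨fun ζ t => ?_, fun k t => ?_, fun k t => ?_⟩
  · have key t : tF α ζ ((y t).1 - (y 0).1 - ∫ s in (0 : ℝ)..t, (pertB α ν R (y s)).1) =
        tF α (genD d m ζ) (∫ s in (0 : ℝ)..t, (y s).1) := by
      refine (isClosed_eq (continuous_tF _) ((continuous_tF _).comp continuous_genD)).mem_of_tendsto
        ((tendsto_cut ζ.1).prodMk_nhds (tendsto_cut ζ.2)) (.of_forall fun N => ?_)
      set ζ' : SR d × SR d := (cut N ζ.1, cut N ζ.2)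
      have c1 : Continuous fun s => tF α (genD d m ζ') (y s).1 :=
        (tF α (genD d m ζ')).continuous.comp hy1
      have c2 : Continuous fun s => tF α ζ' (pertB α ν R (y s)).1 := (tF α ζ').continuous.comp hyB
      have hI := intervalIntegral.integral_eq_sub_of_hasDerivAt (fun s _ => hcomp ζ'
        (hasCompactSupport_cut N _) (hasCompactSupport_cut N _) s) ((c1.add c2).intervalIntegrable 0 t)
      rw [intervalIntegral.integral_add (c1.intervalIntegrable 0 t) (c2.intervalIntegrable 0 t),
        (tF α (genD d m ζ')).intervalIntegral_comp_comm (hy1.intervalIntegrable 0 t),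
        (tF α ζ').intervalIntegral_comp_comm (hyB.intervalIntegrable 0 t)] at hI
      simp only [Set.mem_ofPred_eq, Function.comp_apply, map_sub]
      linarith
    simp only [map_sub] at key
    exact ((((hy1.integral_hasStrictDerivAt 0 t).hasDerivAt.map (tF α (genD d m ζ))).add
      ((hyB.integral_hasStrictDerivAt 0 t).hasDerivAt.map (tF α ζ))).const_add
      (tF α ζ (y 0).1)).congr_of_eventuallyEq (.of_forall fun t => by
        simp only [Pi.add_apply, ← key]; ring)
  · have h1 := (h.eq_u k t).const_smul (wt 1 α (latPt k))
    simp only [u_eqF, v_eqF, wt_smul_wt_neg_smul, Pi.smul_def] at h1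
    exact h1
  · have h1 := (h.eq_v k t).const_smul (wt 1 α (latPt k))
    rw [wt_smul_force hR] at h1
    simpa only [v_eqF, wt_smul_wt_neg_smul, Pi.smul_def] using h1

end coupled

/-! ### Well-posedness -/

section wellposed

variable {d n : ℕ} {α m ν : ℝ} {R : Space d → Vec n}

local notation "cF" => coordF d n α
local notation "𝓔" => Phase d n 0 α

open ContinuousLinearMap (fst snd)

/-- The test functionals on the phase space in coordinates. -/
def testX (α : ℝ) (i : (SR d × SR d) × (Lat d × Vec n × Vec n)) :
    XF d n →L[ℝ] ℝ :=
  (tF α i.1).comp (fst ℝ _ _) +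
    ((innerSL ℝ (lp.single (E := fun _ => Vec n) 2 i.2.1 i.2.2.1)).comp
      ((fst ℝ _ _).comp (snd ℝ _ _)) +
    (innerSL ℝ (lp.single (E := fun _ => Vec n) 2 i.2.1 i.2.2.2)).comp
      ((snd ℝ _ _).comp (snd ℝ _ _)))

lemma inner_single (k : Lat d) (e : Vec n) (u : Ell2 d n) :
    inner ℝ (lp.single (E := fun _ => Vec n) 2 k e) u = inner ℝ e (u k) := by
  rw [lp.inner_single_left]

lemma testX_apply (i : (SR d × SR d) × (Lat d × Vec n × Vec n)) (y : XF d n) :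
    testX α i y = tF α i.1 y.1 +
      (inner ℝ i.2.2.1 (y.2.1 i.2.1) + inner ℝ i.2.2.2 (y.2.2 i.2.1)) := by
  rw [← inner_single, ← inner_single]; rfl

lemma eq_zero_of_testX {y : XF d n} (h : ∀ i, testX α i y = 0) : y = 0 := by
  have h1 : y.1 = 0 := eq_zero_of_tF (α := α) fun ζ => by simpa [testX_apply] using h (ζ, 0, 0, 0)
  refine Prod.ext h1 (Prod.ext ?_ ?_) <;> ext1 <;> funext k <;>
    refine ext_inner_left ℝ fun e => ?_
  · simpa [testX_apply, tF_apply] using h (0, k, e, 0)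
  · simpa [testX_apply, tF_apply] using h (0, k, 0, e)

variable [Fact (α < -(d : ℝ) / 2)]

/-- A mild solution of the coupled system in coordinates. -/
def IsMild (α m ν : ℝ) (R : Space d → Vec n) (y : ℝ → XF d n) : Prop := ∀ t, HasDerivAt
  (fun s => freeU d n α m (-s) (y s)) (freeU d n α m (-t) (pertB α ν R (y t))) t

lemma CoordEqs.isMild (hm : 0 < m) {y : ℝ → XF d n} (hy : Continuous y)
    (h : CoordEqs m ν R α y) : IsMild α m ν R y := fun t => by
  refine (isC0Family_freeU d n α hm).hasDerivAt_of_weak hy (l := testX α)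
    (l' := fun i => testX α (genD d m i.1, i.2.1, 0, 0)) (fun x => eq_zero_of_testX)
    (fun i y s => ?_) (fun i s t => ?_) t
  · simp only [testX_apply, freeU_apply, inner_zero_left, add_zero]
    exact (hasDerivAt_tF_W0 hm i.1 y.1 s).add_const _
  · simp only [testX_apply, freeU_apply, inner_zero_left, add_zero]
    have h1 := h.field (evD d m s i.1) t
    rw [genD_evD, ← tF_W0 hm, ← tF_W0 hm] at h1
    simp only [← tF_W0 hm] at h1
    have h2 := (h.disp i.2.1 t).map (innerSL ℝ i.2.2.1)
    have h3 := (h.vel i.2.1 t).map (innerSL ℝ i.2.2.2)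
    refine (h1.add (h2.add h3)).congr_deriv ?_
    simp only [innerSL_apply_apply]
    ring

lemma IsMild.coordEqs (hm : 0 < m) {y : ℝ → XF d n} (h : IsMild α m ν R y) :
    CoordEqs m ν R α y := by
  have h2 := fun t => (h t).map (snd ℝ (L2 d × L2 d) (Ell2 d n × Ell2 d n))
  let ev := lp.evalCLM ℝ (fun _ : Lat d => Vec n) 2
  exact ⟨fun ζ t => (isC0Family_freeU d n α hm).hasDerivAt_perturbed
      (φ := (tF α ζ).comp (fst ℝ _ _)) (b := fun y => tF α (genD d m ζ) y.1)
      (φ' := fun _ => (tF α ζ).comp (fst ℝ _ _)) (fun y => ContinuousLinearMap.hasStrictFDerivAt _)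
      (fun y t => hasDerivAt_tF_W0 hm ζ y.1 t) h t,
    fun k t => (h2 t).map ((ev k).comp (fst ℝ _ _)), fun k t => (h2 t).map ((ev k).comp (snd ℝ _ _))⟩

/-- The Cauchy problem is well posed, and its solution is given by bounded operators. -/
theorem exists_propagator (hm : 0 < m) (ν : ℝ) (hR : CondR1 R) : ∃ V : ℝ → XF d n →L[ℝ] XF d n, (∀ y, V 0 y = y) ∧
      (∀ y, IsMild α m ν R (V · y)) ∧
      (∀ Y₀ : 𝓔, IsSolution m ν R Y₀
        fun t => (cF).symm (V t (cF Y₀))) ∧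
      ∀ (Y₀ : 𝓔) (Y : ℝ → 𝓔), IsSolution m ν R Y₀ Y →
        ∀ t, Y t = (cF).symm (V t (cF Y₀)) := by
  obtain ⟨V, h0, hc, hd, hu⟩ := (isC0Family_freeU d n α hm).exists_perturbed (pertB α ν R)
  refine ⟨V, h0, hd, fun Y₀ => ?_, fun Y₀ Y hY t => ?_⟩
  · have h := isSolution_of_coordEqs hm hR (hc (cF Y₀)) (IsMild.coordEqs (ν := ν) hm (hd _))
    rwa [h0, ContinuousLinearEquiv.symm_apply_apply] at h
  · have h := hu _ (fun t => (hY.coordEqs hm hR).isMild hm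
      ((cF).continuous.comp hY.cont) t) t
    simp only [Function.comp_apply, hY.2] at h
    rw [← h, ContinuousLinearEquiv.symm_apply_apply]

end wellposed

/-! ### Fourier series on the torus -/

section torus

open scoped ComplexConjugate

variable {d : ℕ}

/-- The character `θ ↦ e^{ik·θ}`. -/
def eK (k : Lat d) (θ : Space d) : ℂ := Complex.exp (Complex.I * (inner ℝ (latPt k) θ : ℂ))

lemma norm_eK (k : Lat d) (θ : Space d) : ‖eK k θ‖ = 1 := Complex.norm_exp_I_mul_ofReal _

lemma continuous_eK (k : Lat d) : Continuous (eK k) := by unfold eK; fun_prop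

lemma eK_add (k l : Lat d) (θ : Space d) : eK (k + l) θ = eK k θ * eK l θ := by
  rw [eK, eK, eK, ← Complex.exp_add, latPt_add, inner_add_left]
  push_cast
  rw [mul_add]

lemma conj_eK (k : Lat d) (θ : Space d) : conj (eK k θ) = eK (-k) θ := by
  rw [eK, eK, ← Complex.exp_conj, latPt_neg, inner_neg_left]
  simp

/-- The cube `[0,2π]^d`. -/
def cube (d : ℕ) : Set (Space d) := {θ | ∀ i, θ i ∈ Set.Icc 0 (2 * Real.pi)}

lemma cube_eq : cube d = (WithLp.ofLp (p := 2)) ⁻¹'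
    (Set.univ.pi fun _ : Fin d => Set.Icc (0 : ℝ) (2 * Real.pi)) := by
  ext θ; simp [cube, Pi.le_def, forall_and]

lemma measurableSet_cube : MeasurableSet (cube d) := by
  rw [cube_eq]
  exact (PiLp.volume_preserving_ofLp (Fin d)).measurable
    (MeasurableSet.univ_pi fun _ => measurableSet_Icc)

lemma volume_cube : volume (cube d) = ENNReal.ofReal ((2 * Real.pi) ^ d) := by
  rw [cube_eq, (PiLp.volume_preserving_ofLp (Fin d)).measure_preimage
    (MeasurableSet.univ_pi fun _ => measurableSet_Icc).nullMeasurableSet, volume_pi_pi]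
  simp only [Real.volume_Icc, sub_zero, Finset.prod_const, Finset.card_univ, Fintype.card_fin]
  rw [ENNReal.ofReal_pow (by positivity)]

instance : IsFiniteMeasure (volume.restrict (cube d)) :=
  ⟨by rw [Measure.restrict_apply_univ, volume_cube]; exact ENNReal.ofReal_lt_top⟩

lemma integral_exp_int (k : ℤ) :
    ∫ x in Set.Icc (0 : ℝ) (2 * Real.pi), Complex.exp (Complex.I * ((k * x : ℝ) : ℂ)) =
      if k = 0 then ((2 * Real.pi : ℝ) : ℂ) else 0 := by
  rw [integral_Icc_eq_integral_Ioc, ← intervalIntegral.integral_of_le (by positivity)]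
  split_ifs with h
  · subst h; simp
  · have hc : Complex.I * (k : ℂ) ≠ 0 := mul_ne_zero Complex.I_ne_zero (by exact_mod_cast h)
    have e : ∀ x : ℝ, Complex.exp (Complex.I * ((k * x : ℝ) : ℂ)) =
        Complex.exp (Complex.I * (k : ℂ) * x) := fun x => by push_cast; ring_nf
    simp only [e]
    rw [integral_exp_mul_complex hc]
    have e2 : Complex.I * (k : ℂ) * ((2 * Real.pi : ℝ) : ℂ) = k * (2 * Real.pi * Complex.I) := by
      push_cast; ring
    rw [e2, Complex.exp_int_mul_two_pi_mul_I]
    simp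

lemma integral_eK (k : Lat d) :
    ∫ θ in cube d, eK k θ = if k = 0 then (((2 * Real.pi) ^ d : ℝ) : ℂ) else 0 := by
  have e : ∀ θ : Space d, eK k θ =
      ∏ i, Complex.exp (Complex.I * ((k i * (WithLp.ofLp θ) i : ℝ) : ℂ)) := fun θ => by
    rw [eK, ← Complex.exp_sum, ← Finset.mul_sum, ← Complex.ofReal_sum]
    congr 3
    simp [PiLp.inner_apply, latPt_apply, mul_comm]
  simp only [e]
  rw [cube_eq, (PiLp.volume_preserving_ofLp (Fin d)).setIntegral_preimage_emb
    (MeasurableEquiv.toLp 2 (Fin d → ℝ)).symm.measurableEmbedding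
    (fun x => ∏ i, Complex.exp (Complex.I * ((k i * x i : ℝ) : ℂ))), volume_pi,
    Measure.restrict_pi_pi, integral_fintype_prod_eq_prod
      (f := fun i x => Complex.exp (Complex.I * ((k i * x : ℝ) : ℂ)))]
  simp only [integral_exp_int]
  split_ifs with h
  · subst h; simp
  · obtain ⟨i, hi⟩ := Function.ne_iff.1 h
    exact Finset.prod_eq_zero (Finset.mem_univ i) (if_neg hi)

lemma continuous_eK_tsum {b : Lat d → ℂ} (hb : Summable fun k => ‖b k‖) :
    Continuous fun θ => ∑' k, eK k θ * b k :=
  continuous_tsum (fun k => (continuous_eK k).mul continuous_const) hb fun k θ => by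
    rw [norm_mul, norm_eK, one_mul]

/-- Parseval's identity for a trigonometric polynomial and an absolutely convergent series. -/
lemma torus_parseval {Λ : Finset (Lat d)} {a b : Lat d → ℂ} (hb : Summable fun k => ‖b k‖) :
    ∫ θ in cube d, conj (∑ l ∈ Λ, eK l θ * a l) * ∑' k, eK k θ * b k =
      (((2 * Real.pi) ^ d : ℝ) : ℂ) * ∑ l ∈ Λ, conj (a l) * b l := by
  have hterm : ∀ l, ∫ θ in cube d, eK (-l) θ * ∑' k, eK k θ * b k =
      (((2 * Real.pi) ^ d : ℝ) : ℂ) * b l := by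
    intro l
    have e : ∀ θ, eK (-l) θ * ∑' k, eK k θ * b k = ∑' k, b k * eK (-l + k) θ := fun θ => by
      rw [← tsum_mul_left]
      exact tsum_congr fun k => by rw [eK_add]; ring
    simp only [e]
    have hn : ∀ k, ∫ θ in cube d, ‖b k * eK (-l + k) θ‖ =
        (volume.restrict (cube d)).real Set.univ * ‖b k‖ := fun k => by
      simp only [norm_mul, norm_eK, mul_one]
      rw [integral_const, smul_eq_mul]
    have hi : ∀ k, Integrable (fun θ => b k * eK (-l + k) θ) (volume.restrict (cube d)) :=
      fun k => Integrable.of_bound (continuous_const.mul (continuous_eK _)).aestronglyMeasurable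
        ‖b k‖ (ae_of_all _ fun θ => by rw [norm_mul, norm_eK, mul_one])
    rw [← integral_tsum_of_summable_integral_norm hi (by simp only [hn]; exact hb.mul_left _),
      tsum_eq_single l fun k hk => ?_]
    · rw [integral_const_mul, integral_eK, if_pos (by simp), mul_comm]
    · rw [integral_const_mul, integral_eK, if_neg, mul_zero]
      intro h
      exact hk (by rw [neg_add_eq_zero] at h; exact h.symm)
  have e : ∀ θ, conj (∑ l ∈ Λ, eK l θ * a l) * ∑' k, eK k θ * b k =
      ∑ l ∈ Λ, conj (a l) * (eK (-l) θ * ∑' k, eK k θ * b k) := fun θ => by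
    rw [map_sum, Finset.sum_mul]
    refine Finset.sum_congr rfl fun l _ => ?_
    rw [map_mul, conj_eK]; ring
  simp only [e]
  rw [integral_finsetSum _ fun l _ => ?_, Finset.mul_sum]
  · refine Finset.sum_congr rfl fun l _ => ?_
    rw [integral_const_mul, hterm]; ring
  · refine Integrable.const_mul (Integrable.of_bound
      ((continuous_eK _).mul (continuous_eK_tsum hb)).aestronglyMeasurable (∑' k, ‖b k‖)
      (ae_of_all _ fun θ => ?_)) _
    change ‖eK (-l) θ * ∑' k, eK k θ * b k‖ ≤ _
    rw [norm_mul, norm_eK, one_mul]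
    refine tsum_of_norm_bounded hb.hasSum fun k => ?_
    rw [norm_mul, norm_eK, one_mul]

end torus

/-! ### The Zak transform -/

section zak

open scoped ComplexConjugate

variable {d n : ℕ}

/-- The phase `e^{iy·θ}`. -/
def phz (θ y : Space d) : ℂ := Complex.exp (Complex.I * (inner ℝ y θ : ℂ))

/-- The Zak transform of a function. -/
def zk (f : Space d → ℝ) (θ y : Space d) : ℂ :=
  phz θ y * ∑' k : Lat d, eK k θ * (f (latPt k + y) : ℂ)

/-- Continuous functions that decay fast enough for lattice sums. -/
def Dec (f : Space d → ℝ) : Prop :=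
  Continuous f ∧ ∃ C : ℝ, 0 ≤ C ∧ ∀ x, |f x| ≤ C * wt 1 (-(d + 1)) x

lemma norm_phz (θ y : Space d) : ‖phz θ y‖ = 1 := Complex.norm_exp_I_mul_ofReal _

lemma phz_add (θ y z : Space d) : phz θ (y + z) = phz θ y * phz θ z := by
  rw [phz, phz, phz, ← Complex.exp_add, inner_add_left]
  push_cast
  rw [mul_add]

lemma tsum_eK_shift (θ : Space d) (F : Lat d → ℂ) (l : Lat d) :
    ∑' k, eK k θ * F (k + l) = eK (-l) θ * ∑' k, eK k θ * F k := by
  rw [← (Equiv.addRight l).tsum_eq fun k => eK k θ * F k, ← tsum_mul_left]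
  refine tsum_congr fun k => ?_
  change _ = eK (-l) θ * (eK (k + l) θ * F (k + l))
  rw [← mul_assoc, ← eK_add, add_comm k l, neg_add_cancel_left]

lemma zk_translate (g : Space d → ℝ) (θ y : Space d) (l : Lat d) :
    zk (fun x => g (x - latPt l)) θ y = eK l θ * zk g θ y := by
  have h := tsum_eK_shift θ (fun k => (g (latPt k + y) : ℂ)) (-l)
  rw [neg_neg] at h
  rw [zk, zk, mul_left_comm, ← h]
  congr 1
  refine tsum_congr fun k => ?_
  rw [latPt_add, latPt_neg]
  congr 4
  abel

lemma zk_mul_const (g : Space d → ℝ) (c : ℝ) (θ y : Space d) :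
    zk (fun x => g x * c) θ y = zk g θ y * c := by
  rw [zk, zk, mul_assoc, ← tsum_mul_right]
  simp only [Complex.ofReal_mul, mul_assoc]

lemma zk_periodic (g : Space d → ℝ) (θ y : Space d) (l : Lat d) :
    zk g θ (y + latPt l) = zk g θ y := by
  have h := tsum_eK_shift θ (fun k => (g (latPt k + y) : ℂ)) l
  have e : phz θ (latPt l) * eK (-l) θ = 1 := by
    rw [← conj_eK]
    change eK l θ * conj (eK l θ) = 1
    rw [Complex.mul_conj, Complex.normSq_eq_norm_sq, norm_eK]; simp
  have h2 : ∑' k : Lat d, eK k θ * (g (latPt k + (y + latPt l)) : ℂ) =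
      eK (-l) θ * ∑' k, eK k θ * (g (latPt k + y) : ℂ) := by
    rw [← h]
    refine tsum_congr fun k => ?_
    rw [latPt_add, add_right_comm, add_assoc]
  rw [zk, h2, phz_add, mul_assoc, ← mul_assoc (phz θ (latPt l)), e, one_mul, zk]

lemma conj_zk (g : Space d → ℝ) (θ y : Space d) : conj (zk g θ y) = zk g (-θ) y := by
  rw [zk, zk, map_mul, Complex.conj_tsum, phz, phz, ← Complex.exp_conj]
  congr 1
  · simp
  · refine tsum_congr fun k => ?_
    rw [map_mul, Complex.conj_ofReal, eK, eK, ← Complex.exp_conj]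
    simp

namespace Dec

variable {f g : Space d → ℝ}

lemma exists_bound (hg : Dec g) : ∃ C : ℝ, 0 ≤ C ∧ ∀ y : Space d,
    (Summable fun k : Lat d => ‖(g (latPt k + y) : ℂ)‖) ∧
      ∑' k : Lat d, ‖(g (latPt k + y) : ℂ)‖ ≤ C := by
  obtain ⟨-, C, hC0, hC⟩ := hg
  obtain ⟨K, hK, -⟩ := exists_lattice_sum_le d
  refine ⟨C * K, by positivity, fun y => ?_⟩
  have h1 : ∑' k : Lat d, ENNReal.ofReal (wt 1 (-(d + 1)) (-y - latPt k)) ≠ ⊤ :=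
    ((hK (-y)).trans_lt ENNReal.coe_lt_top).ne
  have h2 : Summable fun k : Lat d => wt 1 (-(d + 1)) (-y - latPt k) := by
    simpa [ENNReal.toReal_ofReal (wt_pos _ _ _).le] using ENNReal.summable_toReal h1
  have h3 : ∑' k : Lat d, wt 1 (-(d + 1)) (-y - latPt k) ≤ K := by
    have := ENNReal.toReal_mono ENNReal.coe_ne_top (hK (-y))
    rw [ENNReal.tsum_toReal_eq fun k => ENNReal.ofReal_ne_top] at this
    simpa [ENNReal.toReal_ofReal (wt_pos _ _ _).le] using this
  have h4 : ∀ k : Lat d, ‖(g (latPt k + y) : ℂ)‖ ≤ C * wt 1 (-(d + 1)) (-y - latPt k) := by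
    intro k
    rw [Complex.norm_real, Real.norm_eq_abs]
    refine (hC _).trans_eq ?_
    rw [wt, wt, show -y - latPt k = -(latPt k + y) by abel, norm_neg]
  have h5 := Summable.of_nonneg_of_le (fun _ => norm_nonneg _) h4 (h2.mul_left C)
  refine ⟨h5, (h5.tsum_le_tsum h4 (h2.mul_left C)).trans ?_⟩
  rw [tsum_mul_left]
  gcongr

lemma summable_eK (hg : Dec g) (θ y : Space d) :
    Summable fun k : Lat d => eK k θ * (g (latPt k + y) : ℂ) := by
  obtain ⟨C, -, h⟩ := hg.exists_bound
  refine Summable.of_norm ?_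
  simpa only [norm_mul, norm_eK, one_mul] using (h y).1

lemma exists_norm_zk_le (hg : Dec g) : ∃ C : ℝ, 0 ≤ C ∧ ∀ θ y : Space d, ‖zk g θ y‖ ≤ C := by
  obtain ⟨C, hC, h⟩ := hg.exists_bound
  refine ⟨C, hC, fun θ y => ?_⟩
  rw [zk, norm_mul, norm_phz, one_mul]
  refine le_trans (tsum_of_norm_bounded (h y).1.hasSum fun k => ?_) (h y).2
  rw [norm_mul, norm_eK, one_mul]

lemma measurable_zk (hg : Dec g) : Measurable (Function.uncurry (zk g)) := by
  have h1 : Measurable fun p : Space d × Space d => phz p.1 p.2 :=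
    Continuous.measurable (by unfold phz; fun_prop)
  have h2 : ∀ s : Finset (Lat d), Measurable fun p : Space d × Space d =>
      ∑ k ∈ s, eK k p.1 * (g (latPt k + p.2) : ℂ) := fun s =>
    (continuous_finsetSum s fun k _ => ((continuous_eK k).comp continuous_fst).mul
      (Complex.continuous_ofReal.comp (hg.1.comp (continuous_const.add continuous_snd)))).measurable
  have h3 : Measurable fun p : Space d × Space d =>
      ∑' k : Lat d, eK k p.1 * (g (latPt k + p.2) : ℂ) :=
    measurable_of_tendsto_metrizable' (Filter.atTop : Filter (Finset (Lat d))) h2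
      (tendsto_pi_nhds.2 fun p => (hg.summable_eK p.1 p.2).hasSum)
  exact h1.mul h3

lemma zk_sum {ι : Type*} {s : Finset ι} {F : ι → Space d → ℝ} (hF : ∀ i ∈ s, Dec (F i))
    (θ y : Space d) : zk (fun x => ∑ i ∈ s, F i x) θ y = ∑ i ∈ s, zk (F i) θ y := by
  simp only [zk]
  rw [← Finset.mul_sum, ← Summable.tsum_finsetSum fun i hi => (hF i hi).summable_eK θ y]
  simp only [Complex.ofReal_sum, Finset.mul_sum]

lemma sum {ι : Type*} {s : Finset ι} {F : ι → Space d → ℝ} (hF : ∀ i ∈ s, Dec (F i)) :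
    Dec fun x => ∑ i ∈ s, F i x := by
  choose! C hC0 hC using fun i hi => (hF i hi).2
  refine ⟨continuous_finsetSum s fun i hi => (hF i hi).1, ∑ i ∈ s, C i,
    Finset.sum_nonneg hC0, fun x => ?_⟩
  rw [Finset.sum_mul]
  exact (Finset.abs_sum_le_sum_abs _ _).trans (Finset.sum_le_sum fun i hi => hC i hi x)

lemma mul_const (hg : Dec g) (c : ℝ) : Dec fun x => g x * c := by
  obtain ⟨h, C, hC0, hC⟩ := hg
  refine ⟨h.mul continuous_const, C * |c|, by positivity, fun x => ?_⟩
  rw [abs_mul, mul_right_comm]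
  exact mul_le_mul_of_nonneg_right (hC x) (abs_nonneg c)

lemma translate (hg : Dec g) (l : Lat d) : Dec fun x => g (x - latPt l) := by
  obtain ⟨h, C, hC0, hC⟩ := hg
  refine ⟨h.comp (continuous_id.sub continuous_const), C * peetre (-(d + 1)) (-latPt l),
    mul_nonneg hC0 (peetre_pos _ _).le, fun x => (hC _).trans ?_⟩
  rw [mul_assoc]
  refine mul_le_mul_of_nonneg_left ?_ hC0
  have := wt_le_peetre_mul (ε := 1) (by norm_num) (-(d + 1)) (x - latPt l) x
  rwa [sub_sub_cancel_left] at this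

lemma of_schwartz (φ : SR d) : Dec φ := by
  refine ⟨φ.continuous, SchwartzMap.seminorm ℝ 0 0 (wmulR (d + 1) φ), apply_nonneg _ _, fun x => ?_⟩
  have h := SchwartzMap.norm_le_seminorm ℝ (wmulR (d + 1) φ) x
  rw [wmulR_apply, norm_mul, Real.norm_eq_abs, Real.norm_eq_abs, abs_of_pos (wt_pos _ _ _)] at h
  rw [wt_neg, ← div_eq_mul_inv, le_div_iff₀ (wt_pos _ _ _), mul_comm]
  exact h

lemma of_coupling {R : Space d → Vec n} (hR : CondR1 R) (i : Fin n) : Dec fun x => R x i := by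
  obtain ⟨C, hC⟩ := exists_decay hR (d + 1)
  refine ⟨?_, C, C.2, fun x => (PiLp.norm_apply_le (R x) i).trans (hC x)⟩
  have := hR.1.continuous
  fun_prop

end Dec

lemma exists_finset_zero {f : Space d → ℝ} (hf : HasCompactSupport f) (K : ℝ) :
    ∃ Λ : Finset (Lat d), ∀ y, ‖y‖ ≤ K → ∀ k ∉ Λ, f (latPt k + y) = 0 := by
  obtain ⟨r, hr⟩ := hf.isCompact.isBounded.subset_closedBall 0
  have h := (tendsto_norm_latPt (d := d)).eventually_gt_atTop (K + r)
  rw [Filter.eventually_cofinite] at h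
  refine ⟨h.toFinset, fun y hy k hk => ?_⟩
  rw [Set.Finite.mem_toFinset, Set.mem_ofPred_eq, not_not] at hk
  by_contra hne
  have h1 := hr (subset_tsupport f hne)
  rw [mem_closedBall_zero_iff] at h1
  have h2 : ‖latPt k‖ ≤ ‖latPt k + y‖ + ‖y‖ := by simpa using norm_sub_le (latPt k + y) y
  linarith

lemma zk_eq_sum {f : Space d → ℝ} {Λ : Finset (Lat d)} {y : Space d}
    (h : ∀ k ∉ Λ, f (latPt k + y) = 0) (θ : Space d) :
    zk f θ y = phz θ y * ∑ k ∈ Λ, eK k θ * (f (latPt k + y) : ℂ) := by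
  rw [zk, tsum_eq_sum fun k hk => by rw [h k hk, Complex.ofReal_zero, mul_zero]]

instance : IsFiniteMeasure (volume.restrict (cellO d)) :=
  ⟨by rw [Measure.restrict_apply_univ, volume_cellO]; exact ENNReal.one_lt_top⟩

lemma integrable_zk_mul {f g : Space d → ℝ} (hf : Dec f) (hg : Dec g) :
    Integrable (fun p : Space d × Space d => conj (zk f p.1 p.2) * zk g p.1 p.2)
        ((volume.restrict (cube d)).prod (volume.restrict (cellO d))) ∧
      ∀ θ, Integrable (fun y => conj (zk f θ y) * zk g θ y) (volume.restrict (cellO d)) := by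
  obtain ⟨A, hA0, hA⟩ := hf.exists_norm_zk_le
  obtain ⟨B, hB0, hB⟩ := hg.exists_norm_zk_le
  have hm : Measurable fun p : Space d × Space d => conj (zk f p.1 p.2) * zk g p.1 p.2 :=
    (Complex.continuous_conj.measurable.comp hf.measurable_zk).mul hg.measurable_zk
  have hb : ∀ θ y, ‖conj (zk f θ y) * zk g θ y‖ ≤ A * B := fun θ y => by
    rw [norm_mul, RCLike.norm_conj]
    exact mul_le_mul (hA θ y) (hB θ y) (norm_nonneg _) hA0
  exact ⟨Integrable.of_bound hm.aestronglyMeasurable _ (ae_of_all _ fun p => hb _ _), fun θ =>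
    Integrable.of_bound (hm.comp measurable_prodMk_left).aestronglyMeasurable _
      (ae_of_all _ fun y => hb θ y)⟩

/-- The Zak transform is unitary, up to normalization. -/
lemma integral_zk_mul {f g : Space d → ℝ} (hfc : HasCompactSupport f) (hf : Dec f) (hg : Dec g) :
    ∫ θ in cube d, ∫ y in cellO d, conj (zk f θ y) * zk g θ y =
      (((2 * Real.pi) ^ d * ∫ x, f x * g x : ℝ) : ℂ) := by
  obtain ⟨Λ, hΛ⟩ := exists_finset_zero hfc d
  rw [integral_integral_swap (integrable_zk_mul hf hg).1]
  have hcs : HasCompactSupport fun x => f x * g x := hfc.mul_right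
  have hfg : Integrable fun x => f x * g x := (hf.1.mul hg.1).integrable_of_hasCompactSupport hcs
  have hin : ∀ y ∈ cellO d, ∫ θ in cube d, conj (zk f θ y) * zk g θ y =
      (((2 * Real.pi) ^ d * ∑ l ∈ Λ, f (y + latPt l) * g (y + latPt l) : ℝ) : ℂ) := by
    intro y hy
    obtain ⟨C, -, hC⟩ := hg.exists_bound
    have hp := torus_parseval (Λ := Λ) (a := fun k => (f (latPt k + y) : ℂ)) (hC y).1
    have e : ∀ θ, conj (zk f θ y) * zk g θ y =
        conj (∑ l ∈ Λ, eK l θ * (f (latPt l + y) : ℂ)) *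
          ∑' k, eK k θ * (g (latPt k + y) : ℂ) := fun θ => by
      rw [zk_eq_sum (hΛ y (norm_le_of_mem_cellO hy)), zk, map_mul, mul_mul_mul_comm,
        ← Complex.normSq_eq_conj_mul_self, Complex.normSq_eq_norm_sq, norm_phz]
      simp
    simp only [e]
    rw [hp]
    push_cast
    congr 1
    refine Finset.sum_congr rfl fun l _ => ?_
    rw [Complex.conj_ofReal, add_comm y]
  rw [setIntegral_congr_fun measurableSet_cellO hin, integral_complex_ofReal, integral_const_mul,
    integral_finsetSum _ fun l _ => ?_]
  · congr 2
    have hs := hasSum_integral_cell hfg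
    rw [← hs.tsum_eq, tsum_eq_sum fun k hk => ?_]
    refine (setIntegral_congr_fun measurableSet_cellO fun y hy => ?_).trans (integral_zero _ _)
    change f (y + latPt k) * _ = 0
    rw [add_comm y, hΛ y (norm_le_of_mem_cellO hy) k hk, zero_mul]
  · exact ((measurePreserving_add_right volume (latPt l)).integrable_comp_of_integrable
      hfg).integrableOn

section smooth

variable {f : SR d}

lemma zk_eventuallyEq (hf : HasCompactSupport f) (θ y₀ : Space d) : ∃ Λ : Finset (Lat d),
    (∀ᶠ y in 𝓝 y₀, zk f θ y = phz θ y * ∑ k ∈ Λ, eK k θ * (f (latPt k + y) : ℂ)) ∧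
      ∀ᶠ y in 𝓝 y₀, ∀ k ∉ Λ, f (latPt k + y) = 0 := by
  obtain ⟨Λ, hΛ⟩ := exists_finset_zero hf (‖y₀‖ + 1)
  have h : ∀ᶠ y in 𝓝 y₀, ‖y‖ ≤ ‖y₀‖ + 1 :=
    (continuous_norm.tendsto y₀).eventually_le_const (by linarith)
  exact ⟨Λ, h.mono fun y hy => zk_eq_sum (hΛ y hy) θ, h.mono hΛ⟩

lemma contDiff_zk (hf : HasCompactSupport f) (θ : Space d) : ContDiff ℝ ∞ (zk f θ) := by
  refine contDiff_iff_contDiffAt.2 fun y₀ => ?_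
  obtain ⟨Λ, h, -⟩ := zk_eventuallyEq hf θ y₀
  refine ContDiffAt.congr_of_eventuallyEq (ContDiff.contDiffAt ?_) h
  have h1 : ∀ k : Lat d, ContDiff ℝ ∞ fun y : Space d => (f (latPt k + y) : ℂ) := fun k =>
    Complex.ofRealCLM.contDiff.comp (f.smooth'.comp (contDiff_const.add contDiff_id))
  have h2 : ContDiff ℝ ∞ (phz θ) := by
    have : ContDiff ℝ ∞ fun y : Space d => (inner ℝ y θ : ℂ) :=
      Complex.ofRealCLM.contDiff.comp (contDiff_id.inner ℝ contDiff_const)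
    exact (contDiff_const.mul this).cexp
  exact h2.mul (ContDiff.sum fun k _ => contDiff_const.mul (h1 k))

lemma hasCompactSupport_pdR (hf : HasCompactSupport f) (j : Fin d) :
    HasCompactSupport (pdR j f) := by
  rw [show (pdR j f : Space d → ℝ) = _ from funext (pdR_apply j f)]
  exact hf.fderiv_apply ℝ (basisVec j)

lemma magDeriv_zk (hf : HasCompactSupport f) (θ : Space d) (j : Fin d) (y : Space d) :
    magDeriv θ j (zk f θ) y = Complex.I * zk (pdR j f) θ y := by
  obtain ⟨Λ, h, h0⟩ := zk_eventuallyEq hf θ y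
  have hp : HasFDerivAt (phz θ) (phz θ y • Complex.I • Complex.ofRealCLM.comp (innerSL ℝ θ)) y := by
    have := ((Complex.ofRealCLM.comp (innerSL ℝ θ)).hasFDerivAt (x := y)).const_mul Complex.I |>.cexp
    simp only [ContinuousLinearMap.comp_apply, innerSL_apply_apply, real_inner_comm _ θ] at this
    exact this
  have hk k : HasFDerivAt (fun z => (f (latPt k + z) : ℂ))
      (Complex.ofRealCLM.comp (fderiv ℝ f (latPt k + y))) y :=
    Complex.ofRealCLM.hasFDerivAt.comp y
      ((hasFDerivAt_comp_add_left _).2 f.differentiableAt.hasFDerivAt)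
  have hd := (hp.mul (HasFDerivAt.fun_sum fun k _ => (hk k).const_mul (eK k θ)))
    |>.congr_of_eventuallyEq h
  have e2 := zk_eq_sum (f := pdR j f) (fun k hk => by
    have hz : (fun z => f (latPt k + z)) =ᶠ[𝓝 y] fun _ => 0 := h0.mono fun z hz => hz k hk
    rw [pdR_apply, ← fderiv_comp_add_left, hz.fderiv_eq]; simp) θ
  have hθ : inner ℝ θ (EuclideanSpace.single j (1 : ℝ)) = θ j := by
    simp [EuclideanSpace.inner_single_right]
  rw [magDeriv, hd.fderiv, e2, h.self_of_nhds]
  simp [pdR_apply, basisVec, hθ, sum_apply]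
  linear_combination (θ j : ℂ) * phz θ y * (∑ k ∈ Λ, eK k θ * f (latPt k + y)) * Complex.I_mul_I

lemma sum_magDeriv_zk {m : ℝ} (hm : 0 < m) (hf : HasCompactSupport f) (θ y : Space d) :
    ∑ j, magDeriv θ j (magDeriv θ j (zk f θ)) y + (m : ℂ) ^ 2 * zk f θ y = zk (hR d m f) θ y := by
  have h1 : ∀ j, magDeriv θ j (magDeriv θ j (zk f θ)) y = -zk (pdR j (pdR j f)) θ y := fun j => by
    have e : magDeriv θ j (zk f θ) = fun y => Complex.I * zk (pdR j f) θ y :=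
      funext (magDeriv_zk hf θ j)
    have h := magDeriv_zk (hasCompactSupport_pdR hf j) θ j y
    have hd : DifferentiableAt ℝ (zk (pdR j f) θ) y :=
      (contDiff_zk (hasCompactSupport_pdR hf j) θ).differentiable (by simp) y
    rw [e, magDeriv, fderiv_const_mul hd]
    rw [magDeriv] at h
    change Complex.I * (Complex.I * fderiv ℝ (zk (pdR j f) θ) y (EuclideanSpace.single j 1)) +
      (θ j : ℂ) * (Complex.I * zk (pdR j f) θ y) = _
    linear_combination Complex.I * h + zk (pdR j (pdR j f)) θ y * Complex.I_mul_I
  have h2 : (hR d m f : Space d → ℝ) = fun x => ∑ o : Option (Fin d),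
      o.elim (f x * m ^ 2) fun j => pdR j (pdR j f) x * (-1) := by
    funext x
    rw [hR_apply hm, Fintype.sum_option]
    simp only [Option.elim, mul_neg, mul_one, Finset.sum_neg_distrib]
    ring
  have h3 := Dec.zk_sum (s := Finset.univ) (F := fun (o : Option (Fin d)) x =>
    o.elim (f x * m ^ 2) fun j => pdR j (pdR j f) x * (-1)) (fun o _ => by
      cases o
      · exact (Dec.of_schwartz f).mul_const _
      · exact (Dec.of_schwartz _).mul_const _) θ y
  rw [h2, h3, Fintype.sum_option]
  simp only [Option.elim, zk_mul_const, h1]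
  push_cast
  simp only [mul_neg, mul_one, Finset.sum_neg_distrib]
  ring

end smooth

end zak

/-! ### Coercivity of the Hamiltonian from the Bloch decomposition -/

section coercive

open scoped ComplexConjugate

variable {d n : ℕ}

lemma isCompact_box (a : ℝ) : IsCompact {y : Space d | ∀ i, y i ∈ Set.Icc 0 a} := by
  convert (isCompact_univ_pi fun _ : Fin d => isCompact_Icc (a := (0 : ℝ)) (b := a)).image
    (PiLp.continuous_toLp 2 _)
  ext y
  exact ⟨fun h => ⟨y.ofLp, fun i _ => h i, rfl⟩, by rintro ⟨x, hx, rfl⟩ i; exact hx i trivial⟩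

/-- The Bloch transform of a component of a finite sequence. -/
def wK (S : Finset (Lat d)) (u : Lat d → Vec n) (θ : Space d) (i : Fin n) : ℂ :=
  ∑ l ∈ S, eK l θ * (u l i : ℂ)

lemma continuous_wK (S : Finset (Lat d)) (u : Lat d → Vec n) (i : Fin n) :
    Continuous fun θ => wK S u θ i :=
  continuous_finsetSum _ fun l _ => (continuous_eK l).mul continuous_const

/-- The coupling term generated by a finite sequence. -/
def coupFn (R : Space d → Vec n) (S : Finset (Lat d)) (u : Lat d → Vec n) (x : Space d) : ℝ :=
  ∑ l ∈ S, ∑ i, R (x - latPt l) i * u l i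

variable {R : Space d → Vec n}

lemma dec_coupFn (hR : CondR1 R) (S : Finset (Lat d)) (u : Lat d → Vec n) : Dec (coupFn R S u) :=
  Dec.sum fun l _ => Dec.sum fun i _ => ((Dec.of_coupling hR i).translate l).mul_const _

lemma zk_coupFn (hR : CondR1 R) (S : Finset (Lat d)) (u : Lat d → Vec n) (θ y : Space d) :
    zk (coupFn R S u) θ y = ∑ i, zakR R θ y i * wK S u θ i := by
  have hd : ∀ (l : Lat d) (i : Fin n), Dec fun x => R (x - latPt l) i * u l i := fun l i =>
    ((Dec.of_coupling hR i).translate l).mul_const _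
  have h1 : zk (coupFn R S u) θ y = ∑ l ∈ S, ∑ i, zk (fun x => R (x - latPt l) i * u l i) θ y := by
    refine (Dec.zk_sum (fun l _ => Dec.sum fun i _ => hd l i) θ y).trans ?_
    exact Finset.sum_congr rfl fun l _ => Dec.zk_sum (fun i _ => hd l i) θ y
  rw [h1, Finset.sum_comm]
  refine Finset.sum_congr rfl fun i _ => ?_
  rw [wK, Finset.mul_sum]
  refine Finset.sum_congr rfl fun l _ => ?_
  rw [zk_mul_const (fun x => R (x - latPt l) i), zk_translate (fun x => R x i)]
  change eK l θ * zakR R θ y i * _ = _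
  ring

variable {m ν : ℝ} {ψ : SR d}

lemma re_blochForm (hR : CondR1 R) (hm : 0 < m) (hψ : HasCompactSupport ψ) (S : Finset (Lat d))
    (u : Lat d → Vec n) (θ : Space d) :
    (blochForm m ν R θ (zk ψ θ) (wK S u θ)).re =
      (∫ y in cellO d, conj (zk ψ θ y) * zk (FieldCrystal.hR d m ψ) θ y).re +
        2 * (∫ y in cellO d, conj (zk ψ θ y) * zk (coupFn R S u) θ y).re +
        ∑ i, (conj (wK S u θ i) * ((omegaStarSq ν θ : ℂ) * wK S u θ i)).re := by
  have hD := Dec.of_schwartz ψ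
  have hi := (integrable_zk_mul hD (Dec.of_schwartz (FieldCrystal.hR d m ψ))).2 θ
  have hc := (integrable_zk_mul hD (dec_coupFn hR S u)).2 θ
  have hr : ∀ i, Integrable (fun y => conj (zk ψ θ y) * zakR R θ y i) (volume.restrict (cellO d)) :=
    fun i => (integrable_zk_mul hD (Dec.of_coupling hR i)).2 θ
  have h1 : ∫ y in cell d, conj (zk ψ θ y) * blochField m R θ (zk ψ θ) (wK S u θ) y =
      (∫ y in cellO d, conj (zk ψ θ y) * zk (FieldCrystal.hR d m ψ) θ y) +
        ∫ y in cellO d, conj (zk ψ θ y) * zk (coupFn R S u) θ y := by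
    rw [setIntegral_congr_set cell_ae_eq_cellO, ← integral_add hi hc]
    refine integral_congr_ae (ae_of_all _ fun y => ?_)
    simp only
    rw [blochField, sum_magDeriv_zk hm hψ, zk_coupFn hR, mul_add]
  have h2 : ∑ i, conj (wK S u θ i) * (∫ y in cell d, zakR R (-θ) y i * zk ψ θ y) =
      conj (∫ y in cellO d, conj (zk ψ θ y) * zk (coupFn R S u) θ y) := by
    have e : ∫ y in cellO d, conj (zk ψ θ y) * zk (coupFn R S u) θ y =
        ∑ i, wK S u θ i * ∫ y in cellO d, conj (zk ψ θ y) * zakR R θ y i := by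
      simp only [← integral_const_mul]
      rw [← integral_finsetSum _ fun i _ => (hr i).const_mul _]
      refine integral_congr_ae (ae_of_all _ fun y => ?_)
      simp only
      rw [zk_coupFn hR, Finset.mul_sum]
      exact Finset.sum_congr rfl fun i _ => by ring
    rw [e, map_sum]
    refine Finset.sum_congr rfl fun i _ => ?_
    rw [map_mul, ← integral_conj, setIntegral_congr_set cell_ae_eq_cellO]
    congr 1
    refine integral_congr_ae (ae_of_all _ fun y => ?_)
    simp only [map_mul, Complex.conj_conj]
    rw [show conj (zakR R θ y i) = zakR R (-θ) y i from conj_zk (fun x => R x i) θ y, mul_comm]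
  rw [blochForm, h1]
  simp only [blochLattice, mul_add, Finset.sum_add_distrib]
  rw [h2]
  simp only [Complex.add_re, Complex.conj_re, Complex.re_sum]
  ring

lemma hasSum_wK {S : Finset (Lat d)} {u : Ell2 d n} (hu : ∀ k ∉ S, u k = 0) (i : Fin n)
    (θ : Space d) : HasSum (fun k => eK k θ * (u k i : ℂ)) (wK S u θ i) :=
  hasSum_sum_of_ne_finset_zero fun k hk => by simp [hu k hk]

lemma integral_conj_wK_mul {S : Finset (Lat d)} (u : Lat d → Vec n) (i : Fin n) {b : Lat d → ℝ}
    {F : Space d → ℂ} (h : ∀ θ, HasSum (fun k => eK k θ * (b k : ℂ)) (F θ)) :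
    ∫ θ in cube d, conj (wK S u θ i) * F θ =
      (((2 * Real.pi) ^ d * ∑ l ∈ S, u l i * b l : ℝ) : ℂ) := by
  have hp := torus_parseval (Λ := S) (a := fun k => (u k i : ℂ)) (b := fun k => (b k : ℂ))
    (by simpa only [norm_mul, norm_eK, one_mul] using (h 0).summable.norm)
  simp only [(h _).tsum_eq] at hp
  exact hp.trans (by simp)

lemma omega_mul_wK (ε : Eps) {S : Finset (Lat d)} {u : Ell2 d n} (hu : ∀ k ∉ S, u k = 0)
    (θ : Space d) (i : Fin n) :
    HasSum (fun k => eK k θ * ((-(latL d n ν ε 0 u k i) : ℝ) : ℂ))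
      ((omegaStarSq ν θ : ℂ) * wK S u θ i) := by
  have h0 := hasSum_wK hu i θ
  have hs : ∀ l : Lat d, HasSum (fun k => eK k θ * (u (k + l) i : ℂ))
      (eK (-l) θ * wK S u θ i) := fun l => by
    have h1 : Summable fun k => eK k θ * (u (k + l) i : ℂ) := by
      have h2 := h0.summable.norm
      simp only [norm_mul, norm_eK, one_mul] at h2
      refine Summable.of_norm ?_
      simp only [norm_mul, norm_eK, one_mul]
      exact h2.comp_injective (add_left_injective l)
    have h3 := h1.hasSum
    rwa [tsum_eK_shift θ (fun k => (u k i : ℂ)) l, h0.tsum_eq] at h3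
  have ht := (hasSum_sum (s := Finset.univ) fun j (_ : j ∈ Finset.univ) =>
    ((h0.mul_left 2).sub (hs (latE j))).sub (hs (-latE j))).add (h0.mul_left ((ν : ℂ) ^ 2))
  have e1 : ∀ j, eK (latE j) θ + eK (-latE j) θ = 2 * Complex.cos (θ j) := fun j => by
    have : (inner ℝ (latPt (latE j)) θ : ℝ) = θ j := by
      have h : latPt (latE j) = EuclideanSpace.single j (1 : ℝ) := by
        ext i
        rw [latPt_apply]
        by_cases h : i = j
        · subst h; simp
        · simp [h]
      rw [h, EuclideanSpace.inner_single_left]; simp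
    rw [← conj_eK, eK, this, ← Complex.exp_conj, Complex.cos]
    simp only [map_mul, Complex.conj_I, Complex.conj_ofReal]
    ring_nf
  have ef : (fun k => eK k θ * ((-(latL d n ν ε 0 u k i) : ℝ) : ℂ)) = fun k =>
      ∑ j, (2 * (eK k θ * (u k i : ℂ)) - eK k θ * (u (k + latE j) i : ℂ) -
        eK k θ * (u (k + -latE j) i : ℂ)) + (ν : ℂ) ^ 2 * (eK k θ * (u k i : ℂ)) := by
    funext k
    have hk : latL d n ν ε 0 u k i = ∑ j : Fin d, (u (k + latE j) i + u (k + -latE j) i -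
        2 * u k i) - ν ^ 2 * u k i := by
      rw [latL_apply]
      simp only [cf_zero, one_smul]
      simp
    rw [hk]
    push_cast
    rw [neg_sub, mul_sub, Finset.mul_sum, sub_eq_add_neg, ← Finset.sum_neg_distrib, add_comm]
    congr 1
    · exact Finset.sum_congr rfl fun j _ => by ring
    · ring
  have ev : (omegaStarSq ν θ : ℂ) * wK S u θ i = ∑ j, (2 * wK S u θ i -
      eK (-latE j) θ * wK S u θ i - eK (- -latE j) θ * wK S u θ i) + (ν : ℂ) ^ 2 * wK S u θ i := by
    rw [omegaStarSq]
    push_cast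
    rw [add_mul, Finset.sum_mul]
    congr 1
    refine Finset.sum_congr rfl fun j _ => ?_
    rw [neg_neg]
    linear_combination wK S u θ i * e1 j
  rw [ef, ev]
  exact ht

lemma inner_ell2_eq {u v : Ell2 d n} {S : Finset (Lat d)} (hu : ∀ k ∉ S, u k = 0) :
    inner ℝ u v = ∑ i, ∑ l ∈ S, u l i * v l i := by
  rw [lp.inner_eq_tsum, tsum_eq_sum (s := S) fun k hk => by rw [hu k hk, inner_zero_left],
    Finset.sum_comm]
  refine Finset.sum_congr rfl fun l _ => ?_
  rw [PiLp.inner_apply]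
  exact Finset.sum_congr rfl fun i _ => by simp [mul_comm]

lemma coupOp_ae_eq (hR : CondR1 R) (ε : Eps) {u : Ell2 d n} {S : Finset (Lat d)}
    (hu : ∀ k ∉ S, u k = 0) : coupOp R ε 0 u =ᵐ[volume] coupFn R S u := by
  obtain ⟨C, _, hC⟩ := exists_latKer_coupKer hR 0
  filter_upwards [coeFn_latOp (hC ε).1 u] with x hx
  rw [coupOp, hx, tsum_eq_sum (s := S) fun k hk => by rw [hu k hk, inner_zero_right], coupFn]
  refine Finset.sum_congr rfl fun l _ => ?_
  rw [coupKer, cf_zero, one_smul, PiLp.inner_apply]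
  exact Finset.sum_congr rfl fun i _ => by simp [mul_comm]

lemma norm_sLp_sq (φ : SR d) : ‖sLp φ‖ ^ 2 = ∫ x, φ x * φ x := by
  rw [← real_inner_self_eq_norm_sq, inner_sLp]
  refine integral_congr_ae ?_
  filter_upwards [coeFn_sLp φ] with x hx
  rw [hx]

lemma coercive_of_compact (hR : CondR1 R) (hm : 0 < m) {κ : ℝ}
    (hκ : ∀ θ : Space d, (∀ i, θ i ∈ Set.Icc 0 (2 * Real.pi)) →
      ∀ (φ : Space d → ℂ) (w : Fin n → ℂ), ContDiff ℝ ∞ φ →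
      (∀ (y : Space d) (k : Lat d), φ (y + latPt k) = φ y) →
      κ ^ 2 * ((∫ y in cell d,
          (‖φ y‖ ^ 2 + ∑ j, ‖fderiv ℝ φ y (EuclideanSpace.single j 1)‖ ^ 2)) + ∑ i, ‖w i‖ ^ 2)
        ≤ (blochForm m ν R θ φ w).re)
    (ε : Eps) (hψ : HasCompactSupport ψ) {u : Ell2 d n} {S : Finset (Lat d)}
    (hu : ∀ k ∉ S, u k = 0) :
    κ ^ 2 * (‖sLp ψ‖ ^ 2 + ‖u‖ ^ 2) ≤ (∫ x, ψ x * FieldCrystal.hR d m ψ x) +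
      2 * inner ℝ (sLp ψ) (coupOp R ε 0 u) - inner ℝ u (latL d n ν ε 0 u) := by
  have hD := Dec.of_schwartz ψ
  set H := FieldCrystal.hR d m ψ
  let T : (Space d → ℝ) → Space d → ℂ := fun g θ => ∫ y in cellO d, conj (zk ψ θ y) * zk g θ y
  have hre : ∀ {F : Space d → ℂ} {c : ℝ}, Integrable F (volume.restrict (cube d)) →
      ∫ θ in cube d, F θ = c → Integrable (fun θ => (F θ).re) (volume.restrict (cube d)) ∧
        ∫ θ in cube d, (F θ).re = c := fun hF h =>
    ⟨hF.re, by simpa [h] using Complex.reCLM.integral_comp_comm hF⟩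
  have hT : ∀ {g}, Dec g → _ := fun {g} hg =>
    hre (F := T g) (integrable_zk_mul hD hg).1.integral_prod_left (integral_zk_mul hψ hD hg)
  have hcont : ∀ {F : Space d → ℂ}, Continuous F → Integrable F (volume.restrict (cube d)) :=
    fun hF => hF.locallyIntegrable.integrableOn_isCompact (isCompact_box _)
  have hw := fun i => continuous_wK S (u : Lat d → Vec n) i
  have hom : Continuous fun θ : Space d => (omegaStarSq ν θ : ℂ) := by unfold omegaStarSq; fun_prop
  have hV := fun i => hre (hcont ((Complex.continuous_conj.comp (hw i)).mul (hw i)))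
    (integral_conj_wK_mul u i (hasSum_wK hu i))
  have hW := fun i => hre (hcont ((Complex.continuous_conj.comp (hw i)).mul (hom.mul (hw i))))
    (integral_conj_wK_mul u i fun θ => omega_mul_wK (ν := ν) ε hu θ i)
  have hH := hT (Dec.of_schwartz H)
  have hG := hT (dec_coupFn hR S u)
  have hsW := integrable_finsetSum Finset.univ fun i (_ : i ∈ Finset.univ) => (hW i).1
  have hsV := integrable_finsetSum Finset.univ fun i (_ : i ∈ Finset.univ) => (hV i).1
  have hi1 := hH.1.add (hG.1.const_mul 2)
  have e1 := integral_sub (hi1.add hsW) (((hT hD).1.add hsV).const_mul (κ ^ 2))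
  have e2 := integral_add hi1 hsW
  have e3 := integral_add hH.1 (hG.1.const_mul 2)
  have e4 := integral_add (hT hD).1 hsV
  simp only [Pi.add_apply] at e1 e2 e3 e4
  rw [e2, e3, integral_const_mul, integral_const_mul, e4, integral_finsetSum _ fun i _ => (hW i).1,
    integral_finsetSum _ fun i _ => (hV i).1, hH.2, hG.2, (hT hD).2] at e1
  simp only [hV, hW, ← Finset.mul_sum] at e1
  have hpos : (0 : ℝ) ≤ _ := (setIntegral_nonneg measurableSet_cube fun θ hθ => ?_).trans_eq e1
  · have e5 : inner ℝ (sLp ψ) (coupOp R ε 0 u) = ∫ x, ψ x * coupFn R S u x := by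
      rw [inner_sLp]
      refine integral_congr_ae ?_
      filter_upwards [coupOp_ae_eq hR ε hu] with x hx
      rw [hx]
    rw [norm_sLp_sq, e5, ← real_inner_self_eq_norm_sq, inner_ell2_eq hu, inner_ell2_eq hu]
    simp only [mul_neg, Finset.sum_neg_distrib] at hpos
    refine sub_nonneg.1 (nonneg_of_mul_nonneg_right (a := (2 * Real.pi) ^ d) ?_ (by positivity))
    linarith
  have h := hκ θ hθ (zk ψ θ) (wK S u θ) (contDiff_zk hψ θ) fun y k => zk_periodic ψ θ y k
  rw [re_blochForm hR hm hψ] at h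
  have hφ := contDiff_zk hψ θ
  have hφc := hφ.continuous
  have hf : Continuous (fderiv ℝ (zk ψ θ)) := hφ.continuous_fderiv (by simp)
  have hi : ∀ {F : Space d → ℝ}, Continuous F → Integrable F (volume.restrict (cell d)) :=
    fun hF => hF.locallyIntegrable.integrableOn_isCompact (isCompact_box _)
  have hT0 : (T ψ θ).re = ∫ y in cell d, ‖zk ψ θ y‖ ^ 2 := by
    rw [setIntegral_congr_set cell_ae_eq_cellO, ← Complex.ofReal_re (∫ _ in _, _),
      ← integral_complex_ofReal]
    simp only [T, Complex.conj_mul', Complex.ofReal_pow]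
  have hle : (T ψ θ).re ≤ ∫ y in cell d, (‖zk ψ θ y‖ ^ 2 +
      ∑ j, ‖fderiv ℝ (zk ψ θ) y (EuclideanSpace.single j 1)‖ ^ 2) :=
    hT0.trans_le (integral_mono (hi (by fun_prop)) (hi (by fun_prop)) fun y =>
      le_add_of_nonneg_right (by positivity))
  refine sub_nonneg.2 (le_trans (mul_le_mul_of_nonneg_left (add_le_add hle
    (Finset.sum_le_sum fun i _ => le_of_eq ?_)) (sq_nonneg κ)) h)
  change (conj (wK S u θ i) * wK S u θ i).re = _
  rw [Complex.conj_mul', ← Complex.ofReal_pow, Complex.ofReal_re]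

lemma integral_mul_hR (hm : 0 < m) (ψ : SR d) :
    ∫ x, ψ x * FieldCrystal.hR d m ψ x = ∑ j, ‖sLp (pdR j ψ)‖ ^ 2 + m ^ 2 * ‖sLp ψ‖ ^ 2 := by
  have hp : ∀ j, ∫ x, ψ x * pdR j (pdR j ψ) x = -‖sLp (pdR j ψ)‖ ^ 2 := fun j => by
    rw [norm_sLp_sq]
    exact SchwartzMap.integral_mul_lineDerivOp_right_eq_neg_left ψ (pdR j ψ) _
  have e : ∀ x, ψ x * FieldCrystal.hR d m ψ x =
      m ^ 2 * (ψ x * ψ x) - ∑ j, ψ x * pdR j (pdR j ψ) x := fun x => by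
    rw [hR_apply hm, mul_sub, Finset.mul_sum]; ring
  simp only [e]
  rw [integral_sub ((integrable_schwartz_mul ψ ψ).const_mul _)
    (integrable_finsetSum _ fun j _ => integrable_schwartz_mul _ _), integral_const_mul,
    integral_finsetSum _ fun j _ => integrable_schwartz_mul _ _]
  simp only [hp, ← norm_sLp_sq, Finset.sum_neg_distrib]
  ring

/-- Coercivity of the Hamiltonian, without weights. -/
theorem exists_coercive (hR : CondR1 R) (hR2 : CondR2 m ν R) (hm : 0 < m) : ∃ κ : ℝ, 0 < κ ∧
    ∀ (ε : Eps) (ψ : SR d) (u : Ell2 d n), κ * (‖sLp ψ‖ ^ 2 + ‖u‖ ^ 2) ≤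
      ∑ j, ‖sLp (pdR j ψ)‖ ^ 2 + m ^ 2 * ‖sLp ψ‖ ^ 2 + 2 * inner ℝ (sLp ψ) (coupOp R ε 0 u) -
        inner ℝ u (latL d n ν ε 0 u) := by
  obtain ⟨κ, hκ0, hκ⟩ := hR2
  refine ⟨κ ^ 2, by positivity, fun ε ψ u => ?_⟩
  have hpd : ∀ j : Fin d, Continuous fun φ : SR d => pdR j φ := fun j =>
    (LineDeriv.lineDerivOpCLM ℝ (SR d) (basisVec j : Space d)).continuous
  have hs : Continuous (sLp : SR d → L2 d) := sLp.continuous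
  let Q (ψ : SR d) (v : Ell2 d n) : Prop :=
    κ ^ 2 * (‖sLp ψ‖ ^ 2 + ‖v‖ ^ 2) ≤ ∑ j, ‖sLp (pdR j ψ)‖ ^ 2 + m ^ 2 * ‖sLp ψ‖ ^ 2 +
      2 * inner ℝ (sLp ψ) (coupOp R ε 0 v) - inner ℝ v (latL d n ν ε 0 v)
  have hsum := lp.hasSum_single (E := fun _ : Lat d => Vec n) (p := 2) (by norm_num) u
  refine IsClosed.mem_of_tendsto (s := {v | Q ψ v}) (isClosed_le (by fun_prop) (by fun_prop)) hsum
    (.of_forall fun S => IsClosed.mem_of_tendsto (s := {φ | Q φ _})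
      (isClosed_le (by fun_prop) (by fun_prop)) (tendsto_cut ψ) (.of_forall fun N => ?_))
  have := coercive_of_compact hR hm hκ ε (hasCompactSupport_cut N ψ) (S := S)
    (u := ∑ k ∈ S, lp.single 2 k (u k)) fun k hk => by
      rw [lp.coeFn_sum, Finset.sum_apply]
      exact Finset.sum_eq_zero fun l hl => lp.single_apply_ne _ _ _ (by rintro rfl; exact hk hl)
  rwa [integral_mul_hR hm] at this

end coercive

/-! ### The weighted energy of the coupled system -/

section energy

variable {d n : ℕ} {α m ν : ℝ} {R : Space d → Vec n}

local notation "ρ" => ratOp d α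
local notation "Aα" => opA d α
local notation "S₁" => coupOp R Eps.one
local notation "L₁" => latL d n ν Eps.one

lemma rat_mul_cf (ε : Eps) (x z : Space d) :
    rat α ε x * cf Eps.one α x z = cf ε α x z * rat α ε z := by
  have h4 := wt_ne_zero 1 α x
  have h5 := wt_ne_zero ε α z
  simp only [cf, rat, wt_neg, Eps.one]
  field_simp

lemma latL_zero (ε : Eps) : latL d n ν ε 0 = L₁ 0 := by
  ext1 u; ext1; funext k
  simp only [latL_apply, cf_zero]

lemma coupOp_zero (ε : Eps) : coupOp R ε 0 = S₁ 0 := by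
  unfold coupOp
  congr 1
  funext x k
  rw [coupKer, coupKer, cf_zero, cf_zero]

lemma inner_latL (u v : Ell2 d n) :
    inner ℝ u (L₁ 0 v) = inner ℝ (L₁ 0 u) v := by
  have hs : ∀ l : Lat d, ∀ hl : ‖latPt l‖ = 1, ∀ u v : Ell2 d n,
      inner ℝ u (shiftOp n Eps.one 0 l v) = inner ℝ (shiftOp n Eps.one 0 (-l) u) v := by
    intro l hl u v
    have hl' : ‖latPt (-l)‖ = 1 := by rw [latPt_neg, norm_neg, hl]
    rw [lp.inner_eq_tsum, lp.inner_eq_tsum, ← (Equiv.addRight l).tsum_eq fun k =>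
      inner ℝ (shiftOp n Eps.one 0 (-l) u k) (v k)]
    refine tsum_congr fun k => ?_
    change _ = inner ℝ (shiftOp n Eps.one 0 (-l) u (k + l)) (v (k + l))
    rw [shiftOp_apply _ _ hl, shiftOp_apply _ _ hl', cf_zero, cf_zero, one_smul, one_smul,
      add_neg_cancel_right]
  simp only [latL, sub_apply, sum_apply, add_apply, smul_apply, ContinuousLinearMap.id_apply,
    inner_sub_left, inner_sub_right, sum_inner, inner_sum, inner_add_left, inner_add_right,
    real_inner_smul_left, real_inner_smul_right]
  congr 1
  refine Finset.sum_congr rfl fun j _ => ?_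
  rw [hs _ (norm_latPt_latE j), hs _ (norm_latPt_neg_latE j), neg_neg]
  ring

lemma hasDerivAt_opA {y : ℝ → XF d n} (hc : Continuous y) (h : CoordEqs m ν R α y) (t : ℝ) :
    HasDerivAt (fun s => Aα (y s).1.1) (y t).1.2 t := by
  have hZ : Continuous fun s => (y s).1.2 := by fun_prop
  have hD : ∀ t, HasDerivAt (fun t => ∫ s in (0 : ℝ)..t, (y s).1.2) (y t).1.2 t := fun t =>
    intervalIntegral.integral_hasDerivAt_right (hZ.intervalIntegrable 0 t)
      hZ.stronglyMeasurable.stronglyMeasurableAtFilter hZ.continuousAt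
  have key : ∀ t, Aα (y t).1.1 - Aα (y 0).1.1 - ∫ s in (0 : ℝ)..t, (y s).1.2 = 0 := by
    intro t
    refine eq_zero_of_inner_dT (α := α) fun ξ => ?_
    have hd : ∀ t, HasDerivAt (fun t => inner ℝ (dT α ξ) (Aα (y t).1.1 - Aα (y 0).1.1 -
        ∫ s in (0 : ℝ)..t, (y s).1.2)) (0 : ℝ) t := fun t => by
      have h1 := h.field (ξ, 0) t
      have h2 := (hD t).map (innerSL ℝ (dT α ξ))
      have h3 := (h1.sub_const (inner ℝ (dT α ξ) (Aα (y 0).1.1))).fun_sub h2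
      simp only [tF_apply, genD, pertB_apply, map_zero, inner_zero_left, inner_zero_right, neg_zero,
        add_zero, zero_add, innerSL_apply_apply, sub_self] at h3
      simpa only [inner_sub_right] using h3
    have hcst := is_const_of_deriv_eq_zero (fun t => (hd t).differentiableAt)
      (fun t => (hd t).deriv) t 0
    simpa using hcst
  have e : (fun s => Aα (y s).1.1) = fun s => Aα (y 0).1.1 +
      ∫ r in (0 : ℝ)..s, (y r).1.2 := funext fun s => by
    have := key s
    rw [sub_sub, sub_eq_zero] at this
    exact this
  rw [e]
  exact (hD t).const_add _

variable [Fact (α < -(d : ℝ) / 2)]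

/-- Multiplication by `⟨εk⟩^α ⟨k⟩^{-α}` on sequences. -/
def latRat (d n : ℕ) (α : ℝ) [Fact (α < -(d : ℝ) / 2)] (ε : Eps) : Ell2 d n →L[ℝ] Ell2 d n :=
  wShift (Equiv.refl _) (fun k => rat α ε (latPt k)) (ratB α ε) fun _ => rat_le ε _

local notation "ϱ" => latRat d n α

lemma latRat_apply (ε : Eps) (u : Ell2 d n) (k : Lat d) :
    ϱ ε u k = rat α ε (latPt k) • u k := rfl

lemma ratOp_coupOp (hR : CondR1 R) (ε : Eps) (u : Ell2 d n) :
    ρ ε (S₁ α u) = coupOp R ε α (ϱ ε u) := by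
  obtain ⟨C, _, hC⟩ := exists_latKer_coupKer hR α
  ext1
  filter_upwards [coeFn_ratOp (α := α) ε (S₁ α u), coeFn_latOp (hC Eps.one).1 u,
    coeFn_latOp (hC ε).1 (ϱ ε u)] with x h1 h2 h3
  rw [h1, coupOp, h2, coupOp, h3, ← tsum_mul_left]
  refine tsum_congr fun k => ?_
  rw [latRat_apply, coupKer, coupKer, real_inner_smul_left, real_inner_smul_left,
    real_inner_smul_right, ← mul_assoc, ← mul_assoc, rat_mul_cf]

lemma latRat_latL (ε : Eps) (u : Ell2 d n) :
    ϱ ε (L₁ α u) = latL d n ν ε α (ϱ ε u) := by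
  ext1; funext k
  rw [latRat_apply, latL_apply, latL_apply, smul_sub, Finset.smul_sum]
  simp only [smul_sub, smul_add, smul_smul, latRat_apply, rat_mul_cf]
  simp only [mul_comm (rat α ε (latPt k))]

lemma latRat_adjoint (hR : CondR1 R) (ε : Eps) (f : L2 d) :
    ϱ ε ((S₁ (-α)).adjoint f) =
      (coupOp R ε (-α)).adjoint (ρ ε f) := by
  obtain ⟨C, _, hC⟩ := exists_latKer_coupKer hR (-α)
  have e : ∀ (δ : Eps) (x z : Space d), cf δ (-α) x z = cf δ α z x := fun δ x z => by
    rw [cf, cf, neg_neg, mul_comm]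
  ext1; funext k
  rw [latRat_apply, coupOp, coupOp, adjoint_latOp_apply (hC Eps.one).1,
    adjoint_latOp_apply (hC ε).1, ← integral_smul]
  refine integral_congr_ae ?_
  filter_upwards [coeFn_ratOp (α := α) ε f] with x hx
  rw [hx, coupKer, coupKer, e, e, smul_smul, smul_smul, smul_smul]
  congr 1
  linear_combination f x * rat_mul_cf (α := α) ε (latPt k) x

/-- The weighted norm of a state. -/
def wN (d n : ℕ) (α m : ℝ) [Fact (α < -(d : ℝ) / 2)] (ε : Eps) (y : XF d n) : ℝ :=
  fEn d α m ε y.1 + ‖latRat d n α ε y.2.1‖ ^ 2 + ‖latRat d n α ε y.2.2‖ ^ 2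

/-- The weighted energy of a state. -/
def wE (d n : ℕ) (α m ν : ℝ) [Fact (α < -(d : ℝ) / 2)] (R : Space d → Vec n) (ε : Eps)
    (y : XF d n) : ℝ :=
  fEn d α m ε y.1 + ‖latRat d n α ε y.2.2‖ ^ 2 -
    inner ℝ (latRat d n α ε y.2.1) (latL d n ν Eps.one 0 (latRat d n α ε y.2.1)) +
    2 * inner ℝ (ratOp d α ε (opA d α y.1.1)) (coupOp R Eps.one 0 (latRat d n α ε y.2.1))

open ContinuousLinearMap (fst snd)

lemma hasDerivAt_fEn (hm : 0 < m) (ε : Eps) {y : ℝ → XF d n}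
    (h : IsMild α m ν R y) (t : ℝ) :
    HasDerivAt (fun s => fEn d α m ε (y s).1) (fEnDot d α ε (y t).1 -
      2 * inner ℝ (ρ ε (y t).1.2) (ρ ε (S₁ α (y t).2.1))) t := by
  have hs : ∀ (A : XF d n →L[ℝ] L2 d) y, HasStrictFDerivAt (fun y => ‖A y‖ ^ 2)
      ((2 • innerSL ℝ (A y)).comp A) y := fun A y =>
    (hasStrictFDerivAt_norm_sq _).comp y A.hasStrictFDerivAt
  let p : XF d n →L[ℝ] L2 d := (fst ℝ _ _).comp (fst ℝ _ _)
  refine ((isC0Family_freeU d n α hm).hasDerivAt_perturbed (φ := fun y => fEn d α m ε y.1)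
    (b := fun y => fEnDot d α ε y.1)
    (fun y => ((hs ((ρ ε).comp ((snd ℝ _ _).comp (fst ℝ _ _))) y).add (.fun_sum fun j _ =>
      hs (((ρ ε).comp (opD d α j)).comp p) y)).add ((hs (((ρ ε).comp Aα).comp p) y).const_mul (m ^ 2)))
    (fun z t => hasDerivAt_fEn_W0 hm ε z.1 t) h t).congr_deriv ?_
  simp [p, pertB_apply]
  ring

lemma hasDerivAt_wE (hm : 0 < m) (hR : CondR1 R) (ε : Eps) {y : ℝ → XF d n} (hc : Continuous y)
    (h : IsMild α m ν R y) (t : ℝ) :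
    HasDerivAt (fun s => wE d n α m ν R ε (y s)) (fEnDot d α ε (y t).1 +
      2 * (inner ℝ (ϱ ε (y t).2.2)
          ((latL d n ν ε α - latL d n ν ε 0) (ϱ ε (y t).2.1)) -
        inner ℝ (ρ ε (y t).1.2)
          ((coupOp R ε α - coupOp R ε 0) (ϱ ε (y t).2.1)) -
        inner ℝ (ρ ε (Aα (y t).1.1))
          ((coupOp R ε (-α) - coupOp R ε 0) (ϱ ε (y t).2.2)))) t := by
  have h2 : HasDerivAt (fun s => (y s).2) (pertB α ν R (y t)).2 t := (h t).map (snd ℝ _ _)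
  have hu := h2.map ((ϱ ε).comp (fst ℝ _ _))
  have hv := h2.map ((ϱ ε).comp (snd ℝ _ _))
  have ha := (hasDerivAt_opA hc (h.coordEqs hm) t).map (ρ ε)
  have hLu := hu.map (L₁ 0)
  have hSu := hu.map (S₁ 0)
  have hE := (((hasDerivAt_fEn hm ε h t).fun_add hv.norm_sq).fun_sub (hu.inner ℝ hLu)).fun_add
    ((ha.inner ℝ hSu).const_mul 2)
  refine hE.congr_deriv ?_
  simp only [pertB_apply, ContinuousLinearMap.comp_apply, ContinuousLinearMap.coe_fst',
    ContinuousLinearMap.coe_snd', map_sub, ratOp_coupOp hR, latRat_latL,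
    latRat_adjoint hR, inner_sub_right, sub_apply, latL_zero ε,
    coupOp_zero ε, ContinuousLinearMap.adjoint_inner_right]
  rw [inner_latL (ϱ ε (y t).2.1), real_inner_comm (ϱ ε (y t).2.2)
    (L₁ 0 (ϱ ε (y t).2.1)),
    real_inner_comm (ρ ε (Aα (y t).1.1)) (coupOp R ε (-α) _)]
  ring

end energy

section energyBounds

variable {d n : ℕ} {α m ν : ℝ} {R : Space d → Vec n} [Fact (α < -(d : ℝ) / 2)]

local notation "ρ" => ratOp d α
local notation "ϱ" => latRat d n α
local notation "Aα" => opA d α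
local notation "Dα" => opD d α
local notation "S₁" => coupOp R Eps.one
local notation "L₁" => latL d n ν Eps.one
local notation "𝓝ₘ" => wN d n α m

lemma exists_coercive_weighted (hR : CondR1 R) (hR2 : CondR2 m ν R) (hm : 0 < m) :
    ∃ κ : ℝ, 0 < κ ∧ ∀ (ε : Eps) (f : L2 d) (u : Ell2 d n),
      κ * (‖ρ ε (Aα f)‖ ^ 2 + ‖u‖ ^ 2) ≤
        ∑ j, ‖ρ ε (Dα j f) + dratOp d α ε j (Aα f)‖ ^ 2 +
          m ^ 2 * ‖ρ ε (Aα f)‖ ^ 2 +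
          2 * inner ℝ (ρ ε (Aα f)) (S₁ 0 u) -
          inner ℝ u (L₁ 0 u) := by
  obtain ⟨κ, hκ0, hκ⟩ := exists_coercive hR hR2 hm
  refine ⟨κ, hκ0, fun ε f u => ?_⟩
  refine DenseRange.induction_on (denseRange_jPsi (d := d) α) f
    (isClosed_le (by fun_prop) (by fun_prop)) fun ψ => ?_
  let φ : SR d := SchwartzMap.smulLeftCLM ℝ (wt ε α : Space d → ℝ) ψ
  have hφ : ∀ x, φ x = wt ε α x * ψ x := SchwartzMap.smulLeftCLM_apply_apply (wt_growth _ _) ψ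
  have e1 : sLp φ = ρ ε (Aα (jPsi α ψ)) := by
    rw [opA_jPsi]
    ext1
    filter_upwards [coeFn_sLp φ, coeFn_ratOp_jPi (α := α) ε ψ] with x h1 h2
    rw [h1, h2, hφ]
  have e2 : ∀ j, sLp (pdR j φ) = ρ ε (Dα j (jPsi α ψ)) +
      dratOp d α ε j (Aα (jPsi α ψ)) := fun j => by
    rw [opA_jPsi, opD_jPsi]
    ext1
    filter_upwards [coeFn_sLp (pdR j φ), coeFn_ratOp_jPi (α := α) ε (pdR j ψ),
      coeFn_dratOp_jPi (α := α) ε j ψ, Lp.coeFn_add (ρ ε (jPi α (pdR j ψ)))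
        (dratOp d α ε j (jPi α ψ))] with x h1 h2 h3 h4
    rw [h1, h4, Pi.add_apply, h2, h3, pdR_apply, pdR_apply, funext hφ, fderiv_fun_mul
      (hasFDerivAt_wt ε α x).differentiableAt ψ.differentiableAt]
    simp [mul_comm]
  have h := hκ ε φ u
  simpa only [e1, e2, latL_zero ε, coupOp_zero ε] using h

lemma abs_two_inner_le {E F : Type*} [NormedAddCommGroup E] [InnerProductSpace ℝ E]
    [NormedAddCommGroup F] [NormedSpace ℝ F] (A : F →L[ℝ] E) {K : ℝ} (hA : ‖A‖ ≤ K) (x : E) (z : F) :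
    |2 * inner ℝ x (A z)| ≤ K * (‖x‖ ^ 2 + ‖z‖ ^ 2) := by
  rw [abs_mul, abs_two]
  have h1 := (abs_real_inner_le_norm x (A z)).trans
    (mul_le_mul_of_nonneg_left (A.le_of_opNorm_le hA z) (norm_nonneg x))
  have hK := (norm_nonneg A).trans hA
  nlinarith [mul_nonneg hK (sq_nonneg (‖x‖ - ‖z‖))]

lemma norm_ratOp_opA_sq_le (hm : 0 < m) (ε : Eps) (y : XF d n) :
    ‖ρ ε (Aα y.1.1)‖ ^ 2 ≤ (m ^ 2)⁻¹ * 𝓝ₘ ε y ∧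
      ‖ρ ε y.1.2‖ ^ 2 ≤ 𝓝ₘ ε y ∧ ‖ϱ ε y.2.1‖ ^ 2 ≤ 𝓝ₘ ε y ∧
      ‖ϱ ε y.2.2‖ ^ 2 ≤ 𝓝ₘ ε y := by
  have h1 : 0 ≤ ∑ j, ‖ρ ε (Dα j y.1.1)‖ ^ 2 := Finset.sum_nonneg fun j _ => sq_nonneg _
  have h2 : 0 ≤ m ^ 2 * ‖ρ ε (Aα y.1.1)‖ ^ 2 := by positivity
  have h3 := sq_nonneg ‖ρ ε y.1.2‖
  have h4 := sq_nonneg ‖ϱ ε y.2.1‖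
  have h5 := sq_nonneg ‖ϱ ε y.2.2‖
  have h6 : m ^ 2 * ‖ρ ε (Aα y.1.1)‖ ^ 2 ≤ 𝓝ₘ ε y := by rw [wN, fEn]; linarith
  refine ⟨?_, ?_, ?_, ?_⟩
  · rwa [inv_mul_eq_div, le_div_iff₀ (by positivity), mul_comm]
  all_goals rw [wN, fEn]; linarith

lemma exists_abs_deriv_wE_le (hm : 0 < m) (hR : CondR1 R) : ∃ K : ℝ, 0 ≤ K ∧
    ∀ (ε : Eps) (y : XF d n), |fEnDot d α ε y.1 + 2 * (inner ℝ (ϱ ε y.2.2)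
          ((latL d n ν ε α - latL d n ν ε 0) (ϱ ε y.2.1)) -
        inner ℝ (ρ ε y.1.2) ((coupOp R ε α - coupOp R ε 0) (ϱ ε y.2.1)) -
        inner ℝ (ρ ε (Aα y.1.1))
          ((coupOp R ε (-α) - coupOp R ε 0) (ϱ ε y.2.2)))| ≤ K * ε * 𝓝ₘ ε y := by
  obtain ⟨C₁, h₁⟩ := exists_norm_coupOp_sub_le hR α
  obtain ⟨C₂, h₂⟩ := exists_norm_coupOp_sub_le hR (-α)
  refine ⟨2 * |α| * (d + 1) + 2 * d * (|α| * shiftB α) * 2 + C₁ * 2 + C₂ * ((m ^ 2)⁻¹ + 1),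
    by positivity, fun ε y => ?_⟩
  have hε := ε.2.1
  have hN := norm_ratOp_opA_sq_le (α := α) hm ε y
  have g1 := abs_two_inner_le _ (norm_latL_sub_le ν ε α) (ϱ ε y.2.2) (ϱ ε y.2.1)
  have g2 := abs_two_inner_le _ (h₁ ε) (ρ ε y.1.2) (ϱ ε y.2.1)
  have g3 := abs_two_inner_le _ (h₂ ε) (ρ ε (Aα y.1.1)) (ϱ ε y.2.2)
  have g0 := abs_fEnDot_le (α := α) m ε y.1
  have hf : fEn d α m ε y.1 ≤ 𝓝ₘ ε y := by
    rw [wN]; linarith [sq_nonneg ‖ϱ ε y.2.1‖, sq_nonneg ‖ϱ ε y.2.2‖]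
  revert g0 g1 g2 g3 hN hf
  generalize inner ℝ (ϱ ε y.2.2) _ = a₁,
    inner ℝ (ρ ε y.1.2) _ = a₂,
    inner ℝ (ρ ε (Aα y.1.1)) _ = a₃,
    ‖ρ ε (Aα y.1.1)‖ ^ 2 = b₁,
    ‖ρ ε y.1.2‖ ^ 2 = b₂,
    ‖ϱ ε y.2.1‖ ^ 2 = b₃,
    ‖ϱ ε y.2.2‖ ^ 2 = b₄,
    fEnDot d α ε y.1 = a₀,
    𝓝ₘ ε y = N,
    fEn d α m ε y.1 = F
  rintro ⟨n1, n2, n3, n4⟩ g1 g2 g3 g0 hf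
  have k0 : 2 * |α| * (d + 1) * ε * F ≤ 2 * |α| * (d + 1) * ε * N := by gcongr
  have k1 := mul_le_mul_of_nonneg_left (add_le_add n4 n3)
    (by positivity : (0 : ℝ) ≤ ε * (2 * d * (|α| * shiftB α)))
  have k2 : ε * (C₁ : ℝ) * (b₂ + b₃) ≤ ε * C₁ * (N + N) := by gcongr
  have k3 : ε * (C₂ : ℝ) * (b₁ + b₄) ≤ ε * C₂ * ((m ^ 2)⁻¹ * N + N) := by gcongr
  rw [abs_le] at g0 g1 g2 g3 ⊢
  constructor <;> linarith

lemma exists_wN_le_wE (hR : CondR1 R) (hR2 : CondR2 m ν R) (hm : 0 < m) : ∃ ε₀ C : ℝ, 0 < ε₀ ∧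
    0 < C ∧ ∀ (ε : Eps) (y : XF d n), (ε : ℝ) ≤ ε₀ → 𝓝ₘ ε y ≤ C * wE d n α m ν R ε y := by
  obtain ⟨κ, hκ0, hκ⟩ := exists_coercive_weighted (α := α) hR hR2 hm
  set M : ℝ := ‖S₁ 0‖ + ‖L₁ 0‖ with hM
  have hM0 : 0 ≤ M := by positivity
  set c : ℝ := 2 * d * α ^ 2 with hc
  have hc0 : 0 ≤ c := by positivity
  refine ⟨κ / (2 * (M + c + 1)), 2 + (M + m ^ 2 + 1) * (4 / κ), by positivity, by positivity,
    fun ε y hε => ?_⟩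
  have h := hκ ε y.1.1 (ϱ ε y.2.1)
  have hS := abs_two_inner_le (S₁ 0) le_rfl (ρ ε (Aα y.1.1))
    (ϱ ε y.2.1)
  have hL := abs_two_inner_le (L₁ 0) le_rfl (ϱ ε y.2.1)
    (ϱ ε y.2.1)
  have hε0 := ε.2.1
  have hε1 := ε.2.2
  have hG : ∑ j, ‖ρ ε (Dα j y.1.1) + dratOp d α ε j (Aα y.1.1)‖ ^ 2 ≤
      (1 + ε) * ∑ j, ‖ρ ε (Dα j y.1.1)‖ ^ 2 +
        ε * c * ‖ρ ε (Aα y.1.1)‖ ^ 2 := by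
    have hj : ∀ j, ‖ρ ε (Dα j y.1.1) + dratOp d α ε j (Aα y.1.1)‖ ^ 2 ≤
        (1 + ε) * ‖ρ ε (Dα j y.1.1)‖ ^ 2 +
          2 * ε * α ^ 2 * ‖ρ ε (Aα y.1.1)‖ ^ 2 := fun j => by
      have h1 := norm_add_le (ρ ε (Dα j y.1.1)) (dratOp d α ε j (Aα y.1.1))
      have h2 := norm_dratOp_le (α := α) ε j (Aα y.1.1)
      have h3 := pow_le_pow_left₀ (norm_nonneg _) (h1.trans (add_le_add_right h2 _)) 2
      refine h3.trans ?_
      generalize ‖ρ ε (Dα j y.1.1)‖ = p,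
        ‖ρ ε (Aα y.1.1)‖ = q
      have e : α ^ 2 = |α| ^ 2 := (sq_abs α).symm
      rw [e]
      generalize |α| = a
      have h4 : 0 ≤ ε * (p - a * q) ^ 2 := by positivity
      have h5 : 0 ≤ ε * (1 - ε) * (a * q) ^ 2 := by
        have : (0 : ℝ) ≤ 1 - ε := by linarith
        positivity
      linarith
    refine (Finset.sum_le_sum fun j _ => hj j).trans_eq ?_
    rw [Finset.sum_add_distrib, ← Finset.mul_sum, Finset.sum_const, Finset.card_univ,
      Fintype.card_fin, nsmul_eq_mul, hc]
    ring
  have hε2 : ε * (2 * (M + c + 1)) ≤ κ := by rwa [le_div_iff₀ (by positivity)] at hε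
  have hG0 : 0 ≤ ∑ j, ‖ρ ε (Dα j y.1.1)‖ ^ 2 := Finset.sum_nonneg fun j _ => sq_nonneg _
  have ha0 := sq_nonneg ‖ρ ε (Aα y.1.1)‖
  have hb0 := sq_nonneg ‖ϱ ε y.2.1‖
  have hp0 := sq_nonneg ‖ρ ε y.1.2‖
  have hv0 := sq_nonneg ‖ϱ ε y.2.2‖
  rw [abs_le] at hS hL
  rw [wN, wE, fEn]
  have hM1 : ‖S₁ 0‖ ≤ M := by rw [hM]; linarith [norm_nonneg (L₁ 0)]
  have hM2 : ‖L₁ 0‖ ≤ M := by rw [hM]; linarith [norm_nonneg (S₁ 0)]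
  have hM3 : ‖S₁ 0‖ + ‖L₁ 0‖ = M := hM.symm
  revert h hS hL hG hG0 ha0 hb0 hp0 hv0 hM3
  generalize ∑ j, ‖ρ ε (Dα j y.1.1) + dratOp d α ε j (Aα y.1.1)‖ ^ 2 = G',
    ∑ j, ‖ρ ε (Dα j y.1.1)‖ ^ 2 = G,
    ‖ρ ε (Aα y.1.1)‖ ^ 2 = a,
    ‖ϱ ε y.2.1‖ ^ 2 = b,
    ‖ρ ε y.1.2‖ ^ 2 = p,
    ‖ϱ ε y.2.2‖ ^ 2 = v,
    inner ℝ (ρ ε (Aα y.1.1)) _ = s,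
    inner ℝ (ϱ ε y.2.1) _ = l
  generalize ‖S₁ 0‖ = M₁ at hM1 ⊢
  generalize ‖L₁ 0‖ = M₂ at hM2 ⊢
  intro h hS hL hG hG0 ha0 hb0 hp0 hv0 hM3
  obtain ⟨Q, hQ⟩ : ∃ Q, Q = G + m ^ 2 * a + 2 * s - l := ⟨_, rfl⟩
  have hGQ : G ≤ Q + M * (a + b) := by
    have k1 : M₁ * (a + b) ≤ M * (a + b) - M₂ * (a + b) := by rw [← hM3]; linarith
    have k2 : 0 ≤ M₂ * a := mul_nonneg (by linarith) ha0
    have k3 : 0 ≤ m ^ 2 * a := by positivity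
    linarith [hS.1, hL.2]
  have hab : κ * (a + b) ≤ Q + ε * G + ε * c * a := by linarith
  have h2 : ε * G ≤ ε * (Q + M * (a + b)) := by gcongr
  have h3 : (ε : ℝ) * c * a ≤ ε * c * (a + b) := by gcongr; linarith
  have h4 : ε * (M + c + 1) * (a + b) ≤ κ / 2 * (a + b) :=
    mul_le_mul_of_nonneg_right (by linarith) (by linarith)
  have h5 : 0 ≤ ε * (a + b) := by positivity
  have hQ0 : κ / 2 * (a + b) ≤ (1 + ε) * Q := by linarith
  have hQ1 : 0 ≤ Q := by
    have : 0 ≤ (1 + (ε : ℝ)) * Q := le_trans (by positivity) hQ0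
    exact nonneg_of_mul_nonneg_right this (by positivity)
  have hQ2 : a + b ≤ 4 / κ * Q := by
    rw [div_mul_eq_mul_div, le_div_iff₀ hκ0]
    nlinarith [mul_nonneg (sub_nonneg.2 hε1) hQ1]
  have hE : p + G + m ^ 2 * a + v - l + 2 * s = p + v + Q := by rw [hQ]; ring
  rw [hE]
  have k1 : (M + m ^ 2 + 1) * (a + b) ≤ (M + m ^ 2 + 1) * (4 / κ * Q) :=
    mul_le_mul_of_nonneg_left hQ2 (by positivity)
  have k2 : 0 ≤ (M + m ^ 2 + 1) * (4 / κ) * (p + v) := by positivity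
  have k3 : 0 ≤ m ^ 2 * b := by positivity
  linarith

lemma exists_wE_le_wN (hm : 0 < m) : ∃ C : ℝ, 0 < C ∧ ∀ (ε : Eps) (y : XF d n),
    wE d n α m ν R ε y ≤ C * 𝓝ₘ ε y := by
  set M₁ := ‖S₁ 0‖
  set M₂ := ‖L₁ 0‖
  refine ⟨1 + M₂ * 2 + M₁ * ((m ^ 2)⁻¹ + 1), by positivity, fun ε y => ?_⟩
  have hS := abs_two_inner_le (S₁ 0) le_rfl (ρ ε (Aα y.1.1))
    (ϱ ε y.2.1)
  have hL := abs_two_inner_le (L₁ 0) le_rfl (ϱ ε y.2.1)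
    (ϱ ε y.2.1)
  obtain ⟨n1, -, n3, n4⟩ := norm_ratOp_opA_sq_le (α := α) hm ε y
  have k1 : M₂ * (‖ϱ ε y.2.1‖ ^ 2 + ‖ϱ ε y.2.1‖ ^ 2) ≤
    M₂ * (𝓝ₘ ε y + 𝓝ₘ ε y) := by gcongr
  have k2 : M₁ * (‖ρ ε (Aα y.1.1)‖ ^ 2 + ‖ϱ ε y.2.1‖ ^ 2) ≤
    M₁ * ((m ^ 2)⁻¹ * 𝓝ₘ ε y + 𝓝ₘ ε y) := by gcongr
  have k3 : 0 ≤ M₂ * 𝓝ₘ ε y := mul_nonneg (norm_nonneg _) (le_trans (sq_nonneg _) n4)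
  have hN : fEn d α m ε y.1 + ‖ϱ ε y.2.2‖ ^ 2 ≤ 𝓝ₘ ε y := by
    rw [wN]; linarith [sq_nonneg ‖ϱ ε y.2.1‖]
  rw [wE]
  rw [abs_le] at hS hL
  linarith [hS.2, hL.1, hL.2]

/-- The weighted norm of a solution is bounded uniformly in time, for weights adapted to the time. -/
theorem exists_wN_propagator_le (hR : CondR1 R) (hR2 : CondR2 m ν R) (hm : 0 < m) : ∃ C : ℝ≥0,
    ∀ (t : ℝ), ∃ ε : Eps, ∀ y : ℝ → XF d n, Continuous y →
      IsMild α m ν R y →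
      𝓝ₘ ε (y t) ≤ C * 𝓝ₘ ε (y 0) := by
  obtain ⟨K, hK0, hK⟩ := exists_abs_deriv_wE_le (α := α) (ν := ν) hm hR
  obtain ⟨ε₀, C₁, hε₀, hC₁, h₁⟩ := exists_wN_le_wE (α := α) hR hR2 hm
  obtain ⟨C₂, hC₂, h₂⟩ := exists_wE_le_wN (d := d) (n := n) (α := α) (ν := ν) (R := R) hm
  refine ⟨⟨C₁ * (C₂ * Real.exp (K * C₁)), by positivity⟩, fun t => ?_⟩
  have hpos : 0 < min (min ε₀ 1) (1 + |t|)⁻¹ := by positivity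
  let ε : Eps := ⟨min (min ε₀ 1) (1 + |t|)⁻¹, hpos, (min_le_left _ _).trans (min_le_right _ _)⟩
  have hεt : (ε : ℝ) * |t| ≤ 1 := by
    calc (ε : ℝ) * |t| ≤ (1 + |t|)⁻¹ * |t| := by gcongr; exact min_le_right _ _
      _ ≤ 1 := by rw [inv_mul_le_iff₀ (by positivity)]; linarith
  have hle : (ε : ℝ) ≤ ε₀ := (min_le_left _ _).trans (min_le_left _ _)
  refine ⟨ε, fun y hc hy => ?_⟩
  have hN0 : ∀ z : XF d n, 0 ≤ 𝓝ₘ ε z := fun z => by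
    have := fEn_nonneg (α := α) m ε z.1
    rw [wN]; positivity
  have hg := le_mul_exp_of_abs_deriv_le (hasDerivAt_wE hm hR ε hc hy) (c := K * C₁ * ε)
    (fun s => (hK ε (y s)).trans (by
      have := mul_le_mul_of_nonneg_left (h₁ ε (y s) hle) (mul_nonneg hK0 ε.2.1.le)
      linarith)) t
  have hE0 : 0 ≤ wE d n α m ν R ε (y 0) :=
    nonneg_of_mul_nonneg_right ((hN0 _).trans (h₁ ε (y 0) hle)) hC₁
  have hexp : Real.exp (K * C₁ * ε * |t|) ≤ Real.exp (K * C₁) := by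
    refine Real.exp_le_exp.2 ?_
    rw [mul_assoc (K * C₁)]
    exact mul_le_of_le_one_right (by positivity) hεt
  calc 𝓝ₘ ε (y t) ≤ C₁ * wE d n α m ν R ε (y t) := h₁ ε (y t) hle
    _ ≤ C₁ * (wE d n α m ν R ε (y 0) * Real.exp (K * C₁)) := by gcongr; exact hg.trans (by gcongr)
    _ ≤ C₁ * (C₂ * 𝓝ₘ ε (y 0) * Real.exp (K * C₁)) := by gcongr; exact h₂ ε (y 0)
    _ = _ := by
        change _ = C₁ * (C₂ * Real.exp (K * C₁)) * _
        ring

end energyBounds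

/-! ### Lattice translations -/

section Translations

variable {d n : ℕ} {α m ν : ℝ} {R : Space d → Vec n}

lemma mult_translate {g : Space d → ℂ} (hg : g.HasTemperateGrowth) (a : Space d)
    (φ : SC d) :
    𝓜 g (φ.compSubConstCLM ℂ a) =
      (𝓜 g φ).compSubConstCLM ℂ a := by
  ext x
  rw [SchwartzMap.compSubConstCLM_apply, fourierMultiplier_apply_eq hg,
    fourierMultiplier_apply_eq hg]
  refine integral_congr_ae (ae_of_all _ fun ξ => ?_)
  have h : FourierTransform.fourier (φ.compSubConstCLM ℂ a) ξ =
      Complex.exp ((2 * Real.pi * inner ℝ ξ (-a) : ℝ) * Complex.I) * FourierTransform.fourier φ ξ := by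
    rw [SchwartzMap.fourier_coe, SchwartzMap.fourier_coe, Real.fourier_eq', Real.fourier_eq',
      ← integral_add_right_eq_self _ a, ← integral_const_mul]
    refine integral_congr_ae (ae_of_all _ fun v => ?_)
    simp only [SchwartzMap.compSubConstCLM_apply, smul_eq_mul, add_sub_cancel_right]
    rw [← mul_assoc, ← Complex.exp_add, inner_add_left, inner_neg_right, real_inner_comm a]
    congr 2
    push_cast; ring
  have e : Complex.exp ((2 * Real.pi * inner ℝ ξ (x - a) : ℝ) * Complex.I) =
      Complex.exp ((2 * Real.pi * inner ℝ ξ x : ℝ) * Complex.I) *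
        Complex.exp ((2 * Real.pi * inner ℝ ξ (-a) : ℝ) * Complex.I) := by
    rw [← Complex.exp_add, sub_eq_add_neg, inner_add_right]
    congr 1
    push_cast; ring
  simp only [h, e]
  ring

/-- Translation of Schwartz functions, `(τ_k φ)(x) = φ(x + k)`. -/
def tau (k : Lat d) : SR d →L[ℝ] SR d := SchwartzMap.compSubConstCLM ℝ (-latPt k)

lemma tau_apply (k : Lat d) (φ : SR d) (x : Space d) : tau k φ x = φ (x + latPt k) := by
  rw [tau, SchwartzMap.compSubConstCLM_apply, sub_neg_eq_add]

lemma tau_realify (k : Lat d) {g : Space d → ℂ} (hg : g.HasTemperateGrowth)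
    (hr : IsRealOp (𝓜 g)) (φ : SR d) :
    realify (𝓜 g) (tau k φ) =
      tau k (realify (𝓜 g) φ) := by
  have h (φ : SR d) : toC (tau k φ) = (toC φ).compSubConstCLM ℂ (-latPt k) := by ext x; rfl
  apply toC_injective
  rw [toC_realify hr, h, h, toC_realify hr, mult_translate hg]

lemma tau_pdR (k : Lat d) (j : Fin d) (φ : SR d) : pdR j (tau k φ) = tau k (pdR j φ) := by
  ext x
  rw [pdR_apply, tau_apply, pdR_apply, ← fderiv_comp_add_right]
  congr 2
  funext y; exact tau_apply k φ y

lemma ev_tau (k : Lat d) (t : ℝ) (z : SR d × SR d) :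
    ev d m t (tau k z.1, tau k z.2) = (tau k (ev d m t z).1, tau k (ev d m t z).2) := by
  have hc := tau_realify k (cosSym_growth (d := d) (m := m) t) (isRealOp_kgC t)
  have hs := tau_realify k (sinSym_growth (d := d) (m := m) t) (isRealOp_kgS t)
  have hh := tau_realify k (omgSqSym_growth (d := d) (m := m)) isRealOp_kgH
  refine Prod.ext ?_ ?_
  · change evPsi d m t _ = tau k (evPsi d m t z)
    rw [evPsi_apply, evPsi_apply, map_add]
    exact congrArg₂ _ (hc _) (hs _)
  · change evPi d m t _ = tau k (evPi d m t z)
    rw [evPi_apply, evPi_apply, map_sub]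
    exact congrArg₂ _ (hc _) ((congrArg _ (hh _)).trans (hs _))

lemma cf_mul_cf (ε : Eps) (a : ℝ) (x y z : Space d) : cf ε a x y * cf ε a y z = cf ε a x z := by
  have := wt_neg_mul_wt (ε : ℝ) a y
  simp only [cf]
  linear_combination wt ε a x * wt ε (-a) z * this

lemma abs_cf_le (a : ℝ) (x z : Space d) :
    |cf Eps.one a x (x + z)| ≤ (⟨peetre a z, (peetre_pos a z).le⟩ : ℝ≥0) := by
  change _ ≤ peetre a z
  rw [abs_of_pos (cf_pos _ _ _ _), ← peetre_neg]
  simpa using cf_le Eps.one a x (x + z)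

/-- Translation in weighted coordinates, `h ↦ ⟨x⟩^α ⟨x + k⟩^{-α} h(x + k)`. -/
def tL (α : ℝ) (k : Lat d) : L2 d →L[ℝ] L2 d :=
  (mulOp (fun x => cf Eps.one α x (x + latPt k))
    ((measurable_wt _ _).mul ((measurable_wt _ _).comp (measurable_add_const _))) _
    fun x => abs_cf_le α x (latPt k)).comp
    (Lp.compMeasurePreservingₗᵢ ℝ _ (measurePreserving_add_right volume
      (latPt k))).toContinuousLinearMap

lemma coeFn_tL (k : Lat d) (f : L2 d) :
    tL α k f =ᵐ[volume] fun x => cf Eps.one α x (x + latPt k) * f (x + latPt k) := by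
  have hp := measurePreserving_add_right (volume : Measure (Space d)) (latPt k)
  refine (coeFn_mulOp _ ((measurable_wt _ _).mul ((measurable_wt _ _).comp (measurable_add_const _)))
    _ (fun x => abs_cf_le α x (latPt k)) _).trans ?_
  filter_upwards [Lp.coeFn_compMeasurePreserving f hp] with x hx
  exact congrArg _ hx

lemma ae_shift {p : Space d → Prop} (a : Space d) (h : ∀ᵐ x, p x) : ∀ᵐ x, p (x + a) :=
  (measurePreserving_add_right volume a).quasiMeasurePreserving.tendsto_ae.eventually h

lemma tL_jPi (k : Lat d) (φ : SR d) : tL α k (jPi α φ) = jPi α (tau k φ) := by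
  ext1
  filter_upwards [coeFn_tL (α := α) k (jPi α φ), ae_shift (latPt k) (coeFn_jPi (α := α) φ),
    coeFn_jPi (α := α) (tau k φ)] with x h1 h2 h3
  have := wt_neg_mul_wt 1 α (x + latPt k)
  rw [h1, h2, h3, tau_apply, cf]
  simp only [Eps.one]
  linear_combination wt 1 α x * φ (x + latPt k) * this

lemma tL_jPsi (k : Lat d) (φ : SR d) : tL α k (jPsi α φ) = jPsi α (tau k φ) := by
  have hb := tau_realify k (besselSymbol_growth d 1) (isRealOp_bes 1) φ
  rw [jPsi_apply, jPsi_apply, ← jPi_apply, ← jPi_apply, tL_jPi]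
  exact congrArg _ hb.symm

lemma opA_tL (k : Lat d) (f : L2 d) : opA d α (tL α k f) = tL α k (opA d α f) := by
  refine (denseRange_jPsi α).induction_on f (isClosed_eq (by fun_prop) (by fun_prop)) fun φ => ?_
  rw [tL_jPsi, opA_jPsi, opA_jPsi, tL_jPi]

lemma opD_tL (k : Lat d) (j : Fin d) (f : L2 d) : opD d α j (tL α k f) = tL α k (opD d α j f) := by
  refine (denseRange_jPsi α).induction_on f (isClosed_eq (by fun_prop) (by fun_prop)) fun φ => ?_
  rw [tL_jPsi, opD_jPsi, opD_jPsi, tL_jPi, tau_pdR]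

lemma inner_dT_tL (k : Lat d) (ξ : SR d) (g : L2 d) :
    inner ℝ (dT α ξ) (tL α k g) = inner ℝ (dT α (tau (-k) ξ)) g := by
  rw [inner_L2, inner_L2, ← integral_add_right_eq_self (fun x => dT α (tau (-k) ξ) x * g x) (latPt k)]
  refine integral_congr_ae ?_
  filter_upwards [coeFn_tL (α := α) k g, ae_shift (latPt k) (coeFn_dT (α := α) (tau (-k) ξ)),
    coeFn_dT (α := α) ξ] with x h1 h2 h3
  have := wt_neg_mul_wt 1 α x
  rw [h1, h2, h3, tau_apply, cf, latPt_neg, add_neg_cancel_right]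
  simp only [Eps.one]
  linear_combination wt 1 (-α) (x + latPt k) * ξ x * g (x + latPt k) * this

/-- Translation of lattice sequences in weighted coordinates. -/
def tE (n : ℕ) (α : ℝ) (k : Lat d) : Ell2 d n →L[ℝ] Ell2 d n :=
  wShift (Equiv.addRight k) (fun j => cf Eps.one α (latPt j) (latPt j + latPt k)) _
    fun j => abs_cf_le α (latPt j) (latPt k)

lemma tE_apply (k : Lat d) (u : Ell2 d n) (j : Lat d) :
    tE n α k u j = cf Eps.one α (latPt j) (latPt j + latPt k) • u (j + k) :=
  wShift_apply _ _ _ _ _ _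

lemma latL_tE (k : Lat d) (u : Ell2 d n) :
    latL d n ν Eps.one α (tE n α k u) = tE n α k (latL d n ν Eps.one α u) := by
  ext1; funext j
  rw [tE_apply, latL_apply, latL_apply, smul_sub, Finset.smul_sum]
  simp only [smul_sub, smul_add, smul_smul, tE_apply, ← latPt_add, cf_mul_cf, add_right_comm _ k]
  simp only [mul_comm (cf Eps.one α (latPt j) (latPt (j + k)))]

lemma coupOp_tE (hR : CondR1 R) (k : Lat d) (u : Ell2 d n) :
    coupOp R Eps.one α (tE n α k u) = tL α k (coupOp R Eps.one α u) := by
  obtain ⟨C, _, hC⟩ := exists_latKer_coupKer hR α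
  ext1
  filter_upwards [coeFn_latOp (hC Eps.one).1 (tE n α k u), coeFn_tL (α := α) k (coupOp R Eps.one α u),
    ae_shift (latPt k) (coeFn_latOp (hC Eps.one).1 u)] with x h1 h2 h3
  unfold coupOp at h2 ⊢
  rw [h2, h1, h3, ← tsum_mul_left, ← (Equiv.addRight k).tsum_eq (fun j => _ * inner ℝ (coupKer _ _ _ _ j) _)]
  refine tsum_congr fun j => ?_
  rw [tE_apply, coupKer, coupKer, real_inner_smul_left, real_inner_smul_left,
    real_inner_smul_right, ← mul_assoc, ← mul_assoc, cf_mul_cf, Equiv.coe_addRight, latPt_add,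
    cf_mul_cf, add_sub_add_right_eq_sub]

lemma adjoint_tL (hR : CondR1 R) (k : Lat d) (f : L2 d) :
    (coupOp R Eps.one (-α)).adjoint (tL α k f) = tE n α k ((coupOp R Eps.one (-α)).adjoint f) := by
  obtain ⟨C, _, hC⟩ := exists_latKer_coupKer hR (-α)
  have e : ∀ x z : Space d, cf Eps.one (-α) x z = cf Eps.one α z x := fun x z => by
    rw [cf, cf, neg_neg, mul_comm]
  ext1; funext j
  rw [tE_apply, coupOp, adjoint_latOp_apply (hC Eps.one).1, adjoint_latOp_apply (hC Eps.one).1,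
    ← integral_smul, ← integral_add_right_eq_self (fun x => cf Eps.one α (latPt j) _ • f x • _)
    (latPt k)]
  refine integral_congr_ae ?_
  filter_upwards [coeFn_tL (α := α) k f] with x hx
  rw [hx, coupKer, coupKer, e, e, smul_smul, smul_smul, smul_smul, latPt_add,
    add_sub_add_right_eq_sub]
  congr 1
  linear_combination f (x + latPt k) * (cf_mul_cf Eps.one α (latPt j) x (x + latPt k) -
    cf_mul_cf Eps.one α (latPt j) (latPt j + latPt k) (x + latPt k))

/-- Translation of phase space coordinates. -/
def tX (n : ℕ) (α : ℝ) (k : Lat d) : XF d n →L[ℝ] XF d n :=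
  ((tL α k).prodMap (tL α k)).prodMap ((tE n α k).prodMap (tE n α k))

lemma pertB_tX (hR : CondR1 R) (k : Lat d) (y : XF d n) :
    pertB α ν R (tX n α k y) = tX n α k (pertB α ν R y) := by
  rw [pertB_apply, pertB_apply]
  refine Prod.ext (Prod.ext (map_zero (tL α k)).symm ?_) (Prod.ext rfl ?_)
  · exact (congrArg _ (coupOp_tE hR k y.2.1)).trans (map_neg _ _).symm
  · refine Eq.trans ?_ (map_sub (tE n α k) _ _).symm
    rw [← adjoint_tL hR, ← opA_tL, ← latL_tE]
    rfl

variable [Fact (α < -(d : ℝ) / 2)]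

lemma freeU_tX (hm : 0 < m) (k : Lat d) (t : ℝ) (y : XF d n) :
    freeU d n α m t (tX n α k y) = tX n α k (freeU d n α m t y) := by
  have h : ∀ z : L2 d × L2 d, W0 d α m t (tL α k z.1, tL α k z.2) =
      (tL α k (W0 d α m t z).1, tL α k (W0 d α m t z).2) := fun z => by
    refine (denseRange_jF (α := α)).induction_on z (isClosed_eq (by fun_prop) (by fun_prop)) fun w => ?_
    have e : ∀ w, ((tL α k (jF d α w).1, tL α k (jF d α w).2) : L2 d × L2 d) =
        jF d α (tau k w.1, tau k w.2) := fun w => Prod.ext (tL_jPsi k w.1) (tL_jPi k w.2)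
    rw [e, W0_jF hm, W0_jF hm, e, ev_tau]
  exact Prod.ext (h y.1) rfl

lemma propagator_tX (hm : 0 < m) (hR : CondR1 R) {V : ℝ → XF d n →L[ℝ] XF d n}
    (h0 : ∀ y, V 0 y = y) (hV : ∀ y, IsMild α m ν R (V · y)) (k : Lat d) (t : ℝ) (y : XF d n) :
    V t (tX n α k y) = tX n α k (V t y) := by
  have hU := isC0Family_freeU d n α hm
  have h := hU.interaction_unique (pertB α ν R)
    (Z := fun s => freeU d n α m (-s) (V s (tX n α k y)))
    (Z' := fun s => tX n α k (freeU d n α m (-s) (V s y)))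
    (fun t => by rw [hU.neg']; exact hV _ t)
    (fun t => by
      rw [← freeU_tX hm, hU.neg', pertB_tX hR, freeU_tX hm]
      exact (hV y t).map (tX n α k))
    (by simp only [h0, freeU_tX hm])
  have h' := congrFun h t
  rw [← freeU_tX hm] at h'
  rw [← hU.neg' t (V t (tX n α k y)), h', hU.neg']

end Translations

/-! ### Energy per cell -/

section CellEnergy

open ContinuousLinearMap (fst snd)

variable {d n : ℕ} {α m : ℝ}

/-- Comparison constant of weights at points of a common cell. -/
def cK (d : ℕ) (α : ℝ) : ℝ≥0 := ⟨(2 * (1 + (d : ℝ) ^ 2)) ^ (|α| / 2), by positivity⟩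

lemma peetre_le_cK {z : Space d} (hz : ‖z‖ ≤ d) : peetre α z ≤ cK d α := by
  change (2 * (1 + ‖z‖ ^ 2)) ^ (|α| / 2) ≤ (2 * (1 + (d : ℝ) ^ 2)) ^ (|α| / 2)
  gcongr

lemma enorm_wt_le (ε : Eps) {x z : Space d} (h : ‖x - z‖ ≤ d) :
    ‖wt ε α x‖ₑ ≤ cK d α * ‖wt ε α z‖ₑ := by
  rw [Real.enorm_of_nonneg (wt_pos _ _ _).le, Real.enorm_of_nonneg (wt_pos _ _ _).le,
    ← ENNReal.ofReal_coe_nnreal, ← ENNReal.ofReal_mul (NNReal.coe_nonneg _)]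
  exact ENNReal.ofReal_le_ofReal ((wt_le_peetre_mul ε.sq_le_one α x z).trans
    (mul_le_mul_of_nonneg_right (peetre_le_cK h) (wt_pos _ _ _).le))

lemma wt_apply_zero (ε a : ℝ) : wt ε a (0 : Space d) = 1 := by simp [wt]

lemma abs_cellWt_le (x : Space d) :
    |(cellO d).indicator (wt 1 (-α)) x| ≤ cK d α := by
  by_cases hx : x ∈ cellO d
  · rw [Set.indicator_of_mem hx, abs_of_pos (wt_pos _ _ _)]
    have h := wt_le_peetre_mul (ε := 1) (by norm_num) (-α) x 0
    rw [wt_apply_zero, mul_one, sub_zero, peetre_abs] at h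
    exact h.trans (peetre_le_cK (norm_le_of_mem_cellO hx))
  · rw [Set.indicator_of_notMem hx, abs_zero]; exact (cK d α).2

/-- `h ↦ 1_{[0,1)^d} ⟨x⟩^{-α} h`. -/
def qOp (d : ℕ) (α : ℝ) : L2 d →L[ℝ] L2 d :=
  mulOp ((cellO d).indicator (wt 1 (-α))) ((measurable_wt _ _).indicator measurableSet_cellO)
    (cK d α) abs_cellWt_le

lemma enorm_qOp_tL_sq (k : Lat d) (h : L2 d) : ‖qOp d α (tL α k h)‖ₑ ^ 2 =
    ∫⁻ y in cellO d, ‖wt 1 (-α) (y + latPt k) * h (y + latPt k)‖ₑ ^ 2 := by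
  rw [enorm_sq_Lp_two, ← lintegral_indicator measurableSet_cellO]
  refine lintegral_congr_ae ?_
  filter_upwards [coeFn_mulOp _ ((measurable_wt _ _).indicator measurableSet_cellO) _
    abs_cellWt_le (tL α k h), coeFn_tL (α := α) k h] with x h1 h2
  rw [qOp, h1, h2]
  by_cases hx : x ∈ cellO d
  · have := wt_neg_mul_wt 1 α x
    rw [Set.indicator_of_mem hx, Set.indicator_of_mem hx, cf, ← mul_assoc, ← mul_assoc]
    simp only [Eps.one, this, one_mul]
  · rw [Set.indicator_of_notMem hx, Set.indicator_of_notMem hx]; simp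

/-- The sum of the squared weights. -/
def mW (d : ℕ) (α : ℝ) (ε : Eps) : ℝ≥0∞ := ∑' k : Lat d, ‖wt ε α (latPt k)‖ₑ ^ 2

lemma mW_ne_zero (ε : Eps) : mW d α ε ≠ 0 := fun h => by
  have := ENNReal.tsum_eq_zero.1 h 0
  simp [(wt_pos (ε : ℝ) α (latPt (0 : Lat d))).ne'] at this

/-- The field parts of the energy. -/
def fO (d n : ℕ) (α m : ℝ) : Fin d ⊕ Bool → XF d n →L[ℝ] L2 d
  | .inl j => (opD d α j).comp ((fst ℝ _ _).comp (.fst ℝ _ _))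
  | .inr true => m • (opA d α).comp ((fst ℝ _ _).comp (.fst ℝ _ _))
  | .inr false => (snd ℝ _ _).comp (.fst ℝ _ _)

/-- The lattice parts of the energy. -/
def lO (d n : ℕ) : Bool → XF d n →L[ℝ] Ell2 d n
  | true => (fst ℝ _ _).comp (.snd ℝ _ _)
  | false => (snd ℝ _ _).comp (.snd ℝ _ _)

lemma continuous_lO_apply (b : Bool) (k : Lat d) : Continuous fun y : XF d n => lO d n b y k :=
  (lp.evalCLM ℝ (fun _ : Lat d => Vec n) 2 k).continuous.comp (lO d n b).continuous

lemma fO_tX (i : Fin d ⊕ Bool) (k : Lat d) (y : XF d n) :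
    fO d n α m i (tX n α k y) = tL α k (fO d n α m i y) := by
  rcases i with j | _ | _
  · exact opD_tL k j y.1.1
  · rfl
  · exact (congrArg (m • ·) (opA_tL k y.1.1)).trans (map_smul _ _ _).symm

lemma lO_tX (b : Bool) (k : Lat d) (y : XF d n) : lO d n b (tX n α k y) = tE n α k (lO d n b y) := by
  cases b <;> rfl

/-- The energy in the unit cell. -/
def cEn (d n : ℕ) (α m : ℝ) (y : XF d n) : ℝ≥0∞ :=
  ∑ i, ‖qOp d α (fO d n α m i y)‖ₑ ^ 2 + ∑ b, ‖lO d n b y 0‖ₑ ^ 2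

variable [Fact (α < -(d : ℝ) / 2)]

lemma enorm_ratOp_sq (ε : Eps) (h : L2 d) : ‖ratOp d α ε h‖ₑ ^ 2 = ∑' k : Lat d,
    ∫⁻ y in cellO d, ‖wt ε α (y + latPt k)‖ₑ ^ 2 *
      ‖wt 1 (-α) (y + latPt k) * h (y + latPt k)‖ₑ ^ 2 := by
  rw [enorm_sq_Lp_two, ← lintegral_eq_tsum_cell
    (fun x => ‖wt ε α x‖ₑ ^ 2 * ‖wt 1 (-α) x * h x‖ₑ ^ 2)]
  refine lintegral_congr_ae ?_
  filter_upwards [coeFn_ratOp (α := α) ε h] with x hx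
  rw [hx, rat, mul_assoc, enorm_mul, mul_pow]

lemma enorm_ratOp_sq_le (ε : Eps) (h : L2 d) : ‖ratOp d α ε h‖ₑ ^ 2 ≤
    (cK d α : ℝ≥0∞) ^ 2 * ∑' k : Lat d, ‖wt ε α (latPt k)‖ₑ ^ 2 * ‖qOp d α (tL α k h)‖ₑ ^ 2 := by
  rw [enorm_ratOp_sq, ← ENNReal.tsum_mul_left]
  refine ENNReal.tsum_le_tsum fun k => ?_
  rw [enorm_qOp_tL_sq, ← mul_assoc, ← mul_pow, ← lintegral_const_mul' _ _ (by finiteness)]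
  refine setLIntegral_mono' measurableSet_cellO fun y hy => ?_
  have := enorm_wt_le (α := α) ε (x := y + latPt k) (z := latPt k)
    (by simpa using norm_le_of_mem_cellO hy)
  gcongr

lemma le_enorm_ratOp_sq (ε : Eps) (h : L2 d) :
    ∑' k : Lat d, ‖wt ε α (latPt k)‖ₑ ^ 2 * ‖qOp d α (tL α k h)‖ₑ ^ 2 ≤
      (cK d α : ℝ≥0∞) ^ 2 * ‖ratOp d α ε h‖ₑ ^ 2 := by
  rw [enorm_ratOp_sq, ← ENNReal.tsum_mul_left]
  refine ENNReal.tsum_le_tsum fun k => ?_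
  rw [enorm_qOp_tL_sq, ← lintegral_const_mul' _ _ (by finiteness),
    ← lintegral_const_mul' _ _ (by finiteness)]
  refine setLIntegral_mono' measurableSet_cellO fun y hy => ?_
  have := enorm_wt_le (α := α) ε (x := latPt k) (z := y + latPt k)
    (by simpa using norm_le_of_mem_cellO hy)
  rw [← mul_assoc, ← mul_pow (cK d α : ℝ≥0∞)]
  gcongr

lemma enorm_latRat_sq (ε : Eps) (u : Ell2 d n) : ‖latRat d n α ε u‖ₑ ^ 2 =
    ∑' k : Lat d, ‖wt ε α (latPt k)‖ₑ ^ 2 * ‖tE n α k u 0‖ₑ ^ 2 := by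
  rw [enorm_ell2_sq]
  refine tsum_congr fun k => ?_
  have h0 : latPt (0 : Lat d) = 0 := by ext i; simp [latPt]
  rw [latRat_apply, tE_apply, h0, zero_add, zero_add, cf, wt_apply_zero, one_mul, rat, mul_smul,
    enorm_smul, mul_pow]
  rfl

lemma mW_ne_top (ε : Eps) : mW d α ε ≠ ⊤ := by
  refine ne_top_of_le_ne_top (b := (cK d α : ℝ≥0∞) ^ 2 * ∫⁻ x : Space d, ‖wt ε α x‖ₑ ^ 2) ?_ ?_
  · refine ENNReal.mul_ne_top (by finiteness) ?_
    have h := (integrable_wt_eps_sq (d := d) (α := α) ε).2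
    simp only [HasFiniteIntegral, enorm_pow] at h
    exact h.ne
  rw [lintegral_eq_tsum_cell, ← ENNReal.tsum_mul_left]
  refine ENNReal.tsum_le_tsum fun k => ?_
  rw [← lintegral_const_mul' _ _ (by finiteness)]
  calc ‖wt ε α (latPt k)‖ₑ ^ 2 = ∫⁻ y in cellO d, ‖wt ε α (latPt k)‖ₑ ^ 2 := by
        rw [setLIntegral_const, volume_cellO, mul_one]
    _ ≤ _ := setLIntegral_mono' measurableSet_cellO fun y hy => by
        have := enorm_wt_le (α := α) ε (x := latPt k) (z := y + latPt k)
          (by simpa using norm_le_of_mem_cellO hy)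
        rw [← mul_pow]
        gcongr

lemma ofReal_wN (ε : Eps) (y : XF d n) : ENNReal.ofReal (wN d n α m ε y) =
    ∑ i, ‖ratOp d α ε (fO d n α m i y)‖ₑ ^ 2 + ∑ b, ‖latRat d n α ε (lO d n b y)‖ₑ ^ 2 := by
  simp only [enorm_sq_eq]
  rw [← ENNReal.ofReal_sum_of_nonneg (fun _ _ => by positivity),
    ← ENNReal.ofReal_sum_of_nonneg (fun _ _ => by positivity),
    ← ENNReal.ofReal_add (by positivity) (by positivity)]
  congr 1
  have hm : ‖ratOp d α ε (m • opA d α y.1.1)‖ ^ 2 = m ^ 2 * ‖ratOp d α ε (opA d α y.1.1)‖ ^ 2 := by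
    rw [map_smul, norm_smul, mul_pow, Real.norm_eq_abs, sq_abs]
  rw [Fintype.sum_sum_type, Fintype.sum_bool, Fintype.sum_bool, wN, fEn, ← hm]
  simp only [fO, lO, ContinuousLinearMap.comp_apply, smul_apply,
    ContinuousLinearMap.coe_fst', ContinuousLinearMap.coe_snd']
  ring

lemma ofReal_wN_le (ε : Eps) (y : XF d n) : ENNReal.ofReal (wN d n α m ε y) ≤
    ((cK d α : ℝ≥0∞) ^ 2 + 1) * ∑' k : Lat d, ‖wt ε α (latPt k)‖ₑ ^ 2 * cEn d n α m (tX n α k y) := by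
  simp only [cEn, mul_add, Finset.mul_sum, fO_tX, lO_tX, ofReal_wN, enorm_latRat_sq]
  rw [ENNReal.tsum_add, Summable.tsum_finsetSum fun _ _ => ENNReal.summable,
    Summable.tsum_finsetSum fun _ _ => ENNReal.summable, mul_add]
  refine add_le_add ?_ (le_mul_of_one_le_left' (by simp))
  rw [Finset.mul_sum]
  refine Finset.sum_le_sum fun i _ => (enorm_ratOp_sq_le ε _).trans ?_
  gcongr
  exact le_self_add

lemma le_ofReal_wN (ε : Eps) (y : XF d n) :
    ∑' k : Lat d, ‖wt ε α (latPt k)‖ₑ ^ 2 * cEn d n α m (tX n α k y) ≤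
      ((cK d α : ℝ≥0∞) ^ 2 + 1) * ENNReal.ofReal (wN d n α m ε y) := by
  simp only [cEn, mul_add, Finset.mul_sum, fO_tX, lO_tX, ofReal_wN, enorm_latRat_sq]
  rw [ENNReal.tsum_add, Summable.tsum_finsetSum fun _ _ => ENNReal.summable,
    Summable.tsum_finsetSum fun _ _ => ENNReal.summable]
  refine add_le_add ?_ ?_
  · refine Finset.sum_le_sum fun i _ => (le_enorm_ratOp_sq ε _).trans ?_
    gcongr
    exact le_self_add
  · exact Finset.sum_le_sum fun i _ => le_mul_of_one_le_left' (by simp)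

end CellEnergy

/-! ### Stationarity of the second moments -/

section SecondMoments

lemma enorm_clm_sq_le {E F : Type*} [NormedAddCommGroup E] [NormedSpace ℝ E] [NormedAddCommGroup F]
    [NormedSpace ℝ F] (l : E →L[ℝ] F) (x : E) : ‖l x‖ₑ ^ 2 ≤ ‖l‖ₑ ^ 2 * ‖x‖ₑ ^ 2 := by
  rw [← mul_pow]; gcongr; exact l.le_opENorm x

variable {P : Type*} [NormedAddCommGroup P] [NormedSpace ℝ P] [MeasurableSpace P] [BorelSpace P]
  {μ : Measure P}

lemma memLp_functional (hM : ∫⁻ Y, ‖Y‖ₑ ^ 2 ∂μ < ⊤) (l : P →L[ℝ] ℝ) : MemLp l 2 μ := by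
  refine memLp_two_of_lintegral_lt_top l.continuous.aestronglyMeasurable ?_
  refine (lintegral_mono (enorm_clm_sq_le l)).trans_lt ?_
  rw [lintegral_const_mul' _ _ (by finiteness)]; exact ENNReal.mul_lt_top (by finiteness) hM

/-- A continuous functional, as a square integrable random variable. -/
def rvL (hM : ∫⁻ Y, ‖Y‖ₑ ^ 2 ∂μ < ⊤) : (P →L[ℝ] ℝ) →ₗ[ℝ] Lp ℝ 2 μ where
  toFun l := (memLp_functional hM l).toLp
  map_add' l l' := MemLp.toLp_add (memLp_functional hM l) (memLp_functional hM l')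
  map_smul' c l := MemLp.toLp_const_smul c (memLp_functional hM l)

lemma enorm_rvL (hM : ∫⁻ Y, ‖Y‖ₑ ^ 2 ∂μ < ⊤) (l : P →L[ℝ] ℝ) :
    ‖rvL hM l‖ₑ ^ 2 = ∫⁻ Y, ‖l Y‖ₑ ^ 2 ∂μ := by
  rw [enorm_sq_Lp_two]
  refine lintegral_congr_ae ?_
  filter_upwards [(memLp_functional hM l).coeFn_toLp] with Y hY
  exact congrArg (‖·‖ₑ ^ 2) hY

lemma continuous_rvL (hM : ∫⁻ Y, ‖Y‖ₑ ^ 2 ∂μ < ⊤) : Continuous (rvL hM) := by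
  refine AddMonoidHomClass.continuous_of_bound (rvL hM)
    (NNReal.sqrt (∫⁻ Y, ‖Y‖ₑ ^ 2 ∂μ).toNNReal) fun l => norm_le_of_enorm_sq_le ?_
  rw [enorm_rvL, ← ENNReal.coe_pow, NNReal.sq_sqrt, ENNReal.coe_toNNReal hM.ne, mul_comm,
    ← lintegral_const_mul' _ _ (by finiteness)]
  exact lintegral_mono (enorm_clm_sq_le l)

lemma lintegral_sq_eq_of_dense (hM : ∫⁻ Y, ‖Y‖ₑ ^ 2 ∂μ < ⊤) {E S : Type*} [TopologicalSpace E]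
    {A B : E → P →L[ℝ] ℝ} (hA : Continuous A) (hB : Continuous B) {j : S → E} (hj : DenseRange j)
    (h : ∀ s, ∫ Y, A (j s) Y * A (j s) Y ∂μ = ∫ Y, B (j s) Y * B (j s) Y ∂μ) (e : E) :
    ∫⁻ Y, ‖A e Y‖ₑ ^ 2 ∂μ = ∫⁻ Y, ‖B e Y‖ₑ ^ 2 ∂μ := by
  have hr (l : P →L[ℝ] ℝ) : ‖rvL hM l‖ ^ 2 = ∫ Y, l Y * l Y ∂μ := by
    rw [← real_inner_self_eq_norm_sq, L2.inner_def]
    refine integral_congr_ae ?_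
    filter_upwards [(memLp_functional hM l).coeFn_toLp] with Y hY
    exact congrArg₂ (· * ·) hY hY
  have : ‖rvL hM (A e)‖ ^ 2 = ‖rvL hM (B e)‖ ^ 2 := by
    have := continuous_rvL hM
    refine hj.induction_on (p := fun e => ‖rvL hM (A e)‖ ^ 2 = ‖rvL hM (B e)‖ ^ 2) e
      (isClosed_eq (by fun_prop) (by fun_prop)) fun s => ?_
    rw [hr, hr, h]
  rw [← enorm_rvL hM, ← enorm_rvL hM, enorm_sq_eq, enorm_sq_eq, this]

lemma HilbertBasis.enorm_sq_eq_tsum {ι H : Type*} [NormedAddCommGroup H] [InnerProductSpace ℝ H]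
    (b : HilbertBasis ι ℝ H) (x : H) : ‖x‖ₑ ^ 2 = ∑' i, ‖inner ℝ (b i) x‖ₑ ^ 2 := by
  have h := b.hasSum_inner_mul_inner x x
  have e : ∀ i, inner ℝ x (b i) * inner ℝ (b i) x = ‖inner ℝ (b i) x‖ ^ 2 := fun i => by
    rw [real_inner_comm, Real.norm_eq_abs, sq_abs, sq]
  simp only [e] at h
  simp only [enorm_sq_eq]
  rw [← ENNReal.ofReal_tsum_of_nonneg (fun _ => by positivity) h.summable, h.tsum_eq,
    real_inner_self_eq_norm_sq]

lemma Orthonormal.countable {ι H : Type*} [NormedAddCommGroup H] [InnerProductSpace ℝ H]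
    [TopologicalSpace.SeparableSpace H] {v : ι → H} (hv : Orthonormal ℝ v) : Countable ι := by
  have h : (Set.univ : Set ι).PairwiseDisjoint fun i => Metric.ball (v i) (1 / 2) := by
    intro i _ j _ hij
    refine Metric.ball_disjoint_ball ?_
    have := norm_sub_sq_real (v i) (v j)
    rw [hv.2 hij, hv.1, hv.1] at this
    rw [dist_eq_norm]
    nlinarith [norm_nonneg (v i - v j)]
  exact Set.countable_univ_iff.1 (h.countable_of_isOpen (fun _ _ => Metric.isOpen_ball)
    fun i _ => ⟨v i, Metric.mem_ball_self (by norm_num)⟩)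

lemma lintegral_enorm_sq_eq_of_functional {H : Type*} [NormedAddCommGroup H]
    [InnerProductSpace ℝ H] [CompleteSpace H] [TopologicalSpace.SeparableSpace H]
    {A B : P →L[ℝ] H} (h : ∀ x : H, ∫⁻ Y, ‖inner ℝ x (A Y)‖ₑ ^ 2 ∂μ = ∫⁻ Y, ‖inner ℝ x (B Y)‖ₑ ^ 2 ∂μ) :
    ∫⁻ Y, ‖A Y‖ₑ ^ 2 ∂μ = ∫⁻ Y, ‖B Y‖ₑ ^ 2 ∂μ := by
  obtain ⟨w, b, -⟩ := exists_hilbertBasis ℝ H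
  have : Countable w := Orthonormal.countable b.orthonormal
  simp only [HilbertBasis.enorm_sq_eq_tsum b]
  have hm (C : P →L[ℝ] H) (i : w) : AEMeasurable (fun Y => ‖inner ℝ (b i) (C Y)‖ₑ ^ 2) μ := by
    refine Measurable.aemeasurable (Continuous.measurable ?_)
    fun_prop
  rw [lintegral_tsum (hm A), lintegral_tsum (hm B)]
  exact tsum_congr fun i => h _

end SecondMoments

section Stationary

variable {d n : ℕ} {α : ℝ}

/-- The Riesz functional on the space of coordinates. -/
def phiX (h : XF d n) : XF d n →L[ℝ] ℝ :=
  ((innerSL ℝ h.1.1).coprod (innerSL ℝ h.1.2)).coprod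
    ((innerSL ℝ h.2.1).coprod (innerSL ℝ h.2.2))

lemma phiX_apply (h y : XF d n) : phiX h y = inner ℝ h.1.1 y.1.1 + inner ℝ h.1.2 y.1.2 +
    (inner ℝ h.2.1 y.2.1 + inner ℝ h.2.2 y.2.2) := rfl

lemma continuous_phiX : Continuous (phiX : XF d n → _) := by
  have e : (phiX : XF d n → _) = fun h =>
      ((innerSL ℝ h.1.1).comp (ContinuousLinearMap.fst ℝ _ _) +
        (innerSL ℝ h.1.2).comp (ContinuousLinearMap.snd ℝ _ _)).comp (.fst ℝ _ _) +
      ((innerSL ℝ h.2.1).comp (ContinuousLinearMap.fst ℝ _ _) +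
        (innerSL ℝ h.2.2).comp (ContinuousLinearMap.snd ℝ _ _)).comp (.snd ℝ _ _) := rfl
  rw [e]
  fun_prop

lemma exists_phiX (l : XF d n →L[ℝ] ℝ) : ∃ h, l = phiX h := by
  refine ⟨(((InnerProductSpace.toDual ℝ _).symm (l.comp ((ContinuousLinearMap.inl ℝ _ _).comp (.inl ℝ _ _))),
    (InnerProductSpace.toDual ℝ _).symm (l.comp ((ContinuousLinearMap.inl ℝ _ _).comp (.inr ℝ _ _)))),
    ((InnerProductSpace.toDual ℝ _).symm (l.comp ((ContinuousLinearMap.inr ℝ _ _).comp (.inl ℝ _ _))),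
    (InnerProductSpace.toDual ℝ _).symm (l.comp ((ContinuousLinearMap.inr ℝ _ _).comp (.inr ℝ _ _))))),
    ContinuousLinearMap.ext fun y => ?_⟩
  simp only [phiX_apply, InnerProductSpace.toDual_symm_apply, ContinuousLinearMap.comp_apply,
    ← map_add]
  congr 1
  refine Prod.ext (Prod.ext ?_ ?_) (Prod.ext ?_ ?_) <;> simp

/-- Finitely supported sequences, in the dual weighted coordinates. -/
def lE (α : ℝ) : (Lat d →₀ Vec n) →+ Ell2 d n :=
  Finsupp.liftAddHom fun k => (lp.singleAddMonoidHom (E := fun _ : Lat d => Vec n) 2 k).comp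
    (DistribSMul.toAddMonoidHom (Vec n) (wt 1 (-α) (latPt k)))

lemma inner_lE (χ : Lat d →₀ Vec n) (u : Ell2 d n) : inner ℝ (lE α χ) u =
    χ.sum fun k w => wt 1 (-α) (latPt k) * inner ℝ w (u k) := by
  change inner ℝ (χ.sum fun k w => lp.single (E := fun _ => Vec n) 2 k (wt 1 (-α) (latPt k) • w)) u = _
  rw [Finsupp.sum, Finsupp.sum, sum_inner]
  exact Finset.sum_congr rfl fun k _ => by rw [inner_single, real_inner_smul_left]

lemma denseRange_lE : DenseRange (lE (d := d) (n := n) α) := fun u => by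
  refine mem_closure_of_tendsto (lp.hasSum_single (by norm_num) u) (Eventually.of_forall fun s => ?_)
  refine ⟨∑ k ∈ s, Finsupp.single k (wt 1 α (latPt k) • u k), ?_⟩
  rw [map_sum]
  refine Finset.sum_congr rfl fun k _ => ?_
  rw [lE, Finsupp.liftAddHom_apply_single]
  exact congrArg (lp.single 2 k) (wt_neg_smul_wt_smul 1 α (latPt k) (u k))

lemma denseRange_compact : DenseRange (Subtype.val : {ξ : SR d // HasCompactSupport ξ} → _) :=
  fun ξ => mem_closure_of_tendsto (tendsto_cut ξ)
    (Eventually.of_forall fun N => ⟨⟨cut N ξ, hasCompactSupport_cut N ξ⟩, rfl⟩)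

lemma denseRange_sobTest : DenseRange fun ξ : SR d => sLp (sobTest 1 α ξ) := by
  have h : Function.Surjective (sobTest 1 α : SR d → SR d) := fun φ =>
    ⟨besR 1 (wmulR α φ), toC_injective (by
      rw [toC_sobTest, toC_besR, toC_wmulR, bes_neg_bes, wmul_neg_wmul])⟩
  exact denseRange_sLp.comp h.denseRange sLp.continuous

/-- Real test data. -/
abbrev RTest (d n : ℕ) : Type :=
  ({ξ : SR d // HasCompactSupport ξ} × {ξ : SR d // HasCompactSupport ξ}) ×
    ((Lat d →₀ Vec n) × (Lat d →₀ Vec n))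

def RTest.toX (α : ℝ) (s : RTest d n) : XF d n :=
  ((sLp (sobTest 1 α s.1.1.1), dT α s.1.2.1), (lE α s.2.1, lE α s.2.2))

def RTest.data (s : RTest d n) : TestData d n where
  ξ₀ := toC s.1.1.1
  χ₀ := s.2.1
  ξ₁ := toC s.1.2.1
  χ₁ := s.2.2
  real₀ := toC_im _
  real₁ := toC_im _
  compact₀ := hasCompactSupport_toC s.1.1.2
  compact₁ := hasCompactSupport_toC s.1.2.2

lemma denseRange_toX : DenseRange (RTest.toX α : RTest d n → XF d n) :=
  ((denseRange_sobTest.comp denseRange_compact (sLp.comp (sobTest 1 α)).continuous).prodMap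
    (denseRange_dT.comp denseRange_compact (dT α).continuous)).prodMap
    (denseRange_lE.prodMap denseRange_lE)

lemma pairing_data (Y : Phase d n 0 α) (s : RTest d n) :
    pairing Y s.data = phiX (s.toX α) (coordF d n α Y) := by
  have e (χ : Lat d →₀ Vec n) (u : Ell2 d n) : (χ.sum fun k w => inner ℝ
      (wt 1 (-α) (latPt k) • u k) w) = inner ℝ (lE α χ) u := by
    rw [inner_lE]
    exact Finsupp.sum_congr fun k _ => by rw [real_inner_smul_left, real_inner_comm]
  have h1 : (Y.psi (toC s.1.1.1)).re = inner ℝ (sLp (sobTest 1 α s.1.1.1)) (coordF d n α Y).1.1 := by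
    rw [psi_eqF, sobDist_toC, Complex.ofReal_re]
  have h2 : (Y.mom (toC s.1.2.1)).re = inner ℝ (dT α s.1.2.1) (coordF d n α Y).1.2 := by
    rw [mom_eqF, sobDist_zero_toC, Complex.ofReal_re]
  rw [pairing, phiX_apply]
  simp only [RTest.data, RTest.toX, u_eqF, v_eqF, e, h1, h2]
  ring

def RTest.shift (k : Lat d) (s : RTest d n) : RTest d n :=
  have h (ξ : {ξ : SR d // HasCompactSupport ξ}) : HasCompactSupport (tau (-k) ξ.1) := by
    rw [show (tau (-k) ξ.1 : Space d → ℝ) = ξ.1 ∘ Homeomorph.addRight (latPt (-k)) from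
      funext (tau_apply _ _)]
    exact ξ.2.comp_homeomorph _
  ((⟨tau (-k) s.1.1.1, h _⟩, ⟨tau (-k) s.1.2.1, h _⟩),
    (s.2.1.mapDomain (· + k), s.2.2.mapDomain (· + k)))

lemma isTranslate_shift (k : Lat d) (s : RTest d n) : IsTranslate k s.data (s.shift k).data := by
  have h1 (ξ : SR d) (x : Space d) : toC (tau (-k) ξ) x = toC ξ (x - latPt k) := by
    rw [toC_apply, toC_apply, tau_apply, latPt_neg, sub_eq_add_neg]
  have h2 (χ : Lat d →₀ Vec n) (j : Lat d) : χ.mapDomain (· + k) j = χ (j - k) := by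
    have := Finsupp.mapDomain_apply (add_left_injective k) χ (j - k)
    rwa [sub_add_cancel] at this
  exact ⟨h1 _, h2 _, h1 _, h2 _⟩

lemma phiX_tX (k : Lat d) (s : RTest d n) (y : XF d n) :
    phiX (s.toX α) (tX n α k y) = phiX ((s.shift k).toX α) y := by
  have e (χ : Lat d →₀ Vec n) (u : Ell2 d n) :
      inner ℝ (lE α χ) (tE n α k u) = inner ℝ (lE α (χ.mapDomain (· + k))) u := by
    rw [inner_lE, inner_lE, Finsupp.sum_mapDomain_index (by simp) (by simp [inner_add_left, mul_add])]
    refine Finsupp.sum_congr fun j _ => ?_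
    have := wt_neg_mul_wt 1 α (latPt j)
    rw [tE_apply, real_inner_smul_right, cf, latPt_add]
    simp only [Eps.one]
    linear_combination wt 1 (-α) (latPt j + latPt k) * inner ℝ (χ j) (u (j + k)) * this
  rw [phiX_apply, phiX_apply]
  refine congrArg₂ _ (congrArg₂ _ ?_ (inner_dT_tL _ _ _)) (congrArg₂ _ (e _ _) (e _ _))
  refine (inner_sobTest_one _ _).trans (Eq.trans ?_ (inner_sobTest_one _ _).symm)
  exact (congrArg _ (opA_tL k y.1.1)).trans (inner_dT_tL k s.1.1.1 _)

lemma stationary {μ : Measure (Phase d n 0 α)} (hS : CondS1 μ) (hM : ∫⁻ Y, ‖Y‖ₑ ^ 2 ∂μ < ⊤)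
    {H : Type*} [NormedAddCommGroup H] [InnerProductSpace ℝ H] [CompleteSpace H]
    [TopologicalSpace.SeparableSpace H] (Q : XF d n →L[ℝ] H) (k : Lat d) :
    ∫⁻ Y, ‖Q (tX n α k (coordF d n α Y))‖ₑ ^ 2 ∂μ = ∫⁻ Y, ‖Q (coordF d n α Y)‖ₑ ^ 2 ∂μ := by
  refine lintegral_enorm_sq_eq_of_functional
    (A := Q.comp ((tX n α k).comp (coordF d n α).toContinuousLinearMap))
    (B := Q.comp (coordF d n α).toContinuousLinearMap) fun x => ?_
  obtain ⟨h, hh⟩ := exists_phiX ((innerSL ℝ x).comp Q)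
  have hc := continuous_phiX (d := d) (n := n)
  have key := lintegral_sq_eq_of_dense hM (E := XF d n)
    (A := fun h => (phiX h).comp ((tX n α k).comp (coordF d n α).toContinuousLinearMap))
    (B := fun h => (phiX h).comp (coordF d n α).toContinuousLinearMap) (by fun_prop) (by fun_prop)
    (denseRange_toX (α := α)) (fun s => ?_) h
  · rw [← hh] at key; exact key
  · have := hS k _ _ _ _ (isTranslate_shift k s) (isTranslate_shift k s)
    simp only [pairing_data, ← phiX_tX] at this
    exact this

end Stationary

section InitialMoment

variable {d n : ℕ} {α m : ℝ}

local notation "cF" => coordF d n α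
local notation "𝓔" => Phase d n 0 α

lemma norm_prod_sq_le {E F : Type*} [SeminormedAddCommGroup E] [SeminormedAddCommGroup F]
    (z : E × F) : ‖z‖ ^ 2 ≤ ‖z.1‖ ^ 2 + ‖z.2‖ ^ 2 := by
  rw [Prod.norm_def]
  rcases max_cases ‖z.1‖ ‖z.2‖ with h | h <;> rw [h.1] <;> nlinarith

lemma inner_dT_opD (j : Fin d) (ξ : SR d) (f : L2 d) :
    inner ℝ (dT α ξ) (opD d α j f) = -inner ℝ (dT α (pdR j ξ)) (opA d α f) := by
  refine (denseRange_jPsi α).induction_on f (isClosed_eq (by fun_prop) (by fun_prop)) fun ψ => ?_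
  rw [opD_jPsi, opA_jPsi, inner_dT_jPi, inner_dT_jPi]
  exact SchwartzMap.integral_mul_lineDerivOp_right_eq_neg_left ξ ψ _

lemma represents_pd (j : Fin d) (Y : 𝓔) :
    Represents (fun x => wt 1 (-α) x * opD d α j (cF Y).1.1 x)
      (∂_{(EuclideanSpace.single j 1 : Space d)} Y.psi) :=
  represents_of_inner_dT fun ξ => by
    have h := toC_pdR j ξ
    rw [basisVec] at h
    rw [TemperedDistribution.lineDerivOp_apply_apply, ← h, map_neg, psi_eqF, sobDist_one_toC, inner_dT_opD]
    push_cast; rfl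

lemma lintegral_sq_eq_of_integral_eq {P : Type*} [MeasurableSpace P] {μ : Measure P} {f g : P → ℝ}
    (hf : MemLp f 2 μ) (hg : MemLp g 2 μ) (h : ∫ x, f x * f x ∂μ = ∫ x, g x * g x ∂μ) :
    ∫⁻ x, ‖f x‖ₑ ^ 2 ∂μ = ∫⁻ x, ‖g x‖ₑ ^ 2 ∂μ := by
  have e {f : P → ℝ} (hf : MemLp f 2 μ) :
      ∫⁻ x, ‖f x‖ₑ ^ 2 ∂μ = ENNReal.ofReal (∫ x, f x * f x ∂μ) := by
    simp only [← sq]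
    rw [ofReal_integral_eq_lintegral_ofReal hf.integrable_sq (ae_of_all _ fun x => sq_nonneg _)]
    simp only [enorm_sq_eq, Real.norm_eq_abs, sq_abs]
  rw [e hf, e hg, h]

lemma lintegral_site_eq {μ : Measure (𝓔)} (hS : CondS1 μ)
    (hF : ∀ k : Lat d, ∫⁻ Y, (‖Y.u k‖ₑ ^ 2 + ‖Y.v k‖ₑ ^ 2) ∂μ < ⊤) (b : Bool) (k : Lat d) :
    ∫⁻ Y, ‖wt 1 (-α) (latPt k) • lO d n b (cF Y) k‖ₑ ^ 2 ∂μ =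
      ∫⁻ Y, ‖wt 1 (-α) (latPt (0 : Lat d)) • lO d n b (cF Y) 0‖ₑ ^ 2 ∂μ := by
  have e (k : Lat d) (y : XF d n) : ‖wt 1 (-α) (latPt k) • lO d n b y k‖ₑ ^ 2 =
      ∑ i, ‖wt 1 (-α) (latPt k) * lO d n b y k i‖ₑ ^ 2 := by
    simp only [enorm_sq_eq]
    rw [EuclideanSpace.norm_sq_eq, ENNReal.ofReal_sum_of_nonneg fun _ _ => by positivity]
    rfl
  have hc (k : Lat d) (i : Fin n) : Continuous fun Y : 𝓔 =>
      wt 1 (-α) (latPt k) * lO d n b (cF Y) k i := by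
    have := (continuous_lO_apply (d := d) (n := n) b k).comp (cF).continuous
    fun_prop
  have hL (k : Lat d) (i : Fin n) : MemLp (fun Y : 𝓔 =>
      wt 1 (-α) (latPt k) * lO d n b (cF Y) k i) 2 μ := by
    refine memLp_two_of_lintegral_lt_top (hc k i).aestronglyMeasurable
      (lt_of_le_of_lt (lintegral_mono fun Y => ?_) (hF k))
    refine (Finset.single_le_sum (f := fun i => ‖wt 1 (-α) (latPt k) *
      lO d n b (cF Y) k i‖ₑ ^ 2) (fun _ _ => zero_le) (Finset.mem_univ i)).trans ?_
    rw [← e, u_eqF, v_eqF]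
    cases b
    · exact le_add_self
    · exact le_self_add
  simp only [e]
  rw [lintegral_finsetSum _ fun i _ => ((hc k i).measurable.enorm.pow_const 2),
    lintegral_finsetSum _ fun i _ => ((hc 0 i).measurable.enorm.pow_const 2)]
  refine Finset.sum_congr rfl fun i _ => lintegral_sq_eq_of_integral_eq (hL k i) (hL 0 i) ?_
  let s : RTest d n := ((⟨0, HasCompactSupport.zero⟩, ⟨0, HasCompactSupport.zero⟩),
    if b then (Finsupp.single 0 (EuclideanSpace.single i 1), 0)
      else (0, Finsupp.single 0 (EuclideanSpace.single i 1)))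
  have hp (Y : 𝓔) (k : Lat d) : pairing Y (s.shift k).data =
      wt 1 (-α) (latPt k) * lO d n b (cF Y) k i := by
    rw [pairing]
    cases b <;> simp [s, RTest.shift, RTest.data, u_eqF, v_eqF, lO, Finsupp.mapDomain_single, EuclideanSpace.inner_single_right]
  have h0 := isTranslate_shift 0 s
  have hk := isTranslate_shift k s
  have := (hS k _ _ _ _ hk hk).trans (hS 0 _ _ _ _ h0 h0).symm
  simpa only [hp] using this

variable [hα : Fact (α < -(d : ℝ) / 2)]

lemma lintegral_sq_lt_top_of_represents {μ : Measure (𝓔)} [SFinite μ]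
    {h : 𝓔 → L2 d} {T : 𝓔 → 𝓢'(Space d, ℂ)}
    {p : 𝓔 × Space d → ℝ} (hp : Measurable p)
    (hr : ∀ Y, Represents (fun x => wt 1 (-α) x * h Y x) (T Y))
    (hpr : ∀ᵐ Y ∂μ, Represents (fun x => p (Y, x)) (T Y)) {eF : ℝ≥0}
    (hE : ∀ᵐ x : Space d, ∫⁻ Y, ‖p (Y, x)‖ₑ ^ 2 ∂μ ≤ eF) : ∫⁻ Y, ‖h Y‖ₑ ^ 2 ∂μ < ⊤ := by
  have h1 : ∫⁻ Y, ‖h Y‖ₑ ^ 2 ∂μ =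
      ∫⁻ Y, (∫⁻ x, ‖wt 1 α x‖ₑ ^ 2 * ‖p (Y, x)‖ₑ ^ 2) ∂μ := by
    refine lintegral_congr_ae ?_
    filter_upwards [hpr] with Y hY
    rw [enorm_sq_Lp_two]
    refine lintegral_congr_ae ?_
    filter_upwards [hY.ae_eq (hr Y)] with x hx
    rw [hx, ← mul_pow, ← enorm_mul, ← mul_assoc, wt_mul_wt_neg, one_mul]
  rw [h1, lintegral_lintegral_swap ((((measurable_wt 1 α).comp measurable_snd).enorm.pow_const 2).mul
    (hp.enorm.pow_const 2)).aemeasurable]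
  have h2 := (integrable_wt_one_sq (d := d) hα.out).2
  simp only [HasFiniteIntegral, enorm_pow] at h2
  calc _ ≤ ∫⁻ x : Space d, ‖wt 1 α x‖ₑ ^ 2 * eF := by
        refine lintegral_mono_ae ?_
        filter_upwards [hE] with x hx
        rw [lintegral_const_mul' _ _ (by finiteness)]
        gcongr
    _ < ⊤ := by
        rw [lintegral_mul_const' _ _ (by finiteness)]
        exact ENNReal.mul_lt_top h2 (by finiteness)

lemma enorm_ratOp_one (h : L2 d) : ‖ratOp d α Eps.one h‖ₑ ^ 2 = ‖h‖ₑ ^ 2 := by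
  rw [enorm_sq_Lp_two, enorm_sq_Lp_two]
  refine lintegral_congr_ae ?_
  filter_upwards [coeFn_ratOp (α := α) Eps.one h] with x hx
  rw [hx, rat, Eps.one, wt_mul_wt_neg, one_mul]

lemma lintegral_wN_lt_top {μ : Measure (𝓔)} [SFinite μ] (hS : CondS1 μ)
    (hS2 : CondS2 μ) :
    ∫⁻ Y, ENNReal.ofReal (wN d n α m Eps.one (cF Y)) ∂μ < ⊤ := by
  obtain ⟨⟨p, q, g, hp, hq, hg, hrep, eF, hE⟩, hF⟩ := hS2
  have hgi (j : Fin d) : Measurable fun z => g z j := (measurable_coord j).comp hg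
  have hfO (i : Fin d ⊕ Bool) : ∫⁻ Y, ‖fO d n α m i (cF Y)‖ₑ ^ 2 ∂μ < ⊤ := by
    rcases i with j | _ | _
    · refine lintegral_sq_lt_top_of_represents (hgi j) (represents_pd j) (hrep.mono fun Y h => h.2.2 j)
        (hE.mono fun x hx => (lintegral_mono fun Y => ?_).trans hx)
      rw [add_assoc]
      refine le_add_right ?_
      gcongr
      exact enorm_le_iff_norm_le.2 (PiLp.norm_apply_le _ j)
    · exact lintegral_sq_lt_top_of_represents hq represents_mom (hrep.mono fun Y h => h.2.1)
        (hE.mono fun x hx => (lintegral_mono fun Y => le_add_self).trans hx)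
    · have := lintegral_sq_lt_top_of_represents hp represents_psi (hrep.mono fun Y h => h.1)
        (hE.mono fun x hx => (lintegral_mono fun Y => le_add_right le_add_self).trans hx)
      change ∫⁻ Y, ‖m • opA d α (cF Y).1.1‖ₑ ^ 2 ∂μ < ⊤
      simp only [enorm_smul, mul_pow]
      rw [lintegral_const_mul' _ _ (by finiteness)]
      exact ENNReal.mul_lt_top (by finiteness) this
  have hlO (b : Bool) : ∫⁻ Y, ‖latRat d n α Eps.one (lO d n b (cF Y))‖ₑ ^ 2 ∂μ < ⊤ := by
    have e (Y : 𝓔) (k : Lat d) : ‖latRat d n α Eps.one (lO d n b (cF Y)) k‖ₑ ^ 2 =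
        ‖wt 1 α (latPt k)‖ₑ ^ 2 * ‖wt 1 (-α) (latPt k) • lO d n b (cF Y) k‖ₑ ^ 2 := by
      rw [latRat_apply, rat, mul_smul, enorm_smul, mul_pow]; rfl
    simp only [enorm_ell2_sq, e]
    have hmeas (k : Lat d) : Measurable fun Y : 𝓔 =>
        ‖wt 1 (-α) (latPt k) • lO d n b (cF Y) k‖ₑ ^ 2 := by
      refine Continuous.measurable ?_
      have := (continuous_lO_apply (d := d) (n := n) b k).comp (cF).continuous
      fun_prop
    rw [lintegral_tsum fun k => ((hmeas k).const_mul _).aemeasurable]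
    simp only [lintegral_const_mul' _ _ (ENNReal.pow_ne_top enorm_ne_top), lintegral_site_eq hS hF]
    rw [ENNReal.tsum_mul_right]
    refine ENNReal.mul_lt_top (mW_ne_top Eps.one).lt_top (lt_of_le_of_lt (lintegral_mono fun Y => ?_) (hF 0))
    rw [u_eqF, v_eqF]
    cases b
    · exact le_add_self
    · exact le_self_add
  simp only [ofReal_wN, enorm_ratOp_one]
  have hmc {f : 𝓔 → ℝ≥0∞} (hf : Continuous f) : Measurable f := hf.measurable
  rw [lintegral_add_left (hmc (by fun_prop)), lintegral_finsetSum _ fun i _ => hmc (by fun_prop),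
    lintegral_finsetSum _ fun i _ => hmc (by fun_prop)]
  exact ENNReal.add_lt_top.2 ⟨ENNReal.sum_lt_top.2 fun i _ => hfO i, ENNReal.sum_lt_top.2 fun b _ => hlO b⟩

lemma exists_enorm_sq_le_wN (hm : 0 < m) : ∃ C : ℝ≥0, ∀ (ε : Eps) (y : XF d n),
    ‖y‖ₑ ^ 2 ≤ C * ENNReal.ofReal (wN d n α m ε y) := by
  obtain ⟨C, hC, h⟩ := exists_norm_sq_le_fEn (d := d) (α := α) hm
  refine ⟨(C + 1).toNNReal, fun ε y => ?_⟩
  change _ ≤ ENNReal.ofReal (C + 1) * _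
  rw [enorm_sq_eq, ← ENNReal.ofReal_mul (by positivity)]
  refine ENNReal.ofReal_le_ofReal ?_
  have hl (u : Ell2 d n) : ‖u‖ ^ 2 ≤ ‖latRat d n α ε u‖ ^ 2 := by
    rw [ell2_norm_sq, ell2_norm_sq]
    refine (ell2_summable u).tsum_le_tsum (fun k => ?_) (ell2_summable _)
    rw [latRat_apply, norm_smul, Real.norm_of_nonneg (rat_pos _ _).le]
    gcongr
    exact le_mul_of_one_le_left (norm_nonneg _) (one_le_rat _ _)
  have h1 := h ε y.1
  have h2 := hl y.2.1
  have h3 := hl y.2.2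
  have h0 := fEn_nonneg m ε y.1 (α := α)
  have hn := norm_prod_sq_le y
  have hn' := norm_prod_sq_le y.2
  unfold wN
  nlinarith [mul_nonneg hC.le (sq_nonneg ‖latRat d n α ε y.2.1‖),
    mul_nonneg hC.le (sq_nonneg ‖latRat d n α ε y.2.2‖)]

end InitialMoment

section MomentBound

variable {d n : ℕ} {α m ν : ℝ} {R : Space d → Vec n}

local notation "cF" => coordF d n α
local notation "𝓔" => Phase d n 0 α
local notation "𝓝ₘ" => wN d n α m

instance : TopologicalSpace.SeparableSpace (L2 d) := haveI : Fact ((2 : ℝ≥0∞) ≠ ⊤) := ⟨by norm_num⟩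
  inferInstance

lemma continuous_cEn_comp {P : Type*} [TopologicalSpace P] {S : P → XF d n} (hS : Continuous S) :
    Continuous fun Y => cEn d n α m (S Y) := by
  have h (b : Bool) : Continuous fun Y => lO d n b (S Y) 0 :=
    (continuous_lO_apply b 0).comp hS
  unfold cEn
  fun_prop

lemma lintegral_cEn_tX {μ : Measure (𝓔)} (hS : CondS1 μ)
    (hM : ∫⁻ Y, ‖Y‖ₑ ^ 2 ∂μ < ⊤) {V : XF d n →L[ℝ] XF d n} {k : Lat d}
    (hV : ∀ y, V (tX n α k y) = tX n α k (V y)) :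
    ∫⁻ Y, cEn d n α m (tX n α k (V (cF Y))) ∂μ =
      ∫⁻ Y, cEn d n α m (V (cF Y)) ∂μ := by
  have hc {f : 𝓔 → ℝ≥0∞} (hf : Continuous f) : Measurable f := hf.measurable
  let q (b : Bool) : XF d n →L[ℝ] Vec n :=
    (lp.evalCLM ℝ (fun _ : Lat d => Vec n) 2 0).comp ((lO d n b).comp V)
  have e (y : XF d n) : cEn d n α m (V y) =
      ∑ i, ‖((qOp d α).comp ((fO d n α m i).comp V)) y‖ₑ ^ 2 + ∑ b, ‖q b y‖ₑ ^ 2 := rfl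
  simp only [← hV, e]
  have split (S : XF d n →L[ℝ] XF d n) :
      ∫⁻ Y, (∑ i, ‖((qOp d α).comp ((fO d n α m i).comp V)) (S (cF Y))‖ₑ ^ 2 +
          ∑ b, ‖q b (S (cF Y))‖ₑ ^ 2) ∂μ =
        ∑ i, ∫⁻ Y, ‖((qOp d α).comp ((fO d n α m i).comp V)) (S (cF Y))‖ₑ ^ 2 ∂μ +
          ∑ b, ∫⁻ Y, ‖q b (S (cF Y))‖ₑ ^ 2 ∂μ := by
    rw [lintegral_add_left (hc (by fun_prop)), lintegral_finsetSum _ fun i _ => hc (by fun_prop),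
      lintegral_finsetSum _ fun i _ => hc (by fun_prop)]
  refine (split (tX n α k)).trans (Eq.trans ?_ (split (.id ℝ _)).symm)
  exact congrArg₂ _ (Finset.sum_congr rfl fun i _ => stationary hS hM _ k)
    (Finset.sum_congr rfl fun b _ => stationary hS hM _ k)

variable [Fact (α < -(d : ℝ) / 2)]

lemma lintegral_wN_equiv {μ : Measure (Phase d n 0 α)} {S : Phase d n 0 α →L[ℝ] XF d n}
    (hS : ∀ k, ∫⁻ Y, cEn d n α m (tX n α k (S Y)) ∂μ = ∫⁻ Y, cEn d n α m (S Y) ∂μ) (ε : Eps) :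
    ∫⁻ Y, ENNReal.ofReal (wN d n α m ε (S Y)) ∂μ ≤
        ((cK d α : ℝ≥0∞) ^ 2 + 1) * (mW d α ε * ∫⁻ Y, cEn d n α m (S Y) ∂μ) ∧
      mW d α ε * ∫⁻ Y, cEn d n α m (S Y) ∂μ ≤
        ((cK d α : ℝ≥0∞) ^ 2 + 1) * ∫⁻ Y, ENNReal.ofReal (wN d n α m ε (S Y)) ∂μ := by
  have e : mW d α ε * ∫⁻ Y, cEn d n α m (S Y) ∂μ =
      ∫⁻ Y, ∑' k : Lat d, ‖wt ε α (latPt k)‖ₑ ^ 2 * cEn d n α m (tX n α k (S Y)) ∂μ := by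
    rw [lintegral_tsum fun k => ((continuous_cEn_comp (by fun_prop)).measurable.const_mul
      _).aemeasurable]
    simp only [lintegral_const_mul' _ _ (ENNReal.pow_ne_top enorm_ne_top), hS]
    rw [ENNReal.tsum_mul_right, mW]
  rw [e]
  constructor
  · rw [← lintegral_const_mul' _ _ (by finiteness)]
    exact lintegral_mono fun Y => ofReal_wN_le ε _
  · rw [← lintegral_const_mul' _ _ (by finiteness)]
    exact lintegral_mono fun Y => le_ofReal_wN ε _

theorem exists_lintegral_propagator_le (hm : 0 < m) (hR : CondR1 R) (hR2 : CondR2 m ν R)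
    {μ : Measure (𝓔)} [SFinite μ] (hS1 : CondS1 μ) (hS2 : CondS2 μ)
    {V : ℝ → XF d n →L[ℝ] XF d n} (h0 : ∀ y, V 0 y = y) (hc : ∀ y, Continuous fun t => V t y)
    (hV : ∀ y, IsMild α m ν R (V · y)) :
    ∃ C : ℝ≥0, ∀ t, ∫⁻ Y, ‖V t (cF Y)‖ₑ ^ 2 ∂μ ≤ C := by
  obtain ⟨A, hA⟩ := exists_enorm_sq_le_wN (d := d) (n := n) (α := α) hm
  obtain ⟨C, hC⟩ := exists_wN_propagator_le (α := α) hR hR2 hm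
  have hW := lintegral_wN_lt_top (m := m) hS1 hS2
  have hM : ∫⁻ Y, ‖Y‖ₑ ^ 2 ∂μ < ⊤ := by
    refine lt_of_le_of_lt (lintegral_mono (g := fun Y => ‖((cF).symm :
      XF d n →L[ℝ] 𝓔)‖ₑ ^ 2 * (A * ENNReal.ofReal (𝓝ₘ Eps.one
        (cF Y)))) fun Y => ?_) ?_
    · have := enorm_clm_sq_le ((cF).symm : XF d n →L[ℝ] 𝓔) (cF Y)
      rw [ContinuousLinearEquiv.coe_coe, ContinuousLinearEquiv.symm_apply_apply] at this
      exact this.trans (mul_le_mul' le_rfl (hA _ _))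
    · rw [lintegral_const_mul' _ _ (by finiteness), lintegral_const_mul' _ _ (by finiteness)]
      exact ENNReal.mul_lt_top (by finiteness) (ENNReal.mul_lt_top (by finiteness) hW)
  have hst (t : ℝ) := lintegral_wN_equiv (m := m) (S := (V t).comp (cF).toContinuousLinearMap)
    fun k => lintegral_cEn_tX hS1 hM (propagator_tX hm hR h0 hV k t)
  have hst0 := lintegral_wN_equiv (m := m) (S := (cF).toContinuousLinearMap)
    fun k => lintegral_cEn_tX hS1 hM (V := .id ℝ _) fun _ => rfl
  set B : ℝ≥0∞ := (cK d α : ℝ≥0∞) ^ 2 + 1 with hB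
  have hB' : B ≠ ⊤ := by rw [hB]; finiteness
  set M := ∫⁻ Y, ENNReal.ofReal (𝓝ₘ Eps.one (cF Y)) ∂μ with hMdef
  set e₀ := ∫⁻ Y, cEn d n α m (cF Y) ∂μ with he₀
  have hfin : A * (B * (B * C * B * (B * M))) < ⊤ := by
    have := hW.ne
    finiteness
  refine ⟨(A * (B * (B * C * B * (B * M)))).toNNReal, fun t => ?_⟩
  rw [ENNReal.coe_toNNReal hfin.ne]
  set e := ∫⁻ Y, cEn d n α m (V t (cF Y)) ∂μ with he
  have hee : e ≤ B * C * B * e₀ := by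
    obtain ⟨ε, hε⟩ := hC t
    have h1 : mW d α ε * e ≤ mW d α ε * (B * C * B * e₀) :=
      calc mW d α ε * e ≤ B * ∫⁻ Y, ENNReal.ofReal (𝓝ₘ ε (V t (cF Y))) ∂μ :=
            (hst t ε).2
        _ ≤ B * ∫⁻ Y, C * ENNReal.ofReal (𝓝ₘ ε (cF Y)) ∂μ := by
            gcongr with Y
            rw [← ENNReal.ofReal_coe_nnreal, ← ENNReal.ofReal_mul (NNReal.coe_nonneg _)]
            have := hε (fun s => V s (cF Y)) (hc _) (hV _)
            rw [h0] at this
            exact ENNReal.ofReal_le_ofReal this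
        _ ≤ B * (C * (B * (mW d α ε * e₀))) := by
            rw [lintegral_const_mul' _ _ (by finiteness)]
            gcongr
            exact (hst0 ε).1
        _ = _ := by ring
    exact (ENNReal.mul_le_mul_iff_right (mW_ne_zero ε) (mW_ne_top ε)).1 h1
  calc ∫⁻ Y, ‖V t (cF Y)‖ₑ ^ 2 ∂μ
      ≤ ∫⁻ Y, A * ENNReal.ofReal (𝓝ₘ Eps.one (V t (cF Y))) ∂μ :=
        lintegral_mono fun Y => hA _ _
    _ ≤ A * (B * (mW d α Eps.one * e)) := by
        rw [lintegral_const_mul' _ _ (by finiteness)]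
        gcongr
        exact (hst t Eps.one).1
    _ ≤ A * (B * (mW d α Eps.one * (B * C * B * e₀))) := by gcongr
    _ = A * (B * (B * C * B * (mW d α Eps.one * e₀))) := by ring
    _ ≤ A * (B * (B * C * B * (B * M))) :=
        mul_le_mul' le_rfl (mul_le_mul' le_rfl (mul_le_mul' le_rfl (hst0 Eps.one).2))

end MomentBound

section Tightness

variable {P Q : Type*} [NormedAddCommGroup P] [NormedSpace ℝ P] [MeasurableSpace P] [BorelSpace P]
  [NormedAddCommGroup Q] [NormedSpace ℝ Q] [MeasurableSpace Q] [BorelSpace Q]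

theorem isCompact_closure_range_of_moment {J : Type*} {ι : P →L[ℝ] Q} (hι : IsCompactOperator ι)
    (μ : ProbabilityMeasure P) {W : J → P → P} (hW : ∀ t, Measurable (W t)) {C : ℝ≥0}
    (hC : ∀ t, ∫⁻ Y, ‖W t Y‖ₑ ^ 2 ∂(μ : Measure P) ≤ C) :
    IsCompact (closure (Set.range fun t => (μ.map (hW t).aemeasurable).map
      ι.continuous.measurable.aemeasurable)) := by
  refine isCompact_closure_of_isTightMeasureSet
    (isTightMeasureSet_iff_exists_isCompact_measure_compl_le.2 fun ε hε => ?_)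
  obtain ⟨e, he, heε⟩ := ENNReal.lt_iff_exists_nnreal_btwn.1 hε
  have he0 : 0 < e := ENNReal.coe_pos.1 he
  set r : ℝ≥0 := NNReal.sqrt (C / e) + 1 with hr
  refine ⟨closure (ι '' Metric.closedBall 0 r), hι.isCompact_closure_image_closedBall r, ?_⟩
  rintro _ ⟨_, ⟨t, rfl⟩, rfl⟩
  refine le_trans ?_ heε.le
  rw [ProbabilityMeasure.toMeasure_map, ProbabilityMeasure.toMeasure_map,
    Measure.map_apply ι.continuous.measurable isClosed_closure.measurableSet.compl,
    Measure.map_apply (hW t) (ι.continuous.measurable isClosed_closure.measurableSet.compl)]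
  have hsub : W t ⁻¹' (ι ⁻¹' (closure (ι '' Metric.closedBall 0 r))ᶜ) ⊆
      {Y | (r : ℝ≥0∞) ^ 2 ≤ ‖W t Y‖ₑ ^ 2} := fun Y hY => by
    by_contra h
    refine hY (subset_closure ⟨W t Y, ?_, rfl⟩)
    rw [mem_closedBall_zero_iff]
    have : ‖W t Y‖ₑ < r := lt_of_pow_lt_pow_left' 2 (not_le.1 h)
    exact_mod_cast (ENNReal.coe_lt_coe.1 this).le
  have hr0 : (r : ℝ≥0∞) ^ 2 ≠ 0 := by rw [hr]; positivity
  have hle : C ≤ e * r ^ 2 := by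
    have : C / e ≤ r ^ 2 := by
      rw [← NNReal.sq_sqrt (C / e)]
      gcongr
      exact le_self_add
    rw [mul_comm]
    exact (div_le_iff₀ he0).1 this
  refine (measure_mono hsub).trans ((ENNReal.mul_le_mul_iff_right hr0 (by finiteness)).1 ?_)
  refine (mul_meas_ge_le_lintegral ((hW t).enorm.pow_const 2) _).trans ((hC t).trans ?_)
  rw [mul_comm]
  exact_mod_cast hle

end Tightness

end FieldCrystal

end

theorem propositionl2p1 (d n : ℕ) (hd : 1 ≤ d) (hn : 1 ≤ n)
    (m₀ ν₀ : ℝ) (hm₀ : 0 < m₀) (hν₀ : 0 < ν₀)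
    (R : FieldCrystal.Space d → FieldCrystal.Vec n)
    (hR1 : FieldCrystal.CondR1 R) (hR2 : FieldCrystal.CondR2 m₀ ν₀ R)
    (α : ℝ) (hα : α < -(d : ℝ) / 2)
    (μ₀ : ProbabilityMeasure (FieldCrystal.Phase d n 0 α))
    (hS0 : FieldCrystal.CondS0 (μ₀ : Measure (FieldCrystal.Phase d n 0 α)))
    (hS1 : FieldCrystal.CondS1 (μ₀ : Measure (FieldCrystal.Phase d n 0 α)))
    (hS2 : FieldCrystal.CondS2 (μ₀ : Measure (FieldCrystal.Phase d n 0 α)))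
    (hS3 : FieldCrystal.CondS3 (μ₀ : Measure (FieldCrystal.Phase d n 0 α))) :
    (∀ Y₀ : FieldCrystal.Phase d n 0 α, ∃! Y : ℝ → FieldCrystal.Phase d n 0 α,
      FieldCrystal.IsSolution m₀ ν₀ R Y₀ Y) ∧
    ∃ hW : ∀ t : ℝ, Measurable
        (FieldCrystal.flow m₀ ν₀ R t : FieldCrystal.Phase d n 0 α → FieldCrystal.Phase d n 0 α),
      (∃ C : ℝ≥0, ∀ t : ℝ,
        ∫⁻ Y, ‖FieldCrystal.flow m₀ ν₀ R t Y‖ₑ ^ 2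
          ∂(μ₀ : Measure (FieldCrystal.Phase d n 0 α)) ≤ C) ∧
      ∀ s β : ℝ, s < 0 → β < α →
        ∃ ι : FieldCrystal.Phase d n 0 α →L[ℝ] FieldCrystal.Phase d n s β,
          (∀ Y, (ι Y).psi = Y.psi ∧ (ι Y).u = Y.u ∧ (ι Y).mom = Y.mom ∧ (ι Y).v = Y.v) ∧
          IsCompact (closure (Set.range fun t : ℝ =>
            (μ₀.map (hW t).aemeasurable).map ι.continuous.measurable.aemeasurable)) := by
  have : Fact (α < -(d : ℝ) / 2) := ⟨hα⟩
  obtain ⟨V, h0, hV, hsol, huniq⟩ := FieldCrystal.exists_propagator (α := α) hm₀ ν₀ hR1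
  have hflow (t : ℝ) : (FieldCrystal.flow m₀ ν₀ R t : FieldCrystal.Phase d n 0 α → _) =
      fun Y => (FieldCrystal.coordF d n α).symm (V t (FieldCrystal.coordF d n α Y)) := by
    funext Y
    have h : ∃ Z, FieldCrystal.IsSolution m₀ ν₀ R Y Z := ⟨_, hsol Y⟩
    rw [FieldCrystal.flow, dif_pos h]
    exact huniq Y _ h.choose_spec t
  have hW (t : ℝ) : Measurable
      (FieldCrystal.flow m₀ ν₀ R t : FieldCrystal.Phase d n 0 α → FieldCrystal.Phase d n 0 α) := by
    rw [hflow]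
    exact Continuous.measurable (by fun_prop)
  have hc (y : FieldCrystal.XF d n) : Continuous fun t => V t y := by
    have := (FieldCrystal.coordF d n α).continuous.comp
      (hsol ((FieldCrystal.coordF d n α).symm y)).cont
    simpa [Function.comp_def] using this
  obtain ⟨C, hC⟩ := FieldCrystal.exists_lintegral_propagator_le hm₀ hR1 hR2 hS1 hS2 h0 hc hV
  let J : FieldCrystal.XF d n →L[ℝ] FieldCrystal.Phase d n 0 α := (FieldCrystal.coordF d n α).symm
  have hbound (t : ℝ) : ∫⁻ Y, ‖FieldCrystal.flow m₀ ν₀ R t Y‖ₑ ^ 2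
      ∂(μ₀ : Measure (FieldCrystal.Phase d n 0 α)) ≤ (‖J‖₊ ^ 2 * C : ℝ≥0) := by
    rw [hflow]
    refine (lintegral_mono fun Y => FieldCrystal.enorm_clm_sq_le J _).trans ?_
    rw [lintegral_const_mul' _ _ (by finiteness)]
    push_cast
    exact mul_le_mul' le_rfl (hC t)
  refine ⟨fun Y₀ => ⟨_, hsol Y₀, fun Y hY => funext (huniq Y₀ Y hY)⟩, hW, ⟨_, hbound⟩,
    fun s β hs hβ => ?_⟩
  obtain ⟨ι, hι, hιc⟩ := FieldCrystal.exists_compact_embedding d n hs hβ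
  exact ⟨ι, hι, FieldCrystal.isCompact_closure_range_of_moment hιc μ₀ hW hbound⟩
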